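/- **Setting.** Let $m\ge 0$, $n\ge 1$, $0=\theta_0<\theta_1<\dots<\theta_m<2\pi$, $\theta_{m+1}:=2\pi$, $z_j=e^{i\theta_j}$, and let $\alpha_j,\beta_j\in\mathbb C$ with $\Re\alpha_j>-\tfrac12$. Let $$f(e^{i\theta})=e^{i\theta\sum_j\beta_j}\prod_{j=0}^m|e^{i\theta}-z_j|^{2\alpha_j}g_j(\theta)e^{-i\theta_j\beta_j},\quad 0\le\theta<2\pi,\qquad g_j(\theta)=\begin{cases}e^{i\pi\beta_j},&\theta<\theta_j\\ e^{-i\pi\beta_j},&\theta\ge\theta_j,\end{cases}$$ $f_l=\frac1{2\pi}\int_0^{2\pi}f(e^{i\theta})e^{-il\theta}d\theta$, $D_n=\det(f_{j-k})_{j,k=0}^{n-1}$ and $\lambda=\sum_{k=0}^m\frac{\beta_k-\alpha_k}2-\frac n2$. Branches: $\ln z$ and $z^{\lambda}$ are taken with $0\le\arg z<2\pi$ (so $\ln z_j=i\theta_j$), and $\ln(z-z_k)$, $(z-z_k)^{\alpha_k}$ with $\theta_k\le\arg(z-z_k)<\theta_k+2\pi$; $\ln(z_j-z_k)$ and $\ln(-z_k)$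 are the values of $\ln(z-z_k)$ at $z=z_j$ and $z=0$. Write $\sigma_3=\mathrm{diag}(1,-1)$. **The $\Phi$-Riemann–Hilbert problem** (for $e^{4\pi i\alpha_j}\ne1$, $j=0,\dots,m$). Let $C$ be the unit circle, oriented counterclockwise, and $\Gamma_j=\{rz_j:r\ge1\}$, oriented to infinity; $[0,1]$ is oriented from $0$ to $1$; the $+$ side is on the left. Put $$s_j=\exp\Big\{-i\pi\sum_{k\le j}\beta_k+i\pi\sum_{k>j}\beta_k-i\pi\sum_{k\le j}\alpha_k-3i\pi\sum_{k>j}\alpha_k\Big\}.$$ Find a $2\times2$ matrix function $\Phi$ such that: (a) $\Phi$ is analytic off $\Sigma=C\cup[0,1]\cup\bigcup_j\Gamma_j$. (b) $\Phi$ has one-sided limits $\Phi_\pm$ at the points of $\Sigma$ other than $0,z_0,\dots,z_m$, and $\Phi_+=\Phi_-J$ with $J=\begin{pmatrix}1&s_j\\0&1\end{pmatrix}$ on the arc $\theta_j<\arg z<\theta_{j+1}$ of $C$, $J=e^{-2\pi i\alpha_j\sigma_3}$ on $\Gamma_j$ ($j\ge1$), $J=e^{-2\pi i(\alpha_0+\lambda)\sigma_3}$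 on $\Gamma_0$, and $J=e^{-2\pi i\lambda\sigma_3}$ on $(0,1)$. (c) $\Phi(z)=(I+O(1/z))\,z^{(\sum_k\frac{\beta_k+\alpha_k}2+\frac n2)\sigma_3}e^{2\pi i\sum_{k>j}\alpha_k\sigma_3}$ as $z\to\infty$ with $\theta_j<\arg z<\theta_{j+1}$. (d) Near $z_j$, off $\Sigma$, $\Phi(z)=\widetilde\Phi_j(z)(z-z_j)^{\alpha_j\sigma_3}C_j$ with $\widetilde\Phi_j$ holomorphic at $z_j$. Here $C_j=\begin{pmatrix}1&c_j\\0&1\end{pmatrix}$, except that for $j=0$ and $\Im z<0$ this matrix is multiplied on the right by $e^{2\pi i\lambda\sigma_3}$, and $$c_j=\frac{s_j}{1-e^{4\pi i\alpha_j}}\times\begin{cases}1-e^{2\pi i(\beta_j+\alpha_j)},&|z|<1\\1-e^{2\pi i(\beta_j-\alpha_j)},&|z|>1,\ \arg z<\theta_j\\e^{4\pi i\alpha_j}\big(1-e^{2\pi i(\beta_j-\alpha_j)}\big),&|z|>1,\ \arg z>\theta_j\end{cases}$$ (for $j=0$ the last two cases are $\Im z<0$ and $\Im z>0$ respectively). (e)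 Near $0$, off $\Sigma$, $\Phi(z)=\widetilde\Phi^{(0)}(z)z^{\lambda\sigma_3}$ with $\widetilde\Phi^{(0)}$ holomorphic at $0$. Put $A_j=\alpha_j\widetilde\Phi_j(z_j)\sigma_3\widetilde\Phi_j(z_j)^{-1}$ and $B=\lambda\,\widetilde\Phi^{(0)}(0)\sigma_3\widetilde\Phi^{(0)}(0)^{-1}$. **Lemma.** Suppose that $\alpha_j\ne0$ and, moreover, $e^{4\pi i\alpha_j}\neq1$ for $j=0,\dots,m$, and that the $\Phi$-Riemann–Hilbert problem is solvable at $(\alpha,\beta)$. Then $D_n\neq0$, the problem is solvable for all parameters in a neighbourhood of $(\alpha,\beta)$, and for solutions $\Phi$ at the nearby parameters, $D_n$, $\widetilde\Phi_j(z_j)$ and $\widetilde\Phi^{(0)}(0)$ are complex differentiable in each $\alpha_k$ and each $\beta_k$ at $(\alpha,\beta)$, and for every $k=0,\dots,m$ $$\frac{\partial\ln D_n}{\partial\alpha_k}=\sum_{j=0}^m\mathrm{trace}\,A_j\frac{\partial\widetilde\Phi_j(z_j)}{\partial\alpha_k}\widetilde\Phi_j^{-1}(z_j)+\mathrm{trace}\,B\frac{\partial\widetilde\Phi^{(0)}(0)}{\partial\alpha_k}\big(\widetilde\Phi^{(0)}(0)\big)^{-1}-2\sum_{j\ne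 k}\alpha_j\ln(z_j-z_k)-2\lambda\ln(-z_k)+\sum_{j=0}^m\alpha_j\ln z_j-n\ln z_k,$$ $$\frac{\partial\ln D_n}{\partial\beta_k}=\sum_{j=0}^m\mathrm{trace}\,A_j\frac{\partial\widetilde\Phi_j(z_j)}{\partial\beta_k}\widetilde\Phi_j^{-1}(z_j)+\mathrm{trace}\,B\frac{\partial\widetilde\Phi^{(0)}(0)}{\partial\beta_k}\big(\widetilde\Phi^{(0)}(0)\big)^{-1}-\sum_{j=0}^m\alpha_j\ln z_j-n\ln z_k.$$ Here $\partial\ln D_n$ means $D_n^{-1}\partial D_n$. -/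

import Mathlib

open scoped Real Topology

noncomputable section

namespace FisherHartwig

/-- `2 × 2` complex matrices. -/
abbrev M2 : Type := Matrix (Fin 2) (Fin 2) ℂ

/-- The Pauli matrix `σ₃`. -/
def sigma3 : M2 := !![1, 0; 0, -1]

/-- `e^{w σ₃}`. -/
def expSigma3 (w : ℂ) : M2 := !![Complex.exp w, 0; 0, Complex.exp (-w)]

/-- The unipotent matrix with upper right entry `c`. -/
def upper (c : ℂ) : M2 := !![1, c; 0, 1]

/-- The argument of `z` with values in `[φ, φ + 2π)`. -/
def argFrom (φ : ℝ) (z : ℂ) : ℝ := toIcoMod Real.two_pi_pos φ (Complex.arg z)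

/-- The branch of `ln z` with `φ ≤ arg z < φ + 2π`, cut along the ray `arg z = φ`. -/
def logFrom (φ : ℝ) (z : ℂ) : ℂ := (Real.log ‖z‖ : ℂ) + (argFrom φ z : ℂ) * Complex.I

section Symbol

variable {m : ℕ} (θ : Fin (m + 1) → ℝ) (α β : Fin (m + 1) → ℂ)

/-- The singular point `z_j = e^{i θ_j}`. -/
def pt (j : Fin (m + 1)) : ℂ := Complex.exp ((θ j : ℂ) * Complex.I)

/-- The jump factor `g_{z_j, β_j}` at `z = e^{i t}`, `0 ≤ t < 2π`. -/
def jumpFactor (j : Fin (m + 1)) (t : ℝ) : ℂ :=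
  if t < θ j then Complex.exp (Complex.I * π * β j) else Complex.exp (-(Complex.I * π * β j))

/-- The pure Fisher-Hartwig symbol `f(e^{i t})`, `0 ≤ t < 2π`:
`z^{∑ β_j} ∏_j |z - z_j|^{2 α_j} g_{z_j, β_j}(z) z_j^{-β_j}` at `z = e^{i t}`. -/
def symbol (t : ℝ) : ℂ :=
  Complex.exp (Complex.I * t * ∑ j, β j) *
    ∏ j, ((‖Complex.exp ((t : ℂ) * Complex.I) - pt θ j‖ : ℂ) ^ (2 * α j) *
      jumpFactor θ β j t * Complex.exp (-(Complex.I * (θ j : ℂ) * β j)))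

/-- The Fourier coefficient `f_l = (2π)⁻¹ ∫_0^{2π} f(e^{i t}) e^{-i l t} dt`. -/
def fourierCoeff (l : ℤ) : ℂ :=
  (1 / (2 * π) : ℂ) *
    ∫ t in (0 : ℝ)..(2 * π), symbol θ α β t * Complex.exp (-(Complex.I * (l : ℂ) * (t : ℂ)))

/-- The Toeplitz determinant `D_n = det (f_{j-k})_{j,k=0}^{n-1}`. -/
def toeplitzDet (n : ℕ) : ℂ :=
  Matrix.det (Matrix.of fun j k : Fin n => fourierCoeff θ α β ((j : ℤ) - (k : ℤ)))

end Symbol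

section RiemannHilbert

variable {m : ℕ} (n : ℕ) (θ : Fin (m + 1) → ℝ) (α β : Fin (m + 1) → ℂ)

/-- `λ = ∑_k (β_k - α_k) / 2 - n / 2`. -/
def lam : ℂ := ∑ k, (β k - α k) / 2 - (n : ℂ) / 2

/-- `θ_{j+1}`, with the convention `θ_{m+1} = 2π`. -/
def thetaNext (j : Fin (m + 1)) : ℝ :=
  if h : (j : ℕ) + 1 < m + 1 then θ ⟨(j : ℕ) + 1, h⟩ else 2 * π

/-- The constant `s_j` in the jump matrix on the arc `θ_j < arg z < θ_{j+1}`. -/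
def sConst (j : Fin (m + 1)) : ℂ :=
  Complex.exp
    (-(Complex.I * π * ∑ k ∈ Finset.univ.filter (fun k => k ≤ j), β k)
      + Complex.I * π * ∑ k ∈ Finset.univ.filter (fun k => j < k), β k
      - Complex.I * π * ∑ k ∈ Finset.univ.filter (fun k => k ≤ j), α k
      - 3 * Complex.I * π * ∑ k ∈ Finset.univ.filter (fun k => j < k), α k)

/-- The ray `Γ_j` from `z_j` to infinity in the direction `θ_j`. -/
def ray (j : Fin (m + 1)) : Set ℂ := {z | ∃ r : ℝ, 1 ≤ r ∧ z = (r : ℂ) * pt θ j}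

/-- The contour: the unit circle, the segment `[0, 1]` and the rays `Γ_j`. -/
def contour : Set ℂ :=
  Metric.sphere (0 : ℂ) 1 ∪ {z | ∃ x : ℝ, 0 ≤ x ∧ x ≤ 1 ∧ z = (x : ℂ)} ∪ ⋃ j, ray θ j

/-- `Φ₊ = Φ₋ J` at the contour point `ζ`, where `Φ₊` and `Φ₋` are the limits of `Φ` at `ζ` from
the `+` side and from the `-` side. -/
def HasJump (Φ : ℂ → M2) (plusSide minusSide : Set ℂ) (ζ : ℂ) (J : M2) : Prop :=
  ∃ P Q : M2, Filter.Tendsto Φ (𝓝[plusSide] ζ) (𝓝 P) ∧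
    Filter.Tendsto Φ (𝓝[minusSide] ζ) (𝓝 Q) ∧ P = Q * J

/-- The piecewise constant `c_j` in the connection matrix `C_j` at `z_j` (for `α_j ≠ 0`). For
`j = 0` the two exterior sectors at `z_0 = 1` are distinguished by the sign of `Im z`. -/
def cConst (j : Fin (m + 1)) (z : ℂ) : ℂ :=
  let d : ℂ := 1 - Complex.exp (4 * π * Complex.I * α j)
  let cIn : ℂ := (1 - Complex.exp (2 * π * Complex.I * (β j + α j))) / d
  let cOut : ℂ := (1 - Complex.exp (2 * π * Complex.I * (β j - α j))) / d
  sConst α β j *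
    if ‖z‖ < 1 then cIn
    else if (j ≠ 0 ∧ argFrom 0 z < θ j) ∨ (j = 0 ∧ z.im < 0) then cOut
    else Complex.exp (4 * π * Complex.I * α j) * cOut

/-- The piecewise constant connection matrix `C_j` at `z_j` (for `α_j ≠ 0`). -/
def connection (j : Fin (m + 1)) (z : ℂ) : M2 :=
  upper (cConst θ α β j z) *
    if j = 0 ∧ z.im < 0 then expSigma3 (2 * π * Complex.I * lam n α β) else 1

/-- A function `Φ` together with its local factors: `reg j` is `Φ̃_j` (at `z_j`) and `reg0` is
`Φ̃^{(0)}` (at `0`). -/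
structure PhiData (m : ℕ) where
  Φ : ℂ → M2
  reg : Fin (m + 1) → ℂ → M2
  reg0 : ℂ → M2

/-- `S.Φ` solves the `Φ`-Riemann-Hilbert problem with parameters `n, θ, α, β`, and `S.reg`,
`S.reg0` are its local holomorphic factors. Formulated for parameters with
`e^{4 π i α_j} ≠ 1` for all `j`. -/
structure IsPhiSolution (S : PhiData m) : Prop where
  /-- `Φ` is analytic off the contour. -/
  analytic : ∀ a b, DifferentiableOn ℂ (fun z => S.Φ z a b) (contour θ)ᶜ
  /-- Jump on the arcs of the unit circle, oriented counterclockwise. -/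
  jump_arc : ∀ j, ∀ t : ℝ, θ j < t → t < thetaNext θ j →
    HasJump S.Φ {z | ‖z‖ < 1} {z | 1 < ‖z‖} (Complex.exp ((t : ℂ) * Complex.I))
      (upper (sConst α β j))
  /-- Jump on the rays `Γ_j`, `j ≠ 0`, oriented to infinity. -/
  jump_ray : ∀ j, j ≠ 0 → ∀ r : ℝ, 1 < r →
    HasJump S.Φ {z | 0 < (z / pt θ j).im} {z | (z / pt θ j).im < 0} ((r : ℂ) * pt θ j)
      (expSigma3 (-(2 * π * Complex.I * α j)))
  /-- Jump on the ray `Γ_0 = [1, ∞)`, oriented to infinity. -/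
  jump_ray_zero : ∀ r : ℝ, 1 < r →
    HasJump S.Φ {z | 0 < z.im} {z | z.im < 0} (r : ℂ)
      (expSigma3 (-(2 * π * Complex.I * (α 0 + lam n α β))))
  /-- Jump on the segment from `0` to `1`. -/
  jump_segment : ∀ x : ℝ, 0 < x → x < 1 →
    HasJump S.Φ {z | 0 < z.im} {z | z.im < 0} (x : ℂ)
      (expSigma3 (-(2 * π * Complex.I * lam n α β)))
  /-- `Φ(z) = (I + O(1/z)) z^{(∑ (β_k + α_k)/2 + n/2) σ₃} e^{2 π i ∑_{k > j} α_k σ₃}` as `z → ∞`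
  in the sector `θ_j < arg z < θ_{j+1}`. -/
  infinity : ∀ j, ∃ K R : ℝ, ∀ z : ℂ, R < ‖z‖ →
    θ j < argFrom 0 z → argFrom 0 z < thetaNext θ j →
    ∃ E : M2, (∀ a b, ‖E a b‖ ≤ K / ‖z‖) ∧
      S.Φ z = (1 + E) *
        expSigma3 ((∑ k, (β k + α k) / 2 + (n : ℂ) / 2) * logFrom 0 z) *
        expSigma3 (2 * π * Complex.I * ∑ k ∈ Finset.univ.filter (fun k => j < k), α k)
  /-- `Φ̃_j` is holomorphic at `z_j`. -/
  reg_analytic : ∀ j a b, AnalyticAt ℂ (fun z => S.reg j z a b) (pt θ j)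
  /-- `Φ(z) = Φ̃_j(z) (z - z_j)^{α_j σ₃} C_j` near `z_j`, with `θ_j < arg (z - z_j) < θ_j + 2π`. -/
  reg_eq : ∀ j, ∀ᶠ z in 𝓝 (pt θ j), z ∉ contour θ →
    S.Φ z = S.reg j z * expSigma3 (α j * logFrom (θ j) (z - pt θ j)) * connection n θ α β j z
  /-- `Φ̃^{(0)}` is holomorphic at `0`. -/
  reg0_analytic : ∀ a b, AnalyticAt ℂ (fun z => S.reg0 z a b) 0
  /-- `Φ(z) = Φ̃^{(0)}(z) z^{λ σ₃}` near `0`. -/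
  reg0_eq : ∀ᶠ z in 𝓝 (0 : ℂ), z ∉ contour θ →
    S.Φ z = S.reg0 z * expSigma3 (lam n α β * logFrom 0 z)

/-- The `Φ`-Riemann-Hilbert problem is solvable. -/
def PhiSolvable : Prop := ∃ S : PhiData m, IsPhiSolution n θ α β S

/-- `A_j = α_j Φ̃_j(z_j) σ₃ Φ̃_j(z_j)⁻¹` (for `α_j ≠ 0`). -/
def residueA (S : PhiData m) (j : Fin (m + 1)) : M2 :=
  α j • (S.reg j (pt θ j) * sigma3 * (S.reg j (pt θ j))⁻¹)

/-- `B = λ Φ̃^{(0)}(0) σ₃ Φ̃^{(0)}(0)⁻¹`. -/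
def residueB (S : PhiData m) : M2 :=
  lam n α β • (S.reg0 0 * sigma3 * (S.reg0 0)⁻¹)

end RiemannHilbert

/-- The entrywise derivative of a matrix function of a complex variable. -/
def matDeriv (F : ℂ → M2) (t : ℂ) : M2 := Matrix.of fun a b => deriv (fun s => F s a b) t

/-- All entries of a matrix function are complex differentiable at `t`. -/
def MatDifferentiableAt (F : ℂ → M2) (t : ℂ) : Prop :=
  ∀ a b, DifferentiableAt ℂ (fun s => F s a b) t

/-- The monodromy deformation term of a one-parameter family `T` at the parameter value `t`:
`∑_j trace (A_j ∂Φ̃_j(z_j) Φ̃_j(z_j)⁻¹) + trace (B ∂Φ̃^{(0)}(0) Φ̃^{(0)}(0)⁻¹)`, where `∂` is the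
derivative in the parameter and `A_j`, `B` are given. -/
def deformationTerm {m : ℕ} (θ : Fin (m + 1) → ℝ) (A : Fin (m + 1) → M2) (B : M2)
    (T : ℂ → PhiData m) (t : ℂ) : ℂ :=
  ∑ j, Matrix.trace
      (A j * matDeriv (fun s => (T s).reg j (pt θ j)) t * ((T t).reg j (pt θ j))⁻¹) +
    Matrix.trace (B * matDeriv (fun s => (T s).reg0 0) t * ((T t).reg0 0)⁻¹)

end FisherHartwig

end

open FisherHartwig

noncomputable section

namespace FisherHartwig

open Complex MeasureTheory Filter Set Bornology

/-! The Riemann-Hilbert problem is solved explicitly by orthogonal polynomials, and the formula for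
the determinant then becomes a statement about residues. Let `V` be the density `z^{1-n} f(z) ∏
z_k^{α_k+β_k}` (`dens`) and `F` its Cauchy transform. The Hankel matrix `H` of the moments of `V` is
the Toeplitz matrix with its rows reversed, times a constant (`det_hankel_dens`). On each arc `V =
s_j ψ² z` with `ψ = z^λ ∏ (z - z_k)^{α_k}` (`dens_arc`), so the explicit matrix `model`, which is
`upper F` times `ψ^{σ₃}`, has all the prescribed jumps.

Local form. Integration by parts shows that `F' = 2 (ψ'/ψ) F + ∑ ρ_j / (z - z_j) + ρ_0 / z`
(`pair_inv_sub_sq`). Since `2 α_j` is not an integer, this equation has a solution `R` holomorphic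
at `z_j`, with `R(z_j) = -ρ_j / (2 α_j)` (`exists_local_solution`). In each sector at `z_j` the
difference `F - R` is a multiple of `ψ²`. The multiples are fixed by the Plemelj jumps on the two
adjacent arcs and by continuity across the ray, and they are exactly the `c_j` of the connection
matrix (`cauchyT_local`).

Uniqueness and solvability. For a solution `Φ`, the quotient `Φ · model⁻¹` has no jumps and has
limits at the exceptional points, so it is entire (`IsPhiSolution.exists_entire`). By its behaviour
at infinity and Liouville's theorem it is the only normalized matrix. Its existence forces `det H ≠
0` (`hankel_det_ne_zero`) and it equals the matrix `polMat` of orthogonal polynomials. Conversely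
`det H ≠ 0` produces a solution (`phiSolvable_of_hankel`). So `D_n ≠ 0`, solvability is open because
moments are continuous, and the local values are explicit (`IsPhiSolution.reg_pt`,
`IsPhiSolution.reg0_zero`), hence differentiable because moments are.

The derivative. By Jacobi's formula `∂ ln det H = tr H⁻¹ ∂H`, which is the pairing of `∂V` with the
diagonal Christoffel-Darboux kernel. Write `G = P⁻¹ ∂P` for `P = polMat`. Each trace in the
deformation term equals `α_j (G₀₀ - G₁₁) + ρ_j G₁₀` at `z_j`, plus `2 α_j` times the derivative of
the regular part of `ln ψ` there (`trace_residue`). The same holds at `0` with `λ` and `ρ_0`. The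
first contributions add up to `tr H⁻¹ ∂H`, since they are the residues of a function that is
`O(z⁻²)` at infinity (`residue_identity`). The remaining contributions, and the constant factor
between `det H` and `D_n`, are the explicit logarithms of the formula. -/

/-- The pairing `(2π)⁻¹ ∫_0^{2π} V(t) g(e^{it}) dt` of a density with a function on the circle. -/
def pair (V : ℝ → ℂ) (g : ℂ → ℂ) : ℂ :=
  (1 / (2 * π) : ℂ) * ∫ t in (0 : ℝ)..(2 * π), V t * g (cexp ((t : ℂ) * I))

/-- The Cauchy transform of a density on the unit circle. -/
def cauchyT (V : ℝ → ℂ) (z : ℂ) : ℂ := pair V fun s => (s - z)⁻¹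

lemma norm_exp_ofReal_mul_I' (t : ℝ) : cexp ((t : ℂ) * I) ∈ Metric.sphere (0 : ℂ) 1 := by
  simp [norm_exp_ofReal_mul_I]

/-! ### Densities on the circle: pairings, moments and Cauchy transforms. -/

section Pairing

variable {V W : ℝ → ℂ} {f g : ℂ → ℂ}

lemma continuous_comp_circle (hg : ContinuousOn g (Metric.sphere 0 1)) :
    Continuous fun t : ℝ => g (cexp ((t : ℂ) * I)) :=
  hg.comp_continuous (by fun_prop) norm_exp_ofReal_mul_I'

lemma pair_integrable (hV : IntervalIntegrable V volume 0 (2 * π))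
    (hg : ContinuousOn g (Metric.sphere 0 1)) :
    IntervalIntegrable (fun t => V t * g (cexp ((t : ℂ) * I))) volume 0 (2 * π) :=
  hV.mul_continuousOn (continuous_comp_circle hg).continuousOn

lemma pair_congr (h : EqOn f g (Metric.sphere 0 1)) : pair V f = pair V g := by
  unfold pair
  congr 1
  refine intervalIntegral.integral_congr fun t _ => ?_
  simp only [h (norm_exp_ofReal_mul_I' t)]

lemma pair_add (hV : IntervalIntegrable V volume 0 (2 * π))
    (hf : ContinuousOn f (Metric.sphere 0 1)) (hg : ContinuousOn g (Metric.sphere 0 1)) :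
    pair V (fun s => f s + g s) = pair V f + pair V g := by
  unfold pair
  rw [← mul_add, ← intervalIntegral.integral_add (pair_integrable hV hf) (pair_integrable hV hg)]
  simp only [mul_add]

lemma pair_const_mul (c : ℂ) (g : ℂ → ℂ) : pair V (fun s => c * g s) = c * pair V g := by
  unfold pair
  rw [mul_left_comm c, ← intervalIntegral.integral_const_mul c]
  congr 1
  refine intervalIntegral.integral_congr fun t _ => ?_
  ring

lemma pair_sub (hV : IntervalIntegrable V volume 0 (2 * π))
    (hf : ContinuousOn f (Metric.sphere 0 1)) (hg : ContinuousOn g (Metric.sphere 0 1)) :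
    pair V (fun s => f s - g s) = pair V f - pair V g := by
  unfold pair
  rw [← mul_sub, ← intervalIntegral.integral_sub (pair_integrable hV hf) (pair_integrable hV hg)]
  simp only [mul_sub]

lemma pair_sum {ι : Type*} (s : Finset ι) (hV : IntervalIntegrable V volume 0 (2 * π))
    {G : ι → ℂ → ℂ} (hG : ∀ i ∈ s, ContinuousOn (G i) (Metric.sphere 0 1)) :
    pair V (fun z => ∑ i ∈ s, G i z) = ∑ i ∈ s, pair V (G i) := by
  unfold pair
  rw [← Finset.mul_sum, ← intervalIntegral.integral_finsetSum
    (fun i hi => pair_integrable hV (hG i hi))]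
  simp only [Finset.mul_sum]

lemma norm_pair_le {C : ℝ} (hV : IntervalIntegrable V volume 0 (2 * π))
    (hC : ∀ s ∈ Metric.sphere (0 : ℂ) 1, ‖g s‖ ≤ C) :
    ‖pair V g‖ ≤ C * ((1 / (2 * π)) * ∫ t in (0 : ℝ)..(2 * π), ‖V t‖) := by
  unfold pair
  have h1 : ‖(1 / (2 * π) : ℂ)‖ = 1 / (2 * π) := by
    rw [show (1 / (2 * π) : ℂ) = ((1 / (2 * π) : ℝ) : ℂ) by push_cast; ring, norm_real,
      Real.norm_of_nonneg (by positivity)]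
  rw [norm_mul, h1, mul_left_comm]
  refine mul_le_mul_of_nonneg_left ?_ (by positivity)
  rw [← intervalIntegral.integral_const_mul]
  refine intervalIntegral.norm_integral_le_of_norm_le Real.two_pi_pos.le ?_
    (hV.norm.const_mul C)
  filter_upwards with t _
  rw [norm_mul, mul_comm]
  exact mul_le_mul_of_nonneg_right (hC _ (norm_exp_ofReal_mul_I' t)) (norm_nonneg _)

lemma continuousOn_inv_sub {z : ℂ} (hz : ‖z‖ ≠ 1) :
    ContinuousOn (fun s : ℂ => (s - z)⁻¹) (Metric.sphere 0 1) := by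
  refine ContinuousOn.inv₀ (by fun_prop) fun s hs h => hz ?_
  rw [sub_eq_zero] at h
  simpa [h] using hs

lemma norm_inv_sub_le {s z : ℂ} (hs : s ∈ Metric.sphere (0 : ℂ) 1) (hz : 2 ≤ ‖z‖) :
    ‖(s - z)⁻¹‖ ≤ 2 / ‖z‖ := by
  have hs1 : ‖s‖ = 1 := by simpa using hs
  have h := norm_sub_norm_le z s
  rw [norm_sub_rev, hs1] at h
  rw [norm_inv, inv_eq_one_div, div_le_div_iff₀ (by linarith) (by linarith)]
  linarith

/-- The Cauchy transform of `g V` is `O(1/z)` at infinity. -/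
lemma isBigO_pair_div (hV : IntervalIntegrable V volume 0 (2 * π))
    (hg : ContinuousOn g (Metric.sphere 0 1)) :
    (fun z => pair V fun s => g s * (s - z)⁻¹) =O[cobounded ℂ] fun z => z⁻¹ := by
  obtain ⟨C, hC⟩ := (isCompact_sphere (0 : ℂ) 1).exists_bound_of_continuousOn hg
  refine Asymptotics.IsBigO.of_bound
    (2 * C * ((1 / (2 * π)) * ∫ t in (0 : ℝ)..(2 * π), ‖V t‖)) ?_
  filter_upwards [tendsto_norm_cobounded_atTop.eventually_ge_atTop 2] with z hz
  have hC0 : 0 ≤ C := (norm_nonneg _).trans (hC 1 (by simp))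
  refine (norm_pair_le (C := 2 * C * ‖z⁻¹‖) hV fun s hs => ?_).trans (le_of_eq (by ring))
  rw [norm_mul, norm_inv z]
  calc ‖g s‖ * ‖(s - z)⁻¹‖ ≤ C * (2 / ‖z‖) :=
        mul_le_mul (hC s hs) (norm_inv_sub_le hs hz) (norm_nonneg _) hC0
    _ = 2 * C * ‖z‖⁻¹ := by ring

/-- From `s / (s - z) = 1 + z / (s - z)`. Each factor `s` under the transform can be traded for a
factor `z` outside at the price of one moment. -/
lemma pair_mul_id_div (hV : IntervalIntegrable V volume 0 (2 * π))
    (hg : ContinuousOn g (Metric.sphere 0 1)) {z : ℂ} (hz : ‖z‖ ≠ 1) :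
    pair V (fun s => s * g s * (s - z)⁻¹) = pair V g + z * pair V fun s => g s * (s - z)⁻¹ := by
  have hi := continuousOn_inv_sub hz
  rw [← pair_const_mul, ← pair_add hV hg (by fun_prop)]
  refine pair_congr fun s hs => ?_
  have : s - z ≠ 0 := fun h => hz (by rw [sub_eq_zero] at h; simpa [h] using hs)
  field_simp
  ring

/-- Vanishing moments improve the decay of a Cauchy transform. -/
lemma pair_pow_mul_div (hV : IntervalIntegrable V volume 0 (2 * π))
    (hg : ContinuousOn g (Metric.sphere 0 1)) {z : ℂ} (hz : ‖z‖ ≠ 1) (n : ℕ)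
    (h : ∀ k < n, pair V (fun s => s ^ k * g s) = 0) :
    pair V (fun s => s ^ n * g s * (s - z)⁻¹) = z ^ n * pair V fun s => g s * (s - z)⁻¹ := by
  induction n with
  | zero => simp
  | succ n ih =>
    have := pair_mul_id_div (g := fun s => s ^ n * g s) hV (by fun_prop) hz
    rw [h n (by omega), ih fun k hk => h k (by omega), zero_add] at this
    rw [pow_succ', mul_assoc, ← this]
    congr 1
    ext s
    ring

/-- The Cauchy transform is holomorphic off the circle. -/
lemma hasDerivAt_cauchyT (hV : IntervalIntegrable V volume 0 (2 * π)) {z : ℂ} (hz : ‖z‖ ≠ 1) :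
    HasDerivAt (cauchyT V) (pair V fun s => ((s - z)⁻¹) ^ 2) z := by
  unfold cauchyT pair
  refine HasDerivAt.const_mul _ ?_
  -- Half the distance from `z` to the circle, so that points of the `δ`-ball around `z` stay at
  -- distance at least `δ` from the circle and the kernel is uniformly bounded.
  set δ := |‖z‖ - 1| / 2 with hδ
  have hδ0 : 0 < δ := by
    have : 0 < |‖z‖ - 1| := abs_pos.mpr (sub_ne_zero.mpr hz)
    positivity
  have key : ∀ w ∈ Metric.ball z δ, ∀ s ∈ Metric.sphere (0 : ℂ) 1, δ ≤ ‖s - w‖ := by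
    intro w hw s hs
    have h1 : ‖w - z‖ < δ := by simpa [dist_eq_norm] using hw
    have hs1 : ‖s‖ = 1 := by simpa using hs
    have h2 : |‖z‖ - ‖s‖| ≤ ‖z - s‖ := abs_norm_sub_norm_le z s
    have h3 : ‖z - s‖ ≤ ‖s - w‖ + ‖w - z‖ := by
      rw [norm_sub_rev z s]
      simpa using norm_add_le (s - w) (w - z)
    rw [hs1] at h2
    have : |‖z‖ - 1| = 2 * δ := by rw [hδ]; ring
    linarith
  have hne : ∀ w ∈ Metric.ball z δ, ‖w‖ ≠ 1 := by
    intro w hw h1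
    have := key w hw w (by simpa using h1)
    simp at this
    linarith
  have hmeas : ∀ w ∈ Metric.ball z δ, IntervalIntegrable
      (fun t : ℝ => V t * (cexp ((t : ℂ) * I) - w)⁻¹) volume 0 (2 * π) := fun w hw =>
    pair_integrable hV (continuousOn_inv_sub (hne w hw))
  refine (intervalIntegral.hasDerivAt_integral_of_dominated_loc_of_deriv_le
    (bound := fun t => ‖V t‖ * (δ⁻¹) ^ 2) (s := Metric.ball z δ)
    (F' := fun w t => V t * ((cexp ((t : ℂ) * I) - w)⁻¹) ^ 2)
    (Metric.ball_mem_nhds z hδ0) ?_ ?_ ?_ ?_ ?_ ?_).2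
  · filter_upwards [Metric.ball_mem_nhds z hδ0] with w hw
    exact (hmeas w hw).def'.aestronglyMeasurable
  · exact hmeas z (Metric.mem_ball_self hδ0)
  · exact (pair_integrable (g := fun s => ((s - z)⁻¹) ^ 2) hV
      ((continuousOn_inv_sub hz).pow 2)).def'.aestronglyMeasurable
  · filter_upwards with t _ w hw
    rw [norm_mul, norm_pow, norm_inv]
    have := key w hw _ (norm_exp_ofReal_mul_I' t)
    gcongr
  · exact hV.norm.mul_const _
  · filter_upwards with t _ w hw
    have hne' : cexp ((t : ℂ) * I) - w ≠ 0 := by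
      have := key w hw _ (norm_exp_ofReal_mul_I' t)
      intro h0
      rw [h0, norm_zero] at this
      linarith
    have := (((hasDerivAt_id w).const_sub (cexp ((t : ℂ) * I))).inv hne').const_mul (V t)
    refine this.congr_deriv ?_
    simp [div_eq_mul_inv]

end Pairing

/-! ### Liouville's theorem and uniqueness of normalized matrices. -/

lemma tendsto_inv_cobounded : Tendsto (fun z : ℂ => z⁻¹) (cobounded ℂ) (𝓝 0) :=
  tendsto_inv₀_cobounded

/-- An entire function with a limit at infinity is constant. -/
lemma eq_of_tendsto_cobounded {f : ℂ → ℂ} (hf : Differentiable ℂ f) {c : ℂ}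
    (h : Tendsto f (cobounded ℂ) (𝓝 c)) (z : ℂ) : f z = c :=
  hf.apply_eq_of_tendsto_cocompact z (by rwa [← Metric.cobounded_eq_cocompact])

/-- `P` is entire and `P upper(F) z^{-n σ₃} → 1` at infinity. -/
structure IsNormalized (n : ℕ) (F : ℂ → ℂ) (P : ℂ → M2) : Prop where
  entire : ∀ i j, Differentiable ℂ fun z => P z i j
  col0 : ∀ i, Tendsto (fun z => P z i 0 / z ^ n) (cobounded ℂ) (𝓝 ((1 : M2) i 0))
  col1 : ∀ i, Tendsto (fun z => (P z i 0 * F z + P z i 1) * z ^ n) (cobounded ℂ)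
    (𝓝 ((1 : M2) i 1))

/-- Replacing the second columns by those of `P upper(F)` and `Q upper(F)` does not change the
expression, since the terms with `F` cancel. The factors `z^{-n}` and `z^n` of the normalization
cancel as well, so this entire function has a limit at infinity. The case `Q = P` gives determinant
one, the case of two matrices gives uniqueness. -/
lemma IsNormalized.wronskian {n : ℕ} {F : ℂ → ℂ} {P Q : ℂ → M2} (hP : IsNormalized n F P)
    (hQ : IsNormalized n F Q) (i j : Fin 2) (z : ℂ) :
    P z i 0 * Q z j 1 - P z i 1 * Q z j 0 =
      (1 : M2) i 0 * (1 : M2) j 1 - (1 : M2) i 1 * (1 : M2) j 0 := by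
  refine eq_of_tendsto_cobounded (f := fun z => P z i 0 * Q z j 1 - P z i 1 * Q z j 0) ?_ ?_ z
  · exact ((hP.entire i 0).mul (hQ.entire j 1)).sub ((hP.entire i 1).mul (hQ.entire j 0))
  · refine Tendsto.congr' ?_ (((hP.col0 i).mul (hQ.col1 j)).sub ((hP.col1 i).mul (hQ.col0 j)))
    filter_upwards [eventually_ne_cobounded (0 : ℂ)] with z hz
    have : z ^ n ≠ 0 := pow_ne_zero n hz
    field_simp
    ring

lemma IsNormalized.det {n : ℕ} {F : ℂ → ℂ} {P : ℂ → M2} (hP : IsNormalized n F P) (z : ℂ) :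
    P z 0 0 * P z 1 1 - P z 0 1 * P z 1 0 = 1 := by
  simpa using hP.wronskian hP 0 1 z

/-- A normalized matrix function is unique. -/
lemma IsNormalized.unique {n : ℕ} {F : ℂ → ℂ} {P Q : ℂ → M2} (hP : IsNormalized n F P)
    (hQ : IsNormalized n F Q) : P = Q := by
  ext z i j
  have d := hQ.det z
  have h0 := hP.wronskian hQ 0 0 z
  have h1 := hP.wronskian hQ 0 1 z
  have h2 := hP.wronskian hQ 1 0 z
  have h3 := hP.wronskian hQ 1 1 z
  simp at h0 h1 h2 h3
  -- The four Wronskians say that `P` times the adjugate of `Q` is the identity, and `Q` has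
  -- determinant one.
  fin_cases i <;> fin_cases j <;> simp only [Fin.zero_eta, Fin.mk_one]
  · linear_combination Q z 0 0 * h1 - Q z 1 0 * h0 - P z 0 0 * d
  · linear_combination Q z 0 1 * h1 - Q z 1 1 * h0 - P z 0 1 * d
  · linear_combination Q z 0 0 * h3 - Q z 1 0 * h2 - P z 1 0 * d
  · linear_combination Q z 0 1 * h3 - Q z 1 1 * h2 - P z 1 1 * d

/-! ### Orthogonal polynomials, polynomials of the second kind and the Hankel determinant. -/

/-- The moments of a density. -/
def mom (V : ℝ → ℂ) (k : ℕ) : ℂ := pair V fun s => s ^ k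

/-- The Hankel matrix of the moments. -/
def hankel (V : ℝ → ℂ) (n : ℕ) : Matrix (Fin n) (Fin n) ℂ := .of fun i k => mom V (i + k)

/-- The polynomial with coefficients `c 0, …, c n`. -/
def pol (n : ℕ) (c : ℕ → ℂ) (z : ℂ) : ℂ := ∑ i ∈ Finset.range (n + 1), c i * z ^ i

/-- The second kind polynomial of `pol n c`. -/
def spol (V : ℝ → ℂ) (n : ℕ) (c : ℕ → ℂ) (z : ℂ) : ℂ :=
  ∑ i ∈ Finset.range (n + 1), c i * ∑ l ∈ Finset.range i, mom V l * z ^ (i - 1 - l)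

/-- The coefficients of the monic orthogonal polynomial of degree `n`. -/
def coef0 (V : ℝ → ℂ) (n : ℕ) (i : ℕ) : ℂ :=
  if h : i < n then -((hankel V n)⁻¹.mulVec fun k => mom V (n + k)) ⟨i, h⟩
  else if i = n then 1 else 0

/-- The coefficients of the normalized orthogonal polynomial of degree `n - 1`. -/
def coef1 (V : ℝ → ℂ) (n : ℕ) (i : ℕ) : ℂ :=
  if h : i < n then -((hankel V n)⁻¹.mulVec fun k => if (k : ℕ) + 1 = n then 1 else 0) ⟨i, h⟩
  else 0

/-- The polynomial matrix of orthogonal polynomials and their second kind polynomials. -/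
def polMat (V : ℝ → ℂ) (n : ℕ) (z : ℂ) : M2 :=
  !![pol n (coef0 V n) z, spol V n (coef0 V n) z; pol n (coef1 V n) z, spol V n (coef1 V n) z]

lemma differentiable_pol (n : ℕ) (c : ℕ → ℂ) : Differentiable ℂ (pol n c) := by
  unfold pol
  fun_prop

lemma differentiable_spol (V : ℝ → ℂ) (n : ℕ) (c : ℕ → ℂ) : Differentiable ℂ (spol V n c) := by
  unfold spol
  fun_prop

lemma isBigO_pow_div_pow {i n : ℕ} (h : i < n) :
    (fun z : ℂ => z ^ i / z ^ n) =O[cobounded ℂ] fun z => z⁻¹ := by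
  refine Asymptotics.IsBigO.of_bound 1 ?_
  filter_upwards [tendsto_norm_cobounded_atTop.eventually_ge_atTop 1] with z hz
  rw [norm_div, norm_pow, norm_pow, norm_inv, one_mul, div_le_iff₀ (by positivity)]
  rw [inv_mul_eq_div, le_div_iff₀ (by positivity), ← pow_succ]
  exact pow_le_pow_right₀ hz h

lemma isBigO_pol (n : ℕ) (c : ℕ → ℂ) :
    (fun z => pol n c z / z ^ n - c n) =O[cobounded ℂ] fun z => z⁻¹ := by
  have : (fun z => ∑ i ∈ Finset.range n, c i * (z ^ i / z ^ n)) =O[cobounded ℂ] fun z => z⁻¹ :=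
    (Asymptotics.IsBigO.sum fun i hi =>
      (isBigO_pow_div_pow (Finset.mem_range.1 hi)).const_mul_left (c i) :
        (∑ i ∈ Finset.range n, fun z => c i * (z ^ i / z ^ n)) =O[cobounded ℂ] _).congr_left
      fun z => by simp [Finset.sum_apply]
  refine this.congr' ?_ EventuallyEq.rfl
  filter_upwards [eventually_ne_cobounded (0 : ℂ)] with z hz
  have : z ^ n ≠ 0 := pow_ne_zero n hz
  rw [pol, Finset.sum_range_succ, add_div, Finset.sum_div, mul_div_assoc (c n), div_self this]
  simp [mul_div_assoc]

section

variable {V : ℝ → ℂ} (hV : IntervalIntegrable V volume 0 (2 * π))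
include hV

/-- The quotient `(s^i - z^i) / (s - z)` is a geometric sum, and its pairing with the density is the
inner sum in `spol`. Thus the second kind polynomial corrects `p F` to the Cauchy transform of `p
V`, whose decay is governed by orthogonality. -/
lemma pol_mul_cauchyT (n : ℕ) (c : ℕ → ℂ) {z : ℂ} (hz : ‖z‖ ≠ 1) :
    pol n c z * cauchyT V z + spol V n c z = pair V fun s => pol n c s * (s - z)⁻¹ := by
  have hi := continuousOn_inv_sub hz
  have h1 : spol V n c z = pair V fun s =>
      ∑ i ∈ Finset.range (n + 1), c i * ∑ l ∈ Finset.range i, z ^ (i - 1 - l) * s ^ l := by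
    rw [pair_sum _ hV fun i _ => by fun_prop]
    refine Finset.sum_congr rfl fun i _ => ?_
    rw [pair_const_mul, pair_sum _ hV fun i _ => by fun_prop]
    simp only [pair_const_mul, mom]
    simp only [mul_comm]
  rw [h1, cauchyT, ← pair_const_mul, ← pair_add hV (by fun_prop) (by fun_prop)]
  refine pair_congr fun s hs => ?_
  have hne : s - z ≠ 0 := fun h => hz (by rw [sub_eq_zero] at h; simpa [h] using hs)
  have h2 : ∀ i, (∑ l ∈ Finset.range i, z ^ (i - 1 - l) * s ^ l) * (s - z) = s ^ i - z ^ i := by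
    intro i
    simpa only [mul_comm] using geom_sum₂_mul s z i
  rw [← mul_left_inj' hne, add_mul, mul_assoc, mul_assoc, inv_mul_cancel₀ hne, mul_one, mul_one,
    Finset.sum_mul, pol, pol, ← Finset.sum_add_distrib]
  refine Finset.sum_congr rfl fun i _ => ?_
  rw [mul_assoc, h2]
  ring

lemma pair_pow_mul_pol (n k : ℕ) (c : ℕ → ℂ) :
    pair V (fun s => s ^ k * pol n c s) = ∑ i ∈ Finset.range (n + 1), c i * mom V (i + k) := by
  have : (fun s => s ^ k * pol n c s) =
      fun s => ∑ i ∈ Finset.range (n + 1), c i * s ^ (i + k) := by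
    ext s
    rw [pol, Finset.mul_sum]
    exact Finset.sum_congr rfl fun i _ => by ring
  rw [this, pair_sum _ hV fun i _ => by fun_prop]
  simp only [pair_const_mul, mom]

omit hV in
lemma continuous_pol (n : ℕ) (c : ℕ → ℂ) : Continuous (pol n c) :=
  (differentiable_pol n c).continuous

lemma pair_pow_mul_coef0 {n : ℕ} (hd : (hankel V n).det ≠ 0) {k : ℕ} (hk : k < n) :
    pair V (fun s => s ^ k * pol n (coef0 V n) s) = 0 := by
  rw [pair_pow_mul_pol hV, Finset.sum_range_succ, Finset.sum_range]
  have h1 : ∑ i : Fin n, coef0 V n i * mom V (i + k) =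
      -((hankel V n).mulVec ((hankel V n)⁻¹.mulVec fun k => mom V (n + k))) ⟨k, hk⟩ := by
    rw [Matrix.mulVec, dotProduct, ← Finset.sum_neg_distrib]
    refine Finset.sum_congr rfl fun i _ => ?_
    simp only [coef0, i.2, dite_true, hankel, Matrix.of_apply, add_comm k]
    ring
  rw [h1, Matrix.mulVec_mulVec, Matrix.mul_nonsing_inv _ (Ne.isUnit hd), Matrix.one_mulVec]
  simp [coef0]

/-- The sign in `coef1` makes the moment of order `n - 1` equal to `-1`. As `1 / (s - z) = -∑ s^l /
z^{l+1}`, the Cauchy transform is then asymptotic to `+z^{-n}`, as the lower right entry of the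
normalization requires. -/
lemma pair_pow_mul_coef1 {n : ℕ} (hd : (hankel V n).det ≠ 0) {k : ℕ} (hk : k < n) :
    pair V (fun s => s ^ k * pol n (coef1 V n) s) = -(if k + 1 = n then 1 else 0) := by
  rw [pair_pow_mul_pol hV, Finset.sum_range_succ, Finset.sum_range]
  have h1 : ∑ i : Fin n, coef1 V n i * mom V (i + k) =
      -((hankel V n).mulVec ((hankel V n)⁻¹.mulVec
        fun k => if (k : ℕ) + 1 = n then 1 else 0)) ⟨k, hk⟩ := by
    rw [Matrix.mulVec, dotProduct, ← Finset.sum_neg_distrib]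
    refine Finset.sum_congr rfl fun i _ => ?_
    simp only [coef1, i.2, dite_true, hankel, Matrix.of_apply, add_comm k]
    ring
  rw [h1, Matrix.mulVec_mulVec, Matrix.mul_nonsing_inv _ (Ne.isUnit hd), Matrix.one_mulVec]
  simp [coef1]

lemma pair_coef0_div {n : ℕ} (hd : (hankel V n).det ≠ 0) {z : ℂ} (hz : ‖z‖ ≠ 1) :
    (pol n (coef0 V n) z * cauchyT V z + spol V n (coef0 V n) z) * z ^ n =
      pair V fun s => s ^ n * pol n (coef0 V n) s * (s - z)⁻¹ := by
  rw [pol_mul_cauchyT hV _ _ hz, pair_pow_mul_div hV (continuous_pol _ _).continuousOn hz n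
    fun k hk => pair_pow_mul_coef0 hV hd hk, mul_comm]

/-- Only `n - 1` moments vanish here. Extracting the last power of `z` meets the moment `-1`, which
becomes the leading term `1`. -/
lemma pair_coef1_div {n : ℕ} (hn : 1 ≤ n) (hd : (hankel V n).det ≠ 0) {z : ℂ} (hz : ‖z‖ ≠ 1) :
    (pol n (coef1 V n) z * cauchyT V z + spol V n (coef1 V n) z) * z ^ n =
      1 + pair V fun s => s ^ n * pol n (coef1 V n) s * (s - z)⁻¹ := by
  obtain ⟨l, rfl⟩ := Nat.exists_eq_add_of_le' hn
  have hc := (continuous_pol (l + 1) (coef1 V (l + 1)))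
  have h1 := pair_pow_mul_div hV hc.continuousOn hz l fun k hk => by
    rw [pair_pow_mul_coef1 hV hd (by omega)]; simp; omega
  have h2 := pair_mul_id_div (g := fun s => s ^ l * pol (l + 1) (coef1 V (l + 1)) s) hV
    (by fun_prop) hz
  rw [h1, pair_pow_mul_coef1 hV hd (by omega)] at h2
  have h3 : (pair V fun s => s ^ (l + 1) * pol (l + 1) (coef1 V (l + 1)) s * (s - z)⁻¹) =
      pair V fun s => s * (s ^ l * pol (l + 1) (coef1 V (l + 1)) s) * (s - z)⁻¹ := by
    congr 1; ext s; ring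
  rw [pol_mul_cauchyT hV _ _ hz, h3, h2]
  simp only [if_true]
  ring

omit hV in
lemma eventually_norm_ne_one : ∀ᶠ z in cobounded ℂ, ‖z‖ ≠ 1 :=
  (tendsto_norm_cobounded_atTop.eventually_gt_atTop 1).mono fun _ h => h.ne'

omit hV in
lemma polMat_col0 (n : ℕ) (i : Fin 2) :
    (fun z => polMat V n z i 0 / z ^ n - (1 : M2) i 0) =O[cobounded ℂ] fun z => z⁻¹ := by
  revert i
  rw [Fin.forall_fin_two]
  constructor
  · have := isBigO_pol n (coef0 V n)
    simpa [polMat, coef0] using this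
  · have := isBigO_pol n (coef1 V n)
    simpa [polMat, coef1] using this

lemma polMat_col1 {n : ℕ} (hn : 1 ≤ n) (hd : (hankel V n).det ≠ 0) (i : Fin 2) :
    (fun z => (polMat V n z i 0 * cauchyT V z + polMat V n z i 1) * z ^ n - (1 : M2) i 1)
      =O[cobounded ℂ] fun z => z⁻¹ := by
  revert i
  rw [Fin.forall_fin_two]
  constructor
  · refine (isBigO_pair_div (g := fun s => s ^ n * pol n (coef0 V n) s) hV
      (by have := continuous_pol n (coef0 V n); fun_prop)).congr' ?_ EventuallyEq.rfl
    filter_upwards [eventually_norm_ne_one] with z hz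
    simp [polMat, pair_coef0_div hV hd hz]
  · refine (isBigO_pair_div (g := fun s => s ^ n * pol n (coef1 V n) s) hV
      (by have := continuous_pol n (coef1 V n); fun_prop)).congr' ?_ EventuallyEq.rfl
    filter_upwards [eventually_norm_ne_one] with z hz
    simp [polMat, pair_coef1_div hV hn hd hz]

omit hV in
lemma tendsto_of_isBigO_sub {f : ℂ → ℂ} {c : ℂ}
    (h : (fun z => f z - c) =O[cobounded ℂ] fun z => z⁻¹) : Tendsto f (cobounded ℂ) (𝓝 c) := by
  simpa using (h.trans_tendsto tendsto_inv_cobounded).add_const c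

omit hV in
lemma differentiable_polMat (n : ℕ) (i j : Fin 2) : Differentiable ℂ fun z => polMat V n z i j := by
  fin_cases i <;> fin_cases j <;> simp [polMat]
  · exact differentiable_pol _ _
  · exact differentiable_spol _ _ _
  · exact differentiable_pol _ _
  · exact differentiable_spol _ _ _

lemma isNormalized_polMat {n : ℕ} (hn : 1 ≤ n) (hd : (hankel V n).det ≠ 0) :
    IsNormalized n (cauchyT V) (polMat V n) where
  entire := differentiable_polMat n
  col0 i := tendsto_of_isBigO_sub (polMat_col0 n i)
  col1 i := tendsto_of_isBigO_sub (polMat_col1 hV hn hd i)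

/-- If a normalized matrix exists then the Hankel determinant does not vanish. -/
lemma hankel_det_ne_zero {n : ℕ} {P : ℂ → M2} (hP : IsNormalized n (cauchyT V) P) :
    (hankel V n).det ≠ 0 := by
  intro hd
  -- A null vector is a nonzero polynomial of degree below `n` that is orthogonal to all powers
  -- below `n`.
  obtain ⟨v, hv, hv0⟩ := Matrix.exists_mulVec_eq_zero_iff.mpr hd
  set c : ℕ → ℂ := fun i => if h : i < n then v ⟨i, h⟩ else 0 with hc
  have horth : ∀ k < n, pair V (fun s => s ^ k * pol n c s) = 0 := by
    intro k hk
    rw [pair_pow_mul_pol hV, Finset.sum_range_succ, Finset.sum_range]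
    have := congrFun hv0 ⟨k, hk⟩
    simp only [Matrix.mulVec, dotProduct, hankel, Matrix.of_apply, Pi.zero_apply] at this
    simp only [hc, Fin.is_lt, dite_true, Fin.eta, lt_irrefl, dite_false, zero_mul, add_zero]
    rw [← this]
    exact Finset.sum_congr rfl fun i _ => by rw [add_comm k, mul_comm]
  have hcn : c n = 0 := by simp [hc]
  have h0 : Tendsto (fun z => pol n c z / z ^ n) (cobounded ℂ) (𝓝 0) := by
    have := tendsto_of_isBigO_sub (isBigO_pol n c)
    rwa [hcn] at this
  have h1 : Tendsto (fun z => (pol n c z * cauchyT V z + spol V n c z) * z ^ n)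
      (cobounded ℂ) (𝓝 0) := by
    have hcont := continuous_pol n c
    have := (isBigO_pair_div (g := fun s => s ^ n * pol n c s) hV
      (by fun_prop)).trans_tendsto tendsto_inv_cobounded
    refine this.congr' ?_
    filter_upwards [eventually_norm_ne_one] with z hz
    rw [pol_mul_cauchyT hV _ _ hz, pair_pow_mul_div hV hcont.continuousOn hz n horth, mul_comm]
  -- Adding this polynomial and its second kind polynomial to the first row does not disturb the
  -- normalization, so uniqueness makes the polynomial zero.
  have hQ : IsNormalized n (cauchyT V) fun z => P z + !![pol n c z, spol V n c z; 0, 0] := by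
    refine ⟨fun i j => ?_, fun i => ?_, fun i => ?_⟩
    · have e1 := differentiable_pol n c
      have e2 := differentiable_spol V n c
      have e3 := hP.entire i j
      fin_cases i <;> fin_cases j <;> simp at e3 ⊢ <;> fun_prop
    · have := hP.col0 i
      fin_cases i
      · simpa [add_div] using this.add h0
      · simpa using this
    · have := hP.col1 i
      fin_cases i
      · refine (this.add h1).congr' ?_ |>.trans (by simp)
        filter_upwards with z
        simp
        ring
      · simpa using this
  have hpol : ∀ z, pol n c z = 0 := fun z => by
    have := congrFun (congrFun (congrFun (hP.unique hQ) z) 0) 0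
    simpa using this
  apply hv
  have hpoly : (∑ i ∈ Finset.range (n + 1), Polynomial.C (c i) * Polynomial.X ^ i) = 0 := by
    refine Polynomial.funext fun z => ?_
    simpa [Polynomial.eval_finsetSum, pol] using hpol z
  ext i
  have := congrArg (fun q => Polynomial.coeff q (i : ℕ)) hpoly
  simp [Polynomial.finsetSum_coeff, Polynomial.coeff_X_pow, hc] at this
  exact this

end

/-! ### Branches of the logarithm and their limits on the two sides of the cut. -/

section Logs

lemma argFrom_mem (φ : ℝ) (z : ℂ) : argFrom φ z ∈ Ico φ (φ + 2 * π) := toIcoMod_mem_Ico _ _ _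

lemma logFrom_im (φ : ℝ) (z : ℂ) : (logFrom φ z).im = argFrom φ z := by simp [logFrom]

lemma exp_logFrom (φ : ℝ) {z : ℂ} (hz : z ≠ 0) : cexp (logFrom φ z) = z := by
  have h1 : (argFrom φ z : ℂ) * I = (arg z : ℂ) * I +
      ((-toIcoDiv Real.two_pi_pos φ (arg z) : ℤ) : ℂ) * (2 * π * I) := by
    rw [argFrom, toIcoMod]
    simp only [zsmul_eq_mul]
    push_cast
    ring
  rw [logFrom, h1, ← add_assoc, exp_add, exp_int_mul_two_pi_mul_I, mul_one, exp_add,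
    ← ofReal_exp, Real.exp_log (norm_pos_iff.mpr hz)]
  exact norm_mul_exp_arg_mul_I z

/-- A logarithm of `z` is singled out by the window of length `2π` containing its imaginary part.
The branch computations below reduce to locating imaginary parts in this way. -/
lemma logFrom_eq {φ : ℝ} {z w : ℂ} (h : cexp w = z) (h1 : φ ≤ w.im) (h2 : w.im < φ + 2 * π) :
    logFrom φ z = w := by
  have hz : z ≠ 0 := h ▸ exp_ne_zero w
  obtain ⟨k, hk⟩ := exp_eq_exp_iff_exists_int.mp ((exp_logFrom φ hz).trans h.symm)
  have him := congrArg Complex.im hk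
  have hm := argFrom_mem φ z
  rw [← logFrom_im] at hm
  simp at him
  have hk0 : k = 0 := by
    have hlt : (k : ℝ) * (2 * π) < 1 * (2 * π) := by linarith [hm.2]
    have hgt : (-1 : ℝ) * (2 * π) < (k : ℝ) * (2 * π) := by linarith [hm.1]
    have h3 := lt_of_mul_lt_mul_right hlt Real.two_pi_pos.le
    have h4 := lt_of_mul_lt_mul_right hgt Real.two_pi_pos.le
    have h5 : k < 1 := by exact_mod_cast h3
    have h6 : -1 < k := by exact_mod_cast h4
    omega
  rw [hk, hk0]
  simp

lemma exp_div_rot (φ : ℝ) {z : ℂ} (hz : z ≠ 0) (c : ℝ) :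
    cexp (Complex.log (z / cexp (φ * I)) + ((φ : ℂ) + c) * I) = z * cexp (c * I) := by
  rw [exp_add, exp_log (div_ne_zero hz (exp_ne_zero _)), add_mul, exp_add]
  field_simp

/-- Division by `-e^{iφ}` turns the cut `arg z = φ` into the negative real axis, which reduces
holomorphy off the cut to that of the principal logarithm. -/
lemma logFrom_of_mem_slitPlane {φ : ℝ} {z : ℂ} (h : -(z / cexp (φ * I)) ∈ slitPlane) :
    logFrom φ z = Complex.log (-(z / cexp (φ * I))) + ((φ : ℂ) + π) * I := by
  have hz : z ≠ 0 := by
    rintro rfl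
    simp at h
  have h1 := abs_lt.1 (lt_of_le_of_ne (abs_arg_le_pi _) (by
    intro h2
    have h3 := mem_slitPlane_iff_arg.1 h
    have h4 := neg_pi_lt_arg (-(z / cexp (φ * I)))
    rcases abs_choice (arg (-(z / cexp (φ * I)))) with h5 | h5
    · exact h3.1 (h5 ▸ h2)
    · rw [h5] at h2; linarith))
  refine logFrom_eq ?_ ?_ ?_
  · have := exp_div_rot φ (neg_ne_zero.mpr hz) π
    rw [neg_div] at this
    rw [this]
    simp
  · simp [log_im]; linarith [h1.1]
  · simp [log_im]; linarith [h1.2]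

lemma hasDerivAt_logFrom {φ : ℝ} {z : ℂ} (h : -(z / cexp (φ * I)) ∈ slitPlane) :
    HasDerivAt (logFrom φ) z⁻¹ z := by
  have h1 : HasDerivAt (fun w => Complex.log (-(w / cexp (φ * I))) + ((φ : ℂ) + π) * I) z⁻¹ z := by
    have := (((hasDerivAt_id z).div_const (cexp (φ * I))).neg.clog h).add_const
      (((φ : ℂ) + π) * I)
    refine this.congr_deriv ?_
    have hz : z ≠ 0 := by
      rintro rfl
      simp at h
    have := exp_ne_zero (φ * I)
    simp only [id, Pi.neg_apply]
    field_simp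
  refine h1.congr_of_eventuallyEq ?_
  have hc : Continuous fun w : ℂ => -(w / cexp (φ * I)) := by fun_prop
  filter_upwards [hc.continuousAt.preimage_mem_nhds (isOpen_slitPlane.mem_nhds h)] with w hw
  exact logFrom_of_mem_slitPlane hw

/-- Division by `e^{iφ}` instead puts the cut on the positive real axis, where the principal
logarithm is continuous. This and the companion formula for the other side give both one-sided
limits, which differ by `2πi`. -/
lemma logFrom_of_im_pos {φ : ℝ} {z : ℂ} (h : 0 < (z / cexp (φ * I)).im) :
    logFrom φ z = Complex.log (z / cexp (φ * I)) + (φ : ℂ) * I := by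
  have hz : z ≠ 0 := by
    rintro rfl
    simp at h
  refine logFrom_eq ?_ ?_ ?_
  · simpa using exp_div_rot φ hz 0
  · simpa [log_im] using arg_nonneg_iff.mpr h.le
  · simp [log_im]; linarith [arg_le_pi (z / cexp (φ * I)), Real.pi_pos]

lemma logFrom_of_im_neg {φ : ℝ} {z : ℂ} (h : (z / cexp (φ * I)).im < 0) :
    logFrom φ z = Complex.log (z / cexp (φ * I)) + ((φ : ℂ) + 2 * π) * I := by
  have hz : z ≠ 0 := by
    rintro rfl
    simp at h
  refine logFrom_eq ?_ ?_ ?_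
  · have := exp_div_rot φ hz (2 * π)
    push_cast at this
    rw [this, exp_two_pi_mul_I, mul_one]
  · simp [log_im]; linarith [neg_pi_lt_arg (z / cexp (φ * I)), Real.pi_pos]
  · simpa [log_im] using arg_neg_iff.mpr h

lemma tendsto_logFrom_plus {φ : ℝ} {ζ : ℂ} {r : ℝ} (hr : 0 < r) (hζ : ζ = r * cexp (φ * I)) :
    Tendsto (logFrom φ) (𝓝[{z | 0 < (z / cexp (φ * I)).im}] ζ)
      (𝓝 (Real.log r + (φ : ℂ) * I)) := by
  have h1 : ζ / cexp (φ * I) = r := by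
    rw [hζ, mul_div_assoc, div_self (exp_ne_zero _), mul_one]
  have h2 : ContinuousAt (fun z => Complex.log (z / cexp (φ * I)) + (φ : ℂ) * I) ζ := by
    refine ContinuousAt.add (ContinuousAt.clog (by fun_prop) ?_) (by fun_prop)
    rw [h1]
    exact ofReal_mem_slitPlane.mpr hr
  have h3 := h2.tendsto
  rw [h1, ← ofReal_log hr.le] at h3
  refine (h3.mono_left nhdsWithin_le_nhds).congr' ?_
  filter_upwards [self_mem_nhdsWithin] with z hz
  exact (logFrom_of_im_pos hz).symm

lemma tendsto_logFrom_minus {φ : ℝ} {ζ : ℂ} {r : ℝ} (hr : 0 < r) (hζ : ζ = r * cexp (φ * I)) :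
    Tendsto (logFrom φ) (𝓝[{z | (z / cexp (φ * I)).im < 0}] ζ)
      (𝓝 (Real.log r + ((φ : ℂ) + 2 * π) * I)) := by
  have h1 : ζ / cexp (φ * I) = r := by
    rw [hζ, mul_div_assoc, div_self (exp_ne_zero _), mul_one]
  have h2 : ContinuousAt (fun z => Complex.log (z / cexp (φ * I)) + ((φ : ℂ) + 2 * π) * I) ζ := by
    refine ContinuousAt.add (ContinuousAt.clog (by fun_prop) ?_) (by fun_prop)
    rw [h1]
    exact ofReal_mem_slitPlane.mpr hr
  have h3 := h2.tendsto
  rw [h1, ← ofReal_log hr.le] at h3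
  refine (h3.mono_left nhdsWithin_le_nhds).congr' ?_
  filter_upwards [self_mem_nhdsWithin] with z hz
  exact (logFrom_of_im_neg hz).symm

end Logs

/-! ### The function `ψ`, its cuts and its local branches. -/

section Psi

variable {m : ℕ} (n : ℕ) (θ : Fin (m + 1) → ℝ) (α β : Fin (m + 1) → ℂ)

/-- `ln (z - z_k)`. -/
def lg (k : Fin (m + 1)) (z : ℂ) : ℂ := logFrom (θ k) (z - pt θ k)

/-- The logarithm of `ψ(z) = z^λ ∏ (z - z_k)^{α_k}`. -/
def logPsi (z : ℂ) : ℂ := lam n α β * logFrom 0 z + ∑ k, α k * lg θ k z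

/-- The logarithmic derivative of `ψ`. -/
def ratPsi (z : ℂ) : ℂ := lam n α β / z + ∑ k, α k / (z - pt θ k)

/-- The regular part of `ln ψ` at `z_j`. -/
def locLog (j : Fin (m + 1)) (z : ℂ) : ℂ :=
  lam n α β * (Complex.log (z / pt θ j) + θ j * I) + ∑ k ∈ Finset.univ.erase j, α k * lg θ k z

/-- `z` is off the cuts of `ψ`. -/
def OffCuts (z : ℂ) : Prop := -z ∈ slitPlane ∧ ∀ k, 1 - z / pt θ k ∈ slitPlane

lemma pt_ne_zero (k : Fin (m + 1)) : pt θ k ≠ 0 := exp_ne_zero _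

@[simp] lemma norm_pt (k : Fin (m + 1)) : ‖pt θ k‖ = 1 := norm_exp_ofReal_mul_I _

lemma rot_sub_pt (k : Fin (m + 1)) (z : ℂ) :
    (z - pt θ k) / cexp (θ k * I) = z / pt θ k - 1 := by
  rw [pt, sub_div, div_self (exp_ne_zero _)]

variable {θ}

lemma hasDerivAt_lg {k : Fin (m + 1)} {z : ℂ} (h : 1 - z / pt θ k ∈ slitPlane) :
    HasDerivAt (lg θ k) (z - pt θ k)⁻¹ z := by
  have h1 : -((z - pt θ k) / cexp (θ k * I)) ∈ slitPlane := by
    rwa [rot_sub_pt, neg_sub]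
  exact (hasDerivAt_logFrom h1).comp_sub_const z (pt θ k)

lemma hasDerivAt_logFrom_zero {z : ℂ} (h : -z ∈ slitPlane) : HasDerivAt (logFrom 0) z⁻¹ z :=
  hasDerivAt_logFrom (by simpa using h)

lemma hasDerivAt_logPsi {z : ℂ} (h : OffCuts θ z) :
    HasDerivAt (logPsi n θ α β) (ratPsi n θ α β z) z := by
  unfold logPsi ratPsi
  simp only [div_eq_mul_inv]
  exact ((hasDerivAt_logFrom_zero h.1).const_mul _).add
    (HasDerivAt.fun_sum fun k _ => (hasDerivAt_lg (h.2 k)).const_mul _)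

lemma isOpen_offCuts : IsOpen {z | OffCuts θ z} := by
  simp only [OffCuts, ofPred_and, ofPred_forall]
  refine (isOpen_slitPlane.preimage continuous_neg).inter (isOpen_iInter_of_finite fun k => ?_)
  exact isOpen_slitPlane.preimage (by fun_prop)

/-- With `θ 0 = 0` the cut `[0, ∞)` of `ln z` is the segment `[0, 1]` followed by `Γ_0`, and the
other cuts are the rays `Γ_k`. -/
lemma offCuts_of_notMem_contour (h0 : θ 0 = 0) {z : ℂ} (h : z ∉ contour θ) : OffCuts θ z := by
  simp only [contour, mem_union, not_or, mem_iUnion, not_exists] at h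
  obtain ⟨⟨_, h2⟩, h3⟩ := h
  have hp0 : pt θ 0 = 1 := by simp [pt, h0]
  refine ⟨?_, fun k => ?_⟩
  · rw [mem_slitPlane_iff]
    by_contra hc
    push Not at hc
    simp at hc
    have hz : z = (z.re : ℂ) := by
      apply Complex.ext <;> simp [hc.2]
    rcases le_or_gt z.re 1 with h4 | h4
    · exact h2 ⟨z.re, hc.1, h4, hz⟩
    · exact h3 0 ⟨z.re, h4.le, by rw [hp0, mul_one]; exact hz⟩
  · rw [mem_slitPlane_iff]
    by_contra hc
    push Not at hc
    simp at hc
    have hz : z / pt θ k = ((z / pt θ k).re : ℂ) := by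
      apply Complex.ext <;> simp [hc.2]
    refine h3 k ⟨(z / pt θ k).re, hc.1, ?_⟩
    rw [← hz, div_mul_cancel₀ _ (pt_ne_zero θ k)]

lemma norm_ne_one_of_notMem_contour {z : ℂ} (h : z ∉ contour θ) : ‖z‖ ≠ 1 := by
  intro h1
  exact h (Or.inl (Or.inl (by simpa using h1)))

lemma slit_of_norm_eq_one {k : Fin (m + 1)} {z : ℂ} (hz : ‖z‖ ≤ 1) (hne : z ≠ pt θ k) :
    1 - z / pt θ k ∈ slitPlane := by
  rw [mem_slitPlane_iff]
  by_contra hc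
  push Not at hc
  simp at hc
  have hz' : z / pt θ k = ((z / pt θ k).re : ℂ) := by
    apply Complex.ext <;> simp [hc.2]
  have h1 : ‖z / pt θ k‖ ≤ 1 := by simpa using hz
  have h2 : (z / pt θ k).re = 1 := le_antisymm ((re_le_norm _).trans h1) hc.1
  rw [h2] at hz'
  apply hne
  rw [div_eq_iff (pt_ne_zero θ k)] at hz'
  simpa using hz'

variable (hθ_mono : StrictMono θ) (hθ_zero : θ 0 = 0) (hθ_lt : ∀ j, θ j < 2 * π)

lemma exp_mul_I_eq_imp {s t : ℝ} (h : cexp (s * I) = cexp (t * I)) (h1 : |s - t| < 2 * π) :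
    s = t := by
  obtain ⟨k, hk⟩ := exp_eq_exp_iff_exists_int.mp h
  have him := congrArg Complex.im hk
  simp at him
  have h2 : s - t = k * (2 * π) := by linarith
  rw [h2, abs_mul, abs_of_pos Real.two_pi_pos] at h1
  have h3 : |(k : ℝ)| < 1 := by
    have := Real.two_pi_pos
    by_contra hc
    push Not at hc
    nlinarith
  have h4 : k = 0 := by
    have : |k| < 1 := by exact_mod_cast h3
    exact Int.abs_lt_one_iff.mp this
  rw [h4] at h2
  simp at h2
  linarith

section
include hθ_mono hθ_zero hθ_lt

omit hθ_lt in
lemma theta_nonneg (k : Fin (m + 1)) : 0 ≤ θ k := by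
  rw [← hθ_zero]
  exact hθ_mono.monotone (Fin.zero_le k)

lemma pt_injective : Function.Injective (pt θ) := by
  intro j k h
  apply hθ_mono.injective
  refine exp_mul_I_eq_imp h ?_
  rw [abs_lt]
  constructor <;> linarith [theta_nonneg hθ_mono hθ_zero j, theta_nonneg hθ_mono hθ_zero k,
    hθ_lt j, hθ_lt k]

omit hθ_zero hθ_mono in
lemma thetaNext_le (j : Fin (m + 1)) : thetaNext θ j ≤ 2 * π := by
  unfold thetaNext
  split_ifs
  · exact (hθ_lt _).le
  · exact le_rfl

omit hθ_zero hθ_lt in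
lemma thetaNext_le_of_lt {j k : Fin (m + 1)} (h : j < k) : thetaNext θ j ≤ θ k := by
  unfold thetaNext
  rw [dif_pos (by omega)]
  exact hθ_mono.monotone (by rw [Fin.le_def]; simp; omega)

omit hθ_zero in
lemma theta_lt_thetaNext (j : Fin (m + 1)) : θ j < thetaNext θ j := by
  unfold thetaNext
  split_ifs
  · exact hθ_mono (by rw [Fin.lt_def]; simp)
  · exact hθ_lt _

lemma offCuts_arc {j : Fin (m + 1)} {t : ℝ} (h1 : θ j < t) (h2 : t < thetaNext θ j) :
    OffCuts θ (cexp (t * I)) := by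
  have h3 := thetaNext_le hθ_lt j
  have h0 : ∀ k, cexp (t * I) ≠ pt θ k := by
    intro k h
    have hk0 := theta_nonneg hθ_mono hθ_zero k
    have hj0 := theta_nonneg hθ_mono hθ_zero j
    have := exp_mul_I_eq_imp h (by rw [abs_lt]; constructor <;> linarith [hθ_lt k])
    rcases le_or_gt k j with hk | hk
    · linarith [hθ_mono.monotone hk]
    · linarith [thetaNext_le_of_lt hθ_mono hk]
  refine ⟨?_, fun k => slit_of_norm_eq_one (by simp [norm_exp_ofReal_mul_I]) (h0 k)⟩
  rw [mem_slitPlane_iff]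
  by_contra hc
  push Not at hc
  simp [exp_ofReal_mul_I_re, exp_ofReal_mul_I_im] at hc
  apply h0 0
  rw [pt, hθ_zero]
  apply Complex.ext
  · rw [exp_ofReal_mul_I_re]
    have := Real.sin_sq_add_cos_sq t
    rw [hc.2] at this
    simp
    nlinarith
  · simp [exp_ofReal_mul_I_im, hc.2]

omit hθ_zero hθ_mono hθ_lt in
/-- The argument of `1 - e^{-iτ}/ρ`. -/
lemma arg_aux {τ ρ : ℝ} (h1 : 0 < τ) (h2 : τ < 2 * π) (hρ : 1 < ρ) {w : ℂ}
    (hw : w = 1 - cexp (-(τ * I)) / ρ) : 0 ≤ τ + arg w ∧ τ + arg w < 2 * π := by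
  have hρ0 : 0 < ρ := by linarith
  have hre : w.re = 1 - Real.cos τ / ρ := by
    rw [hw, ← neg_mul, ← ofReal_neg, sub_re, div_ofReal_re, exp_ofReal_mul_I_re]
    simp
  have him : w.im = Real.sin τ / ρ := by
    rw [hw, ← neg_mul, ← ofReal_neg, sub_im, div_ofReal_im, exp_ofReal_mul_I_im]
    simp [neg_div]
  have hpos : 0 < w.re := by
    rw [hre, sub_pos, div_lt_one hρ0]
    linarith [Real.cos_le_one τ]
  -- Since `ρ > 1` the point lies in the right half plane, and its argument has the sign of `sin τ`.
  -- So adding `arg w`, of size below `π / 2`, moves `τ` away from the nearer end of `[0, 2π]`.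
  have habs := abs_lt.1 (abs_arg_lt_pi_div_two_iff.mpr (Or.inl hpos))
  rcases le_or_gt τ π with h | h
  · have : 0 ≤ arg w := by
      rw [arg_nonneg_iff, him]
      exact div_nonneg (Real.sin_nonneg_of_nonneg_of_le_pi h1.le h) hρ0.le
    constructor <;> linarith [habs.2, Real.pi_pos]
  · have : arg w < 0 := by
      rw [arg_neg_iff, him]
      refine div_neg_of_neg_of_pos ?_ hρ0
      have := Real.sin_pos_of_pos_of_lt_pi (x := τ - π) (by linarith) (by linarith)
      rw [Real.sin_sub_pi] at this
      linarith
    constructor <;> linarith [habs.1]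

/-- `ln (z - z_k)` in the sector `θ_j < arg z < θ_{j+1}` outside of the circle. -/
lemma lg_of_sector {j : Fin (m + 1)} {z : ℂ} (hz : 1 < ‖z‖) (h1 : θ j < argFrom 0 z)
    (h2 : argFrom 0 z < thetaNext θ j) (k : Fin (m + 1)) :
    lg θ k z = logFrom 0 z + Complex.log (1 - pt θ k / z) + if j < k then 2 * π * I else 0 := by
  have hz0 : z ≠ 0 := by
    rintro rfl
    simp at hz
    linarith
  have h3 := thetaNext_le hθ_lt j
  have hne : 1 - pt θ k / z ≠ 0 := by
    intro h
    rw [sub_eq_zero, eq_comm, div_eq_one_iff_eq hz0] at h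
    rw [← h] at hz
    simp at hz
  have hexp : cexp (logFrom 0 z + Complex.log (1 - pt θ k / z) +
      if j < k then 2 * π * I else 0) = z - pt θ k := by
    have : cexp (if j < k then 2 * π * I else 0) = 1 := by split_ifs <;> simp
    rw [exp_add, this, exp_add, exp_logFrom 0 hz0, exp_log hne]
    field_simp
  set a := argFrom 0 z
  -- The shift `c` will be `0` for `k ≤ j` and `2π` for `k > j`, which brings `a - θ k + c` into
  -- `(0, 2π)`. It is also the origin of the extra `2πi` in the conclusion.
  have hdiv : ∀ c : ℝ, cexp (c * I) = 1 → pt θ k / z = cexp (-((a - θ k + c : ℝ) * I)) / ‖z‖ := by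
    intro c hc
    conv_lhs => rw [← exp_logFrom 0 hz0, logFrom, exp_add, ← ofReal_exp,
      Real.exp_log (norm_pos_iff.mpr hz0)]
    have : -((a - θ k + c : ℝ) * I) = θ k * I - a * I - c * I := by push_cast; ring
    rw [this, exp_sub, exp_sub, hc, pt]
    change _ / (_ * cexp (a * I)) = _
    field_simp
  have hk0 := theta_nonneg hθ_mono hθ_zero k
  have hj0 := theta_nonneg hθ_mono hθ_zero j
  unfold lg
  rcases le_or_gt k j with hk | hk
  · have := hθ_mono.monotone hk
    have h4 := arg_aux (τ := a - θ k + 0) (ρ := ‖z‖) (by linarith) (by linarith) hz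
      (congrArg (1 - ·) (hdiv 0 (by simp)))
    refine logFrom_eq hexp ?_ ?_ <;> rw [if_neg hk.not_gt] <;>
      simp only [add_im, logFrom_im, log_im, zero_im] <;> linarith [h4.1, h4.2]
  · have := thetaNext_le_of_lt hθ_mono hk
    have h4 := arg_aux (τ := a - θ k + 2 * π) (ρ := ‖z‖) (by linarith [hθ_lt k]) (by linarith) hz
      (congrArg (1 - ·) (hdiv (2 * π) (by push_cast; exact exp_two_pi_mul_I)))
    have h5 : (2 * (π : ℂ) * I).im = 2 * π := by simp
    refine logFrom_eq hexp ?_ ?_ <;> rw [if_pos hk] <;>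
      simp only [add_im, logFrom_im, log_im, h5] <;> linarith [h4.1, h4.2]

lemma slit_pt {j k : Fin (m + 1)} (h : k ≠ j) : 1 - pt θ j / pt θ k ∈ slitPlane :=
  slit_of_norm_eq_one (by simp) fun h' => h (pt_injective hθ_mono hθ_zero hθ_lt h'.symm)

lemma eventually_hasDerivAt_locLog (j : Fin (m + 1)) : ∀ᶠ z in 𝓝 (pt θ j),
    HasDerivAt (locLog n θ α β j)
      (lam n α β / z + ∑ k ∈ Finset.univ.erase j, α k / (z - pt θ k)) z := by
  have hs : ∀ᶠ z in 𝓝 (pt θ j), ∀ k, k ≠ j → 1 - z / pt θ k ∈ slitPlane := by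
    rw [eventually_all]
    intro k
    by_cases hk : k = j
    · simp [hk]
    · have hc : Continuous fun z : ℂ => 1 - z / pt θ k := by fun_prop
      filter_upwards [hc.continuousAt.preimage_mem_nhds
        (isOpen_slitPlane.mem_nhds (slit_pt hθ_mono hθ_zero hθ_lt hk))] with z hz _
      exact hz
  have hl : ∀ᶠ z in 𝓝 (pt θ j), z / pt θ j ∈ slitPlane := by
    have hc : Continuous fun z : ℂ => z / pt θ j := by fun_prop
    refine hc.continuousAt.preimage_mem_nhds (isOpen_slitPlane.mem_nhds ?_)
    rw [div_self (pt_ne_zero θ j)]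
    exact one_mem_slitPlane
  filter_upwards [hs, hl] with z h1 h2
  unfold locLog
  refine HasDerivAt.add ?_ (HasDerivAt.fun_sum fun k hk => ?_)
  · have hz : z ≠ 0 := by
      rintro rfl
      simp at h2
    refine ((((hasDerivAt_id z).div_const (pt θ j)).clog h2).add_const (θ j * I)).const_mul
      (lam n α β) |>.congr_deriv ?_
    have := pt_ne_zero θ j
    simp only [id]
    field_simp
  · simpa [div_eq_mul_inv] using (hasDerivAt_lg (h1 k (Finset.ne_of_mem_erase hk))).const_mul (α k)

lemma analyticAt_locLog (j : Fin (m + 1)) : AnalyticAt ℂ (locLog n θ α β j) (pt θ j) := by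
  rw [analyticAt_iff_eventually_differentiableAt]
  filter_upwards [eventually_hasDerivAt_locLog n α β hθ_mono hθ_zero hθ_lt j] with z hz
  exact hz.differentiableAt

/-- `ln z` near `z_j`. -/
lemma eventually_logFrom_zero (j : Fin (m + 1)) : ∀ᶠ z in 𝓝 (pt θ j),
    logFrom 0 z = Complex.log (z / pt θ j) + θ j * I +
      if j = 0 ∧ z.im < 0 then 2 * π * I else 0 := by
  have hk0 := theta_nonneg hθ_mono hθ_zero j
  have hc : ContinuousAt (fun z : ℂ => Complex.log (z / pt θ j)) (pt θ j) := by
    refine ContinuousAt.clog (by fun_prop) ?_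
    rw [div_self (pt_ne_zero θ j)]
    exact one_mem_slitPlane
  have him : ContinuousAt (fun z : ℂ => (Complex.log (z / pt θ j)).im) (pt θ j) :=
    continuous_im.continuousAt.comp hc
  have hexp : ∀ z : ℂ, z ≠ 0 → cexp (Complex.log (z / pt θ j) + θ j * I +
      if j = 0 ∧ z.im < 0 then 2 * π * I else 0) = z := by
    intro z hz
    have : cexp (if j = 0 ∧ z.im < 0 then 2 * π * I else 0) = 1 := by split_ifs <;> simp
    rw [exp_add, this, exp_add, exp_log (div_ne_zero hz (pt_ne_zero θ j)), mul_one,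
      show cexp (θ j * I) = pt θ j from rfl, div_mul_cancel₀ _ (pt_ne_zero θ j)]
  have hne : ∀ᶠ z in 𝓝 (pt θ j), z ≠ 0 := eventually_ne_nhds (pt_ne_zero θ j)
  by_cases hj : j = 0
  · filter_upwards [hne] with z hz
    have hp0 : pt θ j = 1 := by simp [pt, hj, hθ_zero]
    have hθj : θ j = 0 := by rw [hj, hθ_zero]
    refine logFrom_eq (hexp z hz) ?_ ?_
    · by_cases h : z.im < 0
      · simp [hj, h, hθ_zero, hj ▸ hp0, log_im]
        linarith [neg_pi_lt_arg z, Real.pi_pos]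
      · simp [hj, h, hθ_zero, hj ▸ hp0, log_im, arg_nonneg_iff]
        linarith
    · by_cases h : z.im < 0
      · simp [hj, h, hθ_zero, hj ▸ hp0, log_im, arg_neg_iff]
      · simp [hj, h, hθ_zero, hj ▸ hp0, log_im]
        linarith [arg_le_pi z, Real.pi_pos]
  · have hpos : 0 < θ j := by
      rw [← hθ_zero]
      exact hθ_mono (Fin.pos_of_ne_zero hj)
    have h0 : (fun z : ℂ => (Complex.log (z / pt θ j)).im) (pt θ j) = 0 := by
      simp [div_self (pt_ne_zero θ j)]
    have e1 := him.tendsto.eventually_const_lt (u := -θ j) (by simp only at h0; linarith)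
    have e2 := him.tendsto.eventually_lt_const (u := 2 * π - θ j)
      (by simp only at h0; linarith [hθ_lt j])
    filter_upwards [hne, e1, e2] with z hz h1 h2
    refine logFrom_eq (hexp z hz) ?_ ?_ <;>
      simp only [hj, false_and, if_false, add_im, zero_im, mul_I_im, ofReal_re] <;> linarith

/-- The cut of `ln z` passes through `z_0 = 1`. The branch in `locLog` is continued across it, and
the discrepancy `2πiλ` below the real axis is the source of the extra diagonal factor in the
connection matrix at `z_0`. -/
lemma eventually_logPsi (j : Fin (m + 1)) : ∀ᶠ z in 𝓝 (pt θ j),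
    logPsi n θ α β z = locLog n θ α β j z + α j * lg θ j z +
      if j = 0 ∧ z.im < 0 then 2 * π * I * lam n α β else 0 := by
  filter_upwards [eventually_logFrom_zero hθ_mono hθ_zero hθ_lt j] with z hz
  rw [logPsi, locLog, hz, ← Finset.add_sum_erase _ _ (Finset.mem_univ j)]
  split_ifs <;> ring

lemma locLog_pt (j : Fin (m + 1)) : locLog n θ α β j (pt θ j) =
    lam n α β * logFrom 0 (pt θ j) +
      ∑ k ∈ Finset.univ.erase j, α k * logFrom (θ k) (pt θ j - pt θ k) := by
  have h : logFrom 0 (pt θ j) = θ j * I :=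
    logFrom_eq rfl (by simpa using theta_nonneg hθ_mono hθ_zero j) (by simpa using hθ_lt j)
  rw [locLog, h, div_self (pt_ne_zero θ j)]
  simp [lg]

end

end Psi

/-! ### Integrability of products of powers of `|z - z_k|` on the circle. -/

section Integrability

variable {m : ℕ} {θ : Fin (m + 1) → ℝ}

lemma norm_exp_sub_exp (t φ : ℝ) :
    ‖cexp (t * I) - cexp (φ * I)‖ = 2 * |Real.sin ((t - φ) / 2)| := by
  have h1 : cexp (t * I) - cexp (φ * I) = cexp (φ * I) * (cexp (I * ((t - φ : ℝ) : ℂ)) - 1) := by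
    rw [mul_sub, ← exp_add, mul_one]
    congr 2
    push_cast
    ring
  rw [h1, norm_mul, norm_exp_ofReal_mul_I, one_mul, norm_exp_I_mul_ofReal_sub_one]
  simp

/-- By periodicity the window of integration can be centred at `φ`. For negative `a`, Jordan's
inequality bounds the chord below by `2/π` times the arc, and `|t - φ|^a` is integrable. -/
lemma integrable_norm_exp_sub_rpow (φ : ℝ) {a : ℝ} (ha : -1 < a) (t₁ t₂ : ℝ) :
    IntervalIntegrable (fun t : ℝ => ‖cexp (t * I) - cexp (φ * I)‖ ^ a) volume t₁ t₂ := by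
  have hper : Function.Periodic (fun t : ℝ => ‖cexp (t * I) - cexp (φ * I)‖ ^ a) (2 * π) := by
    intro t
    have : cexp (((t + 2 * π : ℝ) : ℂ) * I) = cexp (t * I) := by
      push_cast
      rw [add_mul, exp_add, exp_two_pi_mul_I, mul_one]
    simp only [this]
  refine hper.intervalIntegrable Real.two_pi_pos.ne' (t := φ - π) ?_ _ _
  have hmeas : Measurable (fun t : ℝ => ‖cexp (t * I) - cexp (φ * I)‖ ^ a) := by fun_prop
  rcases le_or_gt 0 a with h | h
  · refine Continuous.intervalIntegrable ?_ _ _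
    exact Continuous.rpow_const (by fun_prop) fun _ => Or.inr h
  · have h1 : IntervalIntegrable (fun u : ℝ => ‖((u - φ : ℝ) : ℂ) ^ (a : ℂ)‖) volume (φ - π)
        (φ - π + 2 * π) := by
      have := (intervalIntegral.intervalIntegrable_cpow' (a := -π) (b := π) (r := (a : ℂ))
        (by simpa using ha)).norm.comp_sub_right φ
      convert this using 1 <;> ring
    have h2 := h1.const_mul ((2 / π) ^ a)
    refine h2.mono_fun hmeas.aestronglyMeasurable ?_
    have hnull : ∀ᵐ t : ℝ, t ≠ φ := by
      simp [ae_iff]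
    filter_upwards [ae_restrict_mem measurableSet_uIoc, ae_restrict_of_ae hnull] with t ht hne
    rw [uIoc_of_le (by linarith [Real.pi_pos])] at ht
    have hu : |(t - φ) / 2| ≤ π / 2 := by
      rw [abs_le]; constructor <;> linarith [ht.1, ht.2]
    have hs := Real.mul_abs_le_abs_sin hu
    have hpos : 0 < |t - φ| := abs_pos.mpr (sub_ne_zero.mpr hne)
    have hge : 2 / π * |t - φ| ≤ ‖cexp (t * I) - cexp (φ * I)‖ := by
      rw [norm_exp_sub_exp]
      rw [abs_div, abs_two] at hs
      linarith
    have hn : ‖((t - φ : ℝ) : ℂ) ^ (a : ℂ)‖ = |t - φ| ^ a := by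
      rw [norm_cpow_of_ne_zero (by exact_mod_cast sub_ne_zero.mpr hne), norm_real]
      simp
    rw [hn, Real.norm_of_nonneg (by positivity), Real.norm_of_nonneg (by positivity),
      ← Real.mul_rpow (by positivity) (by positivity)]
    exact Real.rpow_le_rpow_of_nonpos (by positivity) hge h.le

variable (hinj : Function.Injective (pt θ))
include hinj

/-- The singular points are separated, so near one of them all other factors are bounded, and away
from all of them every factor is. The product is thus dominated by the sum of its factors, and one
singularity can be treated at a time. -/
lemma exists_prod_le (a : Fin (m + 1) → ℝ) : ∃ M d : ℝ, 0 < M ∧ 0 < d ∧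
    (∀ k, ∀ s : ℂ, ‖s‖ = 1 → ‖s - pt θ k‖ < d →
      ∏ l, ‖s - pt θ l‖ ^ a l ≤ M * ‖s - pt θ k‖ ^ a k) ∧
    (∀ s : ℂ, ‖s‖ = 1 → ∏ l, ‖s - pt θ l‖ ^ a l ≤ M * (1 + ∑ k, ‖s - pt θ k‖ ^ a k)) := by
  obtain ⟨d, hd0, hd⟩ : ∃ d > 0, ∀ k l, k ≠ l → 2 * d ≤ ‖pt θ k - pt θ l‖ := by
    have : ∀ k l, ∃ d > 0, k ≠ l → 2 * d ≤ ‖pt θ k - pt θ l‖ := by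
      intro k l
      by_cases h : k = l
      · exact ⟨1, one_pos, fun h' => absurd h h'⟩
      · refine ⟨‖pt θ k - pt θ l‖ / 2, ?_, fun _ => by linarith⟩
        have := norm_pos_iff.mpr (sub_ne_zero.mpr (hinj.ne h))
        positivity
    choose D hD0 hD using this
    refine ⟨Finset.univ.inf' ⟨(0, 0), Finset.mem_univ _⟩
      fun p : Fin (m + 1) × Fin (m + 1) => D p.1 p.2, ?_, fun k l h => ?_⟩
    · exact (Finset.lt_inf'_iff _).mpr fun p _ => hD0 p.1 p.2
    · have := Finset.inf'_le (fun p : Fin (m + 1) × Fin (m + 1) => D p.1 p.2)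
        (Finset.mem_univ (k, l))
      have h2 := hD k l h
      simp only at this
      linarith
  -- On the circle away from `z_k` the distance lies in `[d, 2]`, and the sum of both endpoint
  -- values bounds the power whatever the sign of `a k`. The summand `1` lets factors be dropped
  -- from the product of the bounds.
  set N : Fin (m + 1) → ℝ := fun k => 1 + d ^ a k + 2 ^ a k with hN
  have hN1 : ∀ k, 1 ≤ N k := fun k => by
    have := Real.rpow_nonneg hd0.le (a k)
    have := Real.rpow_nonneg (zero_le_two (α := ℝ)) (a k)
    simp only [hN]; linarith
  have hfar : ∀ k, ∀ s : ℂ, ‖s‖ = 1 → d ≤ ‖s - pt θ k‖ → ‖s - pt θ k‖ ^ a k ≤ N k := by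
    intro k s hs h
    have h2 : ‖s - pt θ k‖ ≤ 2 := by
      refine (norm_sub_le _ _).trans ?_
      rw [hs, norm_pt]; norm_num
    have e1 := Real.rpow_nonneg hd0.le (a k)
    have e2 := Real.rpow_nonneg (zero_le_two (α := ℝ)) (a k)
    simp only [hN]
    rcases le_or_gt 0 (a k) with h0 | h0
    · have := Real.rpow_le_rpow (norm_nonneg _) h2 h0
      linarith
    · have := Real.rpow_le_rpow_of_nonpos hd0 h h0.le
      linarith
  have hM1 : 1 ≤ ∏ k, N k := by
    simpa using Finset.prod_le_prod (s := Finset.univ) (f := fun _ => 1) (g := N)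
      (fun _ _ => zero_le_one) fun k _ => hN1 k
  have hnear : ∀ k, ∀ s : ℂ, ‖s‖ = 1 → ‖s - pt θ k‖ < d →
      ∏ l, ‖s - pt θ l‖ ^ a l ≤ (∏ k, N k) * ‖s - pt θ k‖ ^ a k := by
    intro k s hs h
    rw [← Finset.mul_prod_erase _ _ (Finset.mem_univ k), mul_comm,
      ← Finset.mul_prod_erase Finset.univ N (Finset.mem_univ k)]
    refine mul_le_mul_of_nonneg_right ?_ (by positivity)
    refine (Finset.prod_le_prod (g := N) (fun l _ => by positivity) fun l hl => ?_).trans ?_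
    · refine hfar l s hs ?_
      have h1 := hd k l (Finset.ne_of_mem_erase hl).symm
      have h2 : ‖pt θ k - pt θ l‖ ≤ ‖s - pt θ k‖ + ‖s - pt θ l‖ := by
        rw [norm_sub_rev s]
        simpa using norm_add_le (pt θ k - s) (s - pt θ l)
      linarith
    · exact le_mul_of_one_le_left (Finset.prod_nonneg fun l _ => by linarith [hN1 l]) (hN1 k)
  refine ⟨∏ k, N k, d, by linarith, hd0, hnear, fun s hs => ?_⟩
  have hsum : ∀ k, ‖s - pt θ k‖ ^ a k ≤ ∑ k, ‖s - pt θ k‖ ^ a k := fun k =>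
    Finset.single_le_sum (f := fun k => ‖s - pt θ k‖ ^ a k) (fun l _ => by positivity)
      (Finset.mem_univ k)
  by_cases h : ∃ k, ‖s - pt θ k‖ < d
  · obtain ⟨k, hk⟩ := h
    refine (hnear k s hs hk).trans (mul_le_mul_of_nonneg_left ?_ (by linarith))
    linarith [hsum k]
  · push Not at h
    refine (Finset.prod_le_prod (fun l _ => by positivity) fun l _ => hfar l s hs (h l)).trans ?_
    have : 0 ≤ ∑ k, ‖s - pt θ k‖ ^ a k := Finset.sum_nonneg fun k _ => by positivity
    nlinarith

lemma integrable_prod_rpow {a : Fin (m + 1) → ℝ} (ha : ∀ k, -1 < a k) :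
    IntervalIntegrable (fun t : ℝ => ∏ k, ‖cexp (t * I) - pt θ k‖ ^ a k) volume 0 (2 * π) := by
  obtain ⟨M, d, -, -, -, h⟩ := exists_prod_le hinj a
  have h1 : IntervalIntegrable (fun t : ℝ => M * (1 + ∑ k, ‖cexp (t * I) - pt θ k‖ ^ a k))
      volume 0 (2 * π) := by
    refine ((_root_.intervalIntegrable_const).add ?_).const_mul M
    have := IntervalIntegrable.sum Finset.univ (f := fun k (t : ℝ) =>
      ‖cexp (t * I) - pt θ k‖ ^ a k) (μ := volume) (a := 0) (b := 2 * π)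
      fun k _ => integrable_norm_exp_sub_rpow (θ k) (ha k) 0 (2 * π)
    simpa [Finset.sum_fn] using this
  refine h1.mono_fun (Measurable.aestronglyMeasurable (by fun_prop)) ?_
  filter_upwards with t
  have h2 := h _ (norm_exp_ofReal_mul_I t)
  have h3 : 0 ≤ ∏ k, ‖cexp (t * I) - pt θ k‖ ^ a k := Finset.prod_nonneg fun k _ => by positivity
  rw [Real.norm_of_nonneg h3]
  exact h2.trans (le_abs_self _)

end Integrability

/-! ### The density, its relation to `ψ`, and integration by parts. -/

section Density

variable {m : ℕ} (n : ℕ) (θ : Fin (m + 1) → ℝ) (α β : Fin (m + 1) → ℂ)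

/-- The normalized density `z^{1-n} f(z) ∏ z_k^{α_k+β_k}` at `z = e^{it}`. -/
def dens (t : ℝ) : ℂ :=
  symbol θ α β t * cexp (I * ∑ k, θ k * (α k + β k)) * cexp (-(I * ((n : ℂ) - 1) * t))

/-- The coefficient of `α_k` in the logarithm of the density. -/
def cA (k : Fin (m + 1)) (t : ℝ) : ℂ :=
  2 * (Real.log ‖cexp (t * I) - pt θ k‖ : ℂ) + I * θ k

/-- The coefficient of `β_k` in the logarithm of the density. -/
def cB (k : Fin (m + 1)) (t : ℝ) : ℂ := I * t + if t < θ k then I * π else -(I * π)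

variable {θ}

/-- The logarithm of the density is affine in `(α, β)`. The size bounds and the differentiation in
the parameters rest on this form. -/
lemma dens_eq_exp {t : ℝ} (ht : ∀ k, cexp (t * I) ≠ pt θ k) : dens n θ α β t =
    cexp (∑ k, (α k * cA θ k t + β k * cB θ k t) - I * ((n : ℂ) - 1) * t) := by
  have h1 : ∀ k, ((‖cexp (t * I) - pt θ k‖ : ℂ) ^ (2 * α k) *
      jumpFactor θ β k t * cexp (-(I * (θ k : ℂ) * β k))) =
      cexp (2 * α k * (Real.log ‖cexp (t * I) - pt θ k‖ : ℂ) +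
        β k * (if t < θ k then I * π else -(I * π)) - I * θ k * β k) := by
    intro k
    have hne : ‖cexp (t * I) - pt θ k‖ ≠ 0 := norm_ne_zero_iff.mpr (sub_ne_zero.mpr (ht k))
    rw [cpow_def_of_ne_zero (by exact_mod_cast hne), ← ofReal_log (norm_nonneg _), jumpFactor,
      sub_eq_add_neg _ (I * (θ k : ℂ) * β k), exp_add, exp_add]
    congr 2
    · congr 1; ring
    · split_ifs <;> congr 1 <;> ring
  rw [dens, symbol, Finset.prod_congr rfl fun k _ => h1 k, ← exp_sum, ← exp_add, ← exp_add,
    ← exp_add, sub_eq_add_neg _ (I * ((n : ℂ) - 1) * t)]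
  congr 1
  rw [add_left_inj, Finset.mul_sum, Finset.mul_sum, ← Finset.sum_add_distrib, ← Finset.sum_add_distrib]
  refine Finset.sum_congr rfl fun k _ => ?_
  simp only [cA, cB]
  ring

omit θ in
lemma sConst_eq (j : Fin (m + 1)) : sConst α β j = cexp (∑ k, if k ≤ j then
    -(I * π * β k) - I * π * α k else I * π * β k - 3 * I * π * α k) := by
  rw [sConst]
  congr 1
  simp only [Finset.mul_sum, Finset.sum_filter, ← Finset.sum_neg_distrib,
    ← Finset.sum_add_distrib, ← Finset.sum_sub_distrib]
  refine Finset.sum_congr rfl fun k _ => ?_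
  by_cases h : k ≤ j
  · simp [h, not_lt.mpr h]
  · simp [h, not_le.mp h]

variable (hθ_mono : StrictMono θ) (hθ_zero : θ 0 = 0) (hθ_lt : ∀ j, θ j < 2 * π)
include hθ_mono hθ_zero hθ_lt

lemma arc_ne_pt {j : Fin (m + 1)} {t : ℝ} (h1 : θ j < t) (h2 : t < thetaNext θ j)
    (k : Fin (m + 1)) : cexp (t * I) ≠ pt θ k := by
  intro h
  have := (offCuts_arc hθ_mono hθ_zero hθ_lt h1 h2).2 k
  rw [h, div_self (pt_ne_zero θ k)] at this
  simp at this

/-- Comes from `e^{it} - e^{iφ} = 2 sin((t - φ)/2) e^{i((t + φ)/2 + π/2)}`. The sine is negative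
exactly for the singular points beyond `t`, which adds `π` to the argument. -/
lemma lg_arc {j : Fin (m + 1)} {t : ℝ} (h1 : θ j < t) (h2 : t < thetaNext θ j)
    (k : Fin (m + 1)) : lg θ k (cexp (t * I)) = (Real.log ‖cexp (t * I) - pt θ k‖ : ℂ) +
      ((t + θ k) / 2 + π / 2 + if k ≤ j then 0 else π : ℝ) * I := by
  have hk0 := theta_nonneg hθ_mono hθ_zero k
  have hj0 := theta_nonneg hθ_mono hθ_zero j
  have h3 := thetaNext_le hθ_lt j
  have hne := arc_ne_pt hθ_mono hθ_zero hθ_lt h1 h2 k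
  have hpos : 0 < ‖cexp (t * I) - pt θ k‖ := norm_pos_iff.mpr (sub_ne_zero.mpr hne)
  have hfac : cexp (t * I) - pt θ k =
      (2 * Real.sin ((t - θ k) / 2) : ℝ) * cexp (((t + θ k) / 2 + π / 2 : ℝ) * I) := by
    have e1 : cexp (((t + θ k) / 2 + π / 2 : ℝ) * I) = cexp ((t + θ k) / 2 * I) * I := by
      push_cast
      rw [add_mul, exp_add, exp_pi_div_two_mul_I]
    have e2 : (t : ℂ) * I = (t + θ k) / 2 * I + ((t : ℂ) - θ k) / 2 * I := by ring
    have e3 : (θ k : ℂ) * I = (t + θ k) / 2 * I + -((t : ℂ) - θ k) / 2 * I := by ring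
    rw [e1, pt, e2, e3, exp_add, exp_add]
    push_cast
    rw [Complex.sin]
    have : I * I = -1 := I_mul_I
    rw [show (-(((t : ℂ) - θ k) / 2) * I) = -((t : ℂ) - θ k) / 2 * I by ring]
    linear_combination (cexp ((t + θ k) / 2 * I) * (cexp (((t : ℂ) - θ k) / 2 * I)
      - cexp (-((t : ℂ) - θ k) / 2 * I))) * this
  unfold lg
  rcases le_or_gt k j with hk | hk
  · have hkj := hθ_mono.monotone hk
    have hs : 0 < Real.sin ((t - θ k) / 2) :=
      Real.sin_pos_of_pos_of_lt_pi (by linarith) (by linarith)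
    refine logFrom_eq ?_ ?_ ?_
    · rw [exp_add, ← ofReal_exp, Real.exp_log hpos, hfac, norm_mul, norm_exp_ofReal_mul_I, mul_one,
        norm_real, Real.norm_of_nonneg (by positivity), if_pos hk, add_zero]
    · simp [hk]; linarith [Real.pi_pos]
    · simp [hk]; linarith [Real.pi_pos]
  · have hkj := thetaNext_le_of_lt hθ_mono hk
    have hs : Real.sin ((t - θ k) / 2) < 0 :=
      Real.sin_neg_of_neg_of_neg_pi_lt (by linarith) (by linarith [hθ_lt k])
    refine logFrom_eq ?_ ?_ ?_
    · rw [exp_add, ← ofReal_exp, Real.exp_log hpos, hfac, norm_mul, norm_exp_ofReal_mul_I, mul_one,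
        norm_real, Real.norm_of_nonpos (by linarith), if_neg hk.not_ge, ofReal_add (_ + _) π,
        add_mul, exp_add, exp_pi_mul_I]
      push_cast
      ring
    · simp [hk.not_ge]; linarith [Real.pi_pos, hθ_lt k]
    · simp [hk.not_ge]; linarith [Real.pi_pos]

/-- On the arc `θ_j < t < θ_{j+1}` the density is `s_j ψ(e^{it})² e^{it}`. -/
lemma dens_arc {j : Fin (m + 1)} {t : ℝ} (h1 : θ j < t) (h2 : t < thetaNext θ j) :
    dens n θ α β t =
      sConst α β j * cexp (2 * logPsi n θ α β (cexp (t * I))) * cexp (t * I) := by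
  have hj0 := theta_nonneg hθ_mono hθ_zero j
  have h3 := thetaNext_le hθ_lt j
  have h0 : logFrom 0 (cexp (t * I)) = t * I :=
    logFrom_eq rfl (by simpa using by linarith) (by simpa using by linarith)
  rw [dens_eq_exp n α β (arc_ne_pt hθ_mono hθ_zero hθ_lt h1 h2), sConst_eq, ← exp_add, ← exp_add]
  congr 1
  -- Twice the `-n/2` in `lam`, together with the factor `e^{it}`, makes up `z^{1-n}`. What remains
  -- is linear in `(α, β)` and is compared index by index.
  rw [logPsi, h0, lam]
  have h4 : ∑ k, (α k * cA θ k t + β k * cB θ k t) = (∑ k, if k ≤ j then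
      -(I * π * β k) - I * π * α k else I * π * β k - 3 * I * π * α k) +
      (∑ k, 2 * ((β k - α k) / 2 * (t * I))) +
      ∑ k, 2 * (α k * lg θ k (cexp (t * I))) := by
    rw [← Finset.sum_add_distrib, ← Finset.sum_add_distrib]
    refine Finset.sum_congr rfl fun k _ => ?_
    rw [lg_arc hθ_mono hθ_zero hθ_lt h1 h2 k, cA, cB]
    by_cases hk : k ≤ j
    · have : ¬ t < θ k := by linarith [hθ_mono.monotone hk]
      simp only [hk, this, if_true, if_false]
      push_cast
      ring
    · have : t < θ k := by linarith [thetaNext_le_of_lt hθ_mono (not_le.mp hk)]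
      simp only [hk, this, if_true, if_false]
      push_cast
      ring
  rw [h4, ← Finset.mul_sum, ← Finset.mul_sum, ← Finset.sum_mul]
  ring

omit hθ_mono hθ_zero hθ_lt in
lemma ae_ne_pt : ∀ᵐ t : ℝ, ∀ k, cexp (t * I) ≠ pt θ k := by
  rw [eventually_countable_forall]
  intro k
  refine measure_mono_null (t := ⋃ l : ℤ, {θ k + l * (2 * π)}) ?_ ?_
  · intro t ht
    simp only [mem_compl_iff, mem_ofPred_eq, not_not] at ht
    obtain ⟨l, hl⟩ := exp_eq_exp_iff_exists_int.mp ht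
    have := congrArg Complex.im hl
    simp at this
    simp only [mem_iUnion, mem_singleton_iff]
    exact ⟨l, this⟩
  · exact (countable_iUnion fun l => countable_singleton _).measure_zero _

omit hθ_mono hθ_zero hθ_lt in
lemma measurable_dens : Measurable (dens n θ α β) := by
  unfold dens symbol
  refine ((Measurable.mul (by fun_prop) (Finset.measurable_prod _ fun k _ => ?_)).mul_const _).mul
    (by fun_prop)
  refine (Measurable.mul (by fun_prop) ?_).mul_const _
  exact Measurable.ite measurableSet_Iio measurable_const measurable_const

/-- Bound of the density by a product of powers. -/
lemma norm_dens_le_exp {t : ℝ} (ht : |t| ≤ 4 * π) (hne : ∀ k, cexp (t * I) ≠ pt θ k) :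
    ‖dens n θ α β t‖ ≤ Real.exp (∑ k, (‖α k‖ * (2 * π) + ‖β k‖ * (5 * π))) *
      ∏ k, ‖cexp (t * I) - pt θ k‖ ^ (2 * (α k).re) := by
  rw [dens_eq_exp n α β hne, norm_exp]
  have h1 : ∀ k, ‖cexp (t * I) - pt θ k‖ ^ (2 * (α k).re) =
      Real.exp (2 * (α k).re * Real.log ‖cexp (t * I) - pt θ k‖) := by
    intro k
    rw [Real.rpow_def_of_pos (norm_pos_iff.mpr (sub_ne_zero.mpr (hne k))), mul_comm]
  rw [Finset.prod_congr rfl fun k _ => h1 k, ← Real.exp_sum, ← Real.exp_add,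
    ← Finset.sum_add_distrib]
  refine Real.exp_le_exp.mpr ?_
  have h2 : (I * ((n : ℂ) - 1) * t).re = 0 := by simp
  rw [sub_re, h2, sub_zero, re_sum]
  refine Finset.sum_le_sum fun k _ => ?_
  have hk0 := theta_nonneg hθ_mono hθ_zero k
  have e1 : (α k * cA θ k t).re ≤ 2 * (α k).re * Real.log ‖cexp (t * I) - pt θ k‖ +
      ‖α k‖ * (2 * π) := by
    have : (α k * cA θ k t).re = 2 * (α k).re * Real.log ‖cexp (t * I) - pt θ k‖ +
        -(α k).im * θ k := by
      simp [cA, mul_re]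
      ring
    rw [this]
    have h4 : -(α k).im ≤ ‖α k‖ := (neg_le_abs _).trans (abs_im_le_norm _)
    have := mul_le_mul h4 (hθ_lt k).le hk0 (norm_nonneg _)
    linarith
  have e2 : (β k * cB θ k t).re ≤ ‖β k‖ * (5 * π) := by
    refine (re_le_norm _).trans ?_
    rw [norm_mul]
    refine mul_le_mul_of_nonneg_left ?_ (norm_nonneg _)
    rw [cB]
    refine (norm_add_le _ _).trans ?_
    have f1 : ‖I * (t : ℂ)‖ ≤ 4 * π := by simpa using ht
    have f2 : ‖(if t < θ k then I * (π : ℂ) else -(I * π))‖ = π := by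
      split_ifs <;> simp [abs_of_pos Real.pi_pos]
    rw [f2]
    linarith
  rw [add_re]
  linarith

lemma norm_dens_le : ∃ C : ℝ, 0 < C ∧ ∀ t : ℝ, |t| ≤ 4 * π → (∀ k, cexp (t * I) ≠ pt θ k) →
    ‖dens n θ α β t‖ ≤ C * ∏ k, ‖cexp (t * I) - pt θ k‖ ^ (2 * (α k).re) :=
  ⟨_, Real.exp_pos _, fun _ ht hne => norm_dens_le_exp n α β hθ_mono hθ_zero hθ_lt ht hne⟩

variable (hα : ∀ j, -1 / 2 < (α j).re)
include hα

lemma integrable_dens : IntervalIntegrable (dens n θ α β) volume 0 (2 * π) := by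
  obtain ⟨C, hC, h⟩ := norm_dens_le n α β hθ_mono hθ_zero hθ_lt
  have h1 := (integrable_prod_rpow (pt_injective hθ_mono hθ_zero hθ_lt)
    (a := fun k => 2 * (α k).re) fun k => by linarith [hα k]).const_mul C
  refine h1.mono_fun
    (measurable_dens n α β).aestronglyMeasurable ?_
  filter_upwards [ae_restrict_of_ae (ae_ne_pt), ae_restrict_mem measurableSet_uIoc]
    with t hne ht
  rw [uIoc_of_le Real.two_pi_pos.le] at ht
  refine (h t ?_ hne).trans (le_abs_self _)
  rw [abs_of_pos ht.1]
  linarith [ht.2, Real.pi_pos]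

/-- The density times a function vanishing at the singular points vanishes there. -/
lemma tendsto_dens_mul {g : ℂ → ℂ} (k : Fin (m + 1)) (hg : DifferentiableAt ℂ g (pt θ k))
    (hg0 : g (pt θ k) = 0) {τ : ℝ} (hτ : cexp (τ * I) = pt θ k) (hτ' : |τ| ≤ 3 * π) :
    Tendsto (fun t : ℝ => dens n θ α β t * g (cexp (t * I))) (𝓝[≠] τ) (𝓝 0) := by
  obtain ⟨C, hC, h⟩ := norm_dens_le n α β hθ_mono hθ_zero hθ_lt
  obtain ⟨M, d, hM, hd, hnear, -⟩ := exists_prod_le (pt_injective hθ_mono hθ_zero hθ_lt)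
    fun k => 2 * (α k).re
  obtain ⟨D, hD⟩ := hg.isBigO_sub.bound
  have hc : Tendsto (fun t : ℝ => cexp (t * I)) (𝓝[≠] τ) (𝓝 (pt θ k)) := by
    rw [← hτ]
    exact (Continuous.tendsto (by fun_prop) τ).mono_left nhdsWithin_le_nhds
  have hx : Tendsto (fun t : ℝ => ‖cexp (t * I) - pt θ k‖) (𝓝[≠] τ) (𝓝 0) := by
    simpa using (hc.sub_const (pt θ k)).norm
  -- The zero of `g` raises the exponent to `2 Re α_k + 1`, which is positive because `Re α_k >
  -- -1/2`.
  have hlim : Tendsto (fun t : ℝ => C * M * D * ‖cexp (t * I) - pt θ k‖ ^ (2 * (α k).re + 1))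
      (𝓝[≠] τ) (𝓝 0) := by
    have := (hx.rpow_const (p := 2 * (α k).re + 1) (Or.inr (by linarith [hα k]))).const_mul
      (C * M * D)
    rwa [Real.zero_rpow (by linarith [hα k]), mul_zero] at this
  have hne : ∀ᶠ t : ℝ in 𝓝[≠] τ, ∀ l, cexp (t * I) ≠ pt θ l := by
    rw [eventually_all]
    intro l
    by_cases hl : l = k
    · have : ∀ᶠ t : ℝ in 𝓝[≠] τ, |t - τ| < 2 * π := by
        have : Tendsto (fun t : ℝ => |t - τ|) (𝓝[≠] τ) (𝓝 0) := by
          have : Continuous fun t : ℝ => |t - τ| := by fun_prop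
          simpa using (this.tendsto τ).mono_left nhdsWithin_le_nhds
        exact this.eventually_lt_const Real.two_pi_pos
      filter_upwards [this, self_mem_nhdsWithin] with t h1 h2 h3
      rw [hl, ← hτ] at h3
      exact h2 (exp_mul_I_eq_imp h3 h1)
    · exact hc.eventually_ne ((pt_injective hθ_mono hθ_zero hθ_lt).ne (Ne.symm hl))
  have hbd : ∀ᶠ t : ℝ in 𝓝[≠] τ, |t| ≤ 4 * π := by
    have : Tendsto (fun t : ℝ => |t|) (𝓝[≠] τ) (𝓝 |τ|) :=
      (continuous_abs.tendsto τ).mono_left nhdsWithin_le_nhds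
    exact (this.eventually_lt_const (by linarith [Real.pi_pos])).mono fun _ h => h.le
  refine squeeze_zero_norm' ?_ hlim
  filter_upwards [hne, hbd, hx.eventually_lt_const hd, hc.eventually hD] with t h1 h2 h3 h4
  have hpos : 0 < ‖cexp (t * I) - pt θ k‖ := norm_pos_iff.mpr (sub_ne_zero.mpr (h1 k))
  rw [hg0, sub_zero] at h4
  rw [norm_mul, Real.rpow_add_one hpos.ne']
  calc ‖dens n θ α β t‖ * ‖g (cexp (t * I))‖ ≤
      (C * (M * ‖cexp (t * I) - pt θ k‖ ^ (2 * (α k).re))) *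
        (D * ‖cexp (t * I) - pt θ k‖) := by
        refine mul_le_mul ?_ h4 (norm_nonneg _) (by positivity)
        exact (h t h2 h1).trans (mul_le_mul_of_nonneg_left
          (hnear k _ (norm_exp_ofReal_mul_I t) h3) hC.le)
    _ = _ := by ring

/-- Integration by parts against the density. -/
lemma pair_deriv_eq_zero {g G : ℂ → ℂ} (hg : ∀ s : ℂ, ‖s‖ = 1 → DifferentiableAt ℂ g s)
    (hg0 : ∀ k, g (pt θ k) = 0) (hG : ContinuousOn G (Metric.sphere 0 1))
    (h : ∀ s : ℂ, ‖s‖ = 1 → (∀ k, s ≠ pt θ k) →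
      G s = 2 * ratPsi n θ α β s * g s + deriv g s) :
    pair (dens n θ α β) G = 0 := by
  have hint := integrable_dens n α β hθ_mono hθ_zero hθ_lt hα
  have hGint := pair_integrable hint hG
  -- The endpoints of the arcs, with `2π` closing the list.
  set a : ℕ → ℝ := fun j => if h : j < m + 1 then θ ⟨j, h⟩ else 2 * π with ha
  have ha0 : a 0 = 0 := by simpa [ha] using hθ_zero
  have ham : a (m + 1) = 2 * π := by simp [ha]
  have hle0 : ∀ j, 0 ≤ a j := by
    intro j
    simp only [ha]
    split_ifs
    · exact theta_nonneg hθ_mono hθ_zero _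
    · exact Real.two_pi_pos.le
  have hle1 : ∀ j, a j ≤ 2 * π := by
    intro j
    simp only [ha]
    split_ifs
    · exact (hθ_lt _).le
    · exact le_rfl
  have hsub : ∀ j, IntervalIntegrable (fun t : ℝ => dens n θ α β t * G (cexp (t * I))) volume
      (a j) (a (j + 1)) := fun j => hGint.mono_set (by
    rw [uIcc_of_le Real.two_pi_pos.le]
    exact uIcc_subset_Icc ⟨hle0 _, hle1 _⟩ ⟨hle0 _, hle1 _⟩)
  unfold pair
  rw [← ha0, ← ham, ← intervalIntegral.sum_integral_adjacent_intervals fun j _ => hsub j,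
    Finset.sum_eq_zero, mul_zero]
  intro j hj
  have hj' := Finset.mem_range.mp hj
  set J : Fin (m + 1) := ⟨j, hj'⟩
  have haj : a j = θ J := dif_pos hj'
  have haj1 : a (j + 1) = thetaNext θ J := rfl
  have hlt := theta_lt_thetaNext hθ_mono hθ_lt J
  -- On an arc `V = s ψ² z`, and `G = (ψ² g)' / ψ²`, so that `V G = -i d/dt (s ψ² g) = -i d/dt (V
  -- z⁻¹ g)`. The boundary values vanish because `g` does at the singular points.
  have hder : ∀ t ∈ Ioo (θ J) (thetaNext θ J), HasDerivAt
      (fun t : ℝ => -I * (dens n θ α β t * (cexp (-(t * I)) * g (cexp (t * I)))))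
      (dens n θ α β t * G (cexp (t * I))) t := by
    intro t ht
    have hoff := offCuts_arc hθ_mono hθ_zero hθ_lt ht.1 ht.2
    have hexp : HasDerivAt (fun t : ℝ => cexp (t * I)) (cexp (t * I) * I) t := by
      have := ((hasDerivAt_id (t : ℂ)).mul_const I).cexp.comp_ofReal
      simpa using this
    have h1 := ((hasDerivAt_logPsi n α β hoff).const_mul 2).cexp.comp t hexp
    have h2 := (hg _ (norm_exp_ofReal_mul_I t)).hasDerivAt.comp t hexp
    have h3 := (((h1.const_mul (sConst α β J)).mul h2).const_mul (-I))
    rw [h _ (norm_exp_ofReal_mul_I t) (arc_ne_pt hθ_mono hθ_zero hθ_lt ht.1 ht.2),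
      dens_arc n α β hθ_mono hθ_zero hθ_lt ht.1 ht.2]
    refine (h3.congr_of_eventuallyEq ?_).congr_deriv ?_
    · filter_upwards [Ioo_mem_nhds ht.1 ht.2] with x hx
      rw [dens_arc n α β hθ_mono hθ_zero hθ_lt hx.1 hx.2, exp_neg]
      have := exp_ne_zero (x * I)
      simp only [Function.comp, Pi.mul_apply]
      field_simp
    · simp only [Function.comp]
      have : I ^ 2 = -1 := I_sq
      linear_combination (-(sConst α β J * cexp (2 * logPsi n θ α β (cexp (t * I))) *
        (2 * ratPsi n θ α β (cexp (t * I))) * cexp (t * I) * g (cexp (t * I)) +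
        sConst α β J * cexp (2 * logPsi n θ α β (cexp (t * I))) * deriv g (cexp (t * I)) *
        cexp (t * I))) * this
  have hlim : ∀ τ : ℝ, (∃ k, cexp (τ * I) = pt θ k) → |τ| ≤ 3 * π → Tendsto
      (fun t : ℝ => -I * (dens n θ α β t * (cexp (-(t * I)) * g (cexp (t * I)))))
      (𝓝[≠] τ) (𝓝 0) := by
    rintro τ ⟨k, hk⟩ hτ
    have h1 := tendsto_dens_mul n α β hθ_mono hθ_zero hθ_lt hα k (hg _ (norm_pt θ k)) (hg0 k)
      hk hτ
    have h2 : Tendsto (fun t : ℝ => -I * cexp (-(t * I))) (𝓝[≠] τ) (𝓝 (-I * cexp (-(τ * I)))) :=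
      (Continuous.tendsto (by fun_prop) τ).mono_left nhdsWithin_le_nhds
    have h3 := h2.mul h1
    rw [mul_zero] at h3
    refine h3.congr fun t => ?_
    ring
  have habs : ∀ i, |a i| ≤ 3 * π := fun i => by
    rw [abs_of_nonneg (hle0 i)]
    linarith [hle1 i, Real.pi_pos]
  have hend : ∃ k, cexp ((a (j + 1) : ℝ) * I) = pt θ k := by
    by_cases hlast : j + 1 < m + 1
    · exact ⟨⟨j + 1, hlast⟩, by simp [ha, pt]; simp [Nat.succ_lt_succ_iff.mp hlast]⟩
    · refine ⟨0, ?_⟩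
      have : ¬ j < m := by omega
      simp [ha, pt, hθ_zero, this]
  rw [intervalIntegral.integral_eq_sub_of_hasDerivAt_of_tendsto
    (f := fun t : ℝ => -I * (dens n θ α β t * (cexp (-(t * I)) * g (cexp (t * I)))))
    (fa := 0) (fb := 0) (by rw [haj, haj1]; exact hlt) (by rw [haj, haj1]; exact hder) (hsub j)
    ((hlim _ ⟨J, by rw [haj]; rfl⟩ (habs j)).mono_left (nhdsWithin_mono _ fun x hx => ne_of_gt hx))
    ((hlim _ hend (habs _)).mono_left (nhdsWithin_mono _ fun x hx => ne_of_lt hx)), sub_zero]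

end Density

/-! ### The Plemelj jump relation. -/

section Plemelj

/-- The density `c e^{it}` corresponds to `c ds / (2πi)`, so this is Cauchy's formula. Such
densities serve as comparison functions in the jump relation. -/
lemma cauchyT_exp_of_norm_lt {z : ℂ} (hz : ‖z‖ < 1) (c : ℂ) :
    cauchyT (fun t => c * cexp (t * I)) z = c := by
  have h := circleIntegral.integral_sub_inv_of_mem_ball (c := 0) (w := z) (R := 1)
    (by simpa using hz)
  rw [circleIntegral] at h
  simp only [deriv_circleMap, circleMap_zero, ofReal_one, one_mul, smul_eq_mul] at h
  have h2 : ∫ t in (0 : ℝ)..(2 * π), c * cexp (t * I) * (cexp (t * I) - z)⁻¹ =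
      -(c * I) * (2 * π * I) := by
    rw [← h, ← intervalIntegral.integral_const_mul]
    refine intervalIntegral.integral_congr fun t _ => ?_
    linear_combination (c * cexp (t * I) * (cexp (t * I) - z)⁻¹) * I_sq
  rw [cauchyT, pair, h2]
  have : (π : ℂ) ≠ 0 := by exact_mod_cast Real.pi_ne_zero
  field_simp
  rw [I_sq]
  ring

lemma cauchyT_exp_of_lt_norm {z : ℂ} (hz : 1 < ‖z‖) (c : ℂ) :
    cauchyT (fun t => c * cexp (t * I)) z = 0 := by
  have hne : ∀ s ∈ Metric.closedBall (0 : ℂ) 1, s - z ≠ 0 := by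
    intro s hs h
    rw [sub_eq_zero] at h
    rw [h] at hs
    simp at hs
    linarith
  have h := circleIntegral_eq_zero_of_differentiable_on_off_countable (c := (0 : ℂ)) zero_le_one
    countable_empty (f := fun s => (s - z)⁻¹) (ContinuousOn.inv₀ (by fun_prop) hne)
    fun s hs => DifferentiableAt.inv (by fun_prop) (hne s (Metric.ball_subset_closedBall hs.1))
  rw [circleIntegral] at h
  simp only [deriv_circleMap, circleMap_zero, ofReal_one, one_mul, smul_eq_mul] at h
  have h2 : ∫ t in (0 : ℝ)..(2 * π), c * cexp (t * I) * (cexp (t * I) - z)⁻¹ = -(c * I) * 0 := by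
    rw [← h, ← intervalIntegral.integral_const_mul]
    refine intervalIntegral.integral_congr fun t _ => ?_
    linear_combination (c * cexp (t * I) * (cexp (t * I) - z)⁻¹) * I_sq
  rw [cauchyT, pair, h2]
  simp

/-- Dominates the kernel at `rζ` by twice the kernel at `ζ`, uniformly in `r`. -/
lemma norm_sub_le_radial {s ζ : ℂ} (hs : ‖s‖ = 1) (hζ : ‖ζ‖ = 1) {r : ℝ} (hr : 0 ≤ r) :
    ‖s - ζ‖ ≤ 2 * ‖s - r * ζ‖ := by
  have h1 : ‖(r : ℂ) * ζ - ζ‖ = |r - 1| := by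
    rw [← sub_one_mul, norm_mul, hζ, mul_one]
    exact_mod_cast norm_real (r - 1)
  have h2 : |r - 1| ≤ ‖s - r * ζ‖ := by
    have := abs_norm_sub_norm_le (r * ζ) s
    rwa [norm_mul, hζ, hs, norm_real, Real.norm_of_nonneg hr, mul_one, norm_sub_rev] at this
  have h3 : ‖s - ζ‖ ≤ ‖s - r * ζ‖ + ‖r * ζ - ζ‖ := by
    simpa using norm_add_le (s - r * ζ) (r * ζ - ζ)
  linarith

variable {V : ℝ → ℂ}

lemma norm_exp_sub_exp_ge {t t₀ : ℝ} (h : |t - t₀| ≤ π) :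
    2 / π * |t - t₀| ≤ ‖cexp (t * I) - cexp (t₀ * I)‖ := by
  have hu : |(t - t₀) / 2| ≤ π / 2 := by
    rw [abs_div, abs_two]
    linarith
  have hs := Real.mul_abs_le_abs_sin hu
  rw [norm_exp_sub_exp]
  rw [abs_div, abs_two] at hs
  linarith

/-- Near `t₀` the quotient is bounded, since `V` is differentiable with a zero there and the chord
is comparable with the arc. Away from `t₀` the denominator is bounded below by compactness. -/
lemma integrable_div_sub {t₀ : ℝ} (h0 : 0 < t₀) (h1 : t₀ < 2 * π)
    (hV : IntervalIntegrable V volume 0 (2 * π)) (hd : DifferentiableAt ℝ V t₀) (hV0 : V t₀ = 0) :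
    IntervalIntegrable (fun t : ℝ => ‖V t‖ / ‖cexp (t * I) - cexp (t₀ * I)‖) volume 0 (2 * π) := by
  obtain ⟨C, hC⟩ := hd.isBigO_sub.bound
  obtain ⟨δ₀, hδ₀, hball₀⟩ := Metric.eventually_nhds_iff.mp hC
  obtain ⟨δ, hδ, hδ₁, hδπ⟩ : ∃ δ > 0, δ ≤ δ₀ ∧ δ ≤ π :=
    ⟨min δ₀ π, lt_min hδ₀ Real.pi_pos, min_le_left _ _, min_le_right _ _⟩
  set K : Set ℝ := Icc 0 (2 * π) ∩ {t | δ ≤ |t - t₀|} with hK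
  have hKc : IsCompact K :=
    isCompact_Icc.inter_right (isClosed_le continuous_const (by fun_prop))
  obtain ⟨c, hc0, hc⟩ : ∃ c > 0, ∀ t ∈ K, c ≤ ‖cexp (t * I) - cexp (t₀ * I)‖ := by
    rcases K.eq_empty_or_nonempty with hE | hE
    · exact ⟨1, one_pos, by simp [hE]⟩
    · obtain ⟨x, hx, hmin⟩ := hKc.exists_isMinOn hE
        (f := fun t : ℝ => ‖cexp (t * I) - cexp (t₀ * I)‖) (by fun_prop)
      refine ⟨_, norm_pos_iff.mpr (sub_ne_zero.mpr fun h => ?_), fun t ht => hmin ht⟩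
      have := exp_mul_I_eq_imp h (by rw [abs_lt]; constructor <;> linarith [hx.1.1, hx.1.2])
      have h2 := hx.2
      simp only [mem_ofPred_eq, this, sub_self, abs_zero] at h2
      linarith
  have hmeas : AEStronglyMeasurable (fun t : ℝ => ‖V t‖ / ‖cexp (t * I) - cexp (t₀ * I)‖)
      (volume.restrict (uIoc 0 (2 * π))) := by
    refine (AEMeasurable.div (hV.def'.aestronglyMeasurable.norm.aemeasurable) ?_).aestronglyMeasurable
    exact (Continuous.aemeasurable (by fun_prop))
  have hbound := (hV.norm.mul_const c⁻¹).add
    (_root_.intervalIntegrable_const (μ := volume) (a := 0) (b := 2 * π) (c := |C| * (π / 2)))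
  refine hbound.mono_fun hmeas ?_
  filter_upwards [ae_restrict_mem measurableSet_uIoc] with t ht
  rw [uIoc_of_le Real.two_pi_pos.le] at ht
  have hCp : 0 ≤ |C| * (π / 2) := by positivity
  rw [Real.norm_of_nonneg (by positivity), Real.norm_of_nonneg (by positivity)]
  by_cases hn : |t - t₀| < δ
  · have e1 := hball₀ (y := t) (by rw [Real.dist_eq]; exact hn.trans_le hδ₁)
    rw [hV0, sub_zero, Real.norm_eq_abs] at e1
    have e2 := norm_exp_sub_exp_ge (hn.le.trans hδπ)
    have e3 : ‖V t‖ / ‖cexp (t * I) - cexp (t₀ * I)‖ ≤ |C| * (π / 2) := by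
      refine div_le_of_le_mul₀ (norm_nonneg _) hCp ?_
      calc ‖V t‖ ≤ |C| * |t - t₀| :=
            e1.trans (mul_le_mul_of_nonneg_right (le_abs_self C) (abs_nonneg _))
        _ = |C| * (π / 2) * (2 / π * |t - t₀|) := by field_simp
        _ ≤ _ := mul_le_mul_of_nonneg_left e2 hCp
    have : 0 ≤ ‖V t‖ * c⁻¹ := by positivity
    linarith
  · have e1 := hc t ⟨⟨ht.1.le, ht.2⟩, not_lt.mp hn⟩
    have : ‖V t‖ / ‖cexp (t * I) - cexp (t₀ * I)‖ ≤ ‖V t‖ * c⁻¹ := by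
      rw [div_eq_mul_inv]
      gcongr
    linarith

/-- Dominated convergence applies from inside and from outside alike, with the same limit. So a
density that vanishes at `t₀` causes no jump there. -/
lemma tendsto_cauchyT_radial {t₀ : ℝ} (h0 : 0 < t₀) (h1 : t₀ < 2 * π)
    (hV : IntervalIntegrable V volume 0 (2 * π)) (hd : DifferentiableAt ℝ V t₀) (hV0 : V t₀ = 0) :
    Tendsto (fun r : ℝ => cauchyT V (r * cexp (t₀ * I))) (𝓝[≠] 1)
      (𝓝 (pair V fun s => (s - cexp (t₀ * I))⁻¹)) := by
  unfold cauchyT pair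
  refine Tendsto.const_mul _ ?_
  have hpos : ∀ᶠ r : ℝ in 𝓝[≠] 1, 0 < r ∧ r ≠ 1 :=
    ((lt_mem_nhds one_pos).filter_mono nhdsWithin_le_nhds).and self_mem_nhdsWithin
  have hzero : ∀ t ∈ uIoc 0 (2 * π), cexp (t * I) = cexp (t₀ * I) → V t = 0 := by
    intro t ht h
    rw [uIoc_of_le Real.two_pi_pos.le] at ht
    rw [exp_mul_I_eq_imp h (by rw [abs_lt]; constructor <;> linarith [ht.1, ht.2]), hV0]
  refine intervalIntegral.tendsto_integral_filter_of_dominated_convergence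
    (fun t => 2 * (‖V t‖ / ‖cexp (t * I) - cexp (t₀ * I)‖)) ?_ ?_
    ((integrable_div_sub h0 h1 hV hd hV0).const_mul 2) ?_
  · filter_upwards [hpos] with r hr
    refine (pair_integrable hV (continuousOn_inv_sub (z := r * cexp (t₀ * I)) ?_)).def'.aestronglyMeasurable
    rw [norm_mul, norm_exp_ofReal_mul_I, mul_one, norm_real, Real.norm_of_nonneg hr.1.le]
    exact hr.2
  · filter_upwards [hpos] with r hr
    filter_upwards with t ht
    rw [norm_mul, norm_inv]
    rcases eq_or_ne (cexp (t * I)) (cexp (t₀ * I)) with h | h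
    · simp [hzero t ht h]
    · have h2 := norm_sub_le_radial (norm_exp_ofReal_mul_I t) (norm_exp_ofReal_mul_I t₀) hr.1.le
      have h3 : 0 < ‖cexp (t * I) - cexp (t₀ * I)‖ := norm_pos_iff.mpr (sub_ne_zero.mpr h)
      have h4 : ‖cexp (t * I) - r * cexp (t₀ * I)‖⁻¹ ≤ 2 / ‖cexp (t * I) - cexp (t₀ * I)‖ := by
        rw [inv_eq_one_div, div_le_div_iff₀ (by linarith) h3]
        linarith
      calc ‖V t‖ * ‖cexp (t * I) - r * cexp (t₀ * I)‖⁻¹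
          ≤ ‖V t‖ * (2 / ‖cexp (t * I) - cexp (t₀ * I)‖) :=
            mul_le_mul_of_nonneg_left h4 (norm_nonneg _)
        _ = _ := by ring
  · filter_upwards with t ht
    rcases eq_or_ne (cexp (t * I)) (cexp (t₀ * I)) with h | h
    · simp [hzero t ht h]
    · have hc : ContinuousAt (fun r : ℝ => V t * (cexp (t * I) - r * cexp (t₀ * I))⁻¹) 1 := by
        refine continuousAt_const.mul (ContinuousAt.inv₀ (by fun_prop) ?_)
        simpa using sub_ne_zero.mpr h
      have := hc.tendsto.mono_left (nhdsWithin_le_nhds (s := {1}ᶜ))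
      simpa using this

/-- The Plemelj jump relation at a point of differentiability of the density. -/
lemma tendsto_cauchyT_jump {t₀ : ℝ} (h0 : 0 < t₀) (h1 : t₀ < 2 * π)
    (hV : IntervalIntegrable V volume 0 (2 * π)) (hd : DifferentiableAt ℝ V t₀) :
    Tendsto (fun r : ℝ => cauchyT V (r * cexp (t₀ * I)) - cauchyT V ((r⁻¹ : ℝ) * cexp (t₀ * I)))
      (𝓝[<] 1) (𝓝 (V t₀ / cexp (t₀ * I))) := by
  -- With this `c` the density `V - c e^{it}` vanishes at `t₀` and has no jump, so the whole jump
  -- `c` comes from `c e^{it}`.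
  set c := V t₀ / cexp (t₀ * I) with hc
  set U : ℝ → ℂ := fun t => V t - c * cexp (t * I) with hU
  have hcont : Continuous fun t : ℝ => c * cexp (t * I) := by fun_prop
  have hW := hcont.intervalIntegrable (μ := volume) 0 (2 * π)
  have hUi : IntervalIntegrable U volume 0 (2 * π) := hV.sub hW
  have hexp : DifferentiableAt ℝ (fun t : ℝ => c * cexp (t * I)) t₀ := by
    have := ((hasDerivAt_id (t₀ : ℂ)).mul_const I).cexp.comp_ofReal
    exact this.differentiableAt.const_mul c
  have hUd : DifferentiableAt ℝ U t₀ := hd.sub hexp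
  have hU0 : U t₀ = 0 := by
    simp [hU, hc]
  have hT := tendsto_cauchyT_radial h0 h1 hUi hUd hU0
  have hsplit : ∀ z : ℂ, ‖z‖ ≠ 1 → cauchyT V z =
      cauchyT U z + cauchyT (fun t => c * cexp (t * I)) z := by
    intro z hz
    simp only [cauchyT, pair]
    rw [← mul_add, ← intervalIntegral.integral_add
      (pair_integrable hUi (continuousOn_inv_sub hz)) (pair_integrable hW (continuousOn_inv_sub hz))]
    congr 1
    refine intervalIntegral.integral_congr fun t _ => ?_
    simp only [hU]
    ring
  have hl : 𝓝[<] (1 : ℝ) ≤ 𝓝[≠] 1 := nhdsWithin_mono _ fun x hx => ne_of_lt hx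
  have hinv : Tendsto (fun r : ℝ => r⁻¹) (𝓝[<] 1) (𝓝[≠] 1) := by
    refine tendsto_nhdsWithin_iff.mpr ⟨?_, ?_⟩
    · have := (tendsto_inv₀ (one_ne_zero (α := ℝ))).mono_left (nhdsWithin_le_nhds (s := Iio 1))
      simpa using this
    · filter_upwards [self_mem_nhdsWithin] with r hr h
      exact hr.ne (by simpa using h)
  have := ((hT.mono_left hl).sub (hT.comp hinv)).add_const c
  rw [sub_self, zero_add] at this
  refine this.congr' ?_
  have hpos : ∀ᶠ r : ℝ in 𝓝[<] 1, 0 < r := (lt_mem_nhds one_pos).filter_mono nhdsWithin_le_nhds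
  filter_upwards [self_mem_nhdsWithin, hpos] with r hr hr0
  have hr' : r < 1 := hr
  have n1 : ‖(r : ℂ) * cexp (t₀ * I)‖ = r := by
    rw [norm_mul, norm_exp_ofReal_mul_I, mul_one, norm_real, Real.norm_of_nonneg hr0.le]
  have n2 : ‖((r⁻¹ : ℝ) : ℂ) * cexp (t₀ * I)‖ = r⁻¹ := by
    rw [norm_mul, norm_exp_ofReal_mul_I, mul_one, norm_real,
      Real.norm_of_nonneg (inv_pos.mpr hr0).le]
  have hgt : 1 < r⁻¹ := (one_lt_inv₀ hr0).mpr hr'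
  rw [hsplit _ (by rw [n1]; exact hr'.ne), hsplit _ (by rw [n2]; exact hgt.ne'),
    cauchyT_exp_of_norm_lt (by rw [n1]; exact hr'), cauchyT_exp_of_lt_norm (by rw [n2]; exact hgt)]
  simp only [Function.comp]
  ring

end Plemelj

/-! ### The first order differential equation of the Cauchy transform. -/

section Equation

variable {m : ℕ} (n : ℕ) (θ : Fin (m + 1) → ℝ) (α β : Fin (m + 1) → ℂ)

/-- The Lagrange basis polynomials of the singular points. -/
def el (j : Fin (m + 1)) (s : ℂ) : ℂ := (Lagrange.basis Finset.univ (pt θ) j).eval s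

/-- The function whose integral against the density is the residue at `z_j`. -/
def rhoFun (j : Fin (m + 1)) (s : ℂ) : ℂ :=
  deriv (el θ j) s + ∑ k, 2 * α k * dslope (el θ j) (pt θ k) s + 2 * lam n α β * (el θ j s * s⁻¹)

/-- The residue at `z_j` in the differential equation of the Cauchy transform. -/
def rho (j : Fin (m + 1)) : ℂ := pair (dens n θ α β) (rhoFun n θ α β j)

/-- The residue at `0` in the differential equation of the Cauchy transform. -/
def rhoZero : ℂ := -(2 * lam n α β * cauchyT (dens n θ α β) 0)

/-- The inhomogeneity of the differential equation of the Cauchy transform. -/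
def inhom (z : ℂ) : ℂ := ∑ j, rho n θ α β j / (z - pt θ j) + rhoZero n θ α β / z

variable {θ}

lemma differentiable_el (j : Fin (m + 1)) : Differentiable ℂ (el θ j) :=
  Polynomial.differentiable _

lemma continuous_dslope_el (j k : Fin (m + 1)) : Continuous (dslope (el θ j) (pt θ k)) := by
  rw [← continuousOn_univ, continuousOn_dslope univ_mem]
  exact ⟨(differentiable_el j).continuous.continuousOn, differentiable_el j _⟩

lemma continuous_deriv_el (j : Fin (m + 1)) : Continuous (deriv (el θ j)) := by
  have : deriv (el θ j) =
      fun s => (Polynomial.derivative (Lagrange.basis Finset.univ (pt θ) j)).eval s := by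
    ext s
    exact Polynomial.deriv _
  rw [this]
  exact Polynomial.continuous _

lemma continuousOn_inv_sphere : ContinuousOn (fun s : ℂ => s⁻¹) (Metric.sphere 0 1) :=
  ContinuousOn.inv₀ continuousOn_id fun s hs h => by
    simp [h] at hs

lemma continuousOn_rhoFun (j : Fin (m + 1)) :
    ContinuousOn (rhoFun n θ α β j) (Metric.sphere 0 1) := by
  have h1 := continuous_deriv_el (θ := θ) j
  have h2 := fun k => continuous_dslope_el (θ := θ) j k
  have h3 := (differentiable_el (θ := θ) j).continuous
  have h4 := continuousOn_inv_sphere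
  unfold rhoFun
  fun_prop

variable (hθ_mono : StrictMono θ) (hθ_zero : θ 0 = 0) (hθ_lt : ∀ j, θ j < 2 * π)
include hθ_mono hθ_zero hθ_lt

lemma el_pt (j k : Fin (m + 1)) : el θ j (pt θ k) = if j = k then 1 else 0 := by
  have hinj := (pt_injective hθ_mono hθ_zero hθ_lt).injOn (s := (Finset.univ : Finset (Fin (m+1))))
  unfold el
  split_ifs with h
  · subst h
    exact Lagrange.eval_basis_self hinj (Finset.mem_univ _)
  · exact Lagrange.eval_basis_of_ne h (Finset.mem_univ _)

variable (hα : ∀ j, -1 / 2 < (α j).re)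
include hα

/-- The differential equation of the Cauchy transform. -/
lemma pair_inv_sub_sq {z : ℂ} (hz : ‖z‖ ≠ 1) (hz0 : z ≠ 0) :
    pair (dens n θ α β) (fun s => ((s - z)⁻¹) ^ 2) =
      2 * ratPsi n θ α β z * cauchyT (dens n θ α β) z + inhom n θ α β z := by
  have hint := integrable_dens n α β hθ_mono hθ_zero hθ_lt hα
  have hi := continuousOn_inv_sub hz
  have hi0 := continuousOn_inv_sphere
  have hrc := fun j => continuousOn_rhoFun n α β (θ := θ) j
  have hzp : ∀ k, z - pt θ k ≠ 0 := fun k h => hz (by rw [sub_eq_zero] at h; simp [h])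
  have hsz : ∀ s : ℂ, ‖s‖ = 1 → s - z ≠ 0 := fun s hs h => hz (by
    rw [sub_eq_zero] at h; simpa [h] using hs)
  -- The function `1/(s - z)` is corrected by Lagrange interpolation so as to vanish at all singular
  -- points, which kills the boundary terms. In the resulting identity the first two terms of `G`
  -- give `F` and `F'`, and the others depend on `z` only through simple poles, whose coefficients
  -- are the residues `rho` and `rhoZero`.
  have key := pair_deriv_eq_zero n α β hθ_mono hθ_zero hθ_lt hα
    (g := fun s => (s - z)⁻¹ + ∑ j, (z - pt θ j)⁻¹ * el θ j s)
    (G := fun s => 2 * ratPsi n θ α β z * (s - z)⁻¹ - ((s - z)⁻¹) ^ 2 +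
      (∑ j, (z - pt θ j)⁻¹ * rhoFun n θ α β j s - 2 * lam n α β * z⁻¹ * s⁻¹))
    (fun s hs => by
      have := fun j => (differentiable_el (θ := θ) j) s
      exact DifferentiableAt.add (DifferentiableAt.inv (by fun_prop) (hsz s hs)) (by fun_prop))
    (fun k => by
      simp only [el_pt hθ_mono hθ_zero hθ_lt, mul_ite, mul_one, mul_zero, Finset.sum_ite_eq',
        Finset.mem_univ, if_true]
      rw [← neg_sub z, inv_neg, neg_add_cancel])
    (by fun_prop) ?_
  · rw [pair_add hint (by fun_prop) (by fun_prop), pair_sub hint (by fun_prop) (by fun_prop),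
      pair_sub hint (by fun_prop) (by fun_prop), pair_sum _ hint (fun j _ => by fun_prop)] at key
    simp only [pair_const_mul] at key
    have e1 : pair (dens n θ α β) (fun s => s⁻¹) = cauchyT (dens n θ α β) 0 := by
      simp [cauchyT]
    have e2 : pair (dens n θ α β) (fun s => (s - z)⁻¹) = cauchyT (dens n θ α β) z := rfl
    rw [e1, e2] at key
    simp only [inhom, rho, rhoZero, div_eq_inv_mul]
    linear_combination -key
  · intro s hs hsp
    have hs0 : s ≠ 0 := by
      rintro rfl
      simp at hs
    have hsk : ∀ k, s - pt θ k ≠ 0 := fun k => sub_ne_zero.mpr (hsp k)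
    have hder : deriv (fun s => (s - z)⁻¹ + ∑ j, (z - pt θ j)⁻¹ * el θ j s) s =
        -((s - z)⁻¹) ^ 2 + ∑ j, (z - pt θ j)⁻¹ * deriv (el θ j) s := by
      have h1 : HasDerivAt (fun s : ℂ => (s - z)⁻¹) (-((s - z)⁻¹) ^ 2) s := by
        have := ((hasDerivAt_id s).sub_const z).inv (hsz s hs)
        refine this.congr_deriv ?_
        simp [div_eq_mul_inv]
      exact (h1.add (HasDerivAt.fun_sum fun j _ =>
        ((differentiable_el (θ := θ) j s).hasDerivAt.const_mul _))).deriv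
    have hds : ∀ j k, dslope (el θ j) (pt θ k) s =
        (el θ j s - if j = k then 1 else 0) * (s - pt θ k)⁻¹ := by
      intro j k
      rw [dslope_of_ne _ (hsp k), slope_def_field, el_pt hθ_mono hθ_zero hθ_lt, div_eq_mul_inv]
    -- The Lagrange polynomial cancels all poles of `ratPsi` on the circle except the one at `z_j`,
    -- which is subtracted. This is why `rhoFun`, written with `dslope`, is continuous on the
    -- circle.
    have hrho : ∀ j, rhoFun n θ α β j s = deriv (el θ j) s + 2 * ratPsi n θ α β s * el θ j s
        - 2 * α j * (s - pt θ j)⁻¹ := by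
      intro j
      have h1 : ∑ k, 2 * α k * dslope (el θ j) (pt θ k) s =
          2 * (∑ k, α k / (s - pt θ k)) * el θ j s - 2 * α j * (s - pt θ j)⁻¹ := by
        have : ∀ k, 2 * α k * dslope (el θ j) (pt θ k) s =
            2 * (α k / (s - pt θ k)) * el θ j s -
              (if j = k then 2 * α k * (s - pt θ k)⁻¹ else 0) := by
          intro k
          rw [hds]
          split_ifs <;> ring
        rw [Finset.sum_congr rfl fun k _ => this k, Finset.sum_sub_distrib, ← Finset.sum_mul,
          ← Finset.mul_sum]
        simp
      rw [rhoFun, h1, ratPsi]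
      ring
    have hsum : ∑ j, (z - pt θ j)⁻¹ * rhoFun n θ α β j s =
        ∑ j, (z - pt θ j)⁻¹ * deriv (el θ j) s +
        2 * ratPsi n θ α β s * ∑ j, (z - pt θ j)⁻¹ * el θ j s -
        ∑ j, 2 * α j * ((z - pt θ j)⁻¹ * (s - pt θ j)⁻¹) := by
      rw [Finset.mul_sum, ← Finset.sum_add_distrib, ← Finset.sum_sub_distrib]
      refine Finset.sum_congr rfl fun j _ => ?_
      rw [hrho]
      ring
    -- Partial fractions of the difference quotient of `ratPsi`. They replace its value at `s` by
    -- its value at `z`, which can be taken out of the pairing.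
    have hrat : ratPsi n θ α β z * (s - z)⁻¹ = ratPsi n θ α β s * (s - z)⁻¹ +
        ∑ j, α j * ((z - pt θ j)⁻¹ * (s - pt θ j)⁻¹) + lam n α β * z⁻¹ * s⁻¹ := by
      simp only [ratPsi, add_mul, Finset.sum_mul]
      have h1 : ∀ j, α j / (z - pt θ j) * (s - z)⁻¹ = α j / (s - pt θ j) * (s - z)⁻¹ +
          α j * ((z - pt θ j)⁻¹ * (s - pt θ j)⁻¹) := by
        intro j
        have := hzp j
        have := hsk j
        have := hsz s hs
        field_simp
        ring
      rw [Finset.sum_congr rfl fun j _ => h1 j, Finset.sum_add_distrib]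
      have := hsz s hs
      field_simp
      ring
    have h2 : ∑ j, 2 * α j * ((z - pt θ j)⁻¹ * (s - pt θ j)⁻¹) =
        2 * ∑ j, α j * ((z - pt θ j)⁻¹ * (s - pt θ j)⁻¹) := by
      rw [Finset.mul_sum]
      exact Finset.sum_congr rfl fun j _ => by ring
    simp only [hder, hsum, h2]
    linear_combination 2 * hrat

lemma hasDerivAt_cauchyT_dens {z : ℂ} (hz : ‖z‖ ≠ 1) (hz0 : z ≠ 0) :
    HasDerivAt (cauchyT (dens n θ α β))
      (2 * ratPsi n θ α β z * cauchyT (dens n θ α β) z + inhom n θ α β z) z := by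
  rw [← pair_inv_sub_sq n α β hθ_mono hθ_zero hθ_lt hα hz hz0]
  exact hasDerivAt_cauchyT (integrable_dens n α β hθ_mono hθ_zero hθ_lt hα) hz

/-- The jump of the Cauchy transform across the arcs of the circle. -/
lemma tendsto_jump_arc {j : Fin (m + 1)} {t : ℝ} (h1 : θ j < t) (h2 : t < thetaNext θ j) :
    Tendsto (fun r : ℝ => cauchyT (dens n θ α β) (r * cexp (t * I)) -
      cauchyT (dens n θ α β) ((r⁻¹ : ℝ) * cexp (t * I))) (𝓝[<] 1)
      (𝓝 (sConst α β j * cexp (2 * logPsi n θ α β (cexp (t * I))))) := by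
  have hj0 := theta_nonneg hθ_mono hθ_zero j
  have h3 := thetaNext_le hθ_lt j
  have hexp : HasDerivAt (fun t : ℝ => cexp (t * I)) (cexp (t * I) * I) t := by
    have := ((hasDerivAt_id (t : ℂ)).mul_const I).cexp.comp_ofReal
    simpa using this
  have hoff := offCuts_arc hθ_mono hθ_zero hθ_lt h1 h2
  have hd1 := (((hasDerivAt_logPsi n α β hoff).const_mul 2).cexp.comp t hexp).const_mul
    (sConst α β j)
  have hd : DifferentiableAt ℝ (dens n θ α β) t := by
    refine ((hd1.mul hexp).congr_of_eventuallyEq ?_).differentiableAt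
    filter_upwards [Ioo_mem_nhds h1 h2] with x hx
    exact dens_arc n α β hθ_mono hθ_zero hθ_lt hx.1 hx.2
  have := tendsto_cauchyT_jump (by linarith) (by linarith)
    (integrable_dens n α β hθ_mono hθ_zero hθ_lt hα) hd
  rwa [dens_arc n α β hθ_mono hθ_zero hθ_lt h1 h2, mul_div_assoc, div_self (exp_ne_zero _),
    mul_one] at this

end Equation

/-! ### The exponential coordinate near a point of the contour. -/

section LocalCoordinate

/-- In the coordinate `z = ζ e^u` with `|ζ| = 1` the circle is the line `Re u = 0` and the ray
through `ζ` is `Im u = 0`. The sectors at `ζ` become convex sets, on which a function with zero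
derivative is constant. -/
lemma eventually_exists_exp {ζ : ℂ} (hζ : ζ ≠ 0) {ε : ℝ} (hε : 0 < ε) :
    ∀ᶠ z in 𝓝 ζ, ∃ u : ℂ, ‖u‖ < ε ∧ z = ζ * cexp u := by
  have hc : ContinuousAt (fun z : ℂ => Complex.log (z / ζ)) ζ := by
    refine ContinuousAt.clog (by fun_prop) ?_
    rw [div_self hζ]
    exact one_mem_slitPlane
  have h0 : Tendsto (fun z : ℂ => ‖Complex.log (z / ζ)‖) (𝓝 ζ) (𝓝 0) := by
    simpa [div_self hζ] using hc.norm.tendsto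
  filter_upwards [h0.eventually_lt_const hε, eventually_ne_nhds hζ] with z hz hz0
  refine ⟨_, hz, ?_⟩
  rw [exp_log (div_ne_zero hz0 hζ)]
  field_simp

lemma exists_ball_exp {ζ : ℂ} {p : ℂ → Prop} (h : ∀ᶠ z in 𝓝 ζ, p z) :
    ∃ ε > 0, ∀ u : ℂ, ‖u‖ < ε → p (ζ * cexp u) := by
  have hc : Tendsto (fun u : ℂ => ζ * cexp u) (𝓝 0) (𝓝 ζ) := by
    have : Continuous fun u : ℂ => ζ * cexp u := by fun_prop
    simpa using this.tendsto 0
  obtain ⟨ε, hε, hb⟩ := Metric.eventually_nhds_iff.mp (hc.eventually h)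
  exact ⟨ε, hε, fun u hu => hb (by simpa using hu)⟩

/-- Two solutions of a first order linear equation differ by a multiple of the homogeneous
solution on the image of a convex set under the exponential. -/
lemma exists_const_of_ode {F R L r h : ℂ → ℂ} {ζ : ℂ} {W : Set ℂ} (hW : IsOpen W)
    (hWc : Convex ℝ W)
    (hF : ∀ u ∈ W, HasDerivAt F (2 * r (ζ * cexp u) * F (ζ * cexp u) + h (ζ * cexp u))
      (ζ * cexp u))
    (hR : ∀ u ∈ W, HasDerivAt R (2 * r (ζ * cexp u) * R (ζ * cexp u) + h (ζ * cexp u))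
      (ζ * cexp u))
    (hL : ∀ u ∈ W, HasDerivAt L (r (ζ * cexp u)) (ζ * cexp u)) :
    ∃ C : ℂ, ∀ u ∈ W, F (ζ * cexp u) = R (ζ * cexp u) + C * cexp (2 * L (ζ * cexp u)) := by
  have hder : ∀ u ∈ W, HasDerivAt (fun u => (F (ζ * cexp u) - R (ζ * cexp u)) *
      cexp (-(2 * L (ζ * cexp u)))) 0 u := by
    intro u hu
    have he : HasDerivAt (fun u => ζ * cexp u) (ζ * cexp u) u := (hasDerivAt_exp u).const_mul ζ
    have h1 := ((hF u hu).comp u he).sub ((hR u hu).comp u he)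
    have h2 := (((hL u hu).comp u he).const_mul 2).neg.cexp
    refine (h1.mul h2).congr_deriv ?_
    simp only [Function.comp, Pi.sub_apply, Pi.neg_apply]
    ring
  obtain ⟨C, hC⟩ := hW.exists_is_const_of_deriv_eq_zero hWc.isPreconnected
    (fun u hu => (hder u hu).differentiableAt.differentiableWithinAt) fun u hu => (hder u hu).deriv
  refine ⟨C, fun u hu => ?_⟩
  rw [← hC u hu, mul_assoc, ← exp_add, neg_add_cancel, exp_zero]
  ring

end LocalCoordinate

/-! ### Holomorphic solutions at a regular singular point. -/

section Frobenius

/-- The holomorphic solution of `(z - c) u' = a u + k`. -/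
lemma exists_frobenius {k : ℂ → ℂ} {c a : ℂ} (hk : AnalyticAt ℂ k c) (ha : ∀ n : ℕ, a ≠ n) :
    ∃ u : ℂ → ℂ, AnalyticAt ℂ u c ∧ u c = -(k c / a) ∧
      ∀ᶠ z in 𝓝 c, HasDerivAt u (deriv u z) z ∧ (z - c) * deriv u z = a * u z + k z := by
  obtain ⟨p, r, hp⟩ := hk
  obtain ⟨ρ, hρ0, hρ⟩ := ENNReal.lt_iff_exists_nnreal_btwn.mp hp.r_pos
  have hsum := p.summable_norm_mul_pow (hρ.trans_le hp.r_le)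
  have hna : ∀ n : ℕ, (n : ℂ) - a ≠ 0 := fun n => sub_ne_zero.mpr (ha n).symm
  obtain ⟨C, hC⟩ : ∃ C : ℝ, ∀ n : ℕ, ‖((n : ℂ) - a)⁻¹‖ ≤ C := by
    have h1 : Tendsto (fun n : ℕ => ‖(n : ℂ) - a‖) atTop atTop := by
      refine tendsto_atTop_mono (f := fun n : ℕ => (n : ℝ) - ‖a‖) (fun n => ?_)
        (tendsto_atTop_add_const_right _ _ tendsto_natCast_atTop_atTop)
      simpa using norm_sub_norm_le (n : ℂ) a
    obtain ⟨C, hC⟩ := (tendsto_inv_atTop_zero.comp h1).bddAbove_range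
    exact ⟨C, fun n => by simpa using hC ⟨n, rfl⟩⟩
  -- The equation reads `(n - a) u_n = k_n` on Taylor coefficients. As `a` is not a natural number,
  -- `1/(n - a)` is bounded, and the series of `u` converges where that of `k` does.
  set G : ℕ → ℂ → ℂ := fun n z => p.coeff n * ((n : ℂ) - a)⁻¹ * (z - c) ^ n with hG
  set u : ℂ → ℂ := fun z => ∑' n, G n z with hu
  have hcoef : ∀ n, ‖p.coeff n‖ = ‖p n‖ := fun n => p.norm_apply_eq_norm_coef.symm
  have hbound : ∀ n, ∀ z ∈ Metric.ball c ρ, ‖G n z‖ ≤ ‖p n‖ * ρ ^ n * C := by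
    intro n z hz
    have h1 : ‖z - c‖ ≤ ρ := by
      rw [← dist_eq_norm]; exact (Metric.mem_ball.mp hz).le
    simp only [hG]
    rw [norm_mul, norm_mul, norm_pow, hcoef]
    calc ‖p n‖ * ‖((n : ℂ) - a)⁻¹‖ * ‖z - c‖ ^ n ≤ ‖p n‖ * C * ρ ^ n := by
          gcongr
          · exact mul_nonneg (norm_nonneg _) ((norm_nonneg _).trans (hC n))
          · exact hC n
      _ = _ := by ring
  have hS : Summable fun n => ‖p n‖ * (ρ : ℝ) ^ n * C := hsum.mul_right C
  have hGd : ∀ n, DifferentiableOn ℂ (G n) (Metric.ball c ρ) := fun n => by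
    simp only [hG]; fun_prop
  have hud := differentiableOn_tsum_of_summable_norm hS hGd Metric.isOpen_ball hbound
  have hρpos : (0 : ℝ) < ρ := by exact_mod_cast hρ0
  have hnhds : ∀ᶠ z in 𝓝 c, z ∈ Metric.ball c ρ := Metric.ball_mem_nhds c hρpos
  have hk0 : p.coeff 0 = k c := by
    have := hp.coeff_zero 0
    rw [FormalMultilinearSeries.coeff, ← this]
    congr 1
    exact Subsingleton.elim _ _
  refine ⟨u, hud.analyticAt (Metric.ball_mem_nhds c hρpos), ?_, ?_⟩
  · simp only [hu]
    rw [tsum_eq_single 0 fun n hn => by simp [hG, hn]]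
    simp only [hG, sub_self, pow_zero, mul_one, Nat.cast_zero, zero_sub, hk0]
    rw [inv_neg, div_eq_mul_inv]
    ring
  · filter_upwards [hnhds] with z hz
    refine ⟨(hud.differentiableAt (Metric.isOpen_ball.mem_nhds hz)).hasDerivAt, ?_⟩
    have h1 := (hasSum_deriv_of_summable_norm hS hGd Metric.isOpen_ball hbound hz).mul_left (z - c)
    have h2 : HasSum (fun n => G n z) (u z) :=
      (Summable.of_norm_bounded hS fun n => hbound n z hz).hasSum
    have h3 : HasSum (fun n => p.coeff n * (z - c) ^ n) (k z) := by
      have h4 : z - c ∈ Metric.eball (0 : ℂ) r := by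
        rw [Metric.mem_eball, edist_zero_right]
        refine lt_trans ?_ hρ
        rw [enorm_eq_nnnorm, ENNReal.coe_lt_coe, ← NNReal.coe_lt_coe, coe_nnnorm, ← dist_eq_norm]
        exact hz
      have := hp.hasSum h4
      rw [add_sub_cancel] at this
      simpa [mul_comm] using this
    refine h1.unique (((h2.mul_left a).add h3).congr_fun fun n => ?_)
    have hd : deriv (G n) z = p.coeff n * ((n : ℂ) - a)⁻¹ * (n * (z - c) ^ (n - 1)) := by
      have := (((hasDerivAt_id z).sub_const c).fun_pow n).const_mul (p.coeff n * ((n : ℂ) - a)⁻¹)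
      rw [mul_one] at this
      exact this.deriv
    have hpow : (z - c) * ((n : ℂ) * (z - c) ^ (n - 1)) = n * (z - c) ^ n := by
      rcases n with _ | n
      · simp
      · simp only [Nat.add_sub_cancel]
        ring
    rw [hd, mul_left_comm, hpow]
    simp only [hG]
    have := hna n
    field_simp
    ring

end Frobenius

/-! ### The local holomorphic solution, and limits of the Cauchy transform on the arcs. -/

section LocalStructure

variable {m : ℕ} (n : ℕ) {θ : Fin (m + 1) → ℝ} (α β : Fin (m + 1) → ℂ)
variable (hθ_mono : StrictMono θ) (hθ_zero : θ 0 = 0) (hθ_lt : ∀ j, θ j < 2 * π)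
include hθ_mono hθ_zero hθ_lt

-- This rules out resonance in the Frobenius series with exponent `2 α_j`.
omit hθ_mono hθ_zero hθ_lt in
lemma two_alpha_ne_natCast {a : ℂ} (ha : cexp (4 * π * I * a) ≠ 1) (k : ℕ) : 2 * a ≠ k := by
  intro h
  apply ha
  rw [show 4 * π * I * a = k * (2 * π * I) by rw [← h]; ring]
  exact exp_nat_mul_two_pi_mul_I k

/-- The holomorphic solution of the differential equation at `z_j`. -/
lemma exists_local_solution (j : Fin (m + 1)) (hα_exp : cexp (4 * π * I * α j) ≠ 1) :
    ∃ R : ℂ → ℂ, AnalyticAt ℂ R (pt θ j) ∧ R (pt θ j) = -(rho n θ α β j / (2 * α j)) ∧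
      ∀ᶠ z in 𝓝 (pt θ j), z ≠ pt θ j →
        HasDerivAt R (2 * ratPsi n θ α β z * R z + inhom n θ α β z) z := by
  have hloc := analyticAt_locLog n α β hθ_mono hθ_zero hθ_lt j
  have hne : ∀ k ∈ Finset.univ.erase j, pt θ j - pt θ k ≠ 0 := fun k hk =>
    sub_ne_zero.mpr ((pt_injective hθ_mono hθ_zero hθ_lt).ne (Finset.ne_of_mem_erase hk).symm)
  -- The substitution `R = e^{2 locLog} u` removes everything from the coefficient except its pole
  -- at `z_j`, and leaves `(z - z_j) u' = 2 α_j u + q`.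
  set q : ℂ → ℂ := fun z => (rho n θ α β j + (z - pt θ j) *
    (∑ k ∈ Finset.univ.erase j, rho n θ α β k / (z - pt θ k) + rhoZero n θ α β / z)) *
    cexp (-(2 * locLog n θ α β j z)) with hq
  have hqa : AnalyticAt ℂ q (pt θ j) := by
    refine AnalyticAt.mul (analyticAt_const.add ((analyticAt_id.sub analyticAt_const).mul
      (AnalyticAt.add (Finset.analyticAt_fun_sum _ fun k hk => ?_) ?_)))
      (analyticAt_const.mul hloc).neg.cexp
    · exact analyticAt_const.div (analyticAt_id.sub analyticAt_const) (hne k hk)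
    · exact analyticAt_const.div analyticAt_id (pt_ne_zero θ j)
  obtain ⟨u, hu, hu0, hode⟩ := exists_frobenius (a := 2 * α j) hqa
    (two_alpha_ne_natCast hα_exp)
  refine ⟨fun z => cexp (2 * locLog n θ α β j z) * u z,
    (analyticAt_const.mul hloc).cexp.mul hu, ?_, ?_⟩
  · simp only [hu0, hq, sub_self, zero_mul, add_zero]
    rw [exp_neg]
    have := exp_ne_zero (2 * locLog n θ α β j (pt θ j))
    field_simp
  · filter_upwards [hode, eventually_hasDerivAt_locLog n α β hθ_mono hθ_zero hθ_lt j]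
      with z hz hl hzj
    have hzj' : z - pt θ j ≠ 0 := sub_ne_zero.mpr hzj
    refine (((hl.const_mul 2).cexp).mul hz.1).congr_deriv ?_
    have h2 := hz.2
    have hr : ratPsi n θ α β z = lam n α β / z +
        ∑ k ∈ Finset.univ.erase j, α k / (z - pt θ k) + α j / (z - pt θ j) := by
      rw [ratPsi, ← Finset.add_sum_erase _ _ (Finset.mem_univ j)]
      ring
    have hi : inhom n θ α β z = rho n θ α β j / (z - pt θ j) +
        (∑ k ∈ Finset.univ.erase j, rho n θ α β k / (z - pt θ k) + rhoZero n θ α β / z) := by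
      rw [inhom, ← Finset.add_sum_erase _ _ (Finset.mem_univ j)]
      ring
    have h3 : deriv u z = (2 * α j * u z + q z) / (z - pt θ j) := by
      rw [eq_div_iff hzj', mul_comm, h2]
    have h4 : cexp (2 * locLog n θ α β j z) * q z = rho n θ α β j + (z - pt θ j) *
        (∑ k ∈ Finset.univ.erase j, rho n θ α β k / (z - pt θ k) + rhoZero n θ α β / z) := by
      simp only [hq]
      rw [mul_left_comm, ← exp_add, add_neg_cancel, exp_zero, mul_one]
    have h5 : cexp (2 * locLog n θ α β j z) * deriv u z =
        (2 * α j * (cexp (2 * locLog n θ α β j z) * u z) + (rho n θ α β j + (z - pt θ j) *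
        (∑ k ∈ Finset.univ.erase j, rho n θ α β k / (z - pt θ k) + rhoZero n θ α β / z))) /
        (z - pt θ j) := by
      rw [h3, ← h4]
      ring
    rw [h5, hr, hi]
    field_simp
    ring

variable (hα : ∀ j, -1 / 2 < (α j).re)
include hα

/-- One-sided limits of the Cauchy transform on the arcs. -/
lemma cauchyT_limits_arc {j : Fin (m + 1)} {t : ℝ} (h1 : θ j < t) (h2 : t < thetaNext θ j) :
    ∃ A B : ℂ, Tendsto (cauchyT (dens n θ α β)) (𝓝[{z | ‖z‖ < 1}] (cexp (t * I))) (𝓝 A) ∧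
      Tendsto (cauchyT (dens n θ α β)) (𝓝[{z | 1 < ‖z‖}] (cexp (t * I))) (𝓝 B) ∧
      A - B = sConst α β j * cexp (2 * logPsi n θ α β (cexp (t * I))) := by
  set ζ := cexp (t * I) with hζ
  have hζ0 : ζ ≠ 0 := exp_ne_zero _
  have hζn : ‖ζ‖ = 1 := norm_exp_ofReal_mul_I t
  have hoff : OffCuts θ ζ := offCuts_arc hθ_mono hθ_zero hθ_lt h1 h2
  have hopen : ∀ᶠ z in 𝓝 ζ, OffCuts θ z := isOpen_offCuts.mem_nhds hoff
  have hoff_ne : ∀ z, OffCuts θ z → z ≠ 0 ∧ ∀ k, z ≠ pt θ k := by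
    intro z hz
    refine ⟨?_, fun k h => ?_⟩
    · rintro rfl
      simpa using hz.1
    · have := hz.2 k
      rw [h, div_self (pt_ne_zero θ k)] at this
      simp at this
  obtain ⟨d, hd, hball⟩ := Metric.eventually_nhds_iff_ball.mp hopen
  have hdiff : DifferentiableOn ℂ (fun z => inhom n θ α β z * cexp (-(2 * logPsi n θ α β z)))
      (Metric.ball ζ d) := by
    intro z hz
    obtain ⟨hz0, hzk⟩ := hoff_ne z (hball z hz)
    have hl := (hasDerivAt_logPsi n α β (hball z hz)).differentiableAt
    have hi : DifferentiableAt ℂ (inhom n θ α β) z := by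
      unfold inhom
      refine DifferentiableAt.add (DifferentiableAt.fun_sum fun k _ => ?_) ?_
      · exact (differentiableAt_const _).div (by fun_prop) (sub_ne_zero.mpr (hzk k))
      · exact (differentiableAt_const _).div (by fun_prop) hz0
    exact (hi.mul (hl.const_mul 2).neg.cexp).differentiableWithinAt
  -- Variation of constants: with `G` a primitive of `inhom / ψ²`, the product `ψ² G` solves the
  -- equation across the circle. On either side `F` differs from it by a constant multiple of `ψ²`,
  -- so both limits exist without restriction on the approach.
  obtain ⟨G, hG⟩ := hdiff.isExactOn_ball
  set R : ℂ → ℂ := fun z => cexp (2 * logPsi n θ α β z) * G z with hR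
  have hRd : ∀ z ∈ Metric.ball ζ d,
      HasDerivAt R (2 * ratPsi n θ α β z * R z + inhom n θ α β z) z := by
    intro z hz
    refine ((((hasDerivAt_logPsi n α β (hball z hz)).const_mul 2).cexp).mul
      (hG z hz)).congr_deriv ?_
    have := exp_ne_zero (2 * logPsi n θ α β z)
    simp only [hR, exp_neg]
    field_simp
  obtain ⟨ε, hε, hexp⟩ := exists_ball_exp (Metric.ball_mem_nhds ζ hd)
  have hnorm : ∀ u : ℂ, ‖ζ * cexp u‖ = Real.exp u.re := fun u => by
    rw [norm_mul, hζn, one_mul, norm_exp]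
  have hconst : ∀ W : Set ℂ, IsOpen W → Convex ℝ W → (∀ u ∈ W, ‖u‖ < ε ∧ u.re ≠ 0) →
      ∃ C : ℂ, ∀ u ∈ W, cauchyT (dens n θ α β) (ζ * cexp u) = R (ζ * cexp u) +
        C * cexp (2 * logPsi n θ α β (ζ * cexp u)) := by
    intro W hW hWc hWu
    refine exists_const_of_ode (r := ratPsi n θ α β) (h := inhom n θ α β) hW hWc
      (fun u hu => ?_) (fun u hu => hRd _ (hexp u (hWu u hu).1))
      fun u hu => hasDerivAt_logPsi n α β (hball _ (hexp u (hWu u hu).1))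
    refine hasDerivAt_cauchyT_dens n α β hθ_mono hθ_zero hθ_lt hα ?_
      (mul_ne_zero hζ0 (exp_ne_zero _))
    rw [hnorm]
    simpa using (hWu u hu).2
  obtain ⟨C₁, hC₁⟩ := hconst (Metric.ball 0 ε ∩ {u | u.re < 0})
    (Metric.isOpen_ball.inter (isOpen_lt continuous_re continuous_const))
    ((convex_ball 0 ε).inter (convex_halfSpace_re_lt 0))
    (fun u hu => ⟨by simpa using hu.1, ne_of_lt hu.2⟩)
  obtain ⟨C₂, hC₂⟩ := hconst (Metric.ball 0 ε ∩ {u | 0 < u.re})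
    (Metric.isOpen_ball.inter (isOpen_lt continuous_const continuous_re))
    ((convex_ball 0 ε).inter (convex_halfSpace_re_gt 0))
    (fun u hu => ⟨by simpa using hu.1, ne_of_gt hu.2⟩)
  have hlim : ∀ C : ℂ, Tendsto (fun z => R z + C * cexp (2 * logPsi n θ α β z)) (𝓝 ζ)
      (𝓝 (R ζ + C * cexp (2 * logPsi n θ α β ζ))) := by
    intro C
    have c1 := (hRd ζ (Metric.mem_ball_self hd)).continuousAt
    have c2 := (hasDerivAt_logPsi n α β hoff).continuousAt
    exact (c1.add (continuousAt_const.mul (continuousAt_const.mul c2).cexp)).tendsto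
  have hcoord := eventually_exists_exp hζ0 hε
  have hin : Tendsto (cauchyT (dens n θ α β)) (𝓝[{z | ‖z‖ < 1}] ζ)
      (𝓝 (R ζ + C₁ * cexp (2 * logPsi n θ α β ζ))) := by
    refine ((hlim C₁).mono_left nhdsWithin_le_nhds).congr' ?_
    filter_upwards [hcoord.filter_mono nhdsWithin_le_nhds, self_mem_nhdsWithin] with z hz hz1
    obtain ⟨u, hu, rfl⟩ := hz
    change ‖ζ * cexp u‖ < 1 at hz1
    rw [hnorm, Real.exp_lt_one_iff] at hz1
    exact (hC₁ u ⟨by simpa using hu, hz1⟩).symm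
  have hout : Tendsto (cauchyT (dens n θ α β)) (𝓝[{z | 1 < ‖z‖}] ζ)
      (𝓝 (R ζ + C₂ * cexp (2 * logPsi n θ α β ζ))) := by
    refine ((hlim C₂).mono_left nhdsWithin_le_nhds).congr' ?_
    filter_upwards [hcoord.filter_mono nhdsWithin_le_nhds, self_mem_nhdsWithin] with z hz hz1
    obtain ⟨u, hu, rfl⟩ := hz
    change 1 < ‖ζ * cexp u‖ at hz1
    rw [hnorm, Real.one_lt_exp_iff] at hz1
    exact (hC₂ u ⟨by simpa using hu, hz1⟩).symm
  refine ⟨_, _, hin, hout, ?_⟩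
  have hpos : ∀ᶠ r : ℝ in 𝓝[<] 1, 0 < r := (lt_mem_nhds one_pos).filter_mono nhdsWithin_le_nhds
  -- The difference of the two limits can be evaluated along the pairs `rζ`, `r⁻¹ζ`, where the
  -- Plemelj relation applies.
  have hr1 : Tendsto (fun r : ℝ => (r : ℂ) * ζ) (𝓝[<] 1) (𝓝[{z | ‖z‖ < 1}] ζ) := by
    refine tendsto_nhdsWithin_iff.mpr ⟨?_, ?_⟩
    · have : Continuous fun r : ℝ => (r : ℂ) * ζ := by fun_prop
      simpa using (this.tendsto 1).mono_left (nhdsWithin_le_nhds (s := Iio 1))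
    · filter_upwards [hpos, self_mem_nhdsWithin] with r hr hr'
      rwa [norm_mul, hζn, mul_one, norm_real, Real.norm_of_nonneg hr.le]
  have hr2 : Tendsto (fun r : ℝ => ((r⁻¹ : ℝ) : ℂ) * ζ) (𝓝[<] 1) (𝓝[{z | 1 < ‖z‖}] ζ) := by
    refine tendsto_nhdsWithin_iff.mpr ⟨?_, ?_⟩
    · have : ContinuousAt (fun r : ℝ => ((r⁻¹ : ℝ) : ℂ) * ζ) 1 := by
        refine ContinuousAt.mul (continuous_ofReal.continuousAt.comp ?_) continuousAt_const
        exact continuousAt_inv₀ one_ne_zero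
      simpa using this.tendsto.mono_left (nhdsWithin_le_nhds (s := Iio 1))
    · filter_upwards [hpos, self_mem_nhdsWithin] with r hr hr'
      rw [norm_mul, hζn, mul_one, norm_real, Real.norm_of_nonneg (inv_pos.mpr hr).le]
      exact (one_lt_inv₀ hr).mpr hr'
  exact tendsto_nhds_unique ((hin.comp hr1).sub (hout.comp hr2))
    (tendsto_jump_arc n α β hθ_mono hθ_zero hθ_lt hα h1 h2)

end LocalStructure

/-! ### The Cauchy transform at a singular point and the constants `c_j`. -/

section SingularPoint

variable {m : ℕ} (n : ℕ) {θ : Fin (m + 1) → ℝ} (α β : Fin (m + 1) → ℂ)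

variable (θ) in
/-- The logarithm of `ψ` near `z_j`, cut only along `Γ_j`. -/
def locPsi (j : Fin (m + 1)) (z : ℂ) : ℂ := locLog n θ α β j z + α j * lg θ j z

variable (hθ_mono : StrictMono θ) (hθ_zero : θ 0 = 0) (hθ_lt : ∀ j, θ j < 2 * π)
include hθ_mono hθ_zero hθ_lt

lemma eventually_hasDerivAt_locPsi (j : Fin (m + 1)) : ∀ᶠ z in 𝓝 (pt θ j),
    1 - z / pt θ j ∈ slitPlane → HasDerivAt (locPsi n θ α β j) (ratPsi n θ α β z) z := by
  filter_upwards [eventually_hasDerivAt_locLog n α β hθ_mono hθ_zero hθ_lt j] with z hz hs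
  refine (hz.add ((hasDerivAt_lg hs).const_mul (α j))).congr_deriv ?_
  rw [ratPsi, ← Finset.add_sum_erase _ _ (Finset.mem_univ j)]
  ring

lemma eventually_logPsi_eq_locPsi (j : Fin (m + 1)) : ∀ᶠ z in 𝓝 (pt θ j),
    logPsi n θ α β z = locPsi n θ α β j z +
      if j = 0 ∧ z.im < 0 then 2 * π * I * lam n α β else 0 :=
  eventually_logPsi n α β hθ_mono hθ_zero hθ_lt j

/-- The arc ending at `z_j`. -/
lemma exists_arc_below (j : Fin (m + 1)) : ∃ ε > 0, ∀ τ : ℝ, -ε < τ → τ < 0 →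
    ∃ (j' : Fin (m + 1)) (t : ℝ), θ j' < t ∧ t < thetaNext θ j' ∧
      cexp (t * I) = pt θ j * cexp (τ * I) ∧
      sConst α β j' * cexp (2 * if j = 0 then 2 * π * I * lam n α β else 0) =
        sConst α β j * cexp (2 * π * I * (β j - α j)) := by
  rcases Fin.eq_zero_or_eq_succ j with rfl | ⟨i, rfl⟩
  -- The arc that ends at `z_0 = 1` is the last one.
  · refine ⟨2 * π - θ (Fin.last m), by linarith [hθ_lt (Fin.last m)], fun τ h1 h2 => ?_⟩
    refine ⟨Fin.last m, 2 * π + τ, by linarith, ?_, ?_, ?_⟩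
    · rw [thetaNext, dif_neg (by simp)]
      linarith
    · push_cast
      rw [add_mul, exp_add, exp_two_pi_mul_I, pt, hθ_zero]
      simp
    · rw [if_pos rfl, sConst_eq, sConst_eq, ← exp_add, ← exp_add, exp_eq_exp_iff_exists_int]
      -- At `z_0` the exponents agree only modulo `2πi`: the term `-n/2` of `lam` contributes `-2πi
      -- n` to `4πiλ`.
      refine ⟨-n, ?_⟩
      have h : ∀ k : Fin (m + 1), (if k ≤ Fin.last m then
          -(I * π * β k) - I * π * α k else I * π * β k - 3 * I * π * α k) +
          4 * π * I * ((β k - α k) / 2) = (if k ≤ 0 then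
          -(I * π * β k) - I * π * α k else I * π * β k - 3 * I * π * α k) +
          if k = 0 then 2 * π * I * (β 0 - α 0) else 0 := by
        intro k
        rw [if_pos (Fin.le_last k)]
        by_cases hk : k = 0
        · subst hk
          simp only [le_refl, if_true]
          ring
        · have : ¬ k ≤ 0 := fun h => hk (nonpos_iff_eq_zero.mp h)
          simp only [hk, this, if_false]
          ring
      have h3 := Finset.sum_congr (rfl : (Finset.univ : Finset (Fin (m + 1))) = _) fun k _ => h k
      rw [Finset.sum_add_distrib, Finset.sum_add_distrib, ← Finset.mul_sum] at h3
      simp only [Finset.sum_ite_eq', Finset.mem_univ, if_true] at h3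
      rw [lam]
      push_cast
      linear_combination h3
  · refine ⟨θ i.succ - θ i.castSucc, sub_pos.mpr (hθ_mono Fin.castSucc_lt_succ),
      fun τ h1 h2 => ?_⟩
    refine ⟨i.castSucc, θ i.succ + τ, by linarith, ?_, ?_, ?_⟩
    · have : thetaNext θ i.castSucc = θ i.succ := by
        rw [thetaNext, dif_pos (by simp)]
        rfl
      linarith
    · push_cast
      rw [add_mul, exp_add]
      rfl
    · rw [if_neg (Fin.succ_ne_zero i), mul_zero, exp_zero, mul_one, sConst_eq, sConst_eq,
        ← exp_add]
      congr 1
      have h : ∀ k : Fin (m + 1), (if k ≤ i.castSucc then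
          -(I * π * β k) - I * π * α k else I * π * β k - 3 * I * π * α k) = (if k ≤ i.succ then
          -(I * π * β k) - I * π * α k else I * π * β k - 3 * I * π * α k) +
          if k = i.succ then 2 * π * I * (β i.succ - α i.succ) else 0 := by
        intro k
        by_cases hk : k = i.succ
        · subst hk
          have : ¬ i.succ ≤ i.castSucc := not_le.mpr Fin.castSucc_lt_succ
          simp only [this, le_refl, if_true, if_false]
          ring
        · have : k ≤ i.castSucc ↔ k ≤ i.succ := by
            simp only [Fin.le_def, Fin.ext_iff, Fin.val_succ, Fin.val_castSucc] at hk ⊢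
            omega
          simp only [this, hk, if_false, add_zero]
      rw [Finset.sum_congr rfl fun k _ => h k, Finset.sum_add_distrib]
      simp

variable (hα : ∀ j, -1 / 2 < (α j).re)
include hα

/-- The local structure of the Cauchy transform at `z_j`. -/
lemma cauchyT_local (j : Fin (m + 1)) (hα_exp : cexp (4 * π * I * α j) ≠ 1) :
    ∃ R : ℂ → ℂ, AnalyticAt ℂ R (pt θ j) ∧ R (pt θ j) = -(rho n θ α β j / (2 * α j)) ∧
      ∀ᶠ z in 𝓝 (pt θ j), z ∉ contour θ → cauchyT (dens n θ α β) z =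
        R z + cConst θ α β j z * cexp (2 * locPsi n θ α β j z) := by
  obtain ⟨R, hRa, hR0, hRode⟩ := exists_local_solution n α β hθ_mono hθ_zero hθ_lt j hα_exp
  refine ⟨R, hRa, hR0, ?_⟩
  set F := cauchyT (dens n θ α β) with hFdef
  have hp0 := pt_ne_zero θ j
  have hpn := norm_pt θ j
  have hj0 := theta_nonneg hθ_mono hθ_zero j
  obtain ⟨ε₀, hε₀, hexp⟩ := exists_ball_exp (((hRode.and
    (eventually_hasDerivAt_locPsi n α β hθ_mono hθ_zero hθ_lt j)).and
    (eventually_logPsi_eq_locPsi n α β hθ_mono hθ_zero hθ_lt j)).and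
    ((eventually_logFrom_zero hθ_mono hθ_zero hθ_lt j).and
      (eventually_hasDerivAt_locLog n α β hθ_mono hθ_zero hθ_lt j)))
  obtain ⟨ε₁, hε₁, hbelow⟩ := exists_arc_below n α β hθ_mono hθ_zero hθ_lt j
  have habove0 := theta_lt_thetaNext hθ_mono hθ_lt j
  obtain ⟨ε, hε, he0, he1, he2, he3⟩ : ∃ ε > 0, ε ≤ ε₀ ∧ ε ≤ ε₁ ∧ ε ≤ thetaNext θ j - θ j ∧
      ε ≤ π / 2 :=
    ⟨min (min ε₀ ε₁) (min (thetaNext θ j - θ j) (π / 2)), by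
      refine lt_min (lt_min hε₀ hε₁) (lt_min (by linarith) (by positivity)),
      (min_le_left _ _).trans (min_le_left _ _), (min_le_left _ _).trans (min_le_right _ _),
      (min_le_right _ _).trans (min_le_left _ _), (min_le_right _ _).trans (min_le_right _ _)⟩
  have hpi := Real.pi_pos
  have hnorm : ∀ u : ℂ, ‖pt θ j * cexp u‖ = Real.exp u.re := fun u => by
    rw [norm_mul, hpn, one_mul, norm_exp]
  have him : ∀ u : ℂ, ‖u‖ < ε → |u.im| < ε := fun u hu => (abs_im_le_norm u).trans_lt hu
  have hdivp : ∀ u : ℂ, pt θ j * cexp u / pt θ j = cexp u := fun u => by field_simp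
  -- slit condition
  have hslit : ∀ u : ℂ, ‖u‖ < ε → (u.re ≤ 0 ∧ u ≠ 0 ∨ u.im ≠ 0) →
      1 - pt θ j * cexp u / pt θ j ∈ slitPlane := by
    intro u hu h
    rw [hdivp, mem_slitPlane_iff]
    have hi := abs_lt.1 (him u hu)
    by_cases h0 : u.im = 0
    · have h1 : u.re < 0 := by
        rcases h with ⟨h1, h2⟩ | h1
        · exact lt_of_le_of_ne h1 fun h3 => h2 (Complex.ext h3 h0)
        · exact absurd h0 h1
      left
      rw [sub_re, one_re, exp_re, h0, Real.cos_zero, mul_one, sub_pos, Real.exp_lt_one_iff]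
      exact h1
    · right
      rw [sub_im, one_im, exp_im, zero_sub, neg_ne_zero]
      refine mul_ne_zero (Real.exp_ne_zero _) ?_
      rcases lt_or_gt_of_ne h0 with h1 | h1
      · exact (Real.sin_neg_of_neg_of_neg_pi_lt h1 (by linarith)).ne
      · exact (Real.sin_pos_of_pos_of_lt_pi h1 (by linarith)).ne'
  have hne_pt : ∀ u : ℂ, ‖u‖ < ε → u ≠ 0 → pt θ j * cexp u ≠ pt θ j := by
    intro u hu hu0 h
    have h1 : cexp u = 1 := by
      rw [← hdivp u, h, div_self hp0]
    rw [exp_eq_one_iff] at h1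
    obtain ⟨k, hk⟩ := h1
    have hi := him u hu
    have : u.im = k * (2 * π) := by rw [hk]; simp
    rw [this, abs_mul, abs_of_pos Real.two_pi_pos] at hi
    have hk1 : |(k : ℝ)| < 1 := by
      by_contra hc
      push Not at hc
      nlinarith
    have hk0 : k = 0 := Int.abs_lt_one_iff.mp (by exact_mod_cast hk1)
    apply hu0
    rw [hk, hk0]
    simp
  have hRd : ∀ u : ℂ, ‖u‖ < ε → u ≠ 0 → HasDerivAt R (2 * ratPsi n θ α β (pt θ j * cexp u) *
      R (pt θ j * cexp u) + inhom n θ α β (pt θ j * cexp u)) (pt θ j * cexp u) :=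
    fun u hu hu0 => (hexp u (hu.trans_le he0)).1.1.1 (hne_pt u hu hu0)
  have hLd : ∀ u : ℂ, ‖u‖ < ε → (u.re ≤ 0 ∧ u ≠ 0 ∨ u.im ≠ 0) → HasDerivAt (locPsi n θ α β j)
      (ratPsi n θ α β (pt θ j * cexp u)) (pt θ j * cexp u) :=
    fun u hu h => (hexp u (hu.trans_le he0)).1.1.2 (hslit u hu h)
  have hFd : ∀ u : ℂ, u.re ≠ 0 → HasDerivAt F (2 * ratPsi n θ α β (pt θ j * cexp u) *
      F (pt θ j * cexp u) + inhom n θ α β (pt θ j * cexp u)) (pt θ j * cexp u) := by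
    intro u hu
    refine hasDerivAt_cauchyT_dens n α β hθ_mono hθ_zero hθ_lt hα ?_
      (mul_ne_zero hp0 (exp_ne_zero _))
    rw [hnorm]
    simpa using hu
  have hconst : ∀ W : Set ℂ, IsOpen W → Convex ℝ W →
      (∀ u ∈ W, ‖u‖ < ε ∧ u.re ≠ 0 ∧ (u.re ≤ 0 ∧ u ≠ 0 ∨ u.im ≠ 0)) →
      ∃ C : ℂ, ∀ u ∈ W, F (pt θ j * cexp u) = R (pt θ j * cexp u) +
        C * cexp (2 * locPsi n θ α β j (pt θ j * cexp u)) := by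
    intro W hW hWc hWu
    refine exists_const_of_ode (r := ratPsi n θ α β) (h := inhom n θ α β) hW hWc
      (fun u hu => hFd u (hWu u hu).2.1) (fun u hu => hRd u (hWu u hu).1 ?_)
      fun u hu => hLd u (hWu u hu).1 (hWu u hu).2.2
    rintro rfl
    exact (hWu 0 hu).2.1 rfl
  -- In the coordinate `u` the complement of the contour near `z_j` consists of three convex pieces:
  -- inside the circle, and outside it on either side of the ray. On each of them `F - R` is a
  -- constant multiple of `ψ²`.
  obtain ⟨Ci, hCi⟩ := hconst (Metric.ball 0 ε ∩ {u | u.re < 0})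
    (Metric.isOpen_ball.inter (isOpen_lt continuous_re continuous_const))
    ((convex_ball 0 ε).inter (convex_halfSpace_re_lt 0))
    (fun u hu => ⟨by simpa using hu.1, ne_of_lt hu.2, Or.inl ⟨le_of_lt hu.2, by
      rintro rfl
      have h0 : (0 : ℂ).re < 0 := hu.2
      simp at h0⟩⟩)
  obtain ⟨Cp, hCp⟩ := hconst (Metric.ball 0 ε ∩ ({u | 0 < u.re} ∩ {u | 0 < u.im}))
    (Metric.isOpen_ball.inter ((isOpen_lt continuous_const continuous_re).inter
      (isOpen_lt continuous_const continuous_im)))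
    ((convex_ball 0 ε).inter ((convex_halfSpace_re_gt 0).inter (convex_halfSpace_im_gt 0)))
    (fun u hu => ⟨by simpa using hu.1, ne_of_gt hu.2.1, Or.inr (ne_of_gt hu.2.2)⟩)
  obtain ⟨Cm, hCm⟩ := hconst (Metric.ball 0 ε ∩ ({u | 0 < u.re} ∩ {u | u.im < 0}))
    (Metric.isOpen_ball.inter ((isOpen_lt continuous_const continuous_re).inter
      (isOpen_lt continuous_im continuous_const)))
    ((convex_ball 0 ε).inter ((convex_halfSpace_re_gt 0).inter (convex_halfSpace_im_lt 0)))
    (fun u hu => ⟨by simpa using hu.1, ne_of_gt hu.2.1, Or.inr (ne_of_lt hu.2.2)⟩)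
  -- jump relations on the two arcs
  have hjump : ∀ (τ : ℝ) (j' : Fin (m + 1)) (t : ℝ) (C : ℂ), |τ| < ε → τ ≠ 0 → θ j' < t →
      t < thetaNext θ j' → cexp (t * I) = pt θ j * cexp (τ * I) →
      (∀ᶠ x : ℝ in 𝓝[>] 0, F (pt θ j * cexp (x + τ * I)) = R (pt θ j * cexp (x + τ * I)) +
        C * cexp (2 * locPsi n θ α β j (pt θ j * cexp (x + τ * I)))) →
      (Ci - C) * cexp (2 * locPsi n θ α β j (pt θ j * cexp (τ * I))) =
        sConst α β j' * cexp (2 * logPsi n θ α β (pt θ j * cexp (τ * I))) := by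
    intro τ j' t C hτ hτ0 ht1 ht2 hζ hC
    obtain ⟨A, B, hA, hB, hAB⟩ := cauchyT_limits_arc n α β hθ_mono hθ_zero hθ_lt hα ht1 ht2
    rw [hζ] at hA hB hAB
    have hnτ : ‖(τ : ℂ) * I‖ < ε := by simpa using hτ
    have hτI : (τ : ℂ) * I ≠ 0 := by simpa using hτ0
    have hpath : Tendsto (fun x : ℝ => pt θ j * cexp (x + τ * I)) (𝓝 0)
        (𝓝 (pt θ j * cexp (τ * I))) := by
      have : Continuous fun x : ℝ => pt θ j * cexp (x + τ * I) := by fun_prop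
      simpa using this.tendsto 0
    have hcont : ∀ C : ℂ, Tendsto (fun z => R z + C * cexp (2 * locPsi n θ α β j z))
        (𝓝 (pt θ j * cexp (τ * I)))
        (𝓝 (R (pt θ j * cexp (τ * I)) + C * cexp (2 * locPsi n θ α β j (pt θ j * cexp (τ * I))))) := by
      intro C
      have c1 := (hRd _ hnτ hτI).continuousAt
      have c2 := (hLd _ hnτ (Or.inr (by simpa using hτ0))).continuousAt
      exact (c1.add (continuousAt_const.mul (continuousAt_const.mul c2).cexp)).tendsto
    have hsmall : ∀ᶠ x : ℝ in 𝓝 0, ‖(x : ℂ) + τ * I‖ < ε := by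
      have : Continuous fun x : ℝ => ‖(x : ℂ) + τ * I‖ := by fun_prop
      have h := this.tendsto 0
      simp only [ofReal_zero, zero_add] at h
      exact h.eventually_lt_const hnτ
    have hre : ∀ x : ℝ, ((x : ℂ) + τ * I).re = x := fun x => by simp
    have hB' : B = R (pt θ j * cexp (τ * I)) +
        C * cexp (2 * locPsi n θ α β j (pt θ j * cexp (τ * I))) := by
      have h1 : Tendsto (fun x : ℝ => pt θ j * cexp (x + τ * I)) (𝓝[>] 0)
          (𝓝[{z | 1 < ‖z‖}] (pt θ j * cexp (τ * I))) := by
        refine tendsto_nhdsWithin_iff.mpr ⟨hpath.mono_left nhdsWithin_le_nhds, ?_⟩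
        filter_upwards [self_mem_nhdsWithin] with x hx
        rw [hnorm, hre, Real.one_lt_exp_iff]
        exact hx
      refine tendsto_nhds_unique (hB.comp h1) ?_
      refine ((hcont C).comp (hpath.mono_left nhdsWithin_le_nhds)).congr' ?_
      filter_upwards [hC] with x hx
      exact hx.symm
    have hA' : A = R (pt θ j * cexp (τ * I)) +
        Ci * cexp (2 * locPsi n θ α β j (pt θ j * cexp (τ * I))) := by
      have h1 : Tendsto (fun x : ℝ => pt θ j * cexp (x + τ * I)) (𝓝[<] 0)
          (𝓝[{z | ‖z‖ < 1}] (pt θ j * cexp (τ * I))) := by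
        refine tendsto_nhdsWithin_iff.mpr ⟨hpath.mono_left nhdsWithin_le_nhds, ?_⟩
        filter_upwards [self_mem_nhdsWithin] with x hx
        rw [hnorm, hre, Real.exp_lt_one_iff]
        exact hx
      refine tendsto_nhds_unique (hA.comp h1) ?_
      refine ((hcont Ci).comp (hpath.mono_left nhdsWithin_le_nhds)).congr' ?_
      filter_upwards [hsmall.filter_mono nhdsWithin_le_nhds, self_mem_nhdsWithin] with x hx hx'
      refine (hCi _ ⟨by simpa using hx, ?_⟩).symm
      change ((x : ℂ) + τ * I).re < 0
      rw [hre]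
      exact hx'
    rw [← hAB, hA', hB']
    ring
  have hsmall : ∀ τ : ℝ, |τ| < ε → ∀ᶠ x : ℝ in 𝓝[>] 0, ‖(x : ℂ) + τ * I‖ < ε := by
    intro τ hτ
    have : Continuous fun x : ℝ => ‖(x : ℂ) + τ * I‖ := by fun_prop
    have h := this.tendsto 0
    simp only [ofReal_zero, zero_add] at h
    exact (h.eventually_lt_const (by simpa using hτ)).filter_mono nhdsWithin_le_nhds
  have him0 : ∀ τ : ℝ, j = 0 → (pt θ j * cexp (τ * I)).im = Real.sin τ := by
    intro τ hj
    rw [pt, hj, hθ_zero]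
    simp [exp_ofReal_mul_I_im]
  -- Three linear relations determine the constants: the jumps on the arc leaving `z_j` and on the
  -- arc arriving there, and the continuity of `F - R` across the ray, along which the local branch
  -- of `ψ²` changes by `e^{4πiα_j}`.
  have hEq1 : Ci - Cp = sConst α β j := by
    have hτ : |ε / 2| < ε := by rw [abs_of_pos (by positivity)]; linarith
    have h := hjump (ε / 2) j (θ j + ε / 2) Cp hτ (by positivity) (by linarith) (by linarith)
      (by push_cast; rw [add_mul, exp_add]; rfl) ?_
    · have hl := (hexp (((ε / 2 : ℝ) : ℂ) * I) (by
        rw [norm_mul, norm_I, mul_one, norm_real]; exact hτ.trans_le he0)).1.2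
      rw [hl, if_neg, add_zero] at h
      · exact mul_right_cancel₀ (exp_ne_zero _) h
      · rintro ⟨hj, hneg⟩
        rw [him0 _ hj] at hneg
        linarith [Real.sin_pos_of_pos_of_lt_pi (x := ε / 2) (by positivity) (by linarith)]
    · filter_upwards [hsmall _ hτ, self_mem_nhdsWithin] with x hx hx'
      refine hCp _ ⟨by simpa using hx, ?_, ?_⟩
      · change 0 < ((x : ℂ) + (ε / 2 : ℝ) * I).re
        simpa using hx'
      · change 0 < ((x : ℂ) + (ε / 2 : ℝ) * I).im
        simpa using hε
  have hEq2 : Ci - Cm = sConst α β j * cexp (2 * π * I * (β j - α j)) := by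
    have hτ : |-(ε / 2)| < ε := by rw [abs_neg, abs_of_pos (by positivity)]; linarith
    obtain ⟨j', t, ht1, ht2, hζ, hs⟩ := hbelow (-(ε / 2)) (by linarith) (by linarith)
    have h := hjump (-(ε / 2)) j' t Cm hτ (by simpa using hε.ne') ht1 ht2 hζ ?_
    · have hl := (hexp (((-(ε / 2) : ℝ) : ℂ) * I) (by
        rw [norm_mul, norm_I, mul_one, norm_real]; exact hτ.trans_le he0)).1.2
      have hiff : (j = 0 ∧ (pt θ j * cexp ((-(ε / 2) : ℝ) * I)).im < 0) ↔ j = 0 := by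
        refine and_iff_left_of_imp fun hj => ?_
        rw [him0 _ hj, Real.sin_neg, neg_lt_zero]
        exact Real.sin_pos_of_pos_of_lt_pi (by positivity) (by linarith)
      rw [hl, mul_add, exp_add] at h
      simp only [hiff] at h
      rw [← hs]
      refine mul_right_cancel₀ (exp_ne_zero _) (h.trans ?_)
      ring
    · filter_upwards [hsmall _ hτ, self_mem_nhdsWithin] with x hx hx'
      refine hCm _ ⟨by simpa using hx, ?_, ?_⟩
      · change 0 < ((x : ℂ) + (-(ε / 2) : ℝ) * I).re
        simpa using hx'
      · change ((x : ℂ) + (-(ε / 2) : ℝ) * I).im < 0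
        simpa using hε
  -- continuity across the ray
  have hEq3 : Cp = Cm * cexp (4 * π * I * α j) := by
    set x := ε / 2 with hx
    have hx0 : 0 < x := by positivity
    have hxn : ‖(x : ℂ)‖ < ε := by
      rw [norm_real, Real.norm_of_nonneg hx0.le, hx]; linarith
    have hx0' : (x : ℂ) ≠ 0 := by exact_mod_cast hx0.ne'
    set ζ := pt θ j * cexp x with hζ
    have hFc : ContinuousAt F ζ := (hFd x (by simpa using hx0.ne')).continuousAt
    have hRc : ContinuousAt R ζ := (hRd x hxn hx0').continuousAt
    have hpath : Tendsto (fun y : ℝ => pt θ j * cexp (x + y * I)) (𝓝 0) (𝓝 ζ) := by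
      have : Continuous fun y : ℝ => pt θ j * cexp (x + y * I) := by fun_prop
      simpa using this.tendsto 0
    have hlocc : ContinuousAt (locLog n θ α β j) ζ :=
      (hexp x (hxn.trans_le he0)).2.2.continuousAt
    have hnear : ∀ᶠ y : ℝ in 𝓝 0, ‖(x : ℂ) + y * I‖ < ε := by
      have : Continuous fun y : ℝ => ‖(x : ℂ) + y * I‖ := by fun_prop
      have h := this.tendsto 0
      simp only [ofReal_zero, zero_mul, add_zero] at h
      exact h.eventually_lt_const hxn
    have hrot : ∀ y : ℝ, ((pt θ j * cexp (x + y * I) - pt θ j) / cexp (θ j * I)).im =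
        Real.exp x * Real.sin y := by
      intro y
      rw [rot_sub_pt, hdivp, sub_im, one_im, sub_zero, exp_im]
      simp
    have hr : 0 < Real.exp x - 1 := by
      rw [sub_pos, Real.one_lt_exp_iff]; exact hx0
    have hζr : ζ - pt θ j = ((Real.exp x - 1 : ℝ) : ℂ) * cexp (θ j * I) := by
      rw [hζ]
      push_cast
      rw [show cexp (θ j * I) = pt θ j from rfl]
      ring
    have hplus : Tendsto (fun y : ℝ => lg θ j (pt θ j * cexp (x + y * I))) (𝓝[>] 0)
        (𝓝 (Real.log (Real.exp x - 1) + (θ j : ℂ) * I)) := by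
      refine (tendsto_logFrom_plus hr hζr).comp (tendsto_nhdsWithin_iff.mpr ⟨?_, ?_⟩)
      · exact (hpath.sub_const (pt θ j)).mono_left nhdsWithin_le_nhds
      · filter_upwards [self_mem_nhdsWithin, (gt_mem_nhds hpi).filter_mono nhdsWithin_le_nhds]
          with y hy hy'
        rw [hrot]
        exact mul_pos (Real.exp_pos _) (Real.sin_pos_of_pos_of_lt_pi hy hy')
    have hminus : Tendsto (fun y : ℝ => lg θ j (pt θ j * cexp (x + y * I))) (𝓝[<] 0)
        (𝓝 (Real.log (Real.exp x - 1) + ((θ j : ℂ) + 2 * π) * I)) := by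
      refine (tendsto_logFrom_minus hr hζr).comp (tendsto_nhdsWithin_iff.mpr ⟨?_, ?_⟩)
      · exact (hpath.sub_const (pt θ j)).mono_left nhdsWithin_le_nhds
      · filter_upwards [self_mem_nhdsWithin, (lt_mem_nhds (neg_lt_zero.mpr hpi)).filter_mono
          nhdsWithin_le_nhds] with y hy hy'
        rw [hrot]
        exact mul_neg_of_pos_of_neg (Real.exp_pos _) (Real.sin_neg_of_neg_of_neg_pi_lt hy hy')
    have h1 : F ζ - R ζ = Cp * cexp (2 * (locLog n θ α β j ζ +
        α j * (Real.log (Real.exp x - 1) + (θ j : ℂ) * I))) := by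
      have hl : Tendsto (fun y : ℝ => F (pt θ j * cexp (x + y * I)) -
          R (pt θ j * cexp (x + y * I))) (𝓝[>] 0) (𝓝 (F ζ - R ζ)) :=
        ((hFc.sub hRc).tendsto.comp hpath).mono_left nhdsWithin_le_nhds
      refine tendsto_nhds_unique hl ?_
      have hT := ((((hlocc.tendsto.comp hpath).mono_left (nhdsWithin_le_nhds (s := Ioi 0))).add
        (hplus.const_mul (α j))).const_mul 2).cexp.const_mul Cp
      refine hT.congr' ?_
      filter_upwards [hnear.filter_mono nhdsWithin_le_nhds, self_mem_nhdsWithin] with y hy hy'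
      rw [hCp _ ⟨by simpa using hy, ?_, ?_⟩, locPsi]
      · simp only [Function.comp]
        ring
      · change 0 < ((x : ℂ) + y * I).re
        simpa using hx0
      · change 0 < ((x : ℂ) + y * I).im
        simpa using hy'
    have h2 : F ζ - R ζ = Cm * cexp (2 * (locLog n θ α β j ζ +
        α j * (Real.log (Real.exp x - 1) + ((θ j : ℂ) + 2 * π) * I))) := by
      have hl : Tendsto (fun y : ℝ => F (pt θ j * cexp (x + y * I)) -
          R (pt θ j * cexp (x + y * I))) (𝓝[<] 0) (𝓝 (F ζ - R ζ)) :=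
        ((hFc.sub hRc).tendsto.comp hpath).mono_left nhdsWithin_le_nhds
      refine tendsto_nhds_unique hl ?_
      have hT := ((((hlocc.tendsto.comp hpath).mono_left (nhdsWithin_le_nhds (s := Iio 0))).add
        (hminus.const_mul (α j))).const_mul 2).cexp.const_mul Cm
      refine hT.congr' ?_
      filter_upwards [hnear.filter_mono nhdsWithin_le_nhds, self_mem_nhdsWithin] with y hy hy'
      rw [hCm _ ⟨by simpa using hy, ?_, ?_⟩, locPsi]
      · simp only [Function.comp]
        ring
      · change 0 < ((x : ℂ) + y * I).re
        simpa using hx0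
      · change ((x : ℂ) + y * I).im < 0
        simpa using hy'
    rw [h2, show 2 * (locLog n θ α β j ζ + α j * (Real.log (Real.exp x - 1) +
      ((θ j : ℂ) + 2 * π) * I)) = 4 * π * I * α j + 2 * (locLog n θ α β j ζ +
        α j * (Real.log (Real.exp x - 1) + (θ j : ℂ) * I)) by ring, exp_add, ← mul_assoc] at h1
    exact (mul_right_cancel₀ (exp_ne_zero _) h1).symm
  -- conclusion
  have hd : 1 - cexp (4 * π * I * α j) ≠ 0 := sub_ne_zero.mpr hα_exp.symm
  have hmul : cexp (2 * π * I * (β j + α j)) =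
      cexp (4 * π * I * α j) * cexp (2 * π * I * (β j - α j)) := by
    rw [← exp_add]
    congr 1
    ring
  -- The system has determinant `1 - e^{4πiα_j}` up to sign, and its solution is the list of values
  -- in `cConst`.
  have vCm : Cm = sConst α β j *
      ((1 - cexp (2 * π * I * (β j - α j))) / (1 - cexp (4 * π * I * α j))) := by
    rw [hEq3] at hEq1
    rw [← mul_div_assoc, eq_div_iff hd]
    linear_combination hEq1 - hEq2
  have vCp : Cp = sConst α β j * (cexp (4 * π * I * α j) *
      ((1 - cexp (2 * π * I * (β j - α j))) / (1 - cexp (4 * π * I * α j)))) := by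
    rw [hEq3, vCm]
    ring
  have vCi : Ci = sConst α β j *
      ((1 - cexp (2 * π * I * (β j + α j))) / (1 - cexp (4 * π * I * α j))) := by
    have : Ci = sConst α β j + Cp := by linear_combination hEq1
    rw [this, vCp, hmul, ← mul_div_assoc, ← mul_div_assoc, ← mul_div_assoc, eq_div_iff hd,
      add_mul, div_mul_cancel₀ _ hd]
    ring
  filter_upwards [eventually_exists_exp hp0 hε] with z hz hzc
  obtain ⟨u, hu, rfl⟩ := hz
  have hui := abs_lt.1 (him u hu)
  have hre : u.re ≠ 0 := by
    intro h
    refine norm_ne_one_of_notMem_contour hzc ?_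
    rw [hnorm, h, Real.exp_zero]
  have himz : j = 0 → (pt θ j * cexp u).im = Real.exp u.re * Real.sin u.im := by
    intro hj
    rw [pt, hj, hθ_zero]
    simp [exp_im]
  have harg : j ≠ 0 → argFrom 0 (pt θ j * cexp u) = u.im + θ j := by
    intro hj
    have h := (hexp u (hu.trans_le he0)).2.1
    rw [if_neg (fun h => hj h.1), add_zero, hdivp, log_exp (by linarith) (by linarith)] at h
    rw [← logFrom_im, h]
    simp
  rcases lt_or_gt_of_ne hre with h | h
  · rw [hCi u ⟨by simpa using hu, h⟩, vCi]
    have : ‖pt θ j * cexp u‖ < 1 := by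
      rw [hnorm, Real.exp_lt_one_iff]; exact h
    simp only [cConst, this, if_true]
  · have hn : ¬ ‖pt θ j * cexp u‖ < 1 := by
      rw [hnorm, Real.exp_lt_one_iff]; linarith
    have hui0 : u.im ≠ 0 := by
      intro h0
      apply hzc
      refine Or.inr (mem_iUnion.mpr ⟨j, Real.exp u.re, (Real.one_lt_exp_iff.mpr h).le, ?_⟩)
      have : u = (u.re : ℂ) := Complex.ext rfl h0
      rw [mul_comm, ofReal_exp, ← this]
    rcases lt_or_gt_of_ne hui0 with hi | hi
    · have hc : (j ≠ 0 ∧ argFrom 0 (pt θ j * cexp u) < θ j) ∨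
          (j = 0 ∧ (pt θ j * cexp u).im < 0) := by
        by_cases hj : j = 0
        · refine Or.inr ⟨hj, ?_⟩
          rw [himz hj]
          exact mul_neg_of_pos_of_neg (Real.exp_pos _)
            (Real.sin_neg_of_neg_of_neg_pi_lt hi (by linarith))
        · refine Or.inl ⟨hj, ?_⟩
          rw [harg hj]
          linarith
      rw [hCm u ⟨by simpa using hu, h, hi⟩, vCm]
      simp only [cConst, hn, if_false, hc, if_true]
    · have hc : ¬ ((j ≠ 0 ∧ argFrom 0 (pt θ j * cexp u) < θ j) ∨
          (j = 0 ∧ (pt θ j * cexp u).im < 0)) := by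
        rintro (⟨hj, h1⟩ | ⟨hj, h1⟩)
        · rw [harg hj] at h1
          linarith
        · rw [himz hj] at h1
          have := mul_pos (Real.exp_pos u.re)
            (Real.sin_pos_of_pos_of_lt_pi hi (by linarith : u.im < π))
          linarith
      rw [hCp u ⟨by simpa using hu, h, hi⟩, vCp]
      simp only [cConst, hn, if_false, hc]

end SingularPoint

/-! ### Algebra of unipotent and diagonal factors. -/

section Matrices

lemma upper_mul_upper (a b : ℂ) : upper a * upper b = upper (a + b) := by
  simp [upper, add_comm]

lemma upper_zero : upper 0 = 1 := by
  simp [upper, Matrix.one_fin_two]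

lemma expSigma3_mul (a b : ℂ) : expSigma3 a * expSigma3 b = expSigma3 (a + b) := by
  simp [expSigma3, ← exp_add, add_comm]

lemma expSigma3_zero : expSigma3 0 = 1 := by
  simp [expSigma3, Matrix.one_fin_two]

/-- Moving a unipotent factor to the left of `ψ^{σ₃}` multiplies its entry by `ψ²`. This converts
additive relations `F = R + c ψ²` into the constant factors of the Riemann-Hilbert problem. -/
lemma expSigma3_mul_upper (w c : ℂ) :
    expSigma3 w * upper c = upper (c * cexp (2 * w)) * expSigma3 w := by
  simp only [expSigma3, upper, Matrix.mul_fin_two]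
  congr 1
  ext i j
  revert i j
  simp only [Fin.forall_fin_two]
  refine ⟨⟨by simp, ?_⟩, by simp, by simp⟩
  have : cexp (2 * w) * cexp (-w) = cexp w := by rw [← exp_add]; congr 1; ring
  simp only [Matrix.cons_val_zero, Matrix.cons_val_one]
  linear_combination -c * this

@[simp] lemma det_upper (c : ℂ) : (upper c).det = 1 := by simp [upper, Matrix.det_fin_two]

@[simp] lemma det_expSigma3 (w : ℂ) : (expSigma3 w).det = 1 := by
  simp [expSigma3, Matrix.det_fin_two, ← exp_add]

lemma continuous_upper : Continuous upper := by
  refine continuous_matrix fun i j => ?_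
  revert i j
  simp only [Fin.forall_fin_two, upper]
  refine ⟨⟨?_, ?_⟩, ?_, ?_⟩ <;> simp <;> fun_prop

lemma continuous_expSigma3 : Continuous expSigma3 := by
  refine continuous_matrix fun i j => ?_
  revert i j
  simp only [Fin.forall_fin_two, expSigma3]
  refine ⟨⟨?_, ?_⟩, ?_, ?_⟩ <;> simp <;> fun_prop

lemma mul_upper_apply_zero (P : M2) (c : ℂ) (i : Fin 2) : (P * upper c) i 0 = P i 0 := by
  simp [Matrix.mul_apply, upper]

lemma mul_upper_apply_one (P : M2) (c : ℂ) (i : Fin 2) :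
    (P * upper c) i 1 = P i 0 * c + P i 1 := by
  simp [Matrix.mul_apply, upper]

lemma mul_expSigma3_apply_zero (P : M2) (w : ℂ) (i : Fin 2) :
    (P * expSigma3 w) i 0 = P i 0 * cexp w := by
  simp [Matrix.mul_apply, expSigma3]

lemma mul_expSigma3_apply_one (P : M2) (w : ℂ) (i : Fin 2) :
    (P * expSigma3 w) i 1 = P i 1 * cexp (-w) := by
  simp [Matrix.mul_apply, expSigma3]

end Matrices

/-! ### The explicit right factor: its jumps, local forms and asymptotics. -/

section Model

variable {m : ℕ} (n : ℕ) (θ : Fin (m + 1) → ℝ) (α β : Fin (m + 1) → ℂ)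

/-- The explicit right factor of every solution of the `Φ`-Riemann-Hilbert problem. -/
def model (z : ℂ) : M2 :=
  upper (cauchyT (dens n θ α β) z) * expSigma3 (logPsi n θ α β z)

@[simp] lemma det_model (z : ℂ) : (model n θ α β z).det = 1 := by simp [model]

/-- `∑ α_k ln (1 - z_k / z)`. -/
def tauLog (z : ℂ) : ℂ := ∑ k, α k * Complex.log (1 - pt θ k / z)

/-- The regular part of `ln ψ` at `0`. -/
def locLogZero (z : ℂ) : ℂ := ∑ k, α k * lg θ k z

lemma isBigO_exp_tauLog (c : ℂ) :
    (fun z => cexp (c * tauLog θ α z) - 1) =O[cobounded ℂ] fun z => z⁻¹ := by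
  set G : ℂ → ℂ := fun x => cexp (c * ∑ k, α k * Complex.log (1 - pt θ k * x))
  have hG : DifferentiableAt ℂ G 0 := by
    refine (DifferentiableAt.const_mul (DifferentiableAt.fun_sum fun k _ =>
      DifferentiableAt.const_mul (DifferentiableAt.clog (by fun_prop) ?_) _) _).cexp
    simp
  have h := hG.hasDerivAt.isBigO_sub.comp_tendsto tendsto_inv_cobounded
  refine (h.congr_left fun z => ?_).congr_right fun z => ?_
  · simp [G, tauLog, div_eq_mul_inv]
  · simp

variable {θ}

lemma analyticAt_locLogZero (a : Fin (m + 1) → ℂ) : AnalyticAt ℂ (locLogZero θ a) 0 := by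
  rw [analyticAt_iff_eventually_differentiableAt]
  have h : ∀ᶠ z : ℂ in 𝓝 0, ∀ k, 1 - z / pt θ k ∈ slitPlane := by
    rw [eventually_all]
    intro k
    have hc : Continuous fun z : ℂ => 1 - z / pt θ k := by fun_prop
    exact hc.continuousAt.preimage_mem_nhds (isOpen_slitPlane.mem_nhds (by simp))
  filter_upwards [h] with z hz
  exact DifferentiableAt.fun_sum fun k _ => ((hasDerivAt_lg (hz k)).const_mul _).differentiableAt

lemma logPsi_eq_locLogZero (z : ℂ) :
    logPsi n θ α β z = locLogZero θ α z + lam n α β * logFrom 0 z := by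
  rw [logPsi, locLogZero, add_comm]

lemma notMem_contour_of_offCuts {z : ℂ} (h : OffCuts θ z) (h1 : ‖z‖ ≠ 1) :
    z ∉ contour θ := by
  rintro ((hz | ⟨x, hx0, _, rfl⟩) | hz)
  · exact h1 (by simpa using hz)
  · have := h.1
    rw [← ofReal_neg, ofReal_mem_slitPlane] at this
    linarith
  · obtain ⟨k, r, hr, rfl⟩ := mem_iUnion.mp hz
    have := h.2 k
    rw [mul_div_assoc, div_self (pt_ne_zero θ k), mul_one, ← ofReal_one, ← ofReal_sub,
      ofReal_mem_slitPlane] at this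
    linarith

lemma isOpen_compl_contour (h0 : θ 0 = 0) : IsOpen (contour θ)ᶜ := by
  have : (contour θ)ᶜ = {z | OffCuts θ z} ∩ {z : ℂ | ‖z‖ ≠ 1} := by
    ext z
    exact ⟨fun h => ⟨offCuts_of_notMem_contour h0 h, norm_ne_one_of_notMem_contour h⟩,
      fun h => notMem_contour_of_offCuts h.1 h.2⟩
  rw [this]
  exact isOpen_offCuts.inter (isOpen_ne_fun continuous_norm continuous_const)

lemma hasJump_of_continuousAt {P Y : ℂ → M2} {s t : Set ℂ} {ζ : ℂ} {J : M2}
    (hP : ContinuousAt P ζ) (hY : HasJump Y s t ζ J) : HasJump (fun z => P z * Y z) s t ζ J := by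
  obtain ⟨A, B, hA, hB, hAB⟩ := hY
  refine ⟨P ζ * A, P ζ * B, (hP.tendsto.mono_left nhdsWithin_le_nhds).mul hA,
    (hP.tendsto.mono_left nhdsWithin_le_nhds).mul hB, ?_⟩
  rw [hAB, Matrix.mul_assoc]

/-- Off the circle `F` is continuous, so the model jumps only through `ln ψ`. -/
lemma hasJump_model {s t : Set ℂ} {ζ a b : ℂ}
    (hF : ContinuousAt (cauchyT (dens n θ α β)) ζ)
    (ha : Tendsto (logPsi n θ α β) (𝓝[s] ζ) (𝓝 a))
    (hb : Tendsto (logPsi n θ α β) (𝓝[t] ζ) (𝓝 b)) :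
    HasJump (model n θ α β) s t ζ (expSigma3 (a - b)) := by
  have h1 : ∀ s : Set ℂ, Tendsto (fun z => upper (cauchyT (dens n θ α β) z)) (𝓝[s] ζ)
      (𝓝 (upper (cauchyT (dens n θ α β) ζ))) := fun s =>
    ((continuous_upper.tendsto _).comp hF.tendsto).mono_left nhdsWithin_le_nhds
  refine ⟨_, _, (h1 s).mul ((continuous_expSigma3.tendsto a).comp ha),
    (h1 t).mul ((continuous_expSigma3.tendsto b).comp hb), ?_⟩
  rw [Matrix.mul_assoc, expSigma3_mul, add_sub_cancel]

variable (hθ_mono : StrictMono θ) (hθ_zero : θ 0 = 0) (hθ_lt : ∀ j, θ j < 2 * π)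
include hθ_mono hθ_zero hθ_lt

/-- Separates the right factor prescribed at infinity from `-n ln z`, which the polynomial matrix
compensates, and from `tauLog`, which tends to zero. -/
lemma logPsi_of_sector {j : Fin (m + 1)} {z : ℂ} (hz : 1 < ‖z‖) (h1 : θ j < argFrom 0 z)
    (h2 : argFrom 0 z < thetaNext θ j) : logPsi n θ α β z =
      tauLog θ α z - n * logFrom 0 z + (∑ k, (β k + α k) / 2 + (n : ℂ) / 2) * logFrom 0 z +
        2 * π * I * ∑ k ∈ Finset.univ.filter (fun k => j < k), α k := by
  have h : ∀ k, α k * lg θ k z = α k * logFrom 0 z + α k * Complex.log (1 - pt θ k / z) +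
      2 * π * I * if j < k then α k else 0 := by
    intro k
    rw [lg_of_sector hθ_mono hθ_zero hθ_lt hz h1 h2 k]
    split_ifs <;> ring
  have hs : ∑ k, (β k + α k) / 2 = ∑ k, (β k - α k) / 2 + ∑ k, α k := by
    rw [← Finset.sum_add_distrib]
    exact Finset.sum_congr rfl fun k _ => by ring
  rw [logPsi, Finset.sum_congr rfl fun k _ => h k, Finset.sum_add_distrib,
    Finset.sum_add_distrib, ← Finset.sum_mul, ← Finset.mul_sum, Finset.sum_filter, hs, lam, tauLog]
  ring

variable (hα : ∀ j, -1 / 2 < (α j).re)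
include hα

/-- On an arc `ψ` is continuous and `F` jumps by `s_j ψ²`. Commuting the jump to the right of
`ψ^{σ₃}` leaves the constant `s_j`. -/
lemma hasJump_model_arc {j : Fin (m + 1)} {t : ℝ} (h1 : θ j < t) (h2 : t < thetaNext θ j) :
    HasJump (model n θ α β) {z | ‖z‖ < 1} {z | 1 < ‖z‖} (cexp (t * I)) (upper (sConst α β j)) := by
  obtain ⟨A, B, hA, hB, hAB⟩ := cauchyT_limits_arc n α β hθ_mono hθ_zero hθ_lt hα h1 h2
  have hl : ∀ s : Set ℂ, Tendsto (fun z => expSigma3 (logPsi n θ α β z)) (𝓝[s] cexp (t * I))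
      (𝓝 (expSigma3 (logPsi n θ α β (cexp (t * I))))) := fun s =>
    ((continuous_expSigma3.tendsto _).comp (hasDerivAt_logPsi n α β
      (offCuts_arc hθ_mono hθ_zero hθ_lt h1 h2)).continuousAt.tendsto).mono_left nhdsWithin_le_nhds
  refine ⟨_, _, ((continuous_upper.tendsto A).comp hA).mul (hl _),
    ((continuous_upper.tendsto B).comp hB).mul (hl _), ?_⟩
  rw [Matrix.mul_assoc, expSigma3_mul_upper, ← Matrix.mul_assoc, upper_mul_upper, ← hAB,
    add_sub_cancel]

lemma continuousAt_cauchyT_dens {z : ℂ} (hz : ‖z‖ ≠ 1) :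
    ContinuousAt (cauchyT (dens n θ α β)) z :=
  (hasDerivAt_cauchyT (integrable_dens n α β hθ_mono hθ_zero hθ_lt hα) hz).continuousAt

-- Distinct singular points have distinct directions, so `Γ_j` avoids the cut of every other
-- logarithm.
omit hα in
lemma ray_div (k j : Fin (m + 1)) (hk : k ≠ j) (r : ℝ) (hr : 1 < r) :
    1 - r * pt θ j / pt θ k ∈ slitPlane := by
  have h := slit_pt hθ_mono hθ_zero hθ_lt hk
  rw [mem_slitPlane_iff] at h ⊢
  by_contra hc
  push Not at hc
  have him : (pt θ j / pt θ k).im = 0 := by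
    have := hc.2
    rw [mul_div_assoc, sub_im, im_ofReal_mul, one_im, zero_sub, neg_eq_zero] at this
    exact (mul_eq_zero.mp this).resolve_left (by linarith)
  have hre : 0 < (pt θ j / pt θ k).re := by
    have := hc.1
    rw [mul_div_assoc, sub_re, re_ofReal_mul, one_re] at this
    by_contra h0
    nlinarith
  have hone : pt θ j / pt θ k = 1 := by
    have hn : ‖pt θ j / pt θ k‖ = 1 := by simp
    have : pt θ j / pt θ k = ((pt θ j / pt θ k).re : ℂ) := Complex.ext rfl him
    rw [this, norm_real, Real.norm_of_nonneg hre.le] at hn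
    rw [this, hn, ofReal_one]
  rw [hone] at h
  simp at h

omit hα in
lemma neg_ray_mem_slitPlane {j : Fin (m + 1)} (hj : j ≠ 0) {r : ℝ} (hr : 0 < r) :
    -(r * pt θ j) ∈ slitPlane := by
  have h := slit_pt hθ_mono hθ_zero hθ_lt hj.symm
  have h0 : pt θ 0 = 1 := by simp [pt, hθ_zero]
  rw [h0, div_one] at h
  rw [← mul_neg]
  rw [mem_slitPlane_iff]
  by_contra hc
  push Not at hc
  rw [re_ofReal_mul, im_ofReal_mul] at hc
  have him : (pt θ j).im = 0 := by
    have := (mul_eq_zero.mp hc.2).resolve_left hr.ne'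
    simpa using this
  have hre : 0 ≤ (pt θ j).re := by
    have := hc.1
    rw [neg_re] at this
    by_contra h1
    nlinarith
  have hone : pt θ j = 1 := by
    have hn : ‖pt θ j‖ = 1 := by simp
    have : pt θ j = ((pt θ j).re : ℂ) := Complex.ext rfl him
    rw [this, norm_real, Real.norm_of_nonneg hre] at hn
    rw [this, hn, ofReal_one]
  rw [hone] at h
  simp at h

omit hα in
lemma continuousAt_lg_ray {k j : Fin (m + 1)} (hk : k ≠ j) {r : ℝ} (hr : 1 < r) :
    ContinuousAt (lg θ k) (r * pt θ j) :=
  (hasDerivAt_lg (ray_div hθ_mono hθ_zero hθ_lt k j hk r hr)).continuousAt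

omit hα hθ_mono hθ_zero hθ_lt in
lemma lg_ray_limits (j : Fin (m + 1)) {r : ℝ} (hr : 1 < r) :
    Tendsto (lg θ j) (𝓝[{z | 0 < (z / pt θ j).im}] (r * pt θ j))
      (𝓝 (Real.log (r - 1) + θ j * I)) ∧
    Tendsto (lg θ j) (𝓝[{z | (z / pt θ j).im < 0}] (r * pt θ j))
      (𝓝 (Real.log (r - 1) + (θ j + 2 * π) * I)) := by
  have hζ : r * pt θ j - pt θ j = ((r - 1 : ℝ) : ℂ) * cexp (θ j * I) := by
    push_cast
    rw [show cexp (θ j * I) = pt θ j from rfl]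
    ring
  have hrot : ∀ z, ((z - pt θ j) / cexp (θ j * I)).im = (z / pt θ j).im := by
    intro z
    rw [rot_sub_pt, sub_im, one_im, sub_zero]
  have hsub : ContinuousAt (fun z => z - pt θ j) (r * pt θ j) := by fun_prop
  constructor
  · refine (tendsto_logFrom_plus (sub_pos.mpr hr) hζ).comp (tendsto_nhdsWithin_iff.mpr
      ⟨hsub.tendsto.mono_left nhdsWithin_le_nhds, ?_⟩)
    filter_upwards [self_mem_nhdsWithin] with z hz
    rw [hrot]
    exact hz
  · refine (tendsto_logFrom_minus (sub_pos.mpr hr) hζ).comp (tendsto_nhdsWithin_iff.mpr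
      ⟨hsub.tendsto.mono_left nhdsWithin_le_nhds, ?_⟩)
    filter_upwards [self_mem_nhdsWithin] with z hz
    rw [hrot]
    exact hz

omit hα hθ_mono hθ_zero hθ_lt in
lemma logFrom_zero_limits {r : ℝ} (hr : 0 < r) :
    Tendsto (logFrom 0) (𝓝[{z | 0 < z.im}] (r : ℂ)) (𝓝 (Real.log r)) ∧
    Tendsto (logFrom 0) (𝓝[{z | z.im < 0}] (r : ℂ)) (𝓝 (Real.log r + 2 * π * I)) := by
  constructor
  · simpa using tendsto_logFrom_plus (φ := 0) (ζ := r) hr (by simp)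
  · simpa using tendsto_logFrom_minus (φ := 0) (ζ := r) hr (by simp)

lemma hasJump_model_ray {j : Fin (m + 1)} (hj : j ≠ 0) {r : ℝ} (hr : 1 < r) :
    HasJump (model n θ α β) {z | 0 < (z / pt θ j).im} {z | (z / pt θ j).im < 0} (r * pt θ j)
      (expSigma3 (-(2 * π * I * α j))) := by
  have hF := continuousAt_cauchyT_dens n α β hθ_mono hθ_zero hθ_lt hα (z := r * pt θ j)
    (by rw [norm_mul, norm_pt, mul_one, norm_real, Real.norm_of_nonneg (by linarith)]; exact hr.ne')
  set c : ℂ := lam n α β * logFrom 0 (r * pt θ j) +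
    ∑ k ∈ Finset.univ.erase j, α k * lg θ k (r * pt θ j)
  have key : ∀ (s : Set ℂ) (l : ℂ), Tendsto (lg θ j) (𝓝[s] (r * pt θ j)) (𝓝 l) →
      Tendsto (logPsi n θ α β) (𝓝[s] (r * pt θ j)) (𝓝 (c + α j * l)) := by
    intro s l hl
    have h0 : ContinuousAt (fun z => lam n α β * logFrom 0 z +
        ∑ k ∈ Finset.univ.erase j, α k * lg θ k z) (r * pt θ j) := by
      refine ContinuousAt.add (continuousAt_const.mul (hasDerivAt_logFrom_zero
        (neg_ray_mem_slitPlane hθ_mono hθ_zero hθ_lt hj (by linarith))).continuousAt)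
        (tendsto_finsetSum _ fun k hk => ?_)
      exact (continuousAt_lg_ray hθ_mono hθ_zero hθ_lt (Finset.ne_of_mem_erase hk) hr).const_mul _
    refine ((h0.tendsto.mono_left nhdsWithin_le_nhds).add (hl.const_mul (α j))).congr fun z => ?_
    rw [logPsi, ← Finset.sum_erase_add _ _ (Finset.mem_univ j), add_assoc]
  obtain ⟨hp, hm⟩ := lg_ray_limits (θ := θ) j hr
  convert hasJump_model n α β hF (key _ _ hp) (key _ _ hm) using 2
  ring

lemma hasJump_model_ray_zero {r : ℝ} (hr : 1 < r) :
    HasJump (model n θ α β) {z | 0 < z.im} {z | z.im < 0} (r : ℂ)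
      (expSigma3 (-(2 * π * I * (α 0 + lam n α β)))) := by
  have hp0 : pt θ 0 = 1 := by simp [pt, hθ_zero]
  have hF := continuousAt_cauchyT_dens n α β hθ_mono hθ_zero hθ_lt hα (z := r)
    (by rw [norm_real, Real.norm_of_nonneg (by linarith)]; exact hr.ne')
  set c : ℂ := ∑ k ∈ Finset.univ.erase 0, α k * lg θ k r
  have key : ∀ (s : Set ℂ) (l l' : ℂ), Tendsto (lg θ 0) (𝓝[s] (r : ℂ)) (𝓝 l) →
      Tendsto (logFrom 0) (𝓝[s] (r : ℂ)) (𝓝 l') →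
      Tendsto (logPsi n θ α β) (𝓝[s] (r : ℂ)) (𝓝 (lam n α β * l' + (c + α 0 * l))) := by
    intro s l l' hl hl'
    have h0 : ContinuousAt (fun z => ∑ k ∈ Finset.univ.erase 0, α k * lg θ k z) (r : ℂ) := by
      refine tendsto_finsetSum _ fun k hk => ?_
      have := continuousAt_lg_ray hθ_mono hθ_zero hθ_lt (Finset.ne_of_mem_erase hk) hr
      rw [hp0, mul_one] at this
      exact this.const_mul _
    refine ((hl'.const_mul (lam n α β)).add ((h0.tendsto.mono_left nhdsWithin_le_nhds).add
      (hl.const_mul (α 0)))).congr fun z => ?_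
    rw [logPsi, ← Finset.sum_erase_add _ _ (Finset.mem_univ 0)]
  obtain ⟨hp, hm⟩ := lg_ray_limits (θ := θ) 0 hr
  simp only [hp0, div_one, mul_one] at hp hm
  obtain ⟨hp', hm'⟩ := logFrom_zero_limits (r := r) (by linarith)
  convert hasJump_model n α β hF (key _ _ _ hp hp') (key _ _ _ hm hm') using 2
  ring

lemma hasJump_model_segment {x : ℝ} (hx0 : 0 < x) (hx1 : x < 1) :
    HasJump (model n θ α β) {z | 0 < z.im} {z | z.im < 0} (x : ℂ)
      (expSigma3 (-(2 * π * I * lam n α β))) := by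
  have hxn : ‖(x : ℂ)‖ = x := by rw [norm_real, Real.norm_of_nonneg hx0.le]
  have hF := continuousAt_cauchyT_dens n α β hθ_mono hθ_zero hθ_lt hα (z := x)
    (by rw [hxn]; exact hx1.ne)
  have key : ∀ (s : Set ℂ) (l : ℂ), Tendsto (logFrom 0) (𝓝[s] (x : ℂ)) (𝓝 l) →
      Tendsto (logPsi n θ α β) (𝓝[s] (x : ℂ)) (𝓝 (locLogZero θ α x + lam n α β * l)) := by
    intro s l hl
    have h0 : ContinuousAt (locLogZero θ α) (x : ℂ) := by
      refine tendsto_finsetSum _ fun k _ => ?_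
      refine (hasDerivAt_lg (slit_of_norm_eq_one (hxn.trans_le hx1.le) ?_)).continuousAt.const_mul _
      intro h
      have := congrArg norm h
      rw [hxn, norm_pt] at this
      linarith
    refine ((h0.tendsto.mono_left nhdsWithin_le_nhds).add (hl.const_mul (lam n α β))).congr
      fun z => ?_
    rw [logPsi_eq_locLogZero]
  obtain ⟨hp', hm'⟩ := logFrom_zero_limits (r := x) hx0
  convert hasJump_model n α β hF (key _ _ hp') (key _ _ hm') using 2
  ring

/-- The structure of the model at `z_j`. -/
lemma model_local (j : Fin (m + 1)) (hα_exp : cexp (4 * π * I * α j) ≠ 1) :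
    ∃ R : ℂ → ℂ, AnalyticAt ℂ R (pt θ j) ∧ R (pt θ j) = -(rho n θ α β j / (2 * α j)) ∧
      ∀ᶠ z in 𝓝 (pt θ j), z ∉ contour θ → model n θ α β z =
        upper (R z) * expSigma3 (locLog n θ α β j z) *
          expSigma3 (α j * logFrom (θ j) (z - pt θ j)) * connection n θ α β j z := by
  obtain ⟨R, h1, h2, h3⟩ := cauchyT_local n α β hθ_mono hθ_zero hθ_lt hα j hα_exp
  refine ⟨R, h1, h2, ?_⟩
  filter_upwards [h3, eventually_logPsi_eq_locPsi n α β hθ_mono hθ_zero hθ_lt j] with z hz hl hzc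
  rw [model, hz hzc, hl, connection, Matrix.mul_assoc (upper (R z)), expSigma3_mul,
    show α j * logFrom (θ j) (z - pt θ j) = α j * lg θ j z from rfl,
    show locLog n θ α β j z + α j * lg θ j z = locPsi n θ α β j z from rfl, Matrix.mul_assoc,
    ← Matrix.mul_assoc (expSigma3 _), expSigma3_mul_upper, ← upper_mul_upper, ← expSigma3_mul]
  simp only [Matrix.mul_assoc]
  congr 4
  split_ifs
  · rfl
  · exact expSigma3_zero

omit hα hθ_mono hθ_zero hθ_lt in
lemma model_zero (z : ℂ) : model n θ α β z =
    upper (cauchyT (dens n θ α β) z) * expSigma3 (locLogZero θ α z) *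
      expSigma3 (lam n α β * logFrom 0 z) := by
  rw [model, logPsi_eq_locLogZero, Matrix.mul_assoc, expSigma3_mul]

end Model

/-! ### Holomorphy across analytic arcs. -/

section Painleve

/-- A continuous function that is holomorphic off the real axis is holomorphic. -/
lemma differentiableOn_of_im_ne_zero {f : ℂ → ℂ} {ε : ℝ} (hf : ContinuousOn f (Metric.ball 0 ε))
    (hd : ∀ u ∈ Metric.ball (0 : ℂ) ε, u.im ≠ 0 → DifferentiableAt ℂ f u) :
    DifferentiableOn ℂ f (Metric.ball 0 ε) := by
  refine (IsConservativeOn.isExactOn_ball hf fun z w hzw => ?_).differentiableOn Metric.isOpen_ball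
  rw [← add_eq_zero_iff_eq_neg, wedgeIntegral_add_wedgeIntegral_eq]
  have hzw' : uIcc z.re w.re ×ℂ uIcc z.im w.im ⊆ Metric.ball 0 ε := hzw
  -- For Morera's theorem a rectangle that meets the real axis is cut along it. Each part has its
  -- interior off the axis, and Cauchy's theorem needs only continuity on the boundary.
  obtain ⟨c, hc, hc1, hc2⟩ : ∃ c ∈ uIcc z.im w.im,
      (0 : ℝ) ∉ Ioo (min z.im c) (max z.im c) ∧ (0 : ℝ) ∉ Ioo (min c w.im) (max c w.im) := by
    by_cases h : (0 : ℝ) ∈ uIcc z.im w.im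
    · refine ⟨0, h, fun h' => ?_, fun h' => ?_⟩
      · rcases le_total z.im 0 with h0 | h0 <;> simp [h0] at h'
      · rcases le_total w.im 0 with h0 | h0 <;> simp [h0] at h'
    · refine ⟨w.im, right_mem_uIcc, fun h' => h ?_, by simp⟩
      exact ⟨h'.1.le, h'.2.le⟩
  have hvert : ∀ x ∈ uIcc z.re w.re, ∀ a ∈ uIcc z.im w.im, ∀ b ∈ uIcc z.im w.im,
      IntervalIntegrable (fun y : ℝ => f (x + y * I)) volume a b := by
    intro x hx a ha b hb
    refine ContinuousOn.intervalIntegrable (hf.comp (by fun_prop) fun y hy => hzw' ?_)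
    rw [mem_reProdIm]
    refine ⟨by simpa using hx, ?_⟩
    have := uIcc_subset_uIcc ha hb hy
    simpa using this
  have key : ∀ a b : ℝ, a ∈ uIcc z.im w.im → b ∈ uIcc z.im w.im → (0 : ℝ) ∉ Ioo (min a b) (max a b) →
      (∫ x : ℝ in z.re..w.re, f (x + a * I)) - (∫ x : ℝ in z.re..w.re, f (x + b * I)) +
        I • (∫ y : ℝ in a..b, f (w.re + y * I)) - I • (∫ y : ℝ in a..b, f (z.re + y * I)) = 0 := by
    intro a b ha hb h0
    have hsub : uIcc z.re w.re ×ℂ uIcc a b ⊆ Metric.ball 0 ε := fun u hu =>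
      hzw' ⟨hu.1, uIcc_subset_uIcc ha hb hu.2⟩
    have h := integral_boundary_rect_eq_zero_of_continuousOn_of_differentiableOn f
      (z.re + a * I) (w.re + b * I) ?_ ?_
    · simpa using h
    · simpa using hf.mono hsub
    · intro u hu
      have hu2 : u.im ∈ Ioo (min a b) (max a b) := by simpa using hu.2
      have hu1 : u.re ∈ Ioo (min z.re w.re) (max z.re w.re) := by simpa using hu.1
      refine (hd u (hsub ⟨Ioo_subset_Icc_self hu1, Ioo_subset_Icc_self hu2⟩)
        fun h => h0 ?_).differentiableWithinAt
      rwa [h] at hu2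
  have k1 := key z.im c left_mem_uIcc hc hc1
  have k2 := key c w.im hc right_mem_uIcc hc2
  have s1 := intervalIntegral.integral_add_adjacent_intervals
    (hvert w.re right_mem_uIcc _ left_mem_uIcc _ hc) (hvert w.re right_mem_uIcc _ hc _ right_mem_uIcc)
  have s2 := intervalIntegral.integral_add_adjacent_intervals
    (hvert z.re left_mem_uIcc _ left_mem_uIcc _ hc) (hvert z.re left_mem_uIcc _ hc _ right_mem_uIcc)
  rw [← s1, ← s2]
  simp only [smul_eq_mul] at k1 k2 ⊢
  linear_combination k1 + k2

/-- The chart `ζ e^{cu}` straightens the circle for `c = i` and the radial pieces for `c = 1`, so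
that the statement for the real axis covers the whole contour. -/
lemma differentiableAt_of_exp_chart {P : ℂ → ℂ} (hP : Continuous P) {A : Set ℂ}
    (hA : ∀ z ∉ A, DifferentiableAt ℂ P z) {ζ c : ℂ} (hζ : ζ ≠ 0) (hc : c ≠ 0)
    (h : ∀ᶠ u in 𝓝 (0 : ℂ), u.im ≠ 0 → ζ * cexp (c * u) ∉ A) : DifferentiableAt ℂ P ζ := by
  obtain ⟨ε, hε, hb⟩ := Metric.eventually_nhds_iff_ball.mp h
  have hd := differentiableOn_of_im_ne_zero (f := fun u => P (ζ * cexp (c * u))) (ε := ε)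
    (by fun_prop) fun u hu hu0 =>
      DifferentiableAt.comp u (hA _ (hb u hu hu0)) (by fun_prop)
  have h0 : DifferentiableAt ℂ (fun u => P (ζ * cexp (c * u))) 0 :=
    hd.differentiableAt (Metric.ball_mem_nhds 0 hε)
  have hl : DifferentiableAt ℂ (fun z => Complex.log (z / ζ) / c) ζ := by
    refine (DifferentiableAt.clog (by fun_prop) ?_).div_const c
    rw [div_self hζ]
    exact one_mem_slitPlane
  have h1 : (fun z => Complex.log (z / ζ) / c) ζ = 0 := by simp [div_self hζ]
  rw [← h1] at h0
  refine (h0.comp ζ hl).congr_of_eventuallyEq ?_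
  filter_upwards [eventually_ne_nhds hζ] with z hz
  simp only [Function.comp]
  rw [mul_div_cancel₀ _ hc, exp_log (div_ne_zero hz hζ), mul_div_cancel₀ _ hζ]

/-- The asymptotics of a solution are given only off the contour, and continuity transfers them to
its points. -/
lemma tendsto_cobounded_of_dense {f : ℂ → ℂ} {A : Set ℂ} (hA : Dense A) {c : ℂ}
    (hf : ∀ᶠ z in cobounded ℂ, ContinuousAt f z)
    (h : Tendsto f (cobounded ℂ ⊓ 𝓟 A) (𝓝 c)) : Tendsto f (cobounded ℂ) (𝓝 c) := by
  rw [Metric.tendsto_nhds] at h ⊢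
  intro ε hε
  have h1 := h (ε / 2) (half_pos hε)
  rw [eventually_inf_principal] at h1
  obtain ⟨R, -, hR⟩ := (hasBasis_cobounded_norm (E := ℂ)).eventually_iff.mp (h1.and hf)
  have hb := (hasBasis_cobounded_norm (E := ℂ)).mem_of_mem (i := R + 1) trivial
  filter_upwards [hb] with z hz
  have hz' : R < ‖z‖ := (lt_add_one R).trans_le hz
  have hne : (𝓝[A] z).NeBot := mem_closure_iff_nhdsWithin_neBot.mp (hA z)
  have hlim : Tendsto (fun z => dist (f z) c) (𝓝[A] z) (𝓝 (dist (f z) c)) :=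
    ((hR hz'.le).2.tendsto.dist tendsto_const_nhds).mono_left nhdsWithin_le_nhds
  have hle : dist (f z) c ≤ ε / 2 := by
    refine le_of_tendsto hlim ?_
    have ho : ∀ᶠ w in 𝓝 z, R < ‖w‖ :=
      continuous_norm.continuousAt.eventually_const_lt hz'
    filter_upwards [ho.filter_mono nhdsWithin_le_nhds, self_mem_nhdsWithin] with w hw hwA
    exact ((hR (le_of_lt hw)).1 hwA).le
  linarith

end Painleve

/-! ### Entrywise analyticity and quotients of matrix functions. -/

section Entrywise

variable {A B : ℂ → M2} {z : ℂ}

lemma analyticAt_matrix_mul (hA : ∀ a b, AnalyticAt ℂ (fun z => A z a b) z)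
    (hB : ∀ a b, AnalyticAt ℂ (fun z => B z a b) z) (a b : Fin 2) :
    AnalyticAt ℂ (fun z => (A z * B z) a b) z := by
  simp only [Matrix.mul_apply, Fin.sum_univ_two]
  exact ((hA a 0).mul (hB 0 b)).add ((hA a 1).mul (hB 1 b))

lemma analyticAt_upper {f : ℂ → ℂ} (hf : AnalyticAt ℂ f z) (a b : Fin 2) :
    AnalyticAt ℂ (fun z => upper (f z) a b) z := by
  revert a b
  simp only [Fin.forall_fin_two, upper]
  exact ⟨⟨by simpa using analyticAt_const, by simpa using hf⟩, by simpa using analyticAt_const,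
    by simpa using analyticAt_const⟩

lemma analyticAt_expSigma3 {f : ℂ → ℂ} (hf : AnalyticAt ℂ f z) (a b : Fin 2) :
    AnalyticAt ℂ (fun z => expSigma3 (f z) a b) z := by
  revert a b
  simp only [Fin.forall_fin_two, expSigma3]
  exact ⟨⟨by simpa using hf.cexp', by simpa using analyticAt_const⟩,
    by simpa using analyticAt_const, by simpa using hf.neg.cexp'⟩

lemma continuousAt_of_entries (hA : ∀ a b, ContinuousAt (fun z => A z a b) z) : ContinuousAt A z :=
  tendsto_pi_nhds.mpr fun a => tendsto_pi_nhds.mpr fun b => hA a b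

/-- With a common right jump the quotient `Φ Y⁻¹` has the same limit from both sides. The adjugate
stands in for the inverse, so only `det J = 1` is needed. -/
lemma quotient_limit {Φ Y : ℂ → M2} {s t : Set ℂ} {ζ : ℂ} {J : M2} (hΦ : HasJump Φ s t ζ J)
    (hY : HasJump Y s t ζ J) (hJ : J.det = 1) :
    ∃ L, Tendsto (fun z => Φ z * (Y z).adjugate) (𝓝[s ∪ t] ζ) (𝓝 L) := by
  obtain ⟨P, Q, hP, hQ, hPQ⟩ := hΦ
  obtain ⟨P', Q', hP', hQ', hPQ'⟩ := hY
  have hadj : Continuous fun M : M2 => M.adjugate := continuous_id.matrix_adjugate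
  have h1 := hP.mul ((hadj.tendsto P').comp hP')
  have h2 := hQ.mul ((hadj.tendsto Q').comp hQ')
  have : P * P'.adjugate = Q * Q'.adjugate := by
    rw [hPQ, hPQ', Matrix.adjugate_mul_distrib, Matrix.mul_assoc, ← Matrix.mul_assoc J,
      Matrix.mul_adjugate, hJ, one_smul, Matrix.one_mul]
  rw [this] at h1
  exact ⟨_, by rw [nhdsWithin_union]; exact h1.sup h2⟩

lemma mul_adjugate_of_det {Y : M2} (h : Y.det = 1) : Y * Y.adjugate = 1 := by
  rw [Matrix.mul_adjugate, h, one_smul]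

lemma adjugate_mul_of_det {Y : M2} (h : Y.det = 1) : Y.adjugate * Y = 1 := by
  rw [Matrix.adjugate_mul, h, one_smul]

end Entrywise

/-! ### Geometry of the contour. -/

section Geometry

variable {m : ℕ} {θ : Fin (m + 1) → ℝ}

/-- The contour lies in a circle and finitely many real lines, hence is a null set. -/
lemma dense_compl_contour : Dense (contour θ)ᶜ := by
  have hs : ∀ᵐ z : ℂ, z ∉ Metric.sphere (0 : ℂ) 1 :=
    measure_eq_zero_iff_ae_notMem.mp (Measure.addHaar_sphere _ _ _)
  have hl : ∀ w : ℂ, w ≠ 0 → ∀ᵐ z : ℂ, (z * w⁻¹).im ≠ 0 := by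
    intro w hw
    let L : ℂ →ₗ[ℝ] ℝ := imLm.comp (LinearMap.mulRight ℝ w⁻¹)
    have hL : LinearMap.ker L ≠ ⊤ := by
      intro h
      have h1 : I * w ∈ LinearMap.ker L := h ▸ Submodule.mem_top
      simp [L, hw] at h1
    exact measure_eq_zero_iff_ae_notMem.mp (Measure.addHaar_submodule volume _ hL)
  have hall := ae_all_iff.mpr fun k => hl (pt θ k) (pt_ne_zero θ k)
  refine (Measure.dense_of_ae (μ := (volume : Measure ℂ))
    ((hs.and (hl 1 one_ne_zero)).and hall)).mono ?_
  rintro z ⟨⟨h1, h2⟩, h3⟩ ((h | ⟨x, -, -, rfl⟩) | h)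
  · exact h1 h
  · simp at h2
  · obtain ⟨k, r, hr, rfl⟩ := mem_iUnion.mp h
    apply h3 k
    rw [mul_assoc, mul_inv_cancel₀ (pt_ne_zero θ k), mul_one, ofReal_im]

lemma nhdsWithin_compl_contour_neBot (ζ : ℂ) : (𝓝[(contour θ)ᶜ] ζ).NeBot :=
  mem_closure_iff_nhdsWithin_neBot.mp (dense_compl_contour ζ)

/-- Continuous functions that agree off the contour near `ζ` agree at `ζ`. -/
lemma eq_of_eventuallyEq_off_contour {f g : ℂ → ℂ} {ζ : ℂ} (hf : ContinuousAt f ζ)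
    (hg : ContinuousAt g ζ) (h : ∀ᶠ z in 𝓝 ζ, z ∉ contour θ → f z = g z) : f ζ = g ζ := by
  have := nhdsWithin_compl_contour_neBot (θ := θ) ζ
  refine tendsto_nhds_unique (hf.tendsto.mono_left (nhdsWithin_le_nhds (s := (contour θ)ᶜ))) ?_
  refine (hg.tendsto.mono_left nhdsWithin_le_nhds).congr' ?_
  exact eventually_nhdsWithin_iff.mpr (h.mono fun z hz hzc => (hz hzc).symm)

lemma exists_theta_le (hθ_zero : θ 0 = 0) {t : ℝ} (h0 : 0 ≤ t) (h1 : t < 2 * π) :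
    ∃ j, θ j ≤ t ∧ t < thetaNext θ j := by
  have hne : (Finset.univ.filter fun k => θ k ≤ t).Nonempty := ⟨0, by simpa [hθ_zero] using h0⟩
  set j := (Finset.univ.filter fun k => θ k ≤ t).max' hne
  have hj := (Finset.mem_filter.mp (Finset.max'_mem _ hne)).2
  refine ⟨j, hj, ?_⟩
  unfold thetaNext
  split_ifs with h
  · by_contra hc
    push Not at hc
    have := Finset.le_max' (Finset.univ.filter fun k => θ k ≤ t) (⟨(j : ℕ) + 1, h⟩ : Fin (m + 1))
      (Finset.mem_filter.mpr ⟨Finset.mem_univ _, hc⟩)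
    have h2 := Fin.le_def.mp this
    change (j : ℕ) + 1 ≤ (j : ℕ) at h2
    omega
  · exact h1

lemma eq_norm_mul_exp_argFrom {z : ℂ} (hz : z ≠ 0) : z = ‖z‖ * cexp (argFrom 0 z * I) := by
  conv_lhs => rw [← exp_logFrom 0 hz, logFrom, exp_add, ← ofReal_exp,
    Real.exp_log (norm_pos_iff.mpr hz)]

lemma exists_sector (hθ_zero : θ 0 = 0) {z : ℂ} (hz : z ∉ contour θ) (h1 : 1 < ‖z‖) :
    ∃ j, θ j < argFrom 0 z ∧ argFrom 0 z < thetaNext θ j := by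
  have hm := argFrom_mem 0 z
  rw [zero_add] at hm
  obtain ⟨j, hj1, hj2⟩ := exists_theta_le hθ_zero hm.1 hm.2
  refine ⟨j, lt_of_le_of_ne hj1 fun h => hz (Or.inr (mem_iUnion.mpr ⟨j, ‖z‖, h1.le, ?_⟩)), hj2⟩
  have h0 : z ≠ 0 := by
    rintro rfl
    simp at h1
    linarith
  rw [pt, h]
  exact eq_norm_mul_exp_argFrom h0

lemma contour_cases (hθ_zero : θ 0 = 0) {ζ : ℂ} (h : ζ ∈ contour θ) :
    ζ = 0 ∨ (∃ j, ζ = pt θ j) ∨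
    (∃ j, ∃ t : ℝ, θ j < t ∧ t < thetaNext θ j ∧ ζ = cexp (t * I)) ∨
    (∃ x : ℝ, 0 < x ∧ x < 1 ∧ ζ = x) ∨ ∃ j, ∃ r : ℝ, 1 < r ∧ ζ = r * pt θ j := by
  rcases h with (h | ⟨x, hx0, hx1, rfl⟩) | h
  · have hn : ‖ζ‖ = 1 := by simpa using h
    have hz : ζ ≠ 0 := norm_pos_iff.mp (by rw [hn]; exact one_pos)
    have hm := argFrom_mem 0 ζ
    rw [zero_add] at hm
    have he := eq_norm_mul_exp_argFrom hz
    rw [hn, ofReal_one, one_mul] at he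
    obtain ⟨j, hj1, hj2⟩ := exists_theta_le hθ_zero hm.1 hm.2
    rcases hj1.eq_or_lt with h' | h'
    · exact Or.inr (Or.inl ⟨j, by rw [pt, h']; exact he⟩)
    · exact Or.inr (Or.inr (Or.inl ⟨j, _, h', hj2, he⟩))
  · rcases hx0.eq_or_lt with rfl | hx0
    · exact Or.inl ofReal_zero
    rcases hx1.eq_or_lt with rfl | hx1
    · exact Or.inr (Or.inl ⟨0, by simp [pt, hθ_zero]⟩)
    · exact Or.inr (Or.inr (Or.inr (Or.inl ⟨x, hx0, hx1, rfl⟩)))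
  · obtain ⟨j, r, hr, rfl⟩ := mem_iUnion.mp h
    rcases hr.eq_or_lt with rfl | hr
    · exact Or.inr (Or.inl ⟨j, by simp⟩)
    · exact Or.inr (Or.inr (Or.inr (Or.inr ⟨j, r, hr, rfl⟩)))

/-- Close to an interior point of a contour piece, every point off the contour is on one of its two
sides. So equal limits from both sides give a limit along the whole complement. -/
lemma sides_arc {ζ : ℂ} : {z : ℂ | ‖z‖ < 1} ∪ {z | 1 < ‖z‖} ∈ 𝓝[(contour θ)ᶜ] ζ := by
  filter_upwards [self_mem_nhdsWithin] with z hz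
  exact lt_or_gt_of_ne (norm_ne_one_of_notMem_contour hz)

lemma sides_ray (j : Fin (m + 1)) {r : ℝ} (hr : 1 < r) :
    {z : ℂ | 0 < (z / pt θ j).im} ∪ {z | (z / pt θ j).im < 0} ∈
      𝓝[(contour θ)ᶜ] (r * pt θ j) := by
  have hc : Continuous fun z : ℂ => (z / pt θ j).re := by fun_prop
  have h1 : 1 < ((r * pt θ j) / pt θ j).re := by
    rw [mul_div_assoc, div_self (pt_ne_zero θ j)]
    simpa using hr
  filter_upwards [self_mem_nhdsWithin,
    (hc.continuousAt.eventually_const_lt h1).filter_mono nhdsWithin_le_nhds] with z hz hz1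
  have : (z / pt θ j).im ≠ 0 := by
    intro h
    refine hz (Or.inr (mem_iUnion.mpr ⟨j, _, hz1.le, ?_⟩))
    have h2 : (((z / pt θ j).re : ℝ) : ℂ) = z / pt θ j := Complex.ext rfl h.symm
    rw [h2, div_mul_cancel₀ _ (pt_ne_zero θ j)]
  exact (lt_or_gt_of_ne this).symm

lemma sides_segment {x : ℝ} (hx0 : 0 < x) (hx1 : x < 1) :
    {z : ℂ | 0 < z.im} ∪ {z | z.im < 0} ∈ 𝓝[(contour θ)ᶜ] (x : ℂ) := by
  have h0 : ∀ᶠ z : ℂ in 𝓝 (x : ℂ), 0 < z.re :=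
    continuous_re.continuousAt.eventually_const_lt (by simpa using hx0)
  have h1 : ∀ᶠ z : ℂ in 𝓝 (x : ℂ), z.re < 1 :=
    continuous_re.continuousAt.eventually_lt_const (by simpa using hx1)
  filter_upwards [self_mem_nhdsWithin, h0.filter_mono nhdsWithin_le_nhds,
    h1.filter_mono nhdsWithin_le_nhds] with z hz hz0 hz1
  have : z.im ≠ 0 := by
    intro h
    exact hz (Or.inl (Or.inr ⟨z.re, hz0.le, hz1.le, Complex.ext rfl h⟩))
  exact (lt_or_gt_of_ne this).symm

lemma exp_mul_im_ne_zero {ζ : ℂ} (hζ : 0 < ζ.re) (hζ' : ζ.im = 0) :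
    ∀ᶠ u in 𝓝 (0 : ℂ), u.im ≠ 0 → (ζ * cexp u).im ≠ 0 := by
  have hpi := Real.pi_pos
  have e1 : ∀ᶠ u : ℂ in 𝓝 0, u.im < π :=
    continuous_im.continuousAt.eventually_lt_const (by simpa using hpi)
  have e2 : ∀ᶠ u : ℂ in 𝓝 0, -π < u.im :=
    continuous_im.continuousAt.eventually_const_lt (by simpa using hpi)
  filter_upwards [e1, e2] with u h1 h2 hu
  rw [mul_im, hζ', zero_mul, add_zero, exp_im]
  refine mul_ne_zero hζ.ne' (mul_ne_zero (Real.exp_ne_zero _) ?_)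
  rcases lt_or_gt_of_ne hu with h | h
  · exact (Real.sin_neg_of_neg_of_neg_pi_lt h h2).ne
  · exact (Real.sin_pos_of_pos_of_lt_pi h h1).ne'

variable (hθ_mono : StrictMono θ) (hθ_zero : θ 0 = 0) (hθ_lt : ∀ j, θ j < 2 * π)
include hθ_mono hθ_zero hθ_lt

lemma chart_arc {j : Fin (m + 1)} {t : ℝ} (h1 : θ j < t) (h2 : t < thetaNext θ j) :
    ∀ᶠ u in 𝓝 (0 : ℂ), u.im ≠ 0 → cexp (t * I) * cexp (I * u) ∉ contour θ := by
  have hc : Continuous fun u : ℂ => cexp (t * I) * cexp (I * u) := by fun_prop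
  have h : ∀ᶠ u in 𝓝 (0 : ℂ), OffCuts θ (cexp (t * I) * cexp (I * u)) := by
    refine hc.continuousAt.preimage_mem_nhds (isOpen_offCuts.mem_nhds ?_)
    simpa using offCuts_arc hθ_mono hθ_zero hθ_lt h1 h2
  filter_upwards [h] with u hu hu0
  refine notMem_contour_of_offCuts hu ?_
  rw [norm_mul, norm_exp_ofReal_mul_I, one_mul, norm_exp]
  simpa using hu0

lemma chart_ray (j : Fin (m + 1)) {r : ℝ} (hr : 1 < r) :
    ∀ᶠ u in 𝓝 (0 : ℂ), u.im ≠ 0 → (r * pt θ j) * cexp (1 * u) ∉ contour θ := by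
  have hc : Continuous fun u : ℂ => (r * pt θ j) * cexp (1 * u) := by fun_prop
  have hn : ∀ᶠ u in 𝓝 (0 : ℂ), 1 < ‖(r * pt θ j) * cexp (1 * u)‖ := by
    refine hc.norm.continuousAt.eventually_const_lt ?_
    simpa [abs_of_pos (zero_lt_one.trans hr)] using hr
  have hk : ∀ᶠ u in 𝓝 (0 : ℂ), ∀ k, k ≠ j →
      1 - (r * pt θ j) * cexp (1 * u) / pt θ k ∈ slitPlane := by
    rw [eventually_all]
    intro k
    by_cases hkj : k = j
    · simp [hkj]
    · have hc' : Continuous fun u : ℂ => 1 - (r * pt θ j) * cexp (1 * u) / pt θ k := by fun_prop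
      filter_upwards [hc'.continuousAt.preimage_mem_nhds (isOpen_slitPlane.mem_nhds (by
        simpa using ray_div hθ_mono hθ_zero hθ_lt k j hkj r hr))] with u hu _
      exact hu
  have h0 : ∀ᶠ u in 𝓝 (0 : ℂ), j ≠ 0 → -((r * pt θ j) * cexp (1 * u)) ∈ slitPlane := by
    by_cases hj : j = 0
    · simp [hj]
    · filter_upwards [hc.neg.continuousAt.preimage_mem_nhds (isOpen_slitPlane.mem_nhds (by
        simpa using neg_ray_mem_slitPlane hθ_mono hθ_zero hθ_lt hj (zero_lt_one.trans hr)))]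
        with u hu _
      exact hu
  filter_upwards [hn, hk, h0, exp_mul_im_ne_zero (ζ := r) (by simpa using zero_lt_one.trans hr)
    (by simp)] with u h1 h2 h3 h4 hu
  have h5 := h4 hu
  have hdiv : (r * pt θ j) * cexp (1 * u) / pt θ j = r * cexp u := by
    have := pt_ne_zero θ j
    field_simp
  refine notMem_contour_of_offCuts ⟨?_, fun k => ?_⟩ h1.ne'
  · by_cases hj : j = 0
    · rw [mem_slitPlane_iff]
      right
      rw [neg_im, neg_ne_zero]
      have hp0 : pt θ 0 = 1 := by simp [pt, hθ_zero]
      rw [hj, hp0, mul_one, one_mul]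
      exact h5
    · exact h3 hj
  · by_cases hk : k = j
    · rw [hk, hdiv, mem_slitPlane_iff]
      right
      rw [sub_im, one_im, zero_sub, neg_ne_zero]
      exact h5
    · exact h2 k hk

omit hθ_mono hθ_zero hθ_lt in
lemma chart_segment {x : ℝ} (hx0 : 0 < x) (hx1 : x < 1) :
    ∀ᶠ u in 𝓝 (0 : ℂ), u.im ≠ 0 → (x : ℂ) * cexp (1 * u) ∉ contour θ := by
  have hc : Continuous fun u : ℂ => (x : ℂ) * cexp (1 * u) := by fun_prop
  have hn : ∀ᶠ u in 𝓝 (0 : ℂ), ‖(x : ℂ) * cexp (1 * u)‖ < 1 := by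
    refine hc.norm.continuousAt.eventually_lt_const ?_
    simpa [abs_of_pos hx0] using hx1
  filter_upwards [hn, exp_mul_im_ne_zero (ζ := x) (by simpa using hx0) (by simp)] with u h1 h2 hu
  refine notMem_contour_of_offCuts ⟨?_, fun k => slit_of_norm_eq_one h1.le ?_⟩ h1.ne
  · rw [mem_slitPlane_iff]
    right
    rw [neg_im, neg_ne_zero, one_mul]
    exact h2 hu
  · intro h
    rw [h, norm_pt] at h1
    exact lt_irrefl _ h1

end Geometry

/-! ### Existence of a solution from a nonvanishing Hankel determinant. -/

section Existence

variable {m n : ℕ} (hn : 1 ≤ n) {θ : Fin (m + 1) → ℝ} {α β : Fin (m + 1) → ℂ}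
variable (hθ_mono : StrictMono θ) (hθ_zero : θ 0 = 0) (hθ_lt : ∀ j, θ j < 2 * π)
variable (hα : ∀ j, -1 / 2 < (α j).re)
include hθ_mono hθ_zero hθ_lt hα

lemma analyticAt_cauchyT_dens {z : ℂ} (hz : ‖z‖ ≠ 1) :
    AnalyticAt ℂ (cauchyT (dens n θ α β)) z := by
  rw [analyticAt_iff_eventually_differentiableAt]
  filter_upwards [continuous_norm.continuousAt.eventually_ne hz] with w hw
  exact (hasDerivAt_cauchyT (integrable_dens n α β hθ_mono hθ_zero hθ_lt hα) hw).differentiableAt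

lemma analyticAt_model {z : ℂ} (hz : z ∉ contour θ) (a b : Fin 2) :
    AnalyticAt ℂ (fun z => model n θ α β z a b) z := by
  refine analyticAt_matrix_mul (analyticAt_upper ?_) (analyticAt_expSigma3 ?_) a b
  · exact analyticAt_cauchyT_dens hθ_mono hθ_zero hθ_lt hα (norm_ne_one_of_notMem_contour hz)
  · rw [analyticAt_iff_eventually_differentiableAt]
    filter_upwards [isOpen_offCuts.mem_nhds (offCuts_of_notMem_contour hθ_zero hz)] with w hw
    exact (hasDerivAt_logPsi n α β hw).differentiableAt

omit hθ_mono hθ_zero hθ_lt hα in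
lemma analyticAt_polMat (V : ℝ → ℂ) (z : ℂ) (a b : Fin 2) :
    AnalyticAt ℂ (fun z => polMat V n z a b) z :=
  (differentiable_polMat n a b).analyticAt z

omit hθ_mono hθ_zero hθ_lt hα in
lemma continuousAt_polMat (V : ℝ → ℂ) (z : ℂ) : ContinuousAt (polMat V n) z :=
  continuousAt_of_entries fun a b => (analyticAt_polMat V z a b).continuousAt

-- The columns of `polMat upper(F) z^{-nσ₃}` are `O(1/z)`-close to those of the identity by
-- `polMat_col0` and `polMat_col1`. The factor from `tauLog` is `O(1/z)`-close to one, so the error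
-- matrix decays as required.
include hn in
lemma polMat_model_infinity (hd : (hankel (dens n θ α β) n).det ≠ 0) (j : Fin (m + 1)) :
    ∃ K R : ℝ, ∀ z : ℂ, R < ‖z‖ → θ j < argFrom 0 z → argFrom 0 z < thetaNext θ j →
    ∃ E : M2, (∀ a b, ‖E a b‖ ≤ K / ‖z‖) ∧
      polMat (dens n θ α β) n z * model n θ α β z = (1 + E) *
        expSigma3 ((∑ k, (β k + α k) / 2 + (n : ℂ) / 2) * logFrom 0 z) *
        expSigma3 (2 * π * I * ∑ k ∈ Finset.univ.filter (fun k => j < k), α k) := by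
  set V := dens n θ α β
  have hV : IntervalIntegrable V volume 0 (2 * π) :=
    integrable_dens n α β hθ_mono hθ_zero hθ_lt hα
  set E : ℂ → M2 := fun z => polMat V n z * upper (cauchyT V z) *
    expSigma3 (tauLog θ α z - n * logFrom 0 z) - 1 with hE
  have hinv : (fun z : ℂ => z⁻¹) =O[cobounded ℂ] fun _ => (1 : ℂ) :=
    tendsto_inv_cobounded.isBigO_one ℂ
  have hprod : ∀ (f g : ℂ → ℂ) (c : ℂ), (fun z => f z - c) =O[cobounded ℂ] (fun z => z⁻¹) →
      (fun z => g z - 1) =O[cobounded ℂ] (fun z => z⁻¹) →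
      (fun z => f z * g z - c) =O[cobounded ℂ] fun z => z⁻¹ := by
    intro f g c hf hg
    have h1 : f =O[cobounded ℂ] fun _ => (1 : ℂ) := by
      have := (hf.trans hinv).add (Asymptotics.isBigO_const_const c (one_ne_zero (α := ℂ)) _)
      exact this.congr_left fun z => by ring
    have h2 := h1.mul hg
    simp only [one_mul] at h2
    exact (h2.add hf).congr_left fun z => by ring
  have hpos := tendsto_norm_cobounded_atTop (E := ℂ)
  have h1 : ∀ᶠ z : ℂ in cobounded ℂ, z ≠ 0 := by
    filter_upwards [hpos.eventually_gt_atTop 0] with z hz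
    exact norm_pos_iff.mp hz
  have hlog : ∀ z : ℂ, z ≠ 0 → cexp (n * logFrom 0 z) = z ^ n := by
    intro z hz
    rw [exp_nat_mul, exp_logFrom 0 hz]
  have hEO : ∀ a b, (fun z => E z a b) =O[cobounded ℂ] fun z => z⁻¹ := by
    intro a b
    revert b
    rw [Fin.forall_fin_two]
    constructor
    · have h := hprod _ _ _ (polMat_col0 (V := V) n a) (by simpa using isBigO_exp_tauLog θ α 1)
      refine h.congr' ?_ EventuallyEq.rfl
      filter_upwards [h1] with z hz
      simp only [hE]
      rw [Matrix.sub_apply, mul_expSigma3_apply_zero, mul_upper_apply_zero, exp_sub, hlog z hz]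
      ring
    · have h := hprod _ _ _ (polMat_col1 hV hn hd a) (by simpa using isBigO_exp_tauLog θ α (-1))
      refine h.congr' ?_ EventuallyEq.rfl
      filter_upwards [h1] with z hz
      simp only [hE]
      rw [Matrix.sub_apply, mul_expSigma3_apply_one, mul_upper_apply_one, neg_sub, exp_sub,
        hlog z hz, exp_neg]
      ring
  have hbd : ∀ a b, ∃ c : ℝ, ∀ᶠ z in cobounded ℂ, ‖E z a b‖ ≤ c / ‖z‖ := by
    intro a b
    obtain ⟨c, hc⟩ := (hEO a b).bound
    refine ⟨c, hc.mono fun z hz => ?_⟩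
    rwa [norm_inv, ← div_eq_mul_inv] at hz
  choose c hc using hbd
  have hall : ∀ᶠ z in cobounded ℂ, 1 < ‖z‖ ∧ ∀ a b, ‖E z a b‖ ≤ c a b / ‖z‖ :=
    (hpos.eventually_gt_atTop 1).and (eventually_all.mpr fun a => eventually_all.mpr fun b => hc a b)
  obtain ⟨R, -, hR⟩ := (hasBasis_cobounded_norm (E := ℂ)).eventually_iff.mp hall
  refine ⟨∑ a, ∑ b, |c a b|, R, fun z hz hz1 hz2 => ⟨E z, fun a b => ?_, ?_⟩⟩
  · refine ((hR hz.le).2 a b).trans (div_le_div_of_nonneg_right ?_ (norm_nonneg z))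
    calc c a b ≤ |c a b| := le_abs_self _
      _ ≤ ∑ b, |c a b| := Finset.single_le_sum (f := fun b => |c a b|) (fun _ _ => abs_nonneg _)
          (Finset.mem_univ b)
      _ ≤ _ := Finset.single_le_sum (f := fun a => ∑ b, |c a b|)
          (fun _ _ => Finset.sum_nonneg fun _ _ => abs_nonneg _) (Finset.mem_univ a)
  · rw [hE, add_sub_cancel, model, logPsi_of_sector n α β hθ_mono hθ_zero hθ_lt (hR hz.le).1 hz1 hz2,
      Matrix.mul_assoc _ (expSigma3 _) (expSigma3 _), expSigma3_mul, Matrix.mul_assoc _ (expSigma3 _)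
      (expSigma3 _), expSigma3_mul, Matrix.mul_assoc, add_assoc]

variable (hα_exp : ∀ j, cexp (4 * π * I * α j) ≠ 1)
include hα_exp

include hn in
/-- The problem is solvable if the Hankel determinant does not vanish. -/
theorem phiSolvable_of_hankel (hd : (hankel (dens n θ α β) n).det ≠ 0) : PhiSolvable n θ α β := by
  set V := dens n θ α β
  choose R hR1 hR2 hR3 using fun j =>
    model_local n α β hθ_mono hθ_zero hθ_lt hα j (hα_exp j)
  -- An entire left factor changes neither the jumps nor the right factors at the exceptional
  -- points. Only the behaviour at infinity depends on its choice.
  refine ⟨⟨fun z => polMat V n z * model n θ α β z,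
    fun j z => polMat V n z * (upper (R j z) * expSigma3 (locLog n θ α β j z)),
    fun z => polMat V n z * (upper (cauchyT V z) * expSigma3 (locLogZero θ α z))⟩, ?_⟩
  constructor
  · intro a b z hz
    exact (analyticAt_matrix_mul (analyticAt_polMat V z)
      (analyticAt_model hθ_mono hθ_zero hθ_lt hα hz) a b).differentiableAt.differentiableWithinAt
  · intro j t h1 h2
    exact hasJump_of_continuousAt (continuousAt_polMat V _)
      (hasJump_model_arc n α β hθ_mono hθ_zero hθ_lt hα h1 h2)
  · intro j hj r hr
    exact hasJump_of_continuousAt (continuousAt_polMat V _)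
      (hasJump_model_ray n α β hθ_mono hθ_zero hθ_lt hα hj hr)
  · intro r hr
    exact hasJump_of_continuousAt (continuousAt_polMat V _)
      (hasJump_model_ray_zero n α β hθ_mono hθ_zero hθ_lt hα hr)
  · intro x hx0 hx1
    exact hasJump_of_continuousAt (continuousAt_polMat V _)
      (hasJump_model_segment n α β hθ_mono hθ_zero hθ_lt hα hx0 hx1)
  · exact polMat_model_infinity hn hθ_mono hθ_zero hθ_lt hα hd
  · intro j a b
    exact analyticAt_matrix_mul (analyticAt_polMat V _) (analyticAt_matrix_mul
      (analyticAt_upper (hR1 j)) (analyticAt_expSigma3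
        (analyticAt_locLog n α β hθ_mono hθ_zero hθ_lt j))) a b
  · intro j
    filter_upwards [hR3 j] with z hz hzc
    simp only [hz hzc, Matrix.mul_assoc]
  · intro a b
    exact analyticAt_matrix_mul (analyticAt_polMat V _) (analyticAt_matrix_mul
      (analyticAt_upper (analyticAt_cauchyT_dens hθ_mono hθ_zero hθ_lt hα (by simp)))
      (analyticAt_expSigma3 (analyticAt_locLogZero α))) a b
  · refine Eventually.of_forall fun z _ => ?_
    simp only [model_zero, Matrix.mul_assoc]
    rfl

end Existence

/-! ### Every solution is the polynomial matrix times the model. -/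

section Uniqueness

variable {m n : ℕ} {θ : Fin (m + 1) → ℝ} {α β : Fin (m + 1) → ℂ}
variable (hθ_mono : StrictMono θ) (hθ_zero : θ 0 = 0) (hθ_lt : ∀ j, θ j < 2 * π)
variable (hα : ∀ j, -1 / 2 < (α j).re) (hα_exp : ∀ j, cexp (4 * π * I * α j) ≠ 1)
variable {S : PhiData m} (hS : IsPhiSolution n θ α β S)

omit hθ_mono hθ_zero hθ_lt hα hα_exp hS in
lemma det_connection (j : Fin (m + 1)) (z : ℂ) : (connection n θ α β j z).det = 1 := by
  rw [connection, Matrix.det_mul, det_upper, one_mul]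
  split_ifs
  · exact det_expSigma3 _
  · exact Matrix.det_one

include hθ_mono hθ_zero hθ_lt hα hS

omit hθ_mono hθ_lt hα in
lemma IsPhiSolution.analyticAt {z : ℂ} (hz : z ∉ contour θ) (a b : Fin 2) :
    AnalyticAt ℂ (fun z => S.Φ z a b) z :=
  (hS.analytic a b).analyticAt ((isOpen_compl_contour hθ_zero).mem_nhds hz)

include hα_exp in
/-- Near `z_j` the quotient of a solution by the model is continuous. -/
lemma IsPhiSolution.eventually_reg (j : Fin (m + 1)) :
    ∃ R : ℂ → ℂ, AnalyticAt ℂ R (pt θ j) ∧ R (pt θ j) = -(rho n θ α β j / (2 * α j)) ∧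
      ∀ᶠ z in 𝓝 (pt θ j), z ∉ contour θ → S.reg j z =
        S.Φ z * (model n θ α β z).adjugate * (upper (R z) * expSigma3 (locLog n θ α β j z)) := by
  obtain ⟨R, h1, h2, h3⟩ := model_local n α β hθ_mono hθ_zero hθ_lt hα j (hα_exp j)
  refine ⟨R, h1, h2, ?_⟩
  filter_upwards [h3, hS.reg_eq j] with z hz hz' hzc
  set C := connection n θ α β j z
  set X := expSigma3 (α j * logFrom (θ j) (z - pt θ j)) * C
  have hX : X * X.adjugate = 1 := mul_adjugate_of_det (by
    rw [Matrix.det_mul, det_expSigma3, det_connection, one_mul])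
  set U := upper (R z) * expSigma3 (locLog n θ α β j z)
  have hU : U.adjugate * U = 1 := adjugate_mul_of_det (by simp [U])
  have e1 : model n θ α β z = U * X := by rw [hz hzc]; simp only [U, X, C, Matrix.mul_assoc]
  have e2 : S.Φ z = S.reg j z * X := by rw [hz' hzc]; simp only [X, C, Matrix.mul_assoc]
  rw [e1, e2, Matrix.adjugate_mul_distrib]
  calc S.reg j z = S.reg j z * ((X * X.adjugate) * (U.adjugate * U)) := by rw [hX, hU]; simp
    _ = _ := by simp only [Matrix.mul_assoc]

omit hθ_mono hθ_zero hθ_lt hα in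
lemma IsPhiSolution.eventually_reg0 : ∀ᶠ z in 𝓝 (0 : ℂ), z ∉ contour θ → S.reg0 z =
    S.Φ z * (model n θ α β z).adjugate *
      (upper (cauchyT (dens n θ α β) z) * expSigma3 (locLogZero θ α z)) := by
  filter_upwards [hS.reg0_eq] with z hz hzc
  set X := expSigma3 (lam n α β * logFrom 0 z)
  have hX : X * X.adjugate = 1 := mul_adjugate_of_det (det_expSigma3 _)
  set U := upper (cauchyT (dens n θ α β) z) * expSigma3 (locLogZero θ α z)
  have hU : U.adjugate * U = 1 := adjugate_mul_of_det (by simp [U])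
  rw [hz hzc, model_zero, Matrix.adjugate_mul_distrib]
  calc S.reg0 z = S.reg0 z * ((X * X.adjugate) * (U.adjugate * U)) := by rw [hX, hU]; simp
    _ = _ := by simp only [Matrix.mul_assoc]; rfl

-- At the exceptional points the branching right factors of the solution and of the model coincide
-- and cancel, so the quotient is built from holomorphic matrices `X` and `U`.
omit hθ_mono hθ_zero hθ_lt hα hS in
lemma exists_limit_of_regular {M X U : ℂ → M2} {ζ : ℂ}
    (hX : ∀ a b, AnalyticAt ℂ (fun z => X z a b) ζ) (hU : ∀ a b, AnalyticAt ℂ (fun z => U z a b) ζ)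
    (hdet : ∀ z, (U z).det = 1) (h : ∀ᶠ z in 𝓝 ζ, z ∉ contour θ → X z = M z * U z) :
    ∃ L, Tendsto M (𝓝[(contour θ)ᶜ] ζ) (𝓝 L) := by
  have hc : ContinuousAt (fun z => X z * (U z).adjugate) ζ :=
    (continuousAt_of_entries fun a b => (hX a b).continuousAt).mul
      ((continuous_id.matrix_adjugate.continuousAt).comp
        (continuousAt_of_entries fun a b => (hU a b).continuousAt))
  refine ⟨_, (hc.tendsto.mono_left nhdsWithin_le_nhds).congr' ?_⟩
  filter_upwards [h.filter_mono nhdsWithin_le_nhds, self_mem_nhdsWithin] with z hz hzc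
  rw [hz hzc, Matrix.mul_assoc, mul_adjugate_of_det (hdet z), Matrix.mul_one]

include hα_exp

/-- The quotient of a solution by the model has a limit at each point. -/
lemma IsPhiSolution.exists_quotient_limit (ζ : ℂ) : ∃ L, Tendsto
    (fun z => S.Φ z * (model n θ α β z).adjugate) (𝓝[(contour θ)ᶜ] ζ) (𝓝 L) := by
  by_cases hζ : ζ ∈ contour θ
  · rcases contour_cases hθ_zero hζ with rfl | ⟨j, rfl⟩ | ⟨j, t, h1, h2, rfl⟩ | ⟨x, h1, h2, rfl⟩ |
      ⟨j, r, hr, rfl⟩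
    · refine exists_limit_of_regular hS.reg0_analytic (analyticAt_matrix_mul (analyticAt_upper
        (analyticAt_cauchyT_dens hθ_mono hθ_zero hθ_lt hα (by simp)))
        (analyticAt_expSigma3 (analyticAt_locLogZero α))) (by simp) (hS.eventually_reg0)
    · obtain ⟨R, hR, -, h⟩ := hS.eventually_reg hθ_mono hθ_zero hθ_lt hα hα_exp j
      exact exists_limit_of_regular (hS.reg_analytic j) (analyticAt_matrix_mul
        (analyticAt_upper hR) (analyticAt_expSigma3
          (analyticAt_locLog n α β hθ_mono hθ_zero hθ_lt j))) (by simp) h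
    · obtain ⟨L, hL⟩ := quotient_limit (hS.jump_arc j t h1 h2)
        (hasJump_model_arc n α β hθ_mono hθ_zero hθ_lt hα h1 h2) (det_upper _)
      exact ⟨L, hL.mono_left (nhdsWithin_le_iff.mpr sides_arc)⟩
    · obtain ⟨L, hL⟩ := quotient_limit (hS.jump_segment x h1 h2)
        (hasJump_model_segment n α β hθ_mono hθ_zero hθ_lt hα h1 h2) (det_expSigma3 _)
      exact ⟨L, hL.mono_left (nhdsWithin_le_iff.mpr (sides_segment h1 h2))⟩
    · have hsides := sides_ray (θ := θ) j hr
      by_cases hj : j = 0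
      · have hp0 : pt θ 0 = 1 := by simp [pt, hθ_zero]
        rw [hj, hp0, mul_one] at hsides ⊢
        simp only [div_one] at hsides
        obtain ⟨L, hL⟩ := quotient_limit (hS.jump_ray_zero r hr)
          (hasJump_model_ray_zero n α β hθ_mono hθ_zero hθ_lt hα hr) (det_expSigma3 _)
        exact ⟨L, hL.mono_left (nhdsWithin_le_iff.mpr hsides)⟩
      · obtain ⟨L, hL⟩ := quotient_limit (hS.jump_ray j hj r hr)
          (hasJump_model_ray n α β hθ_mono hθ_zero hθ_lt hα hj hr) (det_expSigma3 _)
        exact ⟨L, hL.mono_left (nhdsWithin_le_iff.mpr hsides)⟩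
  · have hc : ContinuousAt (fun z => S.Φ z * (model n θ α β z).adjugate) ζ :=
      (continuousAt_of_entries fun a b => (hS.analyticAt hθ_zero hζ
        a b).continuousAt).mul ((continuous_id.matrix_adjugate.continuousAt).comp
        (continuousAt_of_entries fun a b =>
          (analyticAt_model hθ_mono hθ_zero hθ_lt hα hζ a b).continuousAt))
    exact ⟨_, hc.tendsto.mono_left nhdsWithin_le_nhds⟩

/-- A solution is the model multiplied on the left by an entire function. -/
lemma IsPhiSolution.exists_entire : ∃ P : ℂ → M2, (∀ a b, Differentiable ℂ fun z => P z a b) ∧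
    ∀ z ∉ contour θ, P z = S.Φ z * (model n θ α β z).adjugate := by
  set M := fun z => S.Φ z * (model n θ α β z).adjugate with hM
  have hMl : ∀ a b ζ, ∃ l, Tendsto (fun z => M z a b) (𝓝[(contour θ)ᶜ] ζ) (𝓝 l) := by
    intro a b ζ
    obtain ⟨L, hL⟩ := hS.exists_quotient_limit hθ_mono hθ_zero hθ_lt hα hα_exp ζ
    exact ⟨L a b, tendsto_pi_nhds.mp (tendsto_pi_nhds.mp hL a) b⟩
  have hMc : ∀ a b, ∀ ζ ∉ contour θ, DifferentiableAt ℂ (fun z => M z a b) ζ := by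
    intro a b ζ hζ
    refine (analyticAt_matrix_mul (hS.analyticAt hθ_zero hζ) ?_
      a b).differentiableAt
    have h := analyticAt_model (n := n) (β := β) hθ_mono hθ_zero hθ_lt hα hζ
    simp only [Matrix.adjugate_fin_two, Fin.forall_fin_two]
    exact ⟨⟨by simpa using h 1 1, by simpa using (h 0 1).fun_neg⟩, by simpa using (h 1 0).fun_neg,
      by simpa using h 0 0⟩
  have hPM : ∀ a b, ∀ z ∉ contour θ, extendFrom (contour θ)ᶜ (fun z => M z a b) z = M z a b := by
    intro a b z hz
    exact extendFrom_eq (dense_compl_contour z)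
      ((hMc a b z hz).continuousAt.tendsto.mono_left nhdsWithin_le_nhds)
  refine ⟨fun z => .of fun a b => extendFrom (contour θ)ᶜ (fun z => M z a b) z, fun a b => ?_,
    fun z hz => ?_⟩
  · simp only [Matrix.of_apply]
    set P := extendFrom (contour θ)ᶜ (fun z => M z a b) with hP
    have hc : Continuous P := continuous_extendFrom dense_compl_contour (hMl a b)
    have hd : ∀ z ∉ contour θ, DifferentiableAt ℂ P z := by
      intro z hz
      refine (hMc a b z hz).congr_of_eventuallyEq ?_
      filter_upwards [(isOpen_compl_contour hθ_zero).mem_nhds hz] with w hw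
      exact hPM a b w hw
    -- Across the open contour pieces the extension is holomorphic by straightening charts. The
    -- finitely many points of `T` are isolated singularities at which it is continuous, hence
    -- removable.
    set T : Set ℂ := insert 0 (range (pt θ))
    have hT : T.Finite := (finite_range _).insert 0
    have hreg : ∀ z ∉ T, DifferentiableAt ℂ P z := by
      intro ζ hζT
      by_cases hζ : ζ ∈ contour θ
      · rcases contour_cases hθ_zero hζ with rfl | ⟨j, rfl⟩ | ⟨j, t, h1, h2, rfl⟩ |
          ⟨x, h1, h2, rfl⟩ | ⟨j, r, hr, rfl⟩
        · exact absurd (mem_insert _ _) hζT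
        · exact absurd (mem_insert_of_mem _ (mem_range_self j)) hζT
        · exact differentiableAt_of_exp_chart hc hd (exp_ne_zero _) I_ne_zero
            (chart_arc hθ_mono hθ_zero hθ_lt h1 h2)
        · exact differentiableAt_of_exp_chart hc hd (by exact_mod_cast h1.ne') one_ne_zero
            (chart_segment h1 h2)
        · exact differentiableAt_of_exp_chart hc hd
            (mul_ne_zero (by exact_mod_cast (zero_lt_one.trans hr).ne') (pt_ne_zero θ j))
            one_ne_zero (chart_ray hθ_mono hθ_zero hθ_lt j hr)
      · exact hd ζ hζ
    intro ζ
    have hnear : (T \ {ζ})ᶜ ∈ 𝓝 ζ := (hT.subset sdiff_subset).isClosed.isOpen_compl.mem_nhds (by simp)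
    refine ((differentiableOn_compl_singleton_and_continuousAt_iff hnear).mp
      ⟨fun z hz => (hreg z ?_).differentiableWithinAt, hc.continuousAt⟩).differentiableAt hnear
    intro hzT
    exact hz.1 ⟨hzT, hz.2⟩
  · ext a b
    exact hPM a b z hz

/-- A solution is the model multiplied on the left by the normalized entire function. -/
lemma IsPhiSolution.exists_normalized : ∃ P : ℂ → M2,
    IsNormalized n (cauchyT (dens n θ α β)) P ∧
    ∀ z ∉ contour θ, P z = S.Φ z * (model n θ α β z).adjugate := by
  obtain ⟨P, hP, hPM⟩ := hS.exists_entire hθ_mono hθ_zero hθ_lt hα hα_exp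
  set F := cauchyT (dens n θ α β)
  have hpos := tendsto_norm_cobounded_atTop (E := ℂ)
  choose K R hKR using hS.infinity
  -- In each sector the solution and the model carry the same right factor `X`. Cancelling it leaves
  -- a statement in which the sector no longer occurs, with the sum of the sector constants as
  -- common bound.
  have hbound : ∀ᶠ z in cobounded ℂ, z ∉ contour θ → ∀ a b,
      ‖(P z * upper (F z) * expSigma3 (tauLog θ α z - n * logFrom 0 z)) a b - (1 : M2) a b‖ ≤
        (∑ j, |K j|) * ‖z‖⁻¹ := by
    filter_upwards [hpos.eventually_gt_atTop 1,
      eventually_all.mpr fun j => hpos.eventually_gt_atTop (R j)] with z hz1 hzR hzc a b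
    obtain ⟨j, hj1, hj2⟩ := exists_sector hθ_zero hzc hz1
    obtain ⟨E, hE, hΦ⟩ := hKR j z (hzR j) hj1 hj2
    set X := expSigma3 ((∑ k, (β k + α k) / 2 + (n : ℂ) / 2) * logFrom 0 z) *
      expSigma3 (2 * π * I * ∑ k ∈ Finset.univ.filter (fun k => j < k), α k) with hX
    have hXX : X * X.adjugate = 1 := mul_adjugate_of_det (by
      rw [Matrix.det_mul, det_expSigma3, det_expSigma3, one_mul])
    have hm : model n θ α β z =
        upper (F z) * expSigma3 (tauLog θ α z - n * logFrom 0 z) * X := by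
      rw [model, logPsi_of_sector n α β hθ_mono hθ_zero hθ_lt hz1 hj1 hj2, ← expSigma3_mul,
        ← expSigma3_mul, hX]
      simp only [Matrix.mul_assoc]
      rfl
    have hPm : P z * model n θ α β z = S.Φ z := by
      rw [hPM z hzc, Matrix.mul_assoc, adjugate_mul_of_det (det_model _ _ _ _ _), Matrix.mul_one]
    have hY : P z * upper (F z) * expSigma3 (tauLog θ α z - n * logFrom 0 z) = 1 + E := by
      calc _ = P z * model n θ α β z * X.adjugate := by
            rw [hm]
            simp only [Matrix.mul_assoc]
            rw [hXX, Matrix.mul_one]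
        _ = (1 + E) * (X * X.adjugate) := by rw [hPm, hΦ, hX]; simp only [Matrix.mul_assoc]
        _ = 1 + E := by rw [hXX, Matrix.mul_one]
    rw [hY, Matrix.add_apply, add_sub_cancel_left]
    refine (hE a b).trans ?_
    rw [div_eq_mul_inv]
    exact mul_le_mul_of_nonneg_right ((le_abs_self _).trans (Finset.single_le_sum
      (f := fun j => |K j|) (fun _ _ => abs_nonneg _) (Finset.mem_univ j))) (by positivity)
  have hlim : ∀ a b, Tendsto (fun z =>
      (P z * upper (F z) * expSigma3 (tauLog θ α z - n * logFrom 0 z)) a b)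
      (cobounded ℂ ⊓ 𝓟 (contour θ)ᶜ) (𝓝 ((1 : M2) a b)) := by
    intro a b
    rw [tendsto_iff_norm_sub_tendsto_zero]
    have h0 : Tendsto (fun z : ℂ => (∑ j, |K j|) * ‖z‖⁻¹) (cobounded ℂ ⊓ 𝓟 (contour θ)ᶜ)
        (𝓝 0) := by
      simpa using ((tendsto_inv_atTop_zero.comp hpos).const_mul (∑ j, |K j|)).mono_left inf_le_left
    refine squeeze_zero' (Eventually.of_forall fun _ => norm_nonneg _) ?_ h0
    rw [eventually_inf_principal]
    exact hbound.mono fun z hz hzc => hz hzc a b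
  have hτ : ∀ c : ℂ, Tendsto (fun z => cexp (c * tauLog θ α z)) (cobounded ℂ ⊓ 𝓟 (contour θ)ᶜ)
      (𝓝 1) := fun c =>
    (tendsto_of_isBigO_sub (isBigO_exp_tauLog θ α c)).mono_left inf_le_left
  have hne : ∀ᶠ z in cobounded ℂ, z ≠ 0 := by
    filter_upwards [hpos.eventually_gt_atTop 0] with z hz
    exact norm_pos_iff.mp hz
  have hlog : ∀ z : ℂ, z ≠ 0 → cexp (n * logFrom 0 z) = z ^ n := by
    intro z hz
    rw [exp_nat_mul, exp_logFrom 0 hz]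
  have hPc : ∀ a b, Continuous fun z => P z a b := fun a b => (hP a b).continuous
  refine ⟨P, ⟨hP, fun i => ?_, fun i => ?_⟩, hPM⟩
  · refine tendsto_cobounded_of_dense (dense_compl_contour (θ := θ)) ?_ ?_
    · filter_upwards [hne] with z hz
      exact (hPc i 0).continuousAt.div (by fun_prop) (pow_ne_zero n hz)
    · have h := (hlim i 0).mul (hτ (-1))
      rw [mul_one] at h
      refine h.congr' ?_
      filter_upwards [hne.filter_mono inf_le_left] with z hz
      rw [mul_expSigma3_apply_zero, mul_upper_apply_zero, exp_sub, hlog z hz, neg_one_mul, exp_neg]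
      field_simp [exp_ne_zero]
  · refine tendsto_cobounded_of_dense (dense_compl_contour (θ := θ)) ?_ ?_
    · filter_upwards [hpos.eventually_gt_atTop 1] with z hz
      exact (((hPc i 0).continuousAt.mul (continuousAt_cauchyT_dens n α β hθ_mono hθ_zero hθ_lt hα
        hz.ne')).add (hPc i 1).continuousAt).mul (by fun_prop)
    · have h := (hlim i 1).mul (hτ 1)
      rw [mul_one] at h
      refine h.congr' ?_
      filter_upwards [hne.filter_mono inf_le_left] with z hz
      rw [mul_expSigma3_apply_one, mul_upper_apply_one, neg_sub, exp_sub, hlog z hz, one_mul]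
      field_simp [exp_ne_zero]

/-- Solvability forces the Hankel determinant not to vanish. -/
theorem IsPhiSolution.hankel_det_ne_zero : (hankel (dens n θ α β) n).det ≠ 0 := by
  obtain ⟨P, hP, -⟩ := hS.exists_normalized hθ_mono hθ_zero hθ_lt hα hα_exp
  exact FisherHartwig.hankel_det_ne_zero (integrable_dens n α β hθ_mono hθ_zero hθ_lt hα) hP

variable (hn : 1 ≤ n)
include hn

/-- By uniqueness of the normalized matrix. Every solution is thereby expressed through the moments
of the density. -/
lemma IsPhiSolution.polMat_eq {z : ℂ} (hz : z ∉ contour θ) :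
    polMat (dens n θ α β) n z = S.Φ z * (model n θ α β z).adjugate := by
  obtain ⟨P, hP, hPM⟩ := hS.exists_normalized hθ_mono hθ_zero hθ_lt hα hα_exp
  rw [← hPM z hz, hP.unique (isNormalized_polMat (integrable_dens n α β hθ_mono hθ_zero hθ_lt hα) hn
    (hS.hankel_det_ne_zero hθ_mono hθ_zero hθ_lt hα hα_exp))]

/-- The value at `z_j` is the limit from off the contour, and the entry of the unipotent factor is
the Frobenius value `R(z_j)`. In this form the dependence on the parameters is visible. -/
lemma IsPhiSolution.reg_pt (j : Fin (m + 1)) : S.reg j (pt θ j) = polMat (dens n θ α β) n (pt θ j) *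
    (upper (-(rho n θ α β j / (2 * α j))) * expSigma3 (locLog n θ α β j (pt θ j))) := by
  obtain ⟨R, hR, hR0, h⟩ := hS.eventually_reg hθ_mono hθ_zero hθ_lt hα hα_exp j
  rw [← hR0]
  ext a b
  refine eq_of_eventuallyEq_off_contour (θ := θ) (f := fun z => S.reg j z a b)
    (g := fun z => (polMat (dens n θ α β) n z *
      (upper (R z) * expSigma3 (locLog n θ α β j z))) a b)
    (hS.reg_analytic j a b).continuousAt (analyticAt_matrix_mul (analyticAt_polMat _ _)
      (analyticAt_matrix_mul (analyticAt_upper hR) (analyticAt_expSigma3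
        (analyticAt_locLog n α β hθ_mono hθ_zero hθ_lt j))) a b).continuousAt ?_
  filter_upwards [h] with z hz hzc
  simp only [hz hzc, hS.polMat_eq hθ_mono hθ_zero hθ_lt hα hα_exp hn hzc]

lemma IsPhiSolution.reg0_zero : S.reg0 0 = polMat (dens n θ α β) n 0 *
    (upper (cauchyT (dens n θ α β) 0) * expSigma3 (locLogZero θ α 0)) := by
  ext a b
  refine eq_of_eventuallyEq_off_contour (θ := θ) (f := fun z => S.reg0 z a b)
    (g := fun z => (polMat (dens n θ α β) n z *
      (upper (cauchyT (dens n θ α β) z) * expSigma3 (locLogZero θ α z))) a b)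
    (hS.reg0_analytic a b).continuousAt (analyticAt_matrix_mul (analyticAt_polMat _ _)
      (analyticAt_matrix_mul (analyticAt_upper
        (analyticAt_cauchyT_dens hθ_mono hθ_zero hθ_lt hα (by simp))) (analyticAt_expSigma3
        (analyticAt_locLogZero α))) a b).continuousAt ?_
  filter_upwards [hS.eventually_reg0] with z hz hzc
  simp only [hz hzc, hS.polMat_eq hθ_mono hθ_zero hθ_lt hα hα_exp hn hzc]

end Uniqueness

/-! ### Dependence of the pairings on the parameters. -/

section Parameters

variable {m : ℕ} (n : ℕ) {θ : Fin (m + 1) → ℝ} (α β : Fin (m + 1) → ℂ)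

lemma measurable_cA (k : Fin (m + 1)) : Measurable (cA θ k) := by
  unfold cA
  fun_prop

lemma measurable_cB (k : Fin (m + 1)) : Measurable (cB θ k) := by
  unfold cB
  exact Measurable.add (by fun_prop) (Measurable.ite measurableSet_Iio measurable_const
    measurable_const)

variable (θ) in
/-- The derivative of the density in the direction `(a, b)`. -/
def densDeriv (a b : Fin (m + 1) → ℂ) (t : ℝ) : ℂ :=
  dens n θ α β t * ∑ k, (a k * cA θ k t + b k * cB θ k t)

lemma measurable_densDeriv (a b : Fin (m + 1) → ℂ) : Measurable (densDeriv n θ α β a b) :=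
  (measurable_dens n α β).mul (Finset.measurable_sum _ fun k _ =>
    ((measurable_cA k).const_mul _).add ((measurable_cB k).const_mul _))

lemma hasDerivAt_dens (a b : Fin (m + 1) → ℂ) {t : ℝ} (ht : ∀ k, cexp (t * I) ≠ pt θ k) (s : ℂ) :
    HasDerivAt (fun s : ℂ => dens n θ (α + s • a) (β + s • b) t)
      (densDeriv n θ (α + s • a) (β + s • b) a b t) s := by
  have h : (fun s : ℂ => dens n θ (α + s • a) (β + s • b) t) = fun s =>
      cexp (∑ k, ((α k + s * a k) * cA θ k t + (β k + s * b k) * cB θ k t) -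
        I * ((n : ℂ) - 1) * t) := by
    ext s
    rw [dens_eq_exp n _ _ ht]
    rfl
  rw [densDeriv, h, dens_eq_exp n _ _ ht]
  refine HasDerivAt.cexp (HasDerivAt.sub_const _ (HasDerivAt.fun_sum fun k _ => ?_))
  have h1 : HasDerivAt (fun s => α k + s * a k) (a k) s := by
    simpa using ((hasDerivAt_id s).mul_const (a k)).const_add (α k)
  have h2 : HasDerivAt (fun s => β k + s * b k) (b k) s := by
    simpa using ((hasDerivAt_id s).mul_const (b k)).const_add (β k)
  exact (h1.mul_const _).add (h2.mul_const _)

variable (hθ_mono : StrictMono θ) (hθ_zero : θ 0 = 0) (hθ_lt : ∀ j, θ j < 2 * π)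
variable (hα : ∀ j, -1 / 2 < (α j).re)
include hθ_mono hθ_zero hθ_lt hα

/-- The densities for nearby parameters have a common integrable bound. -/
lemma exists_dens_bound : ∃ ε > 0, ∃ G : ℝ → ℝ, IntervalIntegrable G volume 0 (2 * π) ∧
    ∀ α' β', ‖α' - α‖ ≤ ε → ‖β' - β‖ ≤ ε → ∀ t ∈ uIoc 0 (2 * π),
      (∀ k, cexp (t * I) ≠ pt θ k) → ‖dens n θ α' β' t‖ ≤ G t := by
  -- The margin keeps the exponents `2 (Re α_k - ε)` above `-1`.
  obtain ⟨ε, hε, hε1, hεα⟩ : ∃ ε : ℝ, 0 < ε ∧ ε ≤ 1 ∧ ∀ k, -1 / 2 < (α k).re - ε := by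
    have h : ∀ᶠ ε : ℝ in 𝓝[>] 0, ∀ k, -1 / 2 < (α k).re - ε := by
      rw [eventually_all]
      intro k
      have hc : Continuous fun ε : ℝ => (α k).re - ε := by fun_prop
      exact (hc.continuousAt.eventually_const_lt (by simpa using hα k)).filter_mono
        nhdsWithin_le_nhds
    have h' : ∀ᶠ ε : ℝ in 𝓝[>] 0, ε ≤ 1 :=
      (eventually_le_nhds (zero_lt_one (α := ℝ))).filter_mono nhdsWithin_le_nhds
    obtain ⟨ε, h1, h2, h3⟩ := (h.and (h'.and self_mem_nhdsWithin)).exists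
    exact ⟨ε, h3, h2, h1⟩
  set C := Real.exp (∑ k, ((‖α k‖ + 1) * (2 * π) + (‖β k‖ + 1) * (5 * π)))
  -- A chord `x` is at most `2`. So `x^{2 Re α'}` with `Re α'` within `ε` of `Re α` is at most
  -- `2^{4ε} x^{2 (Re α - ε)}`.
  refine ⟨ε, hε, fun t => C * ∏ k, (2 ^ (4 * ε) * ‖cexp (t * I) - pt θ k‖ ^ (2 * ((α k).re - ε))),
    ?_, ?_⟩
  · simp only [Finset.prod_mul_distrib]
    exact ((integrable_prod_rpow (pt_injective hθ_mono hθ_zero hθ_lt)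
      fun k => by linarith [hεα k]).const_mul _).const_mul _
  · intro α' β' h1 h2 t ht hne
    rw [uIoc_of_le Real.two_pi_pos.le] at ht
    have hpi := Real.pi_pos
    have hk1 : ∀ k, ‖α' k - α k‖ ≤ ε := fun k => (norm_le_pi_norm (α' - α) k).trans h1
    have hk2 : ∀ k, ‖β' k - β k‖ ≤ ε := fun k => (norm_le_pi_norm (β' - β) k).trans h2
    refine (norm_dens_le_exp n α' β' hθ_mono hθ_zero hθ_lt (by
      rw [abs_of_pos ht.1]; linarith [ht.2]) hne).trans ?_
    refine mul_le_mul (Real.exp_le_exp.mpr (Finset.sum_le_sum fun k _ => ?_))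
      (Finset.prod_le_prod (fun k _ => by positivity) fun k _ => ?_)
      (Finset.prod_nonneg fun k _ => by positivity) (Real.exp_pos _).le
    · have e1 : ‖α' k‖ ≤ ‖α k‖ + 1 := by
        have := norm_le_norm_add_norm_sub' (α' k) (α k)
        linarith [hk1 k]
      have e2 : ‖β' k‖ ≤ ‖β k‖ + 1 := by
        have := norm_le_norm_add_norm_sub' (β' k) (β k)
        linarith [hk2 k]
      gcongr
    · set x := ‖cexp (t * I) - pt θ k‖
      have hx : 0 < x := norm_pos_iff.mpr (sub_ne_zero.mpr (hne k))
      have hx2 : x ≤ 2 := by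
        refine (norm_sub_le _ _).trans (le_of_eq ?_)
        rw [norm_exp_ofReal_mul_I, norm_pt]
        norm_num
      have hre := abs_le.1 ((abs_re_le_norm (α' k - α k)).trans (hk1 k))
      rw [sub_re] at hre
      have hsplit : 2 * (α' k).re = 2 * ((α' k).re - (α k).re + ε) + 2 * ((α k).re - ε) := by ring
      rw [hsplit, Real.rpow_add hx]
      refine mul_le_mul_of_nonneg_right ?_ (by positivity)
      calc x ^ (2 * ((α' k).re - (α k).re + ε)) ≤ 2 ^ (2 * ((α' k).re - (α k).re + ε)) :=
            Real.rpow_le_rpow hx.le hx2 (by linarith)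
        _ ≤ 2 ^ (4 * ε) := Real.rpow_le_rpow_of_exponent_le one_le_two (by linarith)

/-- Pairings with the density are continuous in the parameters. -/
lemma continuousAt_pair_dens {g : ℂ → ℂ} (hg : ContinuousOn g (Metric.sphere 0 1)) :
    ContinuousAt (fun p : (Fin (m + 1) → ℂ) × (Fin (m + 1) → ℂ) => pair (dens n θ p.1 p.2) g)
      (α, β) := by
  obtain ⟨ε, hε, G, hG, hb⟩ := exists_dens_bound n α β hθ_mono hθ_zero hθ_lt hα
  have hgc := continuous_comp_circle hg
  unfold pair
  refine ContinuousAt.mul continuousAt_const (intervalIntegral.continuousAt_of_dominated_interval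
    (bound := fun t => G t * ‖g (cexp (t * I))‖) ?_ ?_ ?_ ?_)
  · exact Eventually.of_forall fun p =>
      ((measurable_dens n p.1 p.2).mul hgc.measurable).aestronglyMeasurable
  · have h1 : ∀ᶠ p : (Fin (m + 1) → ℂ) × (Fin (m + 1) → ℂ) in 𝓝 (α, β),
        ‖p.1 - α‖ ≤ ε ∧ ‖p.2 - β‖ ≤ ε := by
      filter_upwards [Metric.closedBall_mem_nhds (α, β) hε] with p hp
      rw [Metric.mem_closedBall, dist_eq_norm] at hp
      exact ⟨(norm_fst_le _).trans hp, (norm_snd_le _).trans hp⟩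
    filter_upwards [h1] with p hp
    filter_upwards [ae_ne_pt (θ := θ)] with t hne ht
    rw [norm_mul]
    exact mul_le_mul_of_nonneg_right (hb _ _ hp.1 hp.2 t ht hne) (norm_nonneg _)
  · exact hG.mul_continuousOn hgc.norm.continuousOn
  · filter_upwards [ae_ne_pt (θ := θ)] with t hne ht
    have : (fun p : (Fin (m + 1) → ℂ) × (Fin (m + 1) → ℂ) => dens n θ p.1 p.2 t) = fun p =>
      cexp (∑ k, (p.1 k * cA θ k t + p.2 k * cB θ k t) - I * ((n : ℂ) - 1) * t) := by
      ext p
      exact dens_eq_exp n _ _ hne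
    refine ContinuousAt.mul ?_ continuousAt_const
    rw [this]
    exact Continuous.continuousAt (by fun_prop)

/-- Differentiation under the integral. For almost every `t` the density is entire in `s`, so
Cauchy's estimate bounds its derivative by the common majorant of the densities, and the logarithms
in the derivative need no separate estimate. -/
lemma pair_dens_deriv_aux (a b : Fin (m + 1) → ℂ) {g : ℂ → ℂ}
    (hg : ContinuousOn g (Metric.sphere 0 1)) :
    IntervalIntegrable (fun t => densDeriv n θ α β a b t * g (cexp (t * I))) volume 0 (2 * π) ∧
    HasDerivAt (fun s : ℂ => ∫ t in (0 : ℝ)..(2 * π),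
      dens n θ (α + s • a) (β + s • b) t * g (cexp (t * I)))
      (∫ t in (0 : ℝ)..(2 * π), densDeriv n θ α β a b t * g (cexp (t * I))) 0 := by
  obtain ⟨ε, hε, G, hG, hb⟩ := exists_dens_bound n α β hθ_mono hθ_zero hθ_lt hα
  have hgc := continuous_comp_circle hg
  -- A point on a circle of radius `r` around a point of the `r`-ball has norm at most `2r`, which
  -- keeps the parameters within `ε`.
  set r := ε / (2 * (‖a‖ + ‖b‖ + 1)) with hr
  have hr0 : 0 < r := by positivity
  have hsmall : ∀ s : ℂ, ‖s‖ ≤ 2 * r → ‖(α + s • a) - α‖ ≤ ε ∧ ‖(β + s • b) - β‖ ≤ ε := by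
    intro s hs
    have hb : ‖s‖ * (‖a‖ + ‖b‖ + 1) ≤ ε := by
      refine (mul_le_mul_of_nonneg_right hs (by positivity)).trans (le_of_eq ?_)
      rw [hr]
      field_simp
    rw [add_sub_cancel_left, add_sub_cancel_left, norm_smul, norm_smul]
    have := norm_nonneg s
    have := norm_nonneg a
    have := norm_nonneg b
    constructor <;> nlinarith
  have h := intervalIntegral.hasDerivAt_integral_of_dominated_loc_of_deriv_le
    (μ := volume) (a := 0) (b := 2 * π) (x₀ := (0 : ℂ)) (s := Metric.ball 0 r)
    (F := fun s t => dens n θ (α + s • a) (β + s • b) t * g (cexp (t * I)))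
    (F' := fun s t => densDeriv n θ (α + s • a) (β + s • b) a b t * g (cexp (t * I)))
    (bound := fun t => G t / r * ‖g (cexp (t * I))‖) (Metric.ball_mem_nhds 0 hr0) ?_ ?_ ?_ ?_ ?_ ?_
  · simpa using h
  · exact Eventually.of_forall fun s =>
      ((measurable_dens n _ _).mul hgc.measurable).aestronglyMeasurable
  · simpa using pair_integrable (integrable_dens n α β hθ_mono hθ_zero hθ_lt hα) hg
  · exact ((measurable_densDeriv n _ _ a b).mul hgc.measurable).aestronglyMeasurable
  · filter_upwards [ae_ne_pt (θ := θ)] with t hne ht s hs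
    rw [norm_mul]
    refine mul_le_mul_of_nonneg_right ?_ (norm_nonneg _)
    rw [← (hasDerivAt_dens n α β a b hne s).deriv]
    refine norm_deriv_le_of_forall_mem_sphere_norm_le hr0 ?_ fun z hz => ?_
    · exact Differentiable.diffContOnCl fun s => (hasDerivAt_dens n α β a b hne s).differentiableAt
    · have hz2 : ‖z‖ ≤ 2 * r := by
        have h1 : ‖z - s‖ = r := by simpa [dist_eq_norm] using hz
        have h2 : ‖s‖ < r := by simpa using hs
        have := norm_le_norm_add_norm_sub' z s
        linarith
      exact hb _ _ (hsmall z hz2).1 (hsmall z hz2).2 t ht hne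
  · exact (hG.div_const r).mul_continuousOn hgc.norm.continuousOn
  · filter_upwards [ae_ne_pt (θ := θ)] with t hne ht s hs
    exact (hasDerivAt_dens n α β a b hne s).mul_const _

lemma integrable_densDeriv (a b : Fin (m + 1) → ℂ) :
    IntervalIntegrable (densDeriv n θ α β a b) volume 0 (2 * π) := by
  simpa using (pair_dens_deriv_aux n α β hθ_mono hθ_zero hθ_lt hα a b (g := fun _ => 1)
    continuousOn_const).1

/-- The directional derivative of the pairing with the density. -/
lemma hasDerivAt_pair_dens (a b : Fin (m + 1) → ℂ) {g : ℂ → ℂ}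
    (hg : ContinuousOn g (Metric.sphere 0 1)) :
    HasDerivAt (fun s : ℂ => pair (dens n θ (α + s • a) (β + s • b)) g)
      (pair (densDeriv n θ α β a b) g) 0 :=
  (pair_dens_deriv_aux n α β hθ_mono hθ_zero hθ_lt hα a b hg).2.const_mul _

end Parameters

/-! ### Orders of growth at infinity. -/

section Growth

lemma eventually_ne_zero_cobounded : ∀ᶠ z : ℂ in cobounded ℂ, z ≠ 0 := by
  filter_upwards [tendsto_norm_cobounded_atTop.eventually_gt_atTop 0] with z hz
  exact norm_pos_iff.mp hz

lemma isBigO_zpow_mul {f g : ℂ → ℂ} {k l j : ℤ} (hf : f =O[cobounded ℂ] fun z => z ^ k)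
    (hg : g =O[cobounded ℂ] fun z => z ^ l) (h : k + l ≤ j) :
    (fun z => f z * g z) =O[cobounded ℂ] fun z => z ^ j := by
  refine (hf.mul hg).trans (Asymptotics.IsBigO.of_bound 1 ?_)
  filter_upwards [tendsto_norm_cobounded_atTop.eventually_ge_atTop 1] with z hz
  have hz0 : z ≠ 0 := norm_pos_iff.mp (by linarith)
  rw [← zpow_add₀ hz0, norm_zpow, norm_zpow, one_mul]
  exact zpow_le_zpow_right₀ hz h

lemma zpow_le_two_pow {x : ℝ} (h1 : 1 / 2 ≤ x) (h2 : x ≤ 2) (k : ℤ) : x ^ k ≤ 2 ^ k.natAbs := by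
  have hx : 0 < x := by linarith
  rcases Int.natAbs_eq k with h | h
  · conv_lhs => rw [h]
    rw [zpow_natCast]
    exact pow_le_pow_left₀ hx.le h2 _
  · conv_lhs => rw [h]
    rw [zpow_neg, zpow_natCast, ← inv_pow]
    refine pow_le_pow_left₀ (inv_nonneg.mpr hx.le) ?_ _
    rw [inv_le_comm₀ hx two_pos]
    linarith

/-- Cauchy's estimate on the disc of radius `|z|/2`, where all moduli are comparable with `|z|`. -/
lemma isBigO_deriv_zpow {f : ℂ → ℂ} {k : ℤ} (hd : ∀ z : ℂ, 1 < ‖z‖ → DifferentiableAt ℂ f z)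
    (hf : f =O[cobounded ℂ] fun z => z ^ k) :
    deriv f =O[cobounded ℂ] fun z => z ^ (k - 1) := by
  obtain ⟨C, hC0, hC⟩ := hf.exists_pos
  obtain ⟨R, -, hR⟩ := (hasBasis_cobounded_norm (E := ℂ)).eventually_iff.mp hC.bound
  refine Asymptotics.IsBigO.of_bound (2 * C * 2 ^ k.natAbs) ?_
  have hT := tendsto_norm_cobounded_atTop (E := ℂ)
  filter_upwards [hT.eventually_gt_atTop 2, hT.eventually_gt_atTop (2 * R)] with z hz1 hz2
  have hz0 : 0 < ‖z‖ := by linarith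
  have hball : ∀ w : ℂ, ‖w - z‖ ≤ ‖z‖ / 2 → ‖z‖ / 2 ≤ ‖w‖ ∧ ‖w‖ ≤ 2 * ‖z‖ := by
    intro w hw
    constructor
    · have := norm_le_norm_add_norm_sub w z
      linarith
    · have := norm_le_norm_add_norm_sub' w z
      linarith
  have h := norm_deriv_le_of_forall_mem_sphere_norm_le (f := f) (c := z) (R := ‖z‖ / 2)
    (C := C * 2 ^ k.natAbs * ‖z‖ ^ k) (by positivity) ?_ ?_
  · refine h.trans (le_of_eq ?_)
    rw [norm_zpow, zpow_sub_one₀ hz0.ne']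
    field_simp
  · refine DifferentiableOn.diffContOnCl fun w hw => ?_
    rw [closure_ball _ (by positivity)] at hw
    have := (hball w (by simpa [dist_eq_norm] using hw)).1
    exact (hd w (by linarith)).differentiableWithinAt
  · intro w hw
    obtain ⟨h1, h2⟩ := hball w (le_of_eq (by simpa [dist_eq_norm] using hw))
    refine (hR (show R ≤ ‖w‖ by linarith)).trans ?_
    rw [mul_assoc, norm_zpow]
    refine mul_le_mul_of_nonneg_left ?_ hC0.le
    have hx : ‖w‖ ^ k = (‖w‖ / ‖z‖) ^ k * ‖z‖ ^ k := by
      rw [← mul_zpow, div_mul_cancel₀ _ hz0.ne']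
    rw [hx]
    refine mul_le_mul_of_nonneg_right (zpow_le_two_pow ?_ ?_ k) (by positivity)
    · rw [le_div_iff₀ hz0]; linarith
    · rw [div_le_iff₀ hz0]; exact h2

lemma isBigO_pol_zpow (n : ℕ) (c : ℕ → ℂ) : pol n c =O[cobounded ℂ] fun z => z ^ (n : ℤ) := by
  unfold pol
  refine Asymptotics.IsBigO.fun_sum fun i hi => Asymptotics.IsBigO.const_mul_left ?_ _
  refine Asymptotics.IsBigO.of_bound 1 ?_
  filter_upwards [tendsto_norm_cobounded_atTop.eventually_ge_atTop 1] with z hz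
  rw [norm_pow, zpow_natCast, norm_pow, one_mul]
  exact pow_le_pow_right₀ hz (by simpa [Nat.lt_succ_iff] using hi)

lemma isBigO_pol_zpow_sub_one {n : ℕ} {c : ℕ → ℂ} (h : c n = 0) :
    pol n c =O[cobounded ℂ] fun z => z ^ ((n : ℤ) - 1) := by
  unfold pol
  simp only [Finset.sum_range_succ, h, zero_mul, add_zero]
  refine Asymptotics.IsBigO.fun_sum fun i hi => Asymptotics.IsBigO.const_mul_left ?_ _
  refine Asymptotics.IsBigO.of_bound 1 ?_
  filter_upwards [tendsto_norm_cobounded_atTop.eventually_ge_atTop 1] with z hz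
  rw [← zpow_natCast, norm_zpow, norm_zpow, one_mul]
  have := Finset.mem_range.mp hi
  exact zpow_le_zpow_right₀ hz (by omega)

/-- If `z^n f = O(1/z)` then `f = O(z^{-n-1})`. -/
lemma isBigO_zpow_of_mul {n : ℕ} {f g : ℂ → ℂ} {k : ℤ} (hg : g =O[cobounded ℂ] fun z => z ^ k)
    (h : ∀ᶠ z in cobounded ℂ, f z * z ^ n = g z) :
    f =O[cobounded ℂ] fun z => z ^ (k - n) := by
  have h1 : (fun z : ℂ => z ^ (-(n : ℤ))) =O[cobounded ℂ] fun z => z ^ (-(n : ℤ)) :=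
    Asymptotics.isBigO_refl _ _
  refine (isBigO_zpow_mul hg h1 (by omega : k + -(n : ℤ) ≤ k - n)).congr' ?_ EventuallyEq.rfl
  filter_upwards [h, eventually_ne_zero_cobounded] with z hz hz0
  rw [← hz, zpow_neg, zpow_natCast, mul_assoc, mul_inv_cancel₀ (pow_ne_zero n hz0), mul_one]

end Growth

/-! ### The Christoffel-Darboux formula. -/

section ChristoffelDarboux

variable {V : ℝ → ℂ} (hV : IntervalIntegrable V volume 0 (2 * π)) {n : ℕ}

lemma hankel_inv_symm (i k : Fin n) : (hankel V n)⁻¹ i k = (hankel V n)⁻¹ k i := by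
  have h : (hankel V n).transpose = hankel V n := by
    ext i k
    simp [hankel, add_comm]
  calc (hankel V n)⁻¹ i k = ((hankel V n)⁻¹).transpose k i := rfl
    _ = _ := by rw [Matrix.transpose_nonsing_inv, h]

/-- The coefficients of the Christoffel-Darboux kernel in its first variable. -/
def kerCoef (V : ℝ → ℂ) (n : ℕ) (t : ℂ) (i : ℕ) : ℂ :=
  if h : i < n then ((hankel V n)⁻¹.mulVec fun k => t ^ (k : ℕ)) ⟨i, h⟩ else 0

lemma pol_of_lt {c : ℕ → ℂ} (h : c n = 0) (z : ℂ) : pol n c z = ∑ i : Fin n, c i * z ^ (i : ℕ) := by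
  rw [pol, Finset.sum_range_succ, h, zero_mul, add_zero, Finset.sum_range]

lemma pol_kerCoef (t z : ℂ) : pol n (kerCoef V n t) z =
    ∑ i : Fin n, ∑ k : Fin n, (hankel V n)⁻¹ i k * (t ^ (k : ℕ) * z ^ (i : ℕ)) := by
  rw [pol_of_lt (by simp [kerCoef])]
  refine Finset.sum_congr rfl fun i _ => ?_
  simp only [kerCoef, i.2, dite_true, Matrix.mulVec, dotProduct, Finset.sum_mul, mul_assoc]

include hV

lemma pol_eq_zero (hd : (hankel V n).det ≠ 0) {c : ℕ → ℂ} (hc : c n = 0)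
    (h : ∀ k < n, pair V (fun s => s ^ k * pol n c s) = 0) (z : ℂ) : pol n c z = 0 := by
  have h1 : (hankel V n).mulVec (fun i => c i) = 0 := by
    ext k
    rw [Pi.zero_apply, ← h k k.2, pair_pow_mul_pol hV, Finset.sum_range_succ, hc, zero_mul,
      add_zero, Finset.sum_range]
    simp only [Matrix.mulVec, dotProduct, hankel, Matrix.of_apply, add_comm, mul_comm]
  have h2 := Matrix.eq_zero_of_mulVec_eq_zero hd h1
  rw [pol_of_lt hc]
  exact Finset.sum_eq_zero fun i _ => by rw [show c i = 0 from congrFun h2 i, zero_mul]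

/-- The reproducing property of the kernel on powers below `n`. -/
lemma pair_pow_mul_kerCoef (hd : (hankel V n).det ≠ 0) (t : ℂ) {k : ℕ} (hk : k < n) :
    pair V (fun s => s ^ k * pol n (kerCoef V n t) s) = t ^ k := by
  rw [pair_pow_mul_pol hV, Finset.sum_range_succ, Finset.sum_range]
  have h1 : ∑ i : Fin n, kerCoef V n t i * mom V (i + k) =
      ((hankel V n).mulVec ((hankel V n)⁻¹.mulVec fun k => t ^ (k : ℕ))) ⟨k, hk⟩ := by
    rw [Matrix.mulVec, dotProduct]
    refine Finset.sum_congr rfl fun i _ => ?_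
    simp only [kerCoef, i.2, dite_true, hankel, Matrix.of_apply, add_comm k]
    ring
  rw [h1, Matrix.mulVec_mulVec, Matrix.mul_nonsing_inv _ (Ne.isUnit hd), Matrix.one_mulVec]
  simp [kerCoef]

/-- At degree `n` reproduction fails by the monic orthogonal polynomial, by the symmetry of the
inverse Hankel matrix. -/
lemma pair_pow_self_mul_kerCoef (t : ℂ) :
    pair V (fun s => s ^ n * pol n (kerCoef V n t) s) = t ^ n - pol n (coef0 V n) t := by
  rw [pair_pow_mul_pol hV, Finset.sum_range_succ, Finset.sum_range, pol, Finset.sum_range_succ,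
    Finset.sum_range]
  have h1 : ∀ i : Fin n, coef0 V n i * t ^ (i : ℕ) =
      -∑ k, (hankel V n)⁻¹ i k * mom V (n + k) * t ^ (i : ℕ) := by
    intro i
    simp only [coef0, i.2, dite_true, Matrix.mulVec, dotProduct, neg_mul, Finset.sum_mul]
  have h2 : ∀ i : Fin n, kerCoef V n t i * mom V (i + n) =
      ∑ k, (hankel V n)⁻¹ i k * t ^ (k : ℕ) * mom V (i + n) := by
    intro i
    simp only [kerCoef, i.2, dite_true, Matrix.mulVec, dotProduct, Finset.sum_mul]
  simp only [h1, h2, Finset.sum_neg_distrib]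
  rw [Finset.sum_comm]
  simp only [kerCoef, coef0, lt_irrefl, dite_false, zero_mul, add_zero, if_true, one_mul]
  rw [neg_add_eq_sub, sub_sub_cancel]
  refine Finset.sum_congr rfl fun i _ => Finset.sum_congr rfl fun k _ => ?_
  rw [hankel_inv_symm, add_comm n]
  ring

/-- The difference of the two sides has no term of degree `n` in `s` and is orthogonal to all powers
below `n`, so it vanishes because the Hankel matrix is invertible. -/
lemma christoffel_darboux (hn : 1 ≤ n) (hd : (hankel V n).det ≠ 0) (t s : ℂ) :
    (s - t) * pol n (kerCoef V n t) s = pol n (coef0 V n) t * pol n (coef1 V n) s -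
      pol n (coef1 V n) t * pol n (coef0 V n) s := by
  set x := pol n (coef0 V n) t
  set y := pol n (coef1 V n) t with hy
  set c : ℕ → ℂ := fun i => (if i = 0 then 0 else kerCoef V n t (i - 1)) - t * kerCoef V n t i -
    x * coef1 V n i + y * coef0 V n i with hc
  have hkn : kerCoef V n t n = 0 := by simp [kerCoef]
  have hpol : ∀ s, pol n c s = s * pol n (kerCoef V n t) s - t * pol n (kerCoef V n t) s -
      x * pol n (coef1 V n) s + y * pol n (coef0 V n) s := by
    intro s
    have h1 : s * pol n (kerCoef V n t) s =
        ∑ i ∈ Finset.range (n + 1), (if i = 0 then 0 else kerCoef V n t (i - 1)) * s ^ i := by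
      rw [pol, Finset.sum_range_succ, hkn, Finset.sum_range_succ']
      simp only [zero_mul, add_zero, Finset.mul_sum, if_true, Nat.add_eq_zero_iff, one_ne_zero,
        and_false, if_false, Nat.add_sub_cancel]
      exact Finset.sum_congr rfl fun i _ => by ring
    rw [h1]
    simp only [pol, Finset.mul_sum, ← Finset.sum_sub_distrib, ← Finset.sum_add_distrib]
    exact Finset.sum_congr rfl fun i _ => by simp only [hc]; ring
  -- The top coefficient of the kernel, as a function of `t`, is minus the second orthogonal
  -- polynomial. This cancels against the monic polynomial multiplied by `y`.
  have hcn : c n = 0 := by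
    have h1 : y = -kerCoef V n t (n - 1) := by
      rw [hy, pol_of_lt (by simp [coef1]), kerCoef, dif_pos (by omega), Matrix.mulVec, dotProduct,
        ← Finset.sum_neg_distrib]
      refine Finset.sum_congr rfl fun i _ => ?_
      have h2 : ∀ k : Fin n, (k : ℕ) + 1 = n ↔ k = ⟨n - 1, by omega⟩ := by
        intro k
        rw [Fin.ext_iff]
        simp only
        omega
      simp only [coef1, i.2, dite_true, Matrix.mulVec, dotProduct, h2, mul_ite, mul_one, mul_zero,
        Finset.sum_ite_eq', Finset.mem_univ, if_true, Fin.eta]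
      rw [hankel_inv_symm]
      ring
    have hn0 : n ≠ 0 := by omega
    simp only [hc, hkn, coef1, coef0, lt_irrefl, dite_false, if_true, hn0, if_false]
    rw [h1]
    ring
  have h := pol_eq_zero hV hd hcn (fun k hk => ?_) s
  · rw [hpol] at h
    linear_combination h
  · have hcont := fun c => (continuous_pol n c).continuousOn (s := Metric.sphere (0 : ℂ) 1)
    have e0 := hcont (coef0 V n)
    have e1 := hcont (coef1 V n)
    have e2 := hcont (kerCoef V n t)
    have h1 : (fun s => s ^ k * pol n c s) = fun s =>
        (s ^ (k + 1) * pol n (kerCoef V n t) s - t * (s ^ k * pol n (kerCoef V n t) s)) -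
          x * (s ^ k * pol n (coef1 V n) s) + y * (s ^ k * pol n (coef0 V n) s) := by
      ext s
      rw [hpol]
      ring
    rw [h1, pair_add hV (by fun_prop) (by fun_prop), pair_sub hV (by fun_prop) (by fun_prop),
      pair_sub hV (by fun_prop) (by fun_prop), pair_const_mul, pair_const_mul, pair_const_mul,
      pair_pow_mul_kerCoef hV hd t hk, pair_pow_mul_coef0 hV hd hk, pair_pow_mul_coef1 hV hd hk]
    by_cases h2 : k + 1 = n
    · rw [if_pos h2, h2, pair_pow_self_mul_kerCoef hV, ← h2]
      simp only [x, ← h2]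
      ring
    · rw [if_neg h2, pair_pow_mul_kerCoef hV hd t (by omega)]
      ring

/-- The confluent Christoffel-Darboux formula. -/
lemma christoffel_darboux_diag (hn : 1 ≤ n) (hd : (hankel V n).det ≠ 0) (z : ℂ) :
    pol n (coef0 V n) z * deriv (pol n (coef1 V n)) z -
      pol n (coef1 V n) z * deriv (pol n (coef0 V n)) z =
      ∑ i : Fin n, ∑ k : Fin n, (hankel V n)⁻¹ i k * z ^ ((i : ℕ) + k) := by
  have hD : ∀ c, HasDerivAt (pol n c) (deriv (pol n c) z) z := fun c =>
    (differentiable_pol n c z).hasDerivAt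
  have h1 := ((hasDerivAt_id z).sub_const z).mul (hD (kerCoef V n z))
  have h2 := ((hD (coef1 V n)).const_mul (pol n (coef0 V n) z)).sub
    ((hD (coef0 V n)).const_mul (pol n (coef1 V n) z))
  have h3 := h1.unique (h2.congr_of_eventuallyEq (Eventually.of_forall fun s =>
    christoffel_darboux hV hn hd z s))
  simp only [id, sub_self, zero_mul, add_zero, one_mul] at h3
  rw [← h3, pol_kerCoef]
  refine Finset.sum_congr rfl fun i _ => Finset.sum_congr rfl fun k _ => ?_
  rw [← pow_add, add_comm]

end ChristoffelDarboux

/-! ### The residue identity. -/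

section Identity

variable {V W : ℝ → ℂ} (hV : IntervalIntegrable V volume 0 (2 * π))
  (hW : IntervalIntegrable W volume 0 (2 * π)) {n : ℕ}

/-- The derivative of the second kind polynomial with respect to a parameter, if the density has
derivative `W` and the coefficients have derivative `e`. -/
def spolDot (V W : ℝ → ℂ) (n : ℕ) (c e : ℕ → ℂ) (z : ℂ) : ℂ := spol W n c z + spol V n e z

lemma differentiable_spolDot (V W : ℝ → ℂ) (n : ℕ) (c e : ℕ → ℂ) :
    Differentiable ℂ (spolDot V W n c e) :=
  (differentiable_spol W n c).add (differentiable_spol V n e)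

lemma differentiable_deriv {f : ℂ → ℂ} (hf : Differentiable ℂ f) : Differentiable ℂ (deriv f) :=
  fun z => ((hf.analyticAt z).deriv).differentiableAt

lemma differentiable_dslope {f : ℂ → ℂ} (hf : Differentiable ℂ f) (c : ℂ) :
    Differentiable ℂ (dslope f c) := by
  rw [← differentiableOn_univ, differentiableOn_dslope univ_mem]
  exact hf.differentiableOn

lemma isBigO_pair_div_zpow (hV : IntervalIntegrable V volume 0 (2 * π)) {g : ℂ → ℂ}
    (hg : ContinuousOn g (Metric.sphere 0 1)) :
    (fun z => pair V fun s => g s * (s - z)⁻¹) =O[cobounded ℂ] fun z => z ^ (-1 : ℤ) := by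
  simpa only [zpow_neg_one] using isBigO_pair_div hV hg

include hV hW in
-- The analogue of `pair_pow_mul_div` for differentiated orthogonality relations, where only the sum
-- of the two moments vanishes.
lemma pair_pow_mul_div_add {f g : ℂ → ℂ} (hf : ContinuousOn f (Metric.sphere 0 1))
    (hg : ContinuousOn g (Metric.sphere 0 1)) {z : ℂ} (hz : ‖z‖ ≠ 1) (n : ℕ)
    (h : ∀ k < n, pair W (fun s => s ^ k * f s) + pair V (fun s => s ^ k * g s) = 0) :
    (pair W (fun s => s ^ n * f s * (s - z)⁻¹) + pair V fun s => s ^ n * g s * (s - z)⁻¹) =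
      z ^ n * (pair W (fun s => f s * (s - z)⁻¹) + pair V fun s => g s * (s - z)⁻¹) := by
  induction n with
  | zero => simp
  | succ n ih =>
    have h1 := pair_mul_id_div (g := fun s => s ^ n * f s) hW (by fun_prop) hz
    have h2 := pair_mul_id_div (g := fun s => s ^ n * g s) hV (by fun_prop) hz
    have h3 := ih fun k hk => h k (by omega)
    have h4 : ∀ f : ℂ → ℂ, (fun s => s ^ (n + 1) * f s * (s - z)⁻¹) =
        fun s => s * (s ^ n * f s) * (s - z)⁻¹ := by
      intro f
      ext s
      ring
    rw [h4, h4, h1, h2]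
    linear_combination h n (by omega) + z * h3

/-- The derivative of a Cauchy transform with vanishing moments decays. -/
lemma isBigO_dot (c e : ℕ → ℂ) (hV : IntervalIntegrable V volume 0 (2 * π))
    (hW : IntervalIntegrable W volume 0 (2 * π))
    (h : ∀ k < n, pair W (fun s => s ^ k * pol n c s) + pair V (fun s => s ^ k * pol n e s) = 0) :
    (fun z => pol n e z * cauchyT V z + pol n c z * cauchyT W z + spolDot V W n c e z)
      =O[cobounded ℂ] fun z => z ^ (-1 - n : ℤ) := by
  have hc := (continuous_pol n c).continuousOn (s := Metric.sphere (0 : ℂ) 1)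
  have he := (continuous_pol n e).continuousOn (s := Metric.sphere (0 : ℂ) 1)
  refine isBigO_zpow_of_mul (k := -1) ((isBigO_pair_div_zpow (g := fun s => s ^ n * pol n c s) hW
    (by fun_prop)).add (isBigO_pair_div_zpow (g := fun s => s ^ n * pol n e s) hV (by fun_prop))) ?_
  filter_upwards [eventually_norm_ne_one] with z hz
  rw [pair_pow_mul_div_add hV hW hc he hz n h, ← pol_mul_cauchyT hW n c hz,
    ← pol_mul_cauchyT hV n e hz, spolDot]
  ring

/-- The coefficients of the confluent Christoffel-Darboux kernel. -/
def diagCoef (V : ℝ → ℂ) (n : ℕ) (l : ℕ) : ℂ :=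
  ∑ i : Fin n, ∑ k : Fin n, if (i : ℕ) + k = l then (hankel V n)⁻¹ i k else 0

lemma pol_diagCoef (z : ℂ) : pol (2 * n) (diagCoef V n) z =
    ∑ i : Fin n, ∑ k : Fin n, (hankel V n)⁻¹ i k * z ^ ((i : ℕ) + k) := by
  simp only [pol, diagCoef, Finset.sum_mul]
  rw [Finset.sum_comm]
  refine Finset.sum_congr rfl fun i _ => ?_
  rw [Finset.sum_comm]
  refine Finset.sum_congr rfl fun k _ => ?_
  simp only [ite_mul, zero_mul, Finset.sum_ite_eq]
  rw [if_pos (Finset.mem_range.mpr (by have := i.2; have := k.2; omega))]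

/-- This is the trace of the inverse Hankel matrix of `V` times the Hankel matrix of `W`, the right
side of Jacobi's formula. -/
lemma pair_diagCoef (hW : IntervalIntegrable W volume 0 (2 * π)) :
    pair W (pol (2 * n) (diagCoef V n)) =
      ∑ i : Fin n, ∑ k : Fin n, (hankel V n)⁻¹ i k * mom W (i + k) := by
  have : pol (2 * n) (diagCoef V n) = fun z =>
      ∑ i : Fin n, ∑ k : Fin n, (hankel V n)⁻¹ i k * z ^ ((i : ℕ) + k) := by
    ext z
    exact pol_diagCoef z
  rw [this, pair_sum _ hW fun i _ => by fun_prop]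
  refine Finset.sum_congr rfl fun i _ => ?_
  rw [pair_sum _ hW fun i _ => by fun_prop]
  exact Finset.sum_congr rfl fun k _ => pair_const_mul _ _

include hV hW

/-- The trace of the logarithmic derivative of the Hankel matrix as a sum of residues. -/
theorem residue_identity {ι : Type*} [Fintype ι] (hn : 1 ≤ n) (hd : (hankel V n).det ≠ 0)
    {e0 e1 : ℕ → ℂ} (he0 : e0 n = 0) (he1 : e1 n = 0)
    (h0 : ∀ k < n, pair W (fun s => s ^ k * pol n (coef0 V n) s) +
      pair V (fun s => s ^ k * pol n e0 s) = 0)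
    (h1 : ∀ k < n, pair W (fun s => s ^ k * pol n (coef1 V n) s) +
      pair V (fun s => s ^ k * pol n e1 s) = 0)
    (x A R : ι → ℂ) (hx : ∀ j, ‖x j‖ ≤ 1)
    (hF : ∀ z : ℂ, 1 < ‖z‖ → HasDerivAt (cauchyT V)
      (2 * (∑ j, A j / (z - x j)) * cauchyT V z + ∑ j, R j / (z - x j)) z) :
    ∑ j, (A j * ((spol V n (coef1 V n) (x j) * pol n e0 (x j) -
        spol V n (coef0 V n) (x j) * pol n e1 (x j)) -
        (pol n (coef0 V n) (x j) * spolDot V W n (coef1 V n) e1 (x j) -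
          pol n (coef1 V n) (x j) * spolDot V W n (coef0 V n) e0 (x j))) +
      R j * (pol n (coef0 V n) (x j) * pol n e1 (x j) -
        pol n (coef1 V n) (x j) * pol n e0 (x j))) =
    ∑ i : Fin n, ∑ k : Fin n, (hankel V n)⁻¹ i k * mom W (i + k) := by
  set p0 := pol n (coef0 V n)
  set p1 := pol n (coef1 V n)
  set q0 := spol V n (coef0 V n)
  set q1 := spol V n (coef1 V n)
  set a0 := pol n e0
  set a1 := pol n e1
  set b0 := spolDot V W n (coef0 V n) e0
  set b1 := spolDot V W n (coef1 V n) e1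
  set F := cauchyT V
  set Fd := cauchyT W
  have dp0 : Differentiable ℂ p0 := differentiable_pol _ _
  have dp1 : Differentiable ℂ p1 := differentiable_pol _ _
  have dq0 : Differentiable ℂ q0 := differentiable_spol _ _ _
  have dq1 : Differentiable ℂ q1 := differentiable_spol _ _ _
  have da0 : Differentiable ℂ a0 := differentiable_pol _ _
  have da1 : Differentiable ℂ a1 := differentiable_pol _ _
  have db0 : Differentiable ℂ b0 := differentiable_spolDot _ _ _ _ _
  have db1 : Differentiable ℂ b1 := differentiable_spolDot _ _ _ _ _
  -- `C0`, `C1` are the second column of `P upper(F)`, and `D0`, `D1` are its derivatives in the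
  -- parameter. Orthogonality and its derivative make them small at infinity.
  set C0 : ℂ → ℂ := fun z => p0 z * F z + q0 z with hC0
  set C1 : ℂ → ℂ := fun z => p1 z * F z + q1 z with hC1
  set D0 : ℂ → ℂ := fun z => a0 z * F z + p0 z * Fd z + b0 z with hD0
  set D1 : ℂ → ℂ := fun z => a1 z * F z + p1 z * Fd z + b1 z with hD1
  set r : ℂ → ℂ := fun z => ∑ j, A j / (z - x j) with hr
  set g : ℂ → ℂ := fun z => (q1 z * a0 z - q0 z * a1 z) - (p0 z * b1 z - p1 z * b0 z) with hg
  set w : ℂ → ℂ := fun z => p0 z * a1 z - p1 z * a0 z with hw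
  set c : ι → ℂ → ℂ := fun j z => A j * g z + R j * w z with hc
  set T : ℂ → ℂ := fun z => -(deriv q1 z * a0 z + deriv p0 z * b1 z - deriv q0 z * a1 z -
    deriv p1 z * b0 z) with hT
  set K := pol (2 * n) (diagCoef V n) with hK
  have hKeq : ∀ z, p0 z * deriv p1 z - p1 z * deriv p0 z = K z := fun z => by
    rw [christoffel_darboux_diag hV hn hd, hK, pol_diagCoef]
  have dC : ∀ z : ℂ, 1 < ‖z‖ → HasDerivAt C0
      (deriv p0 z * F z + p0 z * (2 * r z * F z + ∑ j, R j / (z - x j)) + deriv q0 z) z ∧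
      HasDerivAt C1
      (deriv p1 z * F z + p1 z * (2 * r z * F z + ∑ j, R j / (z - x j)) + deriv q1 z) z :=
    fun z hz => ⟨((dp0 z).hasDerivAt.mul (hF z hz)).add (dq0 z).hasDerivAt,
      ((dp1 z).hasDerivAt.mul (hF z hz)).add (dq1 z).hasDerivAt⟩
  -- growth at infinity
  have gp0 : p0 =O[cobounded ℂ] fun z => z ^ (n : ℤ) := isBigO_pol_zpow _ _
  have gp1 : p1 =O[cobounded ℂ] fun z => z ^ ((n : ℤ) - 1) :=
    isBigO_pol_zpow_sub_one (by simp [coef1])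
  have ga0 : a0 =O[cobounded ℂ] fun z => z ^ ((n : ℤ) - 1) := isBigO_pol_zpow_sub_one he0
  have ga1 : a1 =O[cobounded ℂ] fun z => z ^ ((n : ℤ) - 1) := isBigO_pol_zpow_sub_one he1
  have gD0 : D0 =O[cobounded ℂ] fun z => z ^ (-1 - n : ℤ) := isBigO_dot _ _ hV hW h0
  have gD1 : D1 =O[cobounded ℂ] fun z => z ^ (-1 - n : ℤ) := isBigO_dot _ _ hV hW h1
  have hp0c : ContinuousOn p0 (Metric.sphere 0 1) := dp0.continuous.continuousOn
  have hp1c : ContinuousOn p1 (Metric.sphere 0 1) := dp1.continuous.continuousOn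
  have gC0 : C0 =O[cobounded ℂ] fun z => z ^ (-1 - n : ℤ) := by
    refine isBigO_zpow_of_mul (k := -1)
      (isBigO_pair_div_zpow (g := fun s => s ^ n * p0 s) hV (by fun_prop)) ?_
    filter_upwards [eventually_norm_ne_one] with z hz
    exact pair_coef0_div hV hd hz
  have gC1 : C1 =O[cobounded ℂ] fun z => z ^ (0 - n : ℤ) := by
    have hone : (fun z => 1 + pair V fun s => s ^ n * p1 s * (s - z)⁻¹) =O[cobounded ℂ]
        fun z => z ^ (0 : ℤ) := by
      simp only [zpow_zero]
      refine (Asymptotics.isBigO_refl _ _).add ((isBigO_pair_div (g := fun s => s ^ n * p1 s) hV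
        (by fun_prop)).trans (tendsto_inv_cobounded.isBigO_one ℂ))
    refine isBigO_zpow_of_mul hone ?_
    filter_upwards [eventually_norm_ne_one] with z hz
    exact pair_coef1_div hV hn hd hz
  have gC0' := isBigO_deriv_zpow (fun z hz => (dC z hz).1.differentiableAt) gC0
  have gC1' := isBigO_deriv_zpow (fun z hz => (dC z hz).2.differentiableAt) gC1
  have gp0' := isBigO_deriv_zpow (fun z _ => dp0 z) gp0
  have gp1' := isBigO_deriv_zpow (fun z _ => dp1 z) gp1
  have gr : r =O[cobounded ℂ] fun z => z ^ (-1 : ℤ) := by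
    refine Asymptotics.IsBigO.fun_sum fun j _ => ?_
    simp only [div_eq_mul_inv]
    refine Asymptotics.IsBigO.const_mul_left (Asymptotics.IsBigO.of_bound 2 ?_) _
    filter_upwards [tendsto_norm_cobounded_atTop.eventually_ge_atTop 2] with z hz
    rw [zpow_neg_one, norm_inv, norm_inv, inv_eq_one_div, ← div_eq_mul_inv,
      div_le_div_iff₀ _ (by linarith)]
    · have := norm_sub_norm_le z (x j)
      linarith [hx j]
    · have := norm_sub_norm_le z (x j)
      linarith [hx j]
  -- Written in decaying quantities, `Q` is `O(z⁻²)`. On inserting the definitions and the equation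
  -- for `F`, all terms with `F` cancel. What remains is `r g + (∑ R_j/(z - x_j)) w + T + K Fd`,
  -- where `K` is the diagonal Christoffel-Darboux kernel, and comparing the coefficients of `1/z`
  -- yields the identity.
  set Q : ℂ → ℂ := fun z => r z * (C1 z * a0 z - C0 z * a1 z - p0 z * D1 z + p1 z * D0 z) -
    (deriv C1 z * a0 z + deriv p0 z * D1 z - deriv C0 z * a1 z - deriv p1 z * D0 z) with hQ
  have gQ : Q =O[cobounded ℂ] fun z => z ^ (-2 : ℤ) := by
    refine Asymptotics.IsBigO.sub (isBigO_zpow_mul gr (l := -1) ?_ (by norm_num)) ?_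
    · exact (((isBigO_zpow_mul gC1 ga0 (by omega)).sub (isBigO_zpow_mul gC0 ga1 (by omega))).sub
        (isBigO_zpow_mul gp0 gD1 (by omega))).add (isBigO_zpow_mul gp1 gD0 (by omega))
    · exact (((isBigO_zpow_mul gC1' ga0 (by omega)).add (isBigO_zpow_mul gp0' gD1 (by omega))).sub
        (isBigO_zpow_mul gC0' ga1 (by omega))).sub (isBigO_zpow_mul gp1' gD0 (by omega))
  -- the entire part
  set Ent : ℂ → ℂ := fun z => T z + ∑ j, dslope (c j) (x j) z - spol W (2 * n) (diagCoef V n) z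
    with hEnt
  have dg : Differentiable ℂ g := by fun_prop
  have dw : Differentiable ℂ w := by fun_prop
  have dc : ∀ j, Differentiable ℂ (c j) := fun j => (dg.const_mul _).add (dw.const_mul _)
  have dEnt : Differentiable ℂ Ent := by
    have t1 := differentiable_deriv dp0
    have t2 := differentiable_deriv dp1
    have t3 := differentiable_deriv dq0
    have t4 := differentiable_deriv dq1
    have t5 := differentiable_spol W (2 * n) (diagCoef V n)
    have t6 : Differentiable ℂ fun z => ∑ j, dslope (c j) (x j) z :=
      Differentiable.fun_sum fun j _ => differentiable_dslope (dc j) (x j)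
    fun_prop
  have key : ∀ z : ℂ, 1 < ‖z‖ → Q z = Ent z + ∑ j, c j (x j) / (z - x j) +
      pair W fun s => K s * (s - z)⁻¹ := by
    intro z hz
    have hzx : ∀ j, z - x j ≠ 0 := by
      intro j h
      rw [sub_eq_zero] at h
      rw [h] at hz
      linarith [hx j]
    have e1 : ∑ j, dslope (c j) (x j) z + ∑ j, c j (x j) / (z - x j) = ∑ j, c j z / (z - x j) := by
      rw [← Finset.sum_add_distrib]
      refine Finset.sum_congr rfl fun j _ => ?_
      have := sub_smul_dslope (c j) (x j) z
      rw [smul_eq_mul] at this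
      rw [eq_div_iff (hzx j), add_mul, div_mul_cancel₀ _ (hzx j)]
      linear_combination this
    have e2 : ∑ j, c j z / (z - x j) = r z * g z + (∑ j, R j / (z - x j)) * w z := by
      rw [hr, Finset.sum_mul, Finset.sum_mul, ← Finset.sum_add_distrib]
      exact Finset.sum_congr rfl fun j _ => by rw [hc]; ring
    have e3 := pol_mul_cauchyT hW (2 * n) (diagCoef V n) (z := z) hz.ne'
    have e4 := hKeq z
    rw [hQ]
    simp only
    rw [(dC z hz).1.deriv, (dC z hz).2.deriv]
    simp only [hEnt]
    change K z * Fd z + _ = _ at e3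
    rw [← e3, ← e4, eq_sub_of_add_eq e1, e2]
    simp only [hC0, hC1, hD0, hD1, hT, hg, hw]
    ring
  have lim : Tendsto (fun z => z * Ent z) (cobounded ℂ)
      (𝓝 (pair W K - ∑ j, c j (x j))) := by
    have hKc : ContinuousOn K (Metric.sphere 0 1) := (continuous_pol _ _).continuousOn
    have l1 : Tendsto (fun z => z * Q z) (cobounded ℂ) (𝓝 0) := by
      have h := isBigO_zpow_mul (f := fun z => z) (k := 1) (j := -1)
        (by simpa using Asymptotics.isBigO_refl _ _) gQ (by norm_num)
      simp only [zpow_neg_one] at h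
      exact h.trans_tendsto tendsto_inv_cobounded
    have l2 : Tendsto (fun z => ∑ j, c j (x j) * (z / (z - x j))) (cobounded ℂ)
        (𝓝 (∑ j, c j (x j))) := by
      refine tendsto_finsetSum _ fun j _ => ?_
      have h := (((tendsto_inv_cobounded.const_mul (x j)).const_sub 1).inv₀ (by simp)).const_mul
        (c j (x j))
      simp only [mul_zero, sub_zero, inv_one, mul_one] at h
      refine h.congr' ?_
      filter_upwards [eventually_ne_zero_cobounded] with z hz
      congr 1
      rw [← div_eq_mul_inv, one_sub_div hz, inv_div]
    have l3 : Tendsto (fun z => pair W (fun s => s * K s * (s - z)⁻¹)) (cobounded ℂ) (𝓝 0) :=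
      (isBigO_pair_div (g := fun s => s * K s) hW (by fun_prop)).trans_tendsto tendsto_inv_cobounded
    have h := (l1.sub l2).sub (l3.sub_const (pair W K))
    rw [show 0 - ∑ j, c j (x j) - (0 - pair W K) = pair W K - ∑ j, c j (x j) by ring] at h
    refine h.congr' ?_
    filter_upwards [tendsto_norm_cobounded_atTop.eventually_gt_atTop 1] with z hz
    rw [key z hz, pair_mul_id_div hW hKc hz.ne']
    have : ∑ j, c j (x j) * (z / (z - x j)) = z * ∑ j, c j (x j) / (z - x j) := by
      rw [Finset.mul_sum]
      exact Finset.sum_congr rfl fun j _ => by ring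
    rw [this]
    ring
  -- The function `z Ent(z)` is entire with a limit at infinity, hence constant, and it vanishes at
  -- `0`. So the residues sum to the pairing of `W` with `K`.
  have hfin := eq_of_tendsto_cobounded (differentiable_id.mul dEnt) lim 0
  simp only [zero_mul, Pi.mul_apply] at hfin
  rw [← pair_diagCoef hW]
  linear_combination hfin

end Identity

/-! ### Derivatives of determinants and inverses. -/

section Determinant

variable {ι : Type*} [Fintype ι] [DecidableEq ι] {M : ℂ → Matrix ι ι ℂ} {t : ℂ}

/-- Jacobi's formula. -/
lemma hasDerivAt_det {M' : Matrix ι ι ℂ}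
    (h : ∀ i k, HasDerivAt (fun s => M s i k) (M' i k) t) :
    HasDerivAt (fun s => (M s).det) (∑ i, ∑ k, (M t).adjugate i k * M' k i) t := by
  simp only [Matrix.det_apply]
  have h1 := HasDerivAt.fun_sum (u := (Finset.univ : Finset (Equiv.Perm ι))) fun σ _ =>
    (HasDerivAt.fun_finsetProd (u := (Finset.univ : Finset ι)) fun i _ =>
      h (σ i) i).const_smul (Equiv.Perm.sign σ)
  refine HasDerivAt.congr_deriv h1 ?_
  symm
  have h2 : ∀ i, ∑ k, (M t).adjugate i k * M' k i = ((M t).updateCol i fun k => M' k i).det := by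
    intro i
    rw [← Matrix.cramer_apply, Matrix.cramer_eq_adjugate_mulVec]
    rfl
  simp only [h2, Matrix.det_apply, Finset.smul_sum]
  rw [Finset.sum_comm]
  refine Finset.sum_congr rfl fun σ _ => Finset.sum_congr rfl fun i _ => ?_
  congr 1
  rw [← Finset.mul_prod_erase _ _ (Finset.mem_univ i)]
  simp only [Matrix.updateCol_self, smul_eq_mul]
  rw [mul_comm]
  congr 1
  refine Finset.prod_congr rfl fun k hk => ?_
  rw [Matrix.updateCol_ne (Finset.ne_of_mem_erase hk)]

lemma differentiableAt_det (h : ∀ i k, DifferentiableAt ℂ (fun s => M s i k) t) :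
    DifferentiableAt ℂ (fun s => (M s).det) t :=
  (hasDerivAt_det (M' := .of fun i k => deriv (fun s => M s i k) t)
    fun i k => (h i k).hasDerivAt).differentiableAt

lemma differentiableAt_inv (h : ∀ i k, DifferentiableAt ℂ (fun s => M s i k) t)
    (hd : (M t).det ≠ 0) (i k : ι) : DifferentiableAt ℂ (fun s => (M s)⁻¹ i k) t := by
  simp only [Matrix.inv_def, Matrix.smul_apply, Ring.inverse_eq_inv', Matrix.adjugate_apply]
  refine ((differentiableAt_det h).inv hd).smul (differentiableAt_det fun a b => ?_)
  simp only [Matrix.updateRow_apply]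
  split_ifs
  · exact differentiableAt_const _
  · exact h a b

end Determinant

/-! ### One-parameter families of densities. -/

section Family

variable {V : ℂ → ℝ → ℂ} {W : ℝ → ℂ} {n : ℕ} {t : ℂ}
  (hV : ∀ᶠ s in 𝓝 t, IntervalIntegrable (V s) volume 0 (2 * π))
  (hW : IntervalIntegrable W volume 0 (2 * π))
  (hm : ∀ k, HasDerivAt (fun s => mom (V s) k) (mom W k) t) (hd : (hankel (V t) n).det ≠ 0)

include hm in
lemma hasDerivAt_det_hankel (hd : (hankel (V t) n).det ≠ 0) :
    HasDerivAt (fun s => (hankel (V s) n).det) ((hankel (V t) n).det *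
      ∑ i : Fin n, ∑ k : Fin n, (hankel (V t) n)⁻¹ i k * mom W (i + k)) t := by
  convert hasDerivAt_det (M := fun s => hankel (V s) n) (M' := hankel W n) (fun i k => hm _) using 1
  rw [Finset.mul_sum]
  refine Finset.sum_congr rfl fun i _ => ?_
  rw [Finset.mul_sum]
  refine Finset.sum_congr rfl fun k _ => ?_
  have h : hankel W n k i = mom W (i + k) := by rw [hankel, Matrix.of_apply, add_comm]
  rw [Matrix.inv_def, Matrix.smul_apply, Ring.inverse_eq_inv', smul_eq_mul, h]
  field_simp

include hm hd in
lemma eventually_hankel_ne_zero : ∀ᶠ s in 𝓝 t, (hankel (V s) n).det ≠ 0 :=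
  (hasDerivAt_det_hankel hm hd).continuousAt.eventually_ne hd

include hm hd in
lemma differentiableAt_coef0 (i : ℕ) : DifferentiableAt ℂ (fun s => coef0 (V s) n i) t := by
  unfold coef0
  split_ifs with h
  · simp only [Matrix.mulVec, dotProduct]
    refine (DifferentiableAt.fun_sum fun k _ => (differentiableAt_inv (fun i k => ?_) hd _ _).mul
      (hm _).differentiableAt).fun_neg
    exact (hm _).differentiableAt
  · exact differentiableAt_const _
  · exact differentiableAt_const _

include hm hd in
lemma differentiableAt_coef1 (i : ℕ) : DifferentiableAt ℂ (fun s => coef1 (V s) n i) t := by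
  unfold coef1
  split_ifs with h
  · simp only [Matrix.mulVec, dotProduct]
    refine (DifferentiableAt.fun_sum fun k _ => (differentiableAt_inv (fun i k => ?_) hd _ _).mul
      (differentiableAt_const _)).fun_neg
    exact (hm _).differentiableAt
  · exact differentiableAt_const _

lemma hasDerivAt_pol {c : ℂ → ℕ → ℂ} {e : ℕ → ℂ} (hc : ∀ i, HasDerivAt (fun s => c s i) (e i) t)
    (z : ℂ) : HasDerivAt (fun s => pol n (c s) z) (pol n e z) t :=
  HasDerivAt.fun_sum fun i _ => (hc i).mul_const _

include hm in
lemma hasDerivAt_spol {c : ℂ → ℕ → ℂ} {e : ℕ → ℂ} (hc : ∀ i, HasDerivAt (fun s => c s i) (e i) t)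
    (z : ℂ) : HasDerivAt (fun s => spol (V s) n (c s) z) (spolDot (V t) W n (c t) e z) t := by
  have h : ∀ i, HasDerivAt (fun s => ∑ l ∈ Finset.range i, mom (V s) l * z ^ (i - 1 - l))
      (∑ l ∈ Finset.range i, mom W l * z ^ (i - 1 - l)) t := fun i =>
    HasDerivAt.fun_sum fun l _ => (hm l).mul_const _
  refine (HasDerivAt.fun_sum (u := Finset.range (n + 1)) fun i _ =>
    (hc i).fun_mul (h i)).congr_deriv ?_
  simp only [spolDot, spol]
  rw [← Finset.sum_add_distrib]
  exact Finset.sum_congr rfl fun i _ => by ring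

include hV hW hm in
/-- The differentiated orthogonality relations. -/
lemma pair_pow_mul_dot {c : ℂ → ℕ → ℂ} {e : ℕ → ℂ} (hc : ∀ i, HasDerivAt (fun s => c s i) (e i) t)
    {k : ℕ} {K : ℂ} (h : ∀ᶠ s in 𝓝 t, pair (V s) (fun x => x ^ k * pol n (c s) x) = K) :
    pair W (fun s => s ^ k * pol n (c t) s) + pair (V t) (fun s => s ^ k * pol n e s) = 0 := by
  have h1 : HasDerivAt (fun s => ∑ i ∈ Finset.range (n + 1), c s i * mom (V s) (i + k))
      (∑ i ∈ Finset.range (n + 1), (e i * mom (V t) (i + k) + c t i * mom W (i + k))) t :=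
    HasDerivAt.fun_sum fun i _ => (hc i).fun_mul (hm _)
  have h2 : (fun s => ∑ i ∈ Finset.range (n + 1), c s i * mom (V s) (i + k)) =ᶠ[𝓝 t]
      fun _ => K := by
    filter_upwards [h, hV] with s hs hs'
    rw [← hs, pair_pow_mul_pol hs']
  have h3 := h1.unique ((hasDerivAt_const t K).congr_of_eventuallyEq h2)
  rw [pair_pow_mul_pol hW, pair_pow_mul_pol hV.self_of_nhds, ← Finset.sum_add_distrib, ← h3]
  exact Finset.sum_congr rfl fun i _ => by ring

/-- The derivatives of the coefficients `coef0` in the parameter. -/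
def coefDeriv0 (V : ℂ → ℝ → ℂ) (n : ℕ) (t : ℂ) (i : ℕ) : ℂ := deriv (fun s => coef0 (V s) n i) t

/-- The derivatives of the coefficients `coef1` in the parameter. -/
def coefDeriv1 (V : ℂ → ℝ → ℂ) (n : ℕ) (t : ℂ) (i : ℕ) : ℂ := deriv (fun s => coef1 (V s) n i) t

/-- The derivative of `polMat`. -/
def polMatDot (V : ℂ → ℝ → ℂ) (W : ℝ → ℂ) (n : ℕ) (t z : ℂ) : M2 :=
  !![pol n (coefDeriv0 V n t) z, spolDot (V t) W n (coef0 (V t) n) (coefDeriv0 V n t) z;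
    pol n (coefDeriv1 V n t) z, spolDot (V t) W n (coef1 (V t) n) (coefDeriv1 V n t) z]

include hm hd in
lemma hasDerivAt_polMat (z : ℂ) (i j : Fin 2) :
    HasDerivAt (fun s => polMat (V s) n z i j) (polMatDot V W n t z i j) t := by
  have h0 := fun i => (differentiableAt_coef0 hm hd i).hasDerivAt
  have h1 := fun i => (differentiableAt_coef1 hm hd i).hasDerivAt
  revert i j
  rw [Fin.forall_fin_two, Fin.forall_fin_two, Fin.forall_fin_two]
  exact ⟨⟨hasDerivAt_pol h0 z, hasDerivAt_spol hm h0 z⟩,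
    hasDerivAt_pol h1 z, hasDerivAt_spol hm h1 z⟩

include hV hW hm hd in
/-- The trace of the logarithmic derivative of the Hankel matrix in terms of `polMat`. -/
theorem residue_identity_family {ι : Type*} [Fintype ι] (hn : 1 ≤ n)
    (x A R : ι → ℂ) (hx : ∀ j, ‖x j‖ ≤ 1)
    (hF : ∀ z : ℂ, 1 < ‖z‖ → HasDerivAt (cauchyT (V t))
      (2 * (∑ j, A j / (z - x j)) * cauchyT (V t) z + ∑ j, R j / (z - x j)) z) :
    ∑ j, (A j * (((polMat (V t) n (x j)).adjugate * polMatDot V W n t (x j)) 0 0 -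
        ((polMat (V t) n (x j)).adjugate * polMatDot V W n t (x j)) 1 1) +
      R j * ((polMat (V t) n (x j)).adjugate * polMatDot V W n t (x j)) 1 0) =
    ∑ i : Fin n, ∑ k : Fin n, (hankel (V t) n)⁻¹ i k * mom W (i + k) := by
  have hne := eventually_hankel_ne_zero hm hd
  have h0 := fun i => (differentiableAt_coef0 hm hd i).hasDerivAt
  have h1 := fun i => (differentiableAt_coef1 hm hd i).hasDerivAt
  -- The coefficients of degree `n` are the constants `1` and `0`, so the differentiated polynomials
  -- have degree below `n`.
  have he0 : coefDeriv0 V n t n = 0 := by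
    simp [coefDeriv0, coef0]
  have he1 : coefDeriv1 V n t n = 0 := by
    simp [coefDeriv1, coef1]
  rw [← residue_identity hV.self_of_nhds hW hn hd he0 he1 (fun k hk => ?_) (fun k hk => ?_)
    x A R hx hF]
  · refine Finset.sum_congr rfl fun j _ => ?_
    simp only [polMat, polMatDot, Matrix.adjugate_fin_two_of, Matrix.mul_fin_two, Matrix.of_apply,
      Matrix.cons_val', Matrix.cons_val_zero, Matrix.cons_val_one, Matrix.cons_val_fin_one]
    ring
  · refine pair_pow_mul_dot (K := 0) hV hW hm h0 ?_
    filter_upwards [hV, hne] with s h1 h2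
    exact pair_pow_mul_coef0 h1 h2 hk
  · refine pair_pow_mul_dot (K := -if k + 1 = n then 1 else 0) hV hW hm h1 ?_
    filter_upwards [hV, hne] with s h1 h2
    exact pair_pow_mul_coef1 h1 h2 hk

end Family

/-! ### The contribution of one exceptional point. -/

section Trace

lemma hasDerivAt_matrix_mul {A B : ℂ → M2} {A' B' : M2} {t : ℂ}
    (hA : ∀ i j, HasDerivAt (fun s => A s i j) (A' i j) t)
    (hB : ∀ i j, HasDerivAt (fun s => B s i j) (B' i j) t) (i j : Fin 2) :
    HasDerivAt (fun s => (A s * B s) i j) ((A' * B t + A t * B') i j) t := by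
  simp only [Matrix.add_apply, Matrix.mul_apply, Fin.sum_univ_two]
  refine (((hA i 0).fun_mul (hB 0 j)).fun_add ((hA i 1).fun_mul (hB 1 j))).congr_deriv ?_
  ring

lemma hasDerivAt_upper {u : ℂ → ℂ} {u' t : ℂ} (hu : HasDerivAt u u' t) (i j : Fin 2) :
    HasDerivAt (fun s => upper (u s) i j) (!![0, u'; 0, 0] i j) t := by
  revert i j
  simp only [Fin.forall_fin_two]
  exact ⟨⟨hasDerivAt_const _ _, hu⟩, hasDerivAt_const _ _, hasDerivAt_const _ _⟩

lemma hasDerivAt_expSigma3 {l : ℂ → ℂ} {l' t : ℂ} (hl : HasDerivAt l l' t) (i j : Fin 2) :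
    HasDerivAt (fun s => expSigma3 (l s) i j) ((expSigma3 (l t) * (l' • sigma3)) i j) t := by
  revert i j
  simp only [Fin.forall_fin_two]
  refine ⟨⟨?_, ?_⟩, ?_, ?_⟩
  · exact hl.cexp.congr_deriv (by simp [expSigma3, sigma3])
  · exact (hasDerivAt_const _ _).congr_deriv (by simp [expSigma3, sigma3])
  · exact (hasDerivAt_const _ _).congr_deriv (by simp [expSigma3, sigma3])
  · exact hl.fun_neg.cexp.congr_deriv (by simp [expSigma3, sigma3])

lemma matDeriv_eq {F : ℂ → M2} {F' : M2} {t : ℂ}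
    (h : ∀ i j, HasDerivAt (fun s => F s i j) (F' i j) t) : matDeriv F t = F' := by
  ext i j
  exact (h i j).deriv

/-- The contribution of one singular point to the deformation term. -/
lemma trace_residue {P : ℂ → M2} {u l : ℂ → ℂ} {P' : M2} {u' l' t : ℂ} (a : ℂ)
    (hdet : (P t).det = 1) (hP : ∀ i j, HasDerivAt (fun s => P s i j) (P' i j) t)
    (hu : HasDerivAt u u' t) (hl : HasDerivAt l l' t) {X : ℂ → M2}
    (hX : X =ᶠ[𝓝 t] fun s => P s * (upper (u s) * expSigma3 (l s))) :
    MatDifferentiableAt X t ∧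
    Matrix.trace (a • (X t * sigma3 * (X t)⁻¹) * matDeriv X t * (X t)⁻¹) =
      a * (((P t).adjugate * P') 0 0 - ((P t).adjugate * P') 1 1) +
        -(2 * a * u t) * ((P t).adjugate * P') 1 0 + 2 * a * l' := by
  have h := hasDerivAt_matrix_mul hP
    (hasDerivAt_matrix_mul (hasDerivAt_upper hu) (hasDerivAt_expSigma3 hl))
  have h' := fun i j => (h i j).congr_of_eventuallyEq (f₁ := fun s => X s i j) (by
    filter_upwards [hX] with s hs
    rw [hs])
  refine ⟨fun i j => (h' i j).differentiableAt, ?_⟩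
  rw [matDeriv_eq h', hX.self_of_nhds]
  set U := upper (u t)
  set E := expSigma3 (l t)
  set U' : M2 := !![0, u'; 0, 0]
  set Q := P t
  set G := Q.adjugate * P' with hG
  have hQ : Q.adjugate * Q = 1 := adjugate_mul_of_det hdet
  have hE : expSigma3 (-l t) * E = 1 := by simp only [E, expSigma3_mul, neg_add_cancel, expSigma3_zero]
  have hU : upper (-u t) * U = 1 := by simp only [U, upper_mul_upper, neg_add_cancel, upper_zero]
  set Y := expSigma3 (-l t) * (upper (-u t) * Q.adjugate) with hY
  have hYX : Y * (Q * (U * E)) = 1 := by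
    calc Y * (Q * (U * E)) = expSigma3 (-l t) * (upper (-u t) * (Q.adjugate * Q) * U) * E := by
          simp only [hY, Matrix.mul_assoc]
      _ = 1 := by rw [hQ, Matrix.mul_one, hU, Matrix.mul_one, hE]
  rw [Matrix.inv_eq_left_inv hYX]
  have hXY : Q * (U * E) * Y = 1 := mul_eq_one_comm.mp hYX
  -- For `X = Q U E` this is `X⁻¹ X' = E⁻¹ (U⁻¹ G U + U⁻¹ U') E + l' σ₃`. Against `σ₃` the strictly
  -- triangular term `U⁻¹ U'` has trace zero, so the derivative of `u` drops out, and the first term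
  -- gives `G₀₀ - G₁₁ - 2 u G₁₀`.
  have e1 : Y * (P' * (U * E) + Q * (U' * E + U * (E * l' • sigma3))) =
      expSigma3 (-l t) * (upper (-u t) * G * U) * E +
        expSigma3 (-l t) * (upper (-u t) * U') * E + l' • sigma3 := by
    calc _ = expSigma3 (-l t) * (upper (-u t) * (Q.adjugate * P') * U) * E +
          expSigma3 (-l t) * (upper (-u t) * (Q.adjugate * Q) * U') * E +
          expSigma3 (-l t) * (upper (-u t) * (Q.adjugate * Q) * U) * E * (l' • sigma3) := by
          simp only [hY, Matrix.mul_assoc, Matrix.mul_add, add_assoc]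
      _ = _ := by rw [hQ, Matrix.mul_one, hU, Matrix.mul_one, hE, Matrix.one_mul]
  rw [Matrix.trace_mul_comm, Matrix.smul_mul, Matrix.mul_smul, Matrix.trace_smul]
  rw [show Y * (Q * (U * E) * sigma3 * Y * (P' * (U * E) + Q * (U' * E + U * (E * l' • sigma3)))) =
    (Y * (Q * (U * E))) * sigma3 * (Y * (P' * (U * E) + Q * (U' * E + U * (E * l' • sigma3)))) by
      simp only [Matrix.mul_assoc], hYX, Matrix.one_mul, e1]
  have hexp : cexp (-l t) * cexp (l t) = 1 := by rw [← exp_add, neg_add_cancel, exp_zero]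
  clear_value G
  simp only [Matrix.trace, Matrix.diag, Fin.sum_univ_two, Matrix.mul_apply, sigma3, U, E, U', upper,
    expSigma3, Matrix.add_apply, Matrix.smul_apply, smul_eq_mul, Matrix.of_apply, Matrix.cons_val',
    Matrix.cons_val_zero, Matrix.cons_val_one, Matrix.cons_val_fin_one, neg_neg]
  linear_combination (a * (G 0 0 - G 1 1) - 2 * a * u t * G 1 0) * hexp

end Trace

/-! ### From the Toeplitz to the Hankel determinant. -/

section Toeplitz

variable {m : ℕ} (n : ℕ) (θ : Fin (m + 1) → ℝ) (α β : Fin (m + 1) → ℂ)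

lemma mom_dens (k : ℕ) : mom (dens n θ α β) k =
    cexp (I * ∑ j, θ j * (α j + β j)) * fourierCoeff θ α β ((n : ℤ) - 1 - k) := by
  rw [mom, pair, fourierCoeff, mul_left_comm (cexp _),
    ← intervalIntegral.integral_const_mul (cexp (I * ∑ j, θ j * (α j + β j)))]
  congr 1
  refine intervalIntegral.integral_congr fun t _ => ?_
  simp only [dens]
  rw [← exp_nat_mul, mul_comm (symbol θ α β t), mul_assoc, mul_assoc, mul_assoc, ← exp_add]
  congr 3
  push_cast
  ring

/-- Because of the factor `z^{1-n}` in the density, the entry `(i, k)` is a multiple of the Fourier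
coefficient of index `(n - 1 - i) - k`: the Toeplitz matrix with its rows reversed. -/
lemma det_hankel_dens : (hankel (dens n θ α β) n).det =
    cexp (I * ∑ j, θ j * (α j + β j)) ^ n * ((Equiv.Perm.sign (Fin.revPerm (n := n)) : ℤ) : ℂ) *
      toeplitzDet θ α β n := by
  have h : hankel (dens n θ α β) n = cexp (I * ∑ j, θ j * (α j + β j)) •
      (Matrix.of fun j k : Fin n => fourierCoeff θ α β ((j : ℤ) - (k : ℤ))).submatrix
        (Fin.revPerm (n := n)) id := by
    ext i k
    rw [hankel, Matrix.of_apply, mom_dens, Matrix.smul_apply, smul_eq_mul, Matrix.submatrix_apply,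
      Matrix.of_apply]
    congr 2
    simp only [Fin.revPerm_apply, Fin.val_rev, id]
    have := i.2
    push_cast [Nat.cast_sub (show (i : ℕ) + 1 ≤ n by omega)]
    ring
  rw [h, Matrix.det_smul, Matrix.det_permute, Fintype.card_fin, toeplitzDet]
  ring

lemma toeplitzDet_eq : toeplitzDet θ α β n =
    ((Equiv.Perm.sign (Fin.revPerm (n := n)) : ℤ) : ℂ) *
      (cexp (-(n * (I * ∑ j, θ j * (α j + β j)))) * (hankel (dens n θ α β) n).det) := by
  have h1 : ((Equiv.Perm.sign (Fin.revPerm (n := n)) : ℤ) : ℂ) *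
      ((Equiv.Perm.sign (Fin.revPerm (n := n)) : ℤ) : ℂ) = 1 := by
    rw [← Int.cast_mul, ← Units.val_mul, Int.units_mul_self]
    simp
  rw [det_hankel_dens, ← exp_nat_mul, ← mul_assoc, ← mul_assoc, ← mul_assoc, exp_neg]
  rw [mul_assoc _ (cexp _)⁻¹, inv_mul_cancel₀ (exp_ne_zero _), mul_one, h1, one_mul]

end Toeplitz

/-! ### Directional derivatives of the Toeplitz determinant. -/

section Direction

variable {m n : ℕ} {θ : Fin (m + 1) → ℝ} {α β : Fin (m + 1) → ℂ}

lemma eventually_line {p : (Fin (m + 1) → ℂ) × (Fin (m + 1) → ℂ) → Prop}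
    (h : ∀ᶠ q in 𝓝 (α, β), p q) (a b : Fin (m + 1) → ℂ) :
    ∀ᶠ s in 𝓝 (0 : ℂ), p (α + s • a, β + s • b) := by
  have hc : ContinuousAt (fun s : ℂ => (α + s • a, β + s • b)) 0 := by fun_prop
  have := hc.tendsto
  simp only [zero_smul, add_zero] at this
  exact this.eventually h

lemma eventually_admissible (hα : ∀ j, -1 / 2 < (α j).re)
    (hα_exp : ∀ j, cexp (4 * π * I * α j) ≠ 1) :
    ∀ᶠ q : (Fin (m + 1) → ℂ) × (Fin (m + 1) → ℂ) in 𝓝 (α, β),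
      (∀ j, -1 / 2 < (q.1 j).re) ∧ ∀ j, cexp (4 * π * I * q.1 j) ≠ 1 := by
  refine (eventually_all.mpr fun j => ?_).and (eventually_all.mpr fun j => ?_)
  · have : ContinuousAt (fun q : (Fin (m + 1) → ℂ) × (Fin (m + 1) → ℂ) => (q.1 j).re) (α, β) := by
      fun_prop
    exact this.eventually_const_lt (hα j)
  · have : ContinuousAt (fun q : (Fin (m + 1) → ℂ) × (Fin (m + 1) → ℂ) =>
        cexp (4 * π * I * q.1 j)) (α, β) := by
      fun_prop
    exact this.eventually_ne (hα_exp j)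

lemma ne_zero_of_exp {c : ℂ} (h : cexp (4 * π * I * c) ≠ 1) : c ≠ 0 := by
  rintro rfl
  simp at h

lemma hasDerivAt_line (a c : Fin (m + 1) → ℂ) (k : Fin (m + 1)) (t : ℂ) :
    HasDerivAt (fun s : ℂ => (a + s • c) k) (c k) t := by
  simpa using ((hasDerivAt_id t).mul_const (c k)).const_add (a k)

lemma hasDerivAt_lam (a b : Fin (m + 1) → ℂ) (t : ℂ) :
    HasDerivAt (fun s : ℂ => lam n (α + s • a) (β + s • b)) (∑ k, (b k - a k) / 2) t := by
  unfold lam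
  exact (HasDerivAt.fun_sum fun k _ =>
    ((hasDerivAt_line β b k t).sub (hasDerivAt_line α a k t)).div_const 2).sub_const _

lemma hasDerivAt_locLogZero (a : Fin (m + 1) → ℂ) (t : ℂ) :
    HasDerivAt (fun s : ℂ => locLogZero θ (α + s • a) 0)
      (∑ k, a k * logFrom (θ k) (-pt θ k)) t := by
  simp only [locLogZero, lg, zero_sub]
  exact HasDerivAt.fun_sum fun k _ => (hasDerivAt_line α a k t).mul_const _

variable (hθ_mono : StrictMono θ) (hθ_zero : θ 0 = 0) (hθ_lt : ∀ j, θ j < 2 * π)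
include hθ_mono hθ_zero hθ_lt

lemma hasDerivAt_locLog (a b : Fin (m + 1) → ℂ) (j : Fin (m + 1)) (t : ℂ) :
    HasDerivAt (fun s : ℂ => locLog n θ (α + s • a) (β + s • b) j (pt θ j))
      ((∑ k, (b k - a k) / 2) * logFrom 0 (pt θ j) +
        ∑ k ∈ Finset.univ.erase j, a k * logFrom (θ k) (pt θ j - pt θ k)) t := by
  simp only [fun s : ℂ => locLog_pt n (α + s • a) (β + s • b) hθ_mono hθ_zero hθ_lt j]
  exact ((hasDerivAt_lam a b t).mul_const _).add (HasDerivAt.fun_sum fun k _ =>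
    (hasDerivAt_line α a k t).mul_const _)

variable (hα : ∀ j, -1 / 2 < (α j).re)
include hα

/-- Expanding `rhoFun` separates the parameters `α_k` and `λ` from pairings of the density with
fixed functions. -/
lemma differentiableAt_rho (a b : Fin (m + 1) → ℂ) (j : Fin (m + 1)) :
    DifferentiableAt ℂ (fun s : ℂ => rho n θ (α + s • a) (β + s • b) j) 0 := by
  have c1 := (continuous_deriv_el (θ := θ) j).continuousOn (s := Metric.sphere (0 : ℂ) 1)
  have c2 := fun k => (continuous_dslope_el (θ := θ) j k).continuousOn (s := Metric.sphere (0 : ℂ) 1)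
  have c3 : ContinuousOn (fun s => el θ j s * s⁻¹) (Metric.sphere 0 1) :=
    (differentiable_el (θ := θ) j).continuous.continuousOn.mul continuousOn_inv_sphere
  have hd : ∀ {g : ℂ → ℂ}, ContinuousOn g (Metric.sphere 0 1) →
      DifferentiableAt ℂ (fun s : ℂ => pair (dens n θ (α + s • a) (β + s • b)) g) 0 := fun hg =>
    (hasDerivAt_pair_dens n α β hθ_mono hθ_zero hθ_lt hα a b hg).differentiableAt
  have hre : ∀ᶠ q : (Fin (m + 1) → ℂ) × (Fin (m + 1) → ℂ) in 𝓝 (α, β),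
      ∀ j, -1 / 2 < (q.1 j).re := by
    refine eventually_all.mpr fun j => ?_
    have : ContinuousAt (fun q : (Fin (m + 1) → ℂ) × (Fin (m + 1) → ℂ) => (q.1 j).re) (α, β) := by
      fun_prop
    exact this.eventually_const_lt (hα j)
  have heq : (fun s : ℂ => rho n θ (α + s • a) (β + s • b) j) =ᶠ[𝓝 0] fun s =>
      pair (dens n θ (α + s • a) (β + s • b)) (deriv (el θ j)) +
      ∑ k, 2 * (α + s • a) k * pair (dens n θ (α + s • a) (β + s • b)) (dslope (el θ j) (pt θ k)) +
      2 * lam n (α + s • a) (β + s • b) *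
        pair (dens n θ (α + s • a) (β + s • b)) (fun s => el θ j s * s⁻¹) := by
    filter_upwards [eventually_line hre a b] with s hs
    have hI := integrable_dens n (α + s • a) (β + s • b) hθ_mono hθ_zero hθ_lt hs
    unfold rho rhoFun
    rw [pair_add hI (by fun_prop) (by fun_prop), pair_add hI (by fun_prop) (by fun_prop),
      pair_sum _ hI fun k _ => by fun_prop, pair_const_mul]
    simp only [pair_const_mul]
  refine DifferentiableAt.congr_of_eventuallyEq ?_ heq
  refine ((hd c1).add (DifferentiableAt.fun_sum fun k _ => ?_)).add ?_
  · exact ((hasDerivAt_line α a k 0).differentiableAt.const_mul 2).mul (hd (c2 k))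
  · exact ((hasDerivAt_lam a b 0).differentiableAt.const_mul 2).mul (hd c3)

lemma differentiableAt_cauchyT_zero (a b : Fin (m + 1) → ℂ) :
    DifferentiableAt ℂ (fun s : ℂ => cauchyT (dens n θ (α + s • a) (β + s • b)) 0) 0 := by
  refine (hasDerivAt_pair_dens n α β hθ_mono hθ_zero hθ_lt hα a b
    (g := fun s => (s - 0)⁻¹) ?_).differentiableAt
  simpa using continuousOn_inv_sphere

variable (hα_exp : ∀ j, cexp (4 * π * I * α j) ≠ 1) (hn : 1 ≤ n)
include hα_exp hn

/-- The derivative of the Toeplitz determinant in the direction `(a, b)`. -/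
theorem hasDerivAt_toeplitzDet (a b : Fin (m + 1) → ℂ) {T : ℂ → PhiData m}
    (hT : ∀ᶠ s in 𝓝 (0 : ℂ), IsPhiSolution n θ (α + s • a) (β + s • b) (T s)) :
    HasDerivAt (fun s : ℂ => toeplitzDet θ (α + s • a) (β + s • b) n) (toeplitzDet θ α β n *
      (deformationTerm θ (residueA θ α (T 0)) (residueB n α β (T 0)) T 0
        - 2 * ∑ j, α j * ((∑ k, (b k - a k) / 2) * logFrom 0 (pt θ j) +
          ∑ k ∈ Finset.univ.erase j, a k * logFrom (θ k) (pt θ j - pt θ k))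
        - 2 * lam n α β * ∑ k, a k * logFrom (θ k) (-pt θ k)
        - n * (I * ∑ k, θ k * (a k + b k)))) 0 ∧
    (∀ j, MatDifferentiableAt (fun s => (T s).reg j (pt θ j)) 0) ∧
    MatDifferentiableAt (fun s => (T s).reg0 0) 0 := by
  set V : ℂ → ℝ → ℂ := fun s => dens n θ (α + s • a) (β + s • b) with hV_def
  set W := densDeriv n θ α β a b
  have hV0 : V 0 = dens n θ α β := by simp [hV_def]
  have hadm := eventually_line (eventually_admissible (β := β) hα hα_exp) a b
  have hV : ∀ᶠ s in 𝓝 (0 : ℂ), IntervalIntegrable (V s) volume 0 (2 * π) := by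
    filter_upwards [hadm] with s hs
    exact integrable_dens n _ _ hθ_mono hθ_zero hθ_lt hs.1
  have hW : IntervalIntegrable W volume 0 (2 * π) :=
    integrable_densDeriv n α β hθ_mono hθ_zero hθ_lt hα a b
  have hm : ∀ k, HasDerivAt (fun s => mom (V s) k) (mom W k) 0 := fun k =>
    hasDerivAt_pair_dens n α β hθ_mono hθ_zero hθ_lt hα a b (by fun_prop)
  have hd : (hankel (V 0) n).det ≠ 0 := by
    have := hT.self_of_nhds
    simp only [zero_smul, add_zero] at this
    rw [hV0]
    exact this.hankel_det_ne_zero hθ_mono hθ_zero hθ_lt hα hα_exp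
  have hP := hasDerivAt_polMat hm hd
  have hdet : ∀ z, (polMat (V 0) n z).det = 1 := fun z => by
    rw [Matrix.det_fin_two]
    exact (isNormalized_polMat hV.self_of_nhds hn hd).det z
  have hu : ∀ j, DifferentiableAt ℂ (fun s : ℂ => -(rho n θ (α + s • a) (β + s • b) j /
      (2 * (α + s • a) j))) 0 := fun j =>
    ((differentiableAt_rho hθ_mono hθ_zero hθ_lt hα a b j).fun_div
      ((hasDerivAt_line α a j 0).differentiableAt.const_mul 2) (by
        simpa using ne_zero_of_exp (hα_exp j))).fun_neg
  have hl := fun j => hasDerivAt_locLog (n := n) (α := α) (β := β) hθ_mono hθ_zero hθ_lt a b j 0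
  have hX : ∀ j, (fun s => (T s).reg j (pt θ j)) =ᶠ[𝓝 0] fun s => polMat (V s) n (pt θ j) *
      (upper (-(rho n θ (α + s • a) (β + s • b) j / (2 * (α + s • a) j))) *
        expSigma3 (locLog n θ (α + s • a) (β + s • b) j (pt θ j))) := by
    intro j
    filter_upwards [hT, hadm] with s h1 h2
    exact h1.reg_pt hθ_mono hθ_zero hθ_lt h2.1 h2.2 hn j
  have hpt := fun j => trace_residue (P := fun s => polMat (V s) n (pt θ j)) (α j) (hdet (pt θ j))
    (hP (pt θ j)) (hu j).hasDerivAt (hl j) (hX j)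
  have hX0 : (fun s => (T s).reg0 0) =ᶠ[𝓝 0] fun s => polMat (V s) n 0 *
      (upper (cauchyT (V s) 0) * expSigma3 (locLogZero θ (α + s • a) 0)) := by
    filter_upwards [hT, hadm] with s h1 h2
    exact h1.reg0_zero hθ_mono hθ_zero hθ_lt h2.1 h2.2 hn
  have hzero := trace_residue (P := fun s => polMat (V s) n 0) (lam n α β) (hdet 0) (hP 0)
    (differentiableAt_cauchyT_zero (n := n) (β := β) hθ_mono hθ_zero hθ_lt hα a b).hasDerivAt
    (hasDerivAt_locLogZero (θ := θ) (α := α) a 0) hX0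
  refine ⟨?_, fun j => (hpt j).1, hzero.1⟩
  -- The origin is adjoined to the singular points as `none`, with exponent `λ` and residue
  -- `rhoZero`. The differential equation of `F` has simple poles at all these points alike.
  have hid := residue_identity_family hV hW hm hd hn (ι := Option (Fin (m + 1)))
    (fun o => o.elim 0 (pt θ)) (fun o => o.elim (lam n α β) α)
    (fun o => o.elim (rhoZero n θ α β) (rho n θ α β)) (by
      rintro (_ | j)
      · simp
      · simp [norm_pt]) (fun z hz => by
      have h := hasDerivAt_cauchyT_dens n α β hθ_mono hθ_zero hθ_lt hα hz.ne'
        (norm_pos_iff.mp (by linarith))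
      rw [← hV0] at h
      refine h.congr_deriv ?_
      simp only [Fintype.sum_option, Option.elim, sub_zero, ratPsi, inhom]
      ring)
  simp only [Fintype.sum_option, Option.elim] at hid
  have hdef : deformationTerm θ (residueA θ α (T 0)) (residueB n α β (T 0)) T 0 =
      ∑ i : Fin n, ∑ k : Fin n, (hankel (V 0) n)⁻¹ i k * mom W (i + k)
        + 2 * ∑ j, α j * ((∑ k, (b k - a k) / 2) * logFrom 0 (pt θ j) +
          ∑ k ∈ Finset.univ.erase j, a k * logFrom (θ k) (pt θ j - pt θ k))
        + 2 * lam n α β * ∑ k, a k * logFrom (θ k) (-pt θ k) := by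
    rw [deformationTerm, residueB, hzero.2, ← hid]
    simp only [residueA, fun j => (hpt j).2, zero_smul, add_zero, rhoZero]
    -- The Frobenius value `-ρ_j / (2 α_j)` turns the coefficient of `G₁₀` in `trace_residue` into
    -- the residue `ρ_j`. At the origin `-2 λ F(0)` is `rhoZero` by definition.
    have : ∀ j, 2 * α j * -(rho n θ α β j / (2 * α j)) = -rho n θ α β j := fun j => by
      have := ne_zero_of_exp (hα_exp j)
      field_simp
    have h2 : ∀ f : Fin (m + 1) → ℂ, ∑ j, 2 * α j * f j = 2 * ∑ j, α j * f j := fun f => by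
      rw [Finset.mul_sum]
      exact Finset.sum_congr rfl fun j _ => mul_assoc _ _ _
    simp only [this, Finset.sum_add_distrib, neg_neg, h2]
    ring
  have hexp : HasDerivAt (fun s : ℂ => cexp (-(n * (I * ∑ k, θ k * ((α + s • a) k + (β + s • b) k)))))
      (cexp (-(n * (I * ∑ k, θ k * (α k + β k)))) * -(n * (I * ∑ k, θ k * (a k + b k)))) 0 := by
    have h := ((((HasDerivAt.fun_sum (u := Finset.univ) fun k _ =>
      (((hasDerivAt_line α a k 0).fun_add (hasDerivAt_line β b k 0)).const_mul
        (θ k : ℂ))).const_mul I).const_mul (n : ℂ)).fun_neg).cexp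
    simpa using h
  have hD := (hexp.fun_mul (hasDerivAt_det_hankel hm hd)).const_mul
    ((Equiv.Perm.sign (Fin.revPerm (n := n)) : ℤ) : ℂ)
  simp only [toeplitzDet_eq]
  refine hD.congr_deriv ?_
  rw [hdef, hV0]
  simp only [zero_smul, add_zero]
  ring

end Direction

/-! ### Openness of solvability, and the logarithmic derivative along a line. -/

section Reparametrization

variable {m n : ℕ} {θ : Fin (m + 1) → ℝ} {α β : Fin (m + 1) → ℂ}

lemma update_eq_line (a : Fin (m + 1) → ℂ) (k : Fin (m + 1)) (t : ℂ) :
    Function.update a k t = a + (t - a k) • Pi.single k 1 := by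
  ext j
  rcases eq_or_ne j k with rfl | h
  · simp
  · simp [h]

lemma matDeriv_sub_const (F : ℂ → M2) (c : ℂ) : matDeriv (fun t => F (t - c)) c = matDeriv F 0 := by
  ext i j
  simp only [matDeriv, Matrix.of_apply]
  rw [deriv_comp_sub_const (f := fun s => F s i j), sub_self]

lemma MatDifferentiableAt.sub_const {F : ℂ → M2} (h : MatDifferentiableAt F 0) (c : ℂ) :
    MatDifferentiableAt (fun t => F (t - c)) c := fun i j => by
  have h' := (h i j).hasDerivAt
  rw [← sub_self c] at h'
  exact h'.comp_sub_const.differentiableAt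

lemma toeplitzDet_ne_zero (hd : (hankel (dens n θ α β) n).det ≠ 0) : toeplitzDet θ α β n ≠ 0 := by
  rw [det_hankel_dens] at hd
  exact right_ne_zero_of_mul hd

variable (hθ_mono : StrictMono θ) (hθ_zero : θ 0 = 0) (hθ_lt : ∀ j, θ j < 2 * π)
variable (hα : ∀ j, -1 / 2 < (α j).re) (hα_exp : ∀ j, cexp (4 * π * I * α j) ≠ 1) (hn : 1 ≤ n)
include hθ_mono hθ_zero hθ_lt hα hα_exp hn

/-- Solvability is an open condition on the parameters. -/
theorem eventually_phiSolvable (h : PhiSolvable n θ α β) :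
    ∀ᶠ p in 𝓝 (α, β), PhiSolvable n θ p.1 p.2 := by
  obtain ⟨S, hS⟩ := h
  have hd := hS.hankel_det_ne_zero hθ_mono hθ_zero hθ_lt hα hα_exp
  -- Solvability amounts to a nonzero Hankel determinant, which depends continuously on the
  -- parameters.
  have hc : ContinuousAt (fun p : (Fin (m + 1) → ℂ) × (Fin (m + 1) → ℂ) =>
      hankel (dens n θ p.1 p.2) n) (α, β) :=
    continuousAt_pi.mpr fun i => continuousAt_pi.mpr fun k =>
      continuousAt_pair_dens n α β hθ_mono hθ_zero hθ_lt hα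
        (g := fun s => s ^ ((i : ℕ) + k)) (by fun_prop)
  have hc' := (continuous_id.matrix_det (A := fun M : Matrix (Fin n) (Fin n) ℂ => M)).continuousAt.comp
    hc
  filter_upwards [hc'.eventually_ne hd, eventually_admissible (β := β) hα hα_exp] with p hp hp'
  exact phiSolvable_of_hankel hn hθ_mono hθ_zero hθ_lt hp'.1 hp'.2 hp

/-- The logarithmic derivative of the Toeplitz determinant along a line. -/
theorem logDeriv_toeplitzDet (a b : Fin (m + 1) → ℂ) (c : ℂ)
    {γ : ℂ → (Fin (m + 1) → ℂ) × (Fin (m + 1) → ℂ)}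
    (hγ : ∀ t, γ t = (α + (t - c) • a, β + (t - c) • b))
    {S : (Fin (m + 1) → ℂ) × (Fin (m + 1) → ℂ) → PhiData m}
    (hS : ∀ᶠ p in 𝓝 (α, β), IsPhiSolution n θ p.1 p.2 (S p)) :
    DifferentiableAt ℂ (fun t => toeplitzDet θ (γ t).1 (γ t).2 n) c ∧
    (∀ j, MatDifferentiableAt (fun t => (S (γ t)).reg j (pt θ j)) c) ∧
    MatDifferentiableAt (fun t => (S (γ t)).reg0 0) c ∧
    logDeriv (fun t => toeplitzDet θ (γ t).1 (γ t).2 n) c =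
      deformationTerm θ (residueA θ α (S (α, β))) (residueB n α β (S (α, β))) (fun t => S (γ t)) c
        - 2 * ∑ j, α j * ((∑ k, (b k - a k) / 2) * logFrom 0 (pt θ j) +
          ∑ k ∈ Finset.univ.erase j, a k * logFrom (θ k) (pt θ j - pt θ k))
        - 2 * lam n α β * ∑ k, a k * logFrom (θ k) (-pt θ k)
        - n * (I * ∑ k, θ k * (a k + b k)) := by
  set T : ℂ → PhiData m := fun s => S (α + s • a, β + s • b) with hT
  have hT0 : T 0 = S (α, β) := by simp [hT]
  obtain ⟨h1, h2, h3⟩ := hasDerivAt_toeplitzDet hθ_mono hθ_zero hθ_lt hα hα_exp hn a b (T := T)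
    (eventually_line hS a b)
  simp only [hγ]
  have hD : toeplitzDet θ α β n ≠ 0 :=
    toeplitzDet_ne_zero (hS.self_of_nhds.hankel_det_ne_zero hθ_mono hθ_zero hθ_lt hα hα_exp)
  rw [← sub_self c] at h1
  have h4 := h1.comp_sub_const
  refine ⟨h4.differentiableAt, fun j => (h2 j).sub_const c, h3.sub_const c, ?_⟩
  have h5 : deformationTerm θ (residueA θ α (T 0)) (residueB n α β (T 0)) (fun t => T (t - c)) c =
      deformationTerm θ (residueA θ α (T 0)) (residueB n α β (T 0)) T 0 := by
    simp only [deformationTerm, sub_self, matDeriv_sub_const (fun s => (T s).reg0 0),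
      fun j => matDeriv_sub_const (fun s => (T s).reg j (pt θ j))]
  rw [logDeriv_apply, h4.deriv, ← hT0]
  change _ = deformationTerm θ _ _ (fun t => T (t - c)) c - _ - _ - _
  rw [h5]
  simp only [sub_self, zero_smul, add_zero]
  rw [mul_div_cancel_left₀ _ hD]

end Reparametrization

end FisherHartwig

end

/-! ### The partial derivatives in a single parameter. -/

theorem mainTheorem6 (m n : ℕ) (hn : 1 ≤ n)
    (θ : Fin (m + 1) → ℝ) (hθ_zero : θ 0 = 0) (hθ_mono : StrictMono θ)
    (hθ_lt : ∀ j, θ j < 2 * π)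
    (α β : Fin (m + 1) → ℂ) (hα_re : ∀ j, -1 / 2 < (α j).re) (hα_ne : ∀ j, α j ≠ 0)
    (hα_exp : ∀ j, Complex.exp (4 * π * Complex.I * α j) ≠ 1)
    (hsolv : PhiSolvable n θ α β) :
    toeplitzDet θ α β n ≠ 0 ∧
    (∀ᶠ p in 𝓝 (α, β), PhiSolvable n θ p.1 p.2) ∧
    ∀ S : (Fin (m + 1) → ℂ) × (Fin (m + 1) → ℂ) → PhiData m,
      (∀ᶠ p in 𝓝 (α, β), IsPhiSolution n θ p.1 p.2 (S p)) →
      ∀ k : Fin (m + 1),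
        (DifferentiableAt ℂ (fun t => toeplitzDet θ (Function.update α k t) β n) (α k) ∧
          (∀ j, MatDifferentiableAt
            (fun t => (S (Function.update α k t, β)).reg j (pt θ j)) (α k)) ∧
          MatDifferentiableAt (fun t => (S (Function.update α k t, β)).reg0 0) (α k) ∧
          logDeriv (fun t => toeplitzDet θ (Function.update α k t) β n) (α k) =
            deformationTerm θ (residueA θ α (S (α, β))) (residueB n α β (S (α, β)))
                (fun t => S (Function.update α k t, β)) (α k)
              - 2 * ∑ j ∈ Finset.univ.erase k, α j * logFrom (θ k) (pt θ j - pt θ k)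
              - 2 * lam n α β * logFrom (θ k) (-pt θ k)
              + ∑ j, α j * logFrom 0 (pt θ j)
              - n * logFrom 0 (pt θ k)) ∧
        (DifferentiableAt ℂ (fun t => toeplitzDet θ α (Function.update β k t) n) (β k) ∧
          (∀ j, MatDifferentiableAt
            (fun t => (S (α, Function.update β k t)).reg j (pt θ j)) (β k)) ∧
          MatDifferentiableAt (fun t => (S (α, Function.update β k t)).reg0 0) (β k) ∧
          logDeriv (fun t => toeplitzDet θ α (Function.update β k t) n) (β k) =
            deformationTerm θ (residueA θ α (S (α, β))) (residueB n α β (S (α, β)))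
                (fun t => S (α, Function.update β k t)) (β k)
              - ∑ j, α j * logFrom 0 (pt θ j)
              - n * logFrom 0 (pt θ k)) := by 
  have hS₀ := hsolv
  obtain ⟨S₀, hS₀⟩ := hS₀
  refine ⟨toeplitzDet_ne_zero (hS₀.hankel_det_ne_zero hθ_mono hθ_zero hθ_lt hα_re hα_exp),
    eventually_phiSolvable hθ_mono hθ_zero hθ_lt hα_re hα_exp hn hsolv, fun S hS k => ?_⟩
  have hlog : ∀ j, logFrom 0 (pt θ j) = θ j * Complex.I := fun j =>
    logFrom_eq rfl (by simpa using theta_nonneg hθ_mono hθ_zero j) (by simpa using hθ_lt j)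
  constructor
  · have h := logDeriv_toeplitzDet hθ_mono hθ_zero hθ_lt hα_re hα_exp hn (Pi.single k 1) 0 (α k)
      (γ := fun t => (Function.update α k t, β)) (fun t => by simp [update_eq_line]) hS
    refine ⟨h.1, h.2.1, h.2.2.1, h.2.2.2.trans ?_⟩
    -- The derivative of `λ` in `α_k` is `-1/2`. With the factor `-2` in front it produces the term
    -- `+∑ α_j ln z_j`.
    have h1 : ∑ l, ((0 : Fin (m + 1) → ℂ) l - (Pi.single k 1 : Fin (m + 1) → ℂ) l) / 2 = -1 / 2 := by
      simp [← Finset.sum_div]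
    have h2 : ∑ j, α j * ∑ l ∈ Finset.univ.erase j,
        (Pi.single k 1 : Fin (m + 1) → ℂ) l * logFrom (θ l) (pt θ j - pt θ l) =
        ∑ j ∈ Finset.univ.erase k, α j * logFrom (θ k) (pt θ j - pt θ k) := by
      rw [← Finset.add_sum_erase _ _ (Finset.mem_univ k)]
      simp only [Pi.single_apply, ite_mul, one_mul, zero_mul, Finset.sum_ite_eq', Finset.mem_erase,
        ne_eq, Finset.mem_univ, and_true, not_true_eq_false, if_false, mul_zero, zero_add]
      exact Finset.sum_congr rfl fun j hj => by
        rw [if_pos (Ne.symm (Finset.ne_of_mem_erase hj))]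
    have h3 : ∑ l, (Pi.single k 1 : Fin (m + 1) → ℂ) l * logFrom (θ l) (-pt θ l) =
        logFrom (θ k) (-pt θ k) := by simp [Pi.single_apply]
    -- The constant factor of the density, raised to the power `n` by the determinant, accounts for
    -- `-n ln z_k`.
    have h4 : ∑ l, (θ l : ℂ) * ((Pi.single k 1 : Fin (m + 1) → ℂ) l + (0 : Fin (m + 1) → ℂ) l) =
        θ k := by simp [Pi.single_apply]
    rw [h1, h3, h4, hlog k]
    simp only [mul_add, Finset.sum_add_distrib]
    rw [h2]
    have h5 : ∑ j, α j * (-1 / 2 * logFrom 0 (pt θ j)) = -1 / 2 * ∑ j, α j * logFrom 0 (pt θ j) := by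
      rw [Finset.mul_sum]
      exact Finset.sum_congr rfl fun j _ => by ring
    rw [h5]
    ring
  · have h := logDeriv_toeplitzDet hθ_mono hθ_zero hθ_lt hα_re hα_exp hn 0 (Pi.single k 1) (β k)
      (γ := fun t => (α, Function.update β k t)) (fun t => by simp [update_eq_line]) hS
    refine ⟨h.1, h.2.1, h.2.2.1, h.2.2.2.trans ?_⟩
    -- In `β_k` the derivative of `λ` is `+1/2`, hence the opposite sign of `∑ α_j ln z_j`. The
    -- logarithms `ln (z_j - z_k)` and `ln (-z_k)` carry only `α` and do not appear.
    have h1 : ∑ l, ((Pi.single k 1 : Fin (m + 1) → ℂ) l - (0 : Fin (m + 1) → ℂ) l) / 2 = 1 / 2 := by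
      simp [← Finset.sum_div]
    have h4 : ∑ l, (θ l : ℂ) * ((0 : Fin (m + 1) → ℂ) l + (Pi.single k 1 : Fin (m + 1) → ℂ) l) =
        θ k := by simp [Pi.single_apply]
    have h5 : ∑ j, α j * (1 / 2 * logFrom 0 (pt θ j)) = 1 / 2 * ∑ j, α j * logFrom 0 (pt θ j) := by
      rw [Finset.mul_sum]
      exact Finset.sum_congr rfl fun j _ => by ring
    rw [h1, h4, hlog k]
    simp only [Pi.zero_apply, zero_mul, Finset.sum_const_zero, add_zero, mul_zero, sub_zero]
    rw [h5]
    ring
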